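/- **Conventions.** A *cartesian fibration* is a fibration $p\colon\mathcal E\to\mathcal B$ such that $\mathcal B$ has finite products, every fibre $\mathcal E_X$ has finite products ($\top,\wedge$), and every base change functor $(-)[f]\colon\mathcal E_Y\to\mathcal E_X$ ($f\colon X\to Y$) preserves them. A morphism $p\to q$ is a strictly commutative square of functors which preserves cartesian arrows and the finite products in the base and in the fibres; a 2-cell is a pair of natural transformations, the upper one lying over the lower one. This gives a 2-category $\mathbf{Fib}_{\wedge\top}$. A cartesian fibration is *elementary* if base change along every $\langle 0,0,1\rangle\colon I\times K\to I\times I\times K$ has a left adjoint, and *existential* if base change along every projection $I\times K\to K$ has a left adjoint, where in both cases these left adjoints $\Sigma_f$ satisfy Frobenius reciprocity, $\Sigma_f(\alpha\wedge\beta[f])\cong\Sigma_f\alpha\wedge\beta$, and the Beck–Chevalley condition for the squares obtained by changing $K$ along an arrow $K'\to K$ (the canonical arrows being invertible). $\mathbf{Fib}_{\wedge\top=}$, $\mathbf{Fib}_{\wedge\top\exists}$, $\mathbf{Fib}_{\wedge\top=\exists}$ are the locally full sub-2-categories of $\mathbf{Fib}_{\wedge\top}$ of the elementary, existential, and elementary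 existential (i.e. both) fibrations, with the morphisms that preserve the left adjoints in question (equivalently, that send cocartesian arrows over the arrows of the given kind to cocartesian arrows). Virtual double categories (VDCs) have objects, tight arrows (forming a category), loose arrows, and cells from a path of loose arrows to a loose arrow; with functors and tight transformations they form a 2-category. A VDC is an *FVDC* if it has all restrictions, i.e. cells $r\Rightarrow\alpha$ over each pair $f,g$ of tight arrows into the ends of a loose arrow $\alpha$, through which every cell into $\alpha$ whose boundary factors through $(f,g)$ factors uniquely. For a set $S\subseteq\mathbb N$, it has *$S$-composites* if every path of length in $S$ has a composite, i.e. a cell to a loose arrow with identity tight boundary through which cells factor uniquely at any position of their domain (length $0$: a unit). An FVDC $\mathbb D$ with $S$-composites is *cartesian* if $\mathbb D\to 1$ and $\mathbb D\to\mathbb D\times\mathbb D$ have right adjoints which preserve restrictions and $S$-composites. Let $\mathbf{CFVDC}_S$ be the locally full sub-2-category of VDCs on the cartesian FVDCs with $S$-composites and the functors which preserve restrictions, $S$-composites and finite products. Its objects are the cartesian FVDCs for $S=\varnothing$, the cartesian *unital* FVDCs for $S=\{0\}$, the cartesian *positive-length composable* FVDCs for $S=\{n\mid n>0\}$, and the cartesian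 *composable* FVDCs (cartesian equipments) for $S=\mathbb N$. For a cartesian fibration $p$, let $\mathrm{Bil}[p]$ be the VDC with the objects and arrows of $\mathcal B$ as objects and tight arrows, the objects of $\mathcal E_{I\times J}$ as loose arrows from $I$ to $J$, and as cells from a path $\alpha_1,\dots,\alpha_n$ ($\alpha_i\in\mathcal E_{I_{i-1}\times I_i}$) to $\beta\in\mathcal E_{K\times M}$ over $s\colon I_0\to K$ and $t\colon I_n\to M$ the arrows $\bigwedge_{i}\alpha_i[\langle i-1,i\rangle]\to\beta[(s\times t)\circ\langle 0,n\rangle]$ of $\mathcal E_{I_0\times\dots\times I_n}$. A morphism $F\colon p\to q$ acts on these data (objects over $FI\times FJ$ being obtained by base change along $FI\times FJ\cong F(I\times J)$), giving a functor $\mathrm{Bil}[F]$, and a 2-cell $\theta\colon F\to G$ induces a transformation $\mathrm{Bil}[\theta]$ with components $\theta_I$ and, at a loose arrow $\alpha$, the factorization $F\alpha\to G\alpha[\theta_I\times\theta_J]$ of $\theta_\alpha$. **Theorem.** These assignments underlie a 2-functor (a pseudofunctor, whose coherence 2-cells have identities as tight components) $\mathrm{Bil}$ from $\mathbf{Fib}_{\wedge\top}$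 to the 2-category of VDCs. It takes its values in cartesian FVDCs, and it restricts to 2-functors $$\mathbf{Fib}_{\wedge\top}\to\mathbf{CFVDC}_{\varnothing},\qquad \mathbf{Fib}_{\wedge\top=}\to\mathbf{CFVDC}_{\{0\}},\qquad \mathbf{Fib}_{\wedge\top\exists}\to\mathbf{CFVDC}_{\{n\mid n>0\}},\qquad \mathbf{Fib}_{\wedge\top=\exists}\to\mathbf{CFVDC}_{\mathbb N}.$$ That is: $\mathrm{Bil}$ sends elementary fibrations to cartesian unital FVDCs, existential fibrations to cartesian positive-length composable FVDCs, and elementary existential fibrations to cartesian composable FVDCs; and it sends the morphisms which preserve the relevant left adjoints to functors which preserve restrictions, finite products, and the units, the composites of positive length, or all composites, respectively. -/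

import Mathlib

open CategoryTheory Category Limits

universe u v w x

/-- Paths of loose arrows. -/
inductive LPath {Ob : Type u} (L : Ob → Ob → Type w) : Ob → Ob → Type (max u w)
  | nil (I : Ob) : LPath L I I
  | cons {I J K : Ob} (α : L I J) (q : LPath L J K) : LPath L I K

namespace LPath

variable {Ob : Type u} {L : Ob → Ob → Type w}

abbrev single {I J : Ob} (α : L I J) : LPath L I J := .cons α (.nil J)

def append : ∀ {I J K : Ob}, LPath L I J → LPath L J K → LPath L I K
  | _, _, _, .nil _, q => q
  | _, _, _, .cons α p, q => .cons α (append p q)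

def length : ∀ {I J : Ob}, LPath L I J → ℕ
  | _, _, .nil _ => 0
  | _, _, .cons _ p => length p + 1

@[simp] theorem nil_append {I J : Ob} (q : LPath L I J) : (LPath.nil I).append q = q := rfl

@[simp] theorem cons_append {I J K M : Ob} (α : L I J) (p : LPath L J K) (q : LPath L K M) :
    (LPath.cons α p).append q = .cons α (p.append q) := rfl

@[simp] theorem append_nil {I J : Ob} (p : LPath L I J) : p.append (.nil J) = p := by
  induction p with
  | nil => rfl
  | cons α p ih => rw [cons_append, ih]

theorem append_assoc {I J K M : Ob} (p : LPath L I J) (q : LPath L J K) (r : LPath L K M) :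
    (p.append q).append r = p.append (q.append r) := by
  induction p with
  | nil => rfl
  | cons α p ih => rw [cons_append, cons_append, cons_append, ih]

variable {Ob' : Type u} {L' : Ob' → Ob' → Type w}

def map (f : Ob → Ob') (g : ∀ {I J : Ob}, L I J → L' (f I) (f J)) :
    ∀ {I J : Ob}, LPath L I J → LPath L' (f I) (f J)
  | _, _, .nil I => .nil (f I)
  | _, _, .cons α p => .cons (g α) (map f g p)

theorem map_append (f : Ob → Ob') (g : ∀ {I J : Ob}, L I J → L' (f I) (f J)) {I J K : Ob}
    (p : LPath L I J) (q : LPath L J K) :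
    (p.append q).map f g = (p.map f g).append (q.map f g) := by
  induction p with
  | nil => rfl
  | cons α p ih => simp only [cons_append, map, ih]

theorem map_id {I J : Ob} (p : LPath L I J) : p.map (fun I => I) (fun α => α) = p := by
  induction p with
  | nil => rfl
  | cons α p ih => simp only [map, ih]

theorem map_map {Ob'' : Type u} {L'' : Ob'' → Ob'' → Type w}
    (f : Ob → Ob') (g : ∀ {I J : Ob}, L I J → L' (f I) (f J))
    (f' : Ob' → Ob'') (g' : ∀ {I J : Ob'}, L' I J → L'' (f' I) (f' J)) {I J : Ob}
    (p : LPath L I J) :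
    (p.map f g).map f' g' = p.map (fun I => f' (f I)) (fun α => g' (g α)) := by
  induction p with
  | nil => rfl
  | cons α p ih => simp only [map, ih]

theorem length_map (f : Ob → Ob') (g : ∀ {I J : Ob}, L I J → L' (f I) (f J)) {I J : Ob}
    (p : LPath L I J) : (p.map f g).length = p.length := by
  induction p with
  | nil => rfl
  | cons α p ih => simp only [map, length, ih]

end LPath

/-- The data of objects, tight arrows, loose arrows, and cells (from a path of loose arrows to a
loose arrow, with a tight arrow on either side). -/
structure VDGraph where
  Ob : Type u
  [cat : Category.{v} Ob]
  Loose : Ob → Ob → Type w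
  Cell : ∀ {I J K M : Ob}, LPath Loose I J → (I ⟶ K) → (J ⟶ M) → Loose K M → Type x

attribute [instance] VDGraph.cat

namespace VDGraph

/-- Paths of cells that are adjacent along tight arrows; the domain is the concatenation of the
domains. -/
inductive Cells (D : VDGraph.{u, v, w, x}) :
    ∀ {I J K M : D.Ob}, LPath D.Loose I J → (I ⟶ K) → (J ⟶ M) → LPath D.Loose K M →
      Type (max u v w x)
  | nil {I K : D.Ob} (s s' : I ⟶ K) (h : s = s') : Cells D (.nil I) s s' (.nil K)
  | cons {I J I' K M K' : D.Ob} {α₁ : LPath D.Loose I J} {α₂ : LPath D.Loose J I'}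
      {α : LPath D.Loose I I'} {s : I ⟶ K} {t : J ⟶ M} {s' : I' ⟶ K'}
      {β : D.Loose K M} {q : LPath D.Loose M K'}
      (ξ : D.Cell α₁ s t β) (ξs : Cells D α₂ t s' q) (h : α₁.append α₂ = α) :
      Cells D α s s' (.cons β q)

/-- A path of cells over a concatenation, cut into two pieces. -/
structure Split (D : VDGraph.{u, v, w, x}) {I I' K K' M : D.Ob} (α : LPath D.Loose I I')
    (s : I ⟶ K) (s' : I' ⟶ K') (β₁ : LPath D.Loose K M) (β₂ : LPath D.Loose M K') where
  J : D.Ob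
  mid : J ⟶ M
  α₁ : LPath D.Loose I J
  α₂ : LPath D.Loose J I'
  fst : D.Cells α₁ s mid β₁
  snd : D.Cells α₂ mid s' β₂
  eq : α₁.append α₂ = α

def Split.cons {D : VDGraph.{u, v, w, x}} {I J I' K M K' N : D.Ob} {α₁ : LPath D.Loose I J}
    {α₂ : LPath D.Loose J I'} {α : LPath D.Loose I I'} {s : I ⟶ K} {t : J ⟶ M} {s' : I' ⟶ K'}
    {β : D.Loose K M} {β₁ : LPath D.Loose M N} {β₂ : LPath D.Loose N K'}
    (ξ : D.Cell α₁ s t β) (r : D.Split α₂ t s' β₁ β₂) (h : α₁.append α₂ = α) :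
    D.Split α s s' (.cons β β₁) β₂ :=
  ⟨r.J, r.mid, α₁.append r.α₁, r.α₂, .cons ξ r.fst rfl, r.snd,
    by rw [LPath.append_assoc, r.eq, h]⟩

def Cells.split {D : VDGraph.{u, v, w, x}} : ∀ {K K' M : D.Ob} (β₁ : LPath D.Loose K M)
    (β₂ : LPath D.Loose M K') {I I' : D.Ob} {α : LPath D.Loose I I'} {s : I ⟶ K} {s' : I' ⟶ K'},
    D.Cells α s s' (β₁.append β₂) → D.Split α s s' β₁ β₂
  | _, _, _, .nil _, _, _, _, _, _, _, χ => ⟨_, _, _, _, .nil _ _ rfl, χ, rfl⟩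
  | _, _, _, .cons β β₁, β₂, _, _, _, _, _, χ =>
    match χ with
    | .cons ξ ξs h => Split.cons ξ (Cells.split β₁ β₂ ξs) h

def Cells.single {D : VDGraph.{u, v, w, x}} {I J K M : D.Ob} {α : LPath D.Loose I J} {s : I ⟶ K}
    {t : J ⟶ M} {β : D.Loose K M} (ξ : D.Cell α s t β) : D.Cells α s t (.single β) :=
  .cons ξ (.nil t t rfl) α.append_nil

/-- Transport of a cell along equalities of its boundary. -/
def cast (D : VDGraph.{u, v, w, x}) {I J K M : D.Ob} {α α' : LPath D.Loose I J} {s s' : I ⟶ K}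
    {t t' : J ⟶ M} {β : D.Loose K M} (hα : α = α') (hs : s = s') (ht : t = t')
    (ξ : D.Cell α s t β) : D.Cell α' s' t' β :=
  hα ▸ hs ▸ ht ▸ ξ

end VDGraph

/-- Identity cells, and the composition of a path of cells with a cell. -/
structure VDStruct extends VDGraph.{u, v, w, x} where
  idCell : ∀ {I J : Ob} (α : Loose I J), Cell (.single α) (𝟙 I) (𝟙 J) α
  comp : ∀ {I J K M P Q : Ob} {α : LPath Loose I J} {s : I ⟶ K} {s' : J ⟶ M}
    {β : LPath Loose K M} {t : K ⟶ P} {t' : M ⟶ Q} {γ : Loose P Q} {u : I ⟶ P} {u' : J ⟶ Q},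
    toVDGraph.Cells α s s' β → Cell β t t' γ → s ≫ t = u → s' ≫ t' = u' → Cell α u u' γ

namespace VDStruct

variable (D : VDStruct.{u, v, w, x})

def idCells {I J : D.Ob} : ∀ (α : LPath D.Loose I J), D.Cells α (𝟙 I) (𝟙 J) α
  | .nil I => .nil _ _ rfl
  | .cons α p => .cons (D.idCell α) (idCells p) rfl

/-- Composition of two paths of cells. -/
def compCells : ∀ {K M P Q : D.Ob} {β : LPath D.Loose K M} {t : K ⟶ P} {t' : M ⟶ Q}
    {γ : LPath D.Loose P Q} (_ : D.Cells β t t' γ) {I J : D.Ob} {α : LPath D.Loose I J}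
    {s : I ⟶ K} {s' : J ⟶ M} {u : I ⟶ P} {u' : J ⟶ Q} (_ : D.Cells α s s' β)
    (_ : s ≫ t = u) (_ : s' ≫ t' = u'), D.Cells α u u' γ
  | _, _, _, _, _, _, _, _, .nil _ _ h, _, _, _, _, _, _, _, .nil _ _ h', h₁, h₂ =>
    .nil _ _ (by rw [← h₁, ← h₂, h, h'])
  | _, _, _, _, _, _, _, _, .cons (α₁ := β₁) (α₂ := β₂) ζ ζs rfl, _, _, _, _, _, _, _, χ, h₁, h₂ =>
    let r := VDGraph.Cells.split β₁ β₂ χ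
    .cons (D.comp r.fst ζ h₁ rfl) (compCells ζs r.snd rfl h₂) r.eq
end VDStruct

/-- Virtual double categories. -/
structure VDC extends VDStruct.{u, v, w, x} where
  id_comp : ∀ {I J K M : Ob} {α : LPath Loose I J} {s : I ⟶ K} {s' : J ⟶ M} {β : Loose K M}
    (ξ : Cell α s s' β) (h : 𝟙 I ≫ s = s) (h' : 𝟙 J ≫ s' = s'),
    comp (toVDStruct.idCells α) ξ h h' = ξ
  comp_id : ∀ {I J K M : Ob} {α : LPath Loose I J} {s : I ⟶ K} {s' : J ⟶ M} {β : Loose K M}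
    (ξ : Cell α s s' β) (h : s ≫ 𝟙 K = s) (h' : s' ≫ 𝟙 M = s'),
    comp (VDGraph.Cells.single ξ) (idCell β) h h' = ξ
  assoc : ∀ {I J K M P Q X Y : Ob} {α : LPath Loose I J} {s : I ⟶ K} {s' : J ⟶ M}
    {β : LPath Loose K M} {t : K ⟶ P} {t' : M ⟶ Q} {γ : LPath Loose P Q} {u : P ⟶ X} {u' : Q ⟶ Y}
    {δ : Loose X Y} {st : I ⟶ P} {st' : J ⟶ Q} {tu : K ⟶ X} {tu' : M ⟶ Y} {stu : I ⟶ X}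
    {stu' : J ⟶ Y} (χ : toVDGraph.Cells α s s' β) (ξ : toVDGraph.Cells β t t' γ)
    (ζ : Cell γ u u' δ) (h₁ : s ≫ t = st) (h₁' : s' ≫ t' = st') (h₂ : t ≫ u = tu)
    (h₂' : t' ≫ u' = tu') (h₃ : st ≫ u = stu) (h₃' : st' ≫ u' = stu') (h₄ : s ≫ tu = stu)
    (h₄' : s' ≫ tu' = stu'),
    comp (toVDStruct.compCells ξ χ h₁ h₁') ζ h₃ h₃' = comp χ (comp ξ ζ h₂ h₂') h₄ h₄'

structure VDGraphHom (D E : VDGraph.{u, v, w, x}) where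
  tight : D.Ob ⥤ E.Ob
  loose : ∀ {I J : D.Ob}, D.Loose I J → E.Loose (tight.obj I) (tight.obj J)
  cell : ∀ {I J K M : D.Ob} {α : LPath D.Loose I J} {s : I ⟶ K} {s' : J ⟶ M} {β : D.Loose K M},
    D.Cell α s s' β → E.Cell (α.map tight.obj loose) (tight.map s) (tight.map s') (loose β)

namespace VDGraphHom

variable {D E : VDGraph.{u, v, w, x}} (F : VDGraphHom D E)

abbrev path {I J : D.Ob} (α : LPath D.Loose I J) : LPath E.Loose (F.tight.obj I) (F.tight.obj J) :=
  α.map F.tight.obj F.loose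

def cells : ∀ {I J K M : D.Ob} {α : LPath D.Loose I J} {s : I ⟶ K} {s' : J ⟶ M}
    {β : LPath D.Loose K M},
    D.Cells α s s' β → E.Cells (F.path α) (F.tight.map s) (F.tight.map s') (F.path β)
  | _, _, _, _, _, _, _, _, .nil _ _ h => .nil _ _ (by rw [h])
  | _, _, _, _, _, _, _, _, .cons ξ ξs h =>
    .cons (F.cell ξ) (cells ξs) (by subst h; exact (LPath.map_append _ _ _ _).symm)

end VDGraphHom

/-- Functors of virtual double categories. -/
structure VDFunctor (D E : VDC.{u, v, w, x}) extends VDGraphHom D.toVDGraph E.toVDGraph where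
  cell_id : ∀ {I J : D.Ob} (α : D.Loose I J),
    cell (D.idCell α) =
      E.cast rfl (tight.map_id I).symm (tight.map_id J).symm (E.idCell (loose α))
  cell_comp : ∀ {I J K M P Q : D.Ob} {α : LPath D.Loose I J} {s : I ⟶ K} {s' : J ⟶ M}
    {β : LPath D.Loose K M} {t : K ⟶ P} {t' : M ⟶ Q} {γ : D.Loose P Q} {u : I ⟶ P} {u' : J ⟶ Q}
    (χ : D.Cells α s s' β) (ζ : D.Cell β t t' γ) (h : s ≫ t = u) (h' : s' ≫ t' = u'),
    cell (D.comp χ ζ h h') =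
      E.comp (toVDGraphHom.cells χ) (cell ζ) (by rw [← tight.map_comp, h])
        (by rw [← tight.map_comp, h'])

namespace VDGraph

variable {D : VDGraph.{u, v, w, x}}

def Cells.append : ∀ {I J K M : D.Ob} {α₁ : LPath D.Loose I J} {s : I ⟶ K} {t : J ⟶ M}
    {β₁ : LPath D.Loose K M} (_ : D.Cells α₁ s t β₁) {I' K' : D.Ob} {α₂ : LPath D.Loose J I'}
    {s' : I' ⟶ K'} {β₂ : LPath D.Loose M K'} (_ : D.Cells α₂ t s' β₂) {α : LPath D.Loose I I'}
    {β : LPath D.Loose K K'} (_ : α₁.append α₂ = α) (_ : β₁.append β₂ = β), D.Cells α s s' β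
  | _, _, _, _, _, _, _, _, .nil _ _ rfl, _, _, _, _, _, χ₂, _, _, rfl, rfl => χ₂
  | _, _, _, _, _, _, _, _, .cons ξ ξs rfl, _, _, _, _, _, χ₂, _, _, h, rfl =>
    .cons ξ (append ξs χ₂ rfl rfl) (by rw [← h, LPath.append_assoc])

theorem Cells.cons_append {I J N K M L : D.Ob} {α₀ : LPath D.Loose I J} {α₁ : LPath D.Loose J N}
    {s : I ⟶ K} {r : J ⟶ M} {t : N ⟶ L} {β : D.Loose K M} {β₁ : LPath D.Loose M L}
    {α₀₁ : LPath D.Loose I N}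
    (ξ : D.Cell α₀ s r β) (ξs : D.Cells α₁ r t β₁) (h₀ : α₀.append α₁ = α₀₁)
    {I' K' : D.Ob} {α₂ : LPath D.Loose N I'}
    {s' : I' ⟶ K'} {β₂ : LPath D.Loose L K'} (χ₂ : D.Cells α₂ t s' β₂) {α : LPath D.Loose I I'}
    {α' : LPath D.Loose J I'} {q : LPath D.Loose M K'} (h : α₀₁.append α₂ = α)
    (hα : α₁.append α₂ = α') (hq : β₁.append β₂ = q) :
    (Cells.cons ξ ξs h₀).append χ₂ h (congrArg (LPath.cons β) hq) =
      .cons ξ (ξs.append χ₂ hα hq) (by rw [← h, ← h₀, ← hα, LPath.append_assoc]) := by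
  subst hα h₀ hq h
  rfl

theorem Cells.append_nil {I J K M : D.Ob} {α : LPath D.Loose I J} {s : I ⟶ K} {t t' : J ⟶ M}
    {β : LPath D.Loose K M} (χ : D.Cells α s t β) (h : t = t') :
    χ.append (.nil t t' h) α.append_nil β.append_nil = h ▸ χ := by
  subst h
  induction χ with
  | nil s s' h => subst h; rfl
  | cons ξ ξs h ih =>
    rw [Cells.cons_append ξ ξs h _ _ (LPath.append_nil _) (LPath.append_nil _), ih]

theorem Cells.split_append {I J K M : D.Ob} {α₁ : LPath D.Loose I J} {s : I ⟶ K} {t : J ⟶ M}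
    {β₁ : LPath D.Loose K M} (χ₁ : D.Cells α₁ s t β₁) {I' K' : D.Ob} {α₂ : LPath D.Loose J I'}
    {s' : I' ⟶ K'} {β₂ : LPath D.Loose M K'} (χ₂ : D.Cells α₂ t s' β₂) {α : LPath D.Loose I I'}
    (h : α₁.append α₂ = α) :
    Cells.split β₁ β₂ (χ₁.append χ₂ h rfl) = ⟨J, t, α₁, α₂, χ₁, χ₂, h⟩ := by
  subst h
  induction χ₁ with
  | nil s s' h => subst h; rfl
  | cons ξ ξs h ih =>
    subst h
    exact congrArg (fun r => Split.cons ξ r (LPath.append_assoc _ _ _).symm) (ih χ₂)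

theorem Cells.append_split {K K' M : D.Ob} (β₁ : LPath D.Loose K M)
    (β₂ : LPath D.Loose M K') {I I' : D.Ob} {α : LPath D.Loose I I'} {s : I ⟶ K} {s' : I' ⟶ K'}
    (χ : D.Cells α s s' (β₁.append β₂)) :
    (χ.split β₁ β₂).fst.append (χ.split β₁ β₂).snd (χ.split β₁ β₂).eq rfl = χ := by
  induction β₁ generalizing I with
  | nil => rfl
  | cons β β₁ ih =>
    obtain _ | ⟨ξ, ξs, h⟩ := χ
    exact (Cells.cons_append ξ _ rfl _ _ (Cells.split β₁ β₂ ξs).eq rfl).trans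
      (congrArg (fun r => Cells.cons ξ r _) (ih β₂ ξs))

end VDGraph

namespace VDStruct

variable (D : VDStruct.{u, v, w, x})

theorem compCells_cons {I J I' K M K' P Q P' : D.Ob} {α₁ : LPath D.Loose I J}
    {α₂ : LPath D.Loose J I'} {s : I ⟶ K} {t : J ⟶ M} {s' : I' ⟶ K'}
    {β₁ : LPath D.Loose K M} {β₂ : LPath D.Loose M K'} {a : K ⟶ P} {b : M ⟶ Q} {a' : K' ⟶ P'}
    {γ : D.Loose P Q} {γs : LPath D.Loose Q P'} {α : LPath D.Loose I I'} {β : LPath D.Loose K K'}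
    (χ₁ : D.Cells α₁ s t β₁) (χ₂ : D.Cells α₂ t s' β₂) (hα : α₁.append α₂ = α)
    (hβ : β₁.append β₂ = β) (ζ : D.Cell β₁ a b γ) (ζs : D.Cells β₂ b a' γs)
    {u : I ⟶ P} {u' : I' ⟶ P'} {r : J ⟶ Q} (h : s ≫ a = u) (hr : t ≫ b = r) (h' : s' ≫ a' = u') :
    D.compCells (.cons ζ ζs hβ) (χ₁.append χ₂ hα hβ) h h' =
      .cons (D.comp χ₁ ζ h hr) (D.compCells ζs χ₂ hr h') hα := by
  subst hβ hr
  exact congrArg (fun r : D.Split α s s' β₁ β₂ =>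
    VDGraph.Cells.cons (D.comp r.fst ζ h rfl) (D.compCells ζs r.snd rfl h') r.eq)
    (VDGraph.Cells.split_append χ₁ χ₂ hα)

theorem compCells_single {I J K M P Q : D.Ob} {α : LPath D.Loose I J} {s : I ⟶ K} {s' : J ⟶ M}
    {β : LPath D.Loose K M} {t : K ⟶ P} {t' : M ⟶ Q} {γ : D.Loose P Q} {u : I ⟶ P} {u' : J ⟶ Q}
    (χ : D.Cells α s s' β) (ζ : D.Cell β t t' γ) (h : s ≫ t = u) (h' : s' ≫ t' = u') :
    D.compCells (.single ζ) χ h h' = .single (D.comp χ ζ h h') := by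
  have := D.compCells_cons χ (.nil s' s' rfl) α.append_nil β.append_nil ζ (.nil t' t' rfl)
    h h' h'
  rw [VDGraph.Cells.append_nil] at this
  exact this

end VDStruct

namespace VDGraph

variable {D : VDGraph.{u, v, w, x}}

@[simp] theorem cast_rfl {I J K M : D.Ob} {α : LPath D.Loose I J} {s : I ⟶ K} {t : J ⟶ M}
    {β : D.Loose K M} (hα : α = α) (hs : s = s) (ht : t = t) (ξ : D.Cell α s t β) :
    D.cast hα hs ht ξ = ξ := rfl

@[simp] theorem cast_cast {I J K M : D.Ob} {α α' α'' : LPath D.Loose I J} {s s' s'' : I ⟶ K}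
    {t t' t'' : J ⟶ M} {β : D.Loose K M} (hα : α = α') (hs : s = s') (ht : t = t')
    (hα' : α' = α'') (hs' : s' = s'') (ht' : t' = t'') (ξ : D.Cell α s t β) :
    D.cast hα' hs' ht' (D.cast hα hs ht ξ) =
      D.cast (hα.trans hα') (hs.trans hs') (ht.trans ht') ξ := by
  subst hα hs ht hα' hs' ht'; rfl

/-- Transport of a path of cells along equalities of its boundary. -/
def castCells {I J K M : D.Ob} {α α' : LPath D.Loose I J} {s s' : I ⟶ K}
    {t t' : J ⟶ M} {β β' : LPath D.Loose K M} (hα : α = α') (hs : s = s') (ht : t = t')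
    (hβ : β = β') (ξ : D.Cells α s t β) : D.Cells α' s' t' β' :=
  hα ▸ hs ▸ ht ▸ hβ ▸ ξ

@[simp] theorem castCells_castCells {I J K M : D.Ob} {α α' α'' : LPath D.Loose I J}
    {s s' s'' : I ⟶ K} {t t' t'' : J ⟶ M} {β β' β'' : LPath D.Loose K M} (hα : α = α')
    (hs : s = s') (ht : t = t') (hβ : β = β') (hα' : α' = α'') (hs' : s' = s'') (ht' : t' = t'')
    (hβ' : β' = β'') (ξ : D.Cells α s t β) :
    castCells hα' hs' ht' hβ' (castCells hα hs ht hβ ξ) =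
      castCells (hα.trans hα') (hs.trans hs') (ht.trans ht') (hβ.trans hβ') ξ := by
  subst hα hs ht hβ hα' hs' ht' hβ'; rfl

@[simp] theorem castCells_rfl {I J K M : D.Ob} {α : LPath D.Loose I J} {s : I ⟶ K} {t : J ⟶ M}
    {β : LPath D.Loose K M} (hα : α = α) (hs : s = s) (ht : t = t) (hβ : β = β)
    (ξ : D.Cells α s t β) : castCells hα hs ht hβ ξ = ξ := rfl

theorem castCells_cons {I J I' K M K' : D.Ob} {α₁ α₁' : LPath D.Loose I J}
    {α₂ α₂' : LPath D.Loose J I'} {α α' : LPath D.Loose I I'} {s r : I ⟶ K} {t r' : J ⟶ M}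
    {s' r'' : I' ⟶ K'} {β : D.Loose K M} {q q' : LPath D.Loose M K'}
    (ξ : D.Cell α₁ s t β) (ξs : D.Cells α₂ t s' q) (h : α₁.append α₂ = α) (hα : α = α')
    (hs : s = r) (hs' : s' = r'') (hβ : LPath.cons β q = LPath.cons β q') (hα₁ : α₁ = α₁')
    (hα₂ : α₂ = α₂') (ht : t = r') (hq : q = q') (h' : α₁'.append α₂' = α') :
    castCells hα hs hs' hβ (Cells.cons ξ ξs h) =
      .cons (D.cast hα₁ hs ht ξ) (castCells hα₂ ht hs' hq ξs) h' := by
  subst hα hs hs' hα₁ hα₂ ht hq; rfl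

theorem castCells_single {I J K M : D.Ob} {α α' : LPath D.Loose I J} {s s' : I ⟶ K}
    {t t' : J ⟶ M} {β : D.Loose K M} (ξ : D.Cell α s t β) (hα : α = α') (hs : s = s')
    (ht : t = t') (hβ : LPath.single β = LPath.single β) :
    castCells hα hs ht hβ (Cells.single ξ) = .single (D.cast hα hs ht ξ) := by
  subst hα hs ht; rfl

theorem castCells_nil {I K : D.Ob} {s s' r r' : I ⟶ K} (h : s = s') (hα : LPath.nil I = .nil I)
    (hs : s = r) (hs' : s' = r') (hβ : LPath.nil K = .nil K) :
    castCells (D := D) hα hs hs' hβ (.nil s s' h) = .nil r r' (hs ▸ hs' ▸ h) := by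
  subst hs hs'; rfl

end VDGraph

namespace VDC

variable (D : VDC.{u, v, w, x})

theorem comp_cast {I J K M P Q : D.Ob} {α : LPath D.Loose I J} {s : I ⟶ K} {s' : J ⟶ M}
    {β β₁ : LPath D.Loose K M} {t t₁ : K ⟶ P} {t' t₁' : M ⟶ Q} {γ : D.Loose P Q} {u : I ⟶ P}
    {u' : J ⟶ Q} (χ : D.Cells α s s' β₁) (ζ : D.Cell β t t' γ) (hβ : β = β₁) (ht : t = t₁)
    (ht' : t' = t₁') (h : s ≫ t₁ = u) (h' : s' ≫ t₁' = u') :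
    D.comp χ (D.cast hβ ht ht' ζ) h h' =
      D.comp (VDGraph.castCells rfl rfl rfl hβ.symm χ) ζ (ht ▸ h) (ht' ▸ h') := by
  subst hβ ht ht'; rfl

theorem cast_comp {I J K M P Q : D.Ob} {α α' : LPath D.Loose I J} {s : I ⟶ K} {s' : J ⟶ M}
    {β : LPath D.Loose K M} {t : K ⟶ P} {t' : M ⟶ Q} {γ : D.Loose P Q} {u u₁ : I ⟶ P}
    {u' u₁' : J ⟶ Q} (χ : D.Cells α s s' β) (ζ : D.Cell β t t' γ) (h : s ≫ t = u)
    (h' : s' ≫ t' = u') (hα : α = α') (hu : u = u₁) (hu' : u' = u₁') :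
    D.cast hα hu hu' (D.comp χ ζ h h') =
      D.comp (VDGraph.castCells hα rfl rfl rfl χ) ζ (h.trans hu) (h'.trans hu') := by
  subst hα hu hu'; rfl

theorem id_comp_cast {I J K M : D.Ob} {α : LPath D.Loose I J} {s u : I ⟶ K} {s' u' : J ⟶ M}
    {β : D.Loose K M} (ξ : D.Cell α s s' β) (h : 𝟙 I ≫ s = u) (h' : 𝟙 J ≫ s' = u') :
    D.comp (D.idCells α) ξ h h' =
      D.cast rfl ((Category.id_comp s).symm.trans h) ((Category.id_comp s').symm.trans h') ξ := by
  obtain rfl : s = u := (Category.id_comp s).symm.trans h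
  obtain rfl : s' = u' := (Category.id_comp s').symm.trans h'
  exact D.id_comp ξ _ _

theorem comp_id_cast {I J K M : D.Ob} {α : LPath D.Loose I J} {s u : I ⟶ K} {s' u' : J ⟶ M}
    {β : D.Loose K M} (ξ : D.Cell α s s' β) (h : s ≫ 𝟙 K = u) (h' : s' ≫ 𝟙 M = u') :
    D.comp (.single ξ) (D.idCell β) h h' =
      D.cast rfl ((Category.comp_id s).symm.trans h) ((Category.comp_id s').symm.trans h') ξ := by
  obtain rfl : s = u := (Category.comp_id s).symm.trans h
  obtain rfl : s' = u' := (Category.comp_id s').symm.trans h'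
  exact D.comp_id ξ _ _

end VDC

namespace VDGraphHom

variable {D E : VDGraph.{u, v, w, x}} (F : VDGraphHom D E)

theorem cell_cast {I J K M : D.Ob} {α α' : LPath D.Loose I J} {s s' : I ⟶ K}
    {t t' : J ⟶ M} {β : D.Loose K M} (hα : α = α') (hs : s = s') (ht : t = t')
    (ξ : D.Cell α s t β) :
    F.cell (D.cast hα hs ht ξ) =
      E.cast (hα ▸ rfl) (hs ▸ rfl) (ht ▸ rfl) (F.cell ξ) := by
  subst hα hs ht; rfl

abbrev id (D : VDGraph.{u, v, w, x}) : VDGraphHom D D where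
  tight := 𝟭 _
  loose α := α
  cell ξ := D.cast (LPath.map_id _).symm rfl rfl ξ

abbrev comp {D E F : VDGraph.{u, v, w, x}} (f : VDGraphHom D E) (g : VDGraphHom E F) :
    VDGraphHom D F where
  tight := f.tight ⋙ g.tight
  loose α := g.loose (f.loose α)
  cell ξ := F.cast (LPath.map_map _ _ _ _ _) rfl rfl (g.cell (f.cell ξ))

theorem id_cell {I J K M : D.Ob} {α : LPath D.Loose I J} {s : I ⟶ K} {s' : J ⟶ M}
    {β : D.Loose K M} (ξ : D.Cell α s s' β) :
    (id D).cell ξ = D.cast (LPath.map_id _).symm rfl rfl ξ := rfl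

theorem comp_cell {D E F : VDGraph.{u, v, w, x}} (f : VDGraphHom D E) (g : VDGraphHom E F)
    {I J K M : D.Ob} {α : LPath D.Loose I J} {s : I ⟶ K} {s' : J ⟶ M}
    {β : D.Loose K M} (ξ : D.Cell α s s' β) :
    (comp f g).cell ξ = F.cast (LPath.map_map _ _ _ _ _) rfl rfl (g.cell (f.cell ξ)) := rfl

theorem cells_id {I J K M : D.Ob} {α : LPath D.Loose I J} {s : I ⟶ K} {s' : J ⟶ M}
    {β : LPath D.Loose K M} (χ : D.Cells α s s' β) :
    (id D).cells χ = VDGraph.castCells (LPath.map_id _).symm rfl rfl (LPath.map_id _).symm χ := by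
  induction χ with
  | nil s s' h => rfl
  | cons ξ ξs h ih =>
    refine Eq.trans ?_ (VDGraph.castCells_cons ξ ξs h _ rfl rfl _ (LPath.map_id _).symm
      (LPath.map_id _).symm rfl (LPath.map_id _).symm ?_).symm
    rw [← ih]; rfl

theorem cells_comp {D E F : VDGraph.{u, v, w, x}} (f : VDGraphHom D E) (g : VDGraphHom E F)
    {I J K M : D.Ob} {α : LPath D.Loose I J} {s : I ⟶ K} {s' : J ⟶ M}
    {β : LPath D.Loose K M} (χ : D.Cells α s s' β) :
    (comp f g).cells χ =
      VDGraph.castCells (LPath.map_map _ _ _ _ _) rfl rfl (LPath.map_map _ _ _ _ _)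
        (g.cells (f.cells χ)) := by
  induction χ with
  | nil s s' h => rfl
  | cons ξ ξs h ih =>
    refine Eq.trans ?_ (VDGraph.castCells_cons (g.cell (f.cell ξ)) (g.cells (f.cells ξs)) _ _
      rfl rfl _ (LPath.map_map _ _ _ _ _) (LPath.map_map _ _ _ _ _) rfl
      (LPath.map_map _ _ _ _ _) ?_).symm
    rw [← ih]; rfl

end VDGraphHom

namespace VDFunctor

abbrev id (D : VDC.{u, v, w, x}) : VDFunctor D D where
  toVDGraphHom := VDGraphHom.id D.toVDGraph
  cell_id α := rfl
  cell_comp χ ζ h h' := by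
    rw [VDGraphHom.cells_id, VDGraphHom.id_cell, VDGraphHom.id_cell, VDC.cast_comp]
    refine Eq.trans ?_ (VDC.comp_cast D _ ζ _ _ _ _ _).symm
    rw [VDGraph.castCells_castCells]

abbrev comp {D E F : VDC.{u, v, w, x}} (f : VDFunctor D E) (g : VDFunctor E F) :
    VDFunctor D F where
  toVDGraphHom := VDGraphHom.comp f.toVDGraphHom g.toVDGraphHom
  cell_id α := by
    rw [VDGraphHom.comp_cell, f.cell_id]
    refine (congrArg (F.cast _ _ _) ((VDGraphHom.cell_cast g.toVDGraphHom _ _ _ _).trans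
      (congrArg (F.cast _ _ _) (g.cell_id _)))).trans ?_
    exact (congrArg (F.cast _ _ _) (VDGraph.cast_cast _ _ _ _ _ _ _)).trans
      (VDGraph.cast_cast _ _ _ _ _ _ _)
  cell_comp χ ζ h h' := by
    rw [VDGraphHom.cells_comp, VDGraphHom.comp_cell, VDGraphHom.comp_cell, f.cell_comp,
      g.cell_comp, VDC.cast_comp]
    refine Eq.trans ?_ (VDC.comp_cast F _ _ _ _ _ _ _).symm
    rw [VDGraph.castCells_castCells]

end VDFunctor

namespace VDC

/-- A loose arrow with its endpoints. -/
structure Vert (D : VDC.{u, v, w, x}) where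
  src : D.Ob
  tgt : D.Ob
  loose : D.Loose src tgt

/-- A cell with one-step domain, together with its tight boundary. -/
@[ext]
structure VertHom {D : VDC.{u, v, w, x}} (α β : D.Vert) where
  left : α.src ⟶ β.src
  right : α.tgt ⟶ β.tgt
  cell : D.Cell (.single α.loose) left right β.loose

theorem VertHom.ext_cast {D : VDC.{u, v, w, x}} {α β : D.Vert} {f g : VertHom α β}
    (hl : f.left = g.left) (hr : f.right = g.right) (h : D.cast rfl hl hr f.cell = g.cell) :
    f = g := by
  obtain ⟨fl, fr, fc⟩ := f
  obtain ⟨gl, gr, gc⟩ := g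
  dsimp only at hl hr
  subst hl hr
  rw [VDGraph.cast_rfl] at h
  dsimp only at h
  rw [h]

instance (D : VDC.{u, v, w, x}) : Category D.Vert where
  Hom α β := VertHom α β
  id α := ⟨𝟙 _, 𝟙 _, D.idCell α.loose⟩
  comp f g := ⟨f.left ≫ g.left, f.right ≫ g.right, D.comp (.single f.cell) g.cell rfl rfl⟩
  id_comp f := VertHom.ext_cast (Category.id_comp _) (Category.id_comp _) (by
    rw [VDC.cast_comp]; exact D.id_comp f.cell _ _)
  comp_id f := VertHom.ext_cast (Category.comp_id _) (Category.comp_id _) (by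
    rw [VDC.cast_comp]; exact D.comp_id f.cell _ _)
  assoc f g h := VertHom.ext_cast (Category.assoc _ _ _) (Category.assoc _ _ _) (by
    rw [VDC.cast_comp, VDGraph.castCells_rfl, ← D.compCells_single]
    exact D.assoc _ _ _ _ _ _ _ _ _ _ _)
end VDC

def VDGraph.transCells {D E : VDGraph.{u, v, w, x}} {P Q : D.Ob → E.Ob}
    (lP : ∀ {I J : D.Ob}, D.Loose I J → E.Loose (P I) (P J))
    (lQ : ∀ {I J : D.Ob}, D.Loose I J → E.Loose (Q I) (Q J))
    (app : ∀ I, P I ⟶ Q I)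
    (cell : ∀ {I J : D.Ob} (α : D.Loose I J), E.Cell (.single (lP α)) (app I) (app J) (lQ α)) :
    ∀ {I J : D.Ob} (α : LPath D.Loose I J), E.Cells (α.map P lP) (app I) (app J) (α.map Q lQ)
  | _, _, .nil _ => .nil _ _ rfl
  | _, _, .cons α p => .cons (cell α) (transCells lP lQ app cell p) rfl

/-- Transformations of functors of virtual double categories, with tight components. -/
structure VDTrans {D E : VDC.{u, v, w, x}} (F G : VDFunctor D E) where
  tight : F.tight ⟶ G.tight
  cell : ∀ {I J : D.Ob} (α : D.Loose I J),
    E.Cell (.single (F.loose α)) (tight.app I) (tight.app J) (G.loose α)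
  naturality : ∀ {I J K M : D.Ob} {α : LPath D.Loose I J} {s : I ⟶ K} {s' : J ⟶ M}
    {β : D.Loose K M} (ξ : D.Cell α s s' β),
    E.comp (VDGraph.transCells F.loose G.loose tight.app cell α) (G.cell ξ)
        (tight.naturality s).symm (tight.naturality s').symm =
      E.comp (.single (F.cell ξ)) (cell β) rfl rfl

namespace VDTrans

variable {D E : VDC.{u, v, w, x}} {F G H : VDFunctor D E}

abbrev cells (θ : VDTrans F G) {I J : D.Ob} (α : LPath D.Loose I J) :
    E.Cells (F.path α) (θ.tight.app I) (θ.tight.app J) (G.path α) :=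
  VDGraph.transCells F.loose G.loose θ.tight.app θ.cell α

theorem ext_cast {θ φ : VDTrans F G} (h : θ.tight = φ.tight)
    (h' : ∀ {I J : D.Ob} (α : D.Loose I J),
      E.cast rfl (by rw [h]) (by rw [h]) (θ.cell α) = φ.cell α) : θ = φ := by
  obtain ⟨θt, θc, hθ⟩ := θ
  obtain ⟨φt, φc, hφ⟩ := φ
  dsimp only at h
  subst h
  have : @θc = @φc := by
    funext I J α
    exact h' α
  subst this
  rfl

theorem transCells_id (F : VDFunctor D E) {I J : D.Ob} (α : LPath D.Loose I J) :
    VDGraph.transCells F.loose F.loose (fun I => 𝟙 (F.tight.obj I))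
      (fun α => E.idCell (F.loose α)) α = E.idCells (F.path α) := by
  induction α with
  | nil => rfl
  | cons α p ih => exact congrArg (fun c => VDGraph.Cells.cons (E.idCell (F.loose α)) c rfl) ih

theorem id_naturality (F : VDFunctor D E) {I J K M : D.Ob} {α : LPath D.Loose I J} {s : I ⟶ K}
    {s' : J ⟶ M} {β : D.Loose K M}
    {c₁ c₂ : E.Cell (F.path α) (F.tight.map s) (F.tight.map s') (F.loose β)} (h : c₁ = c₂)
    (h₁ : 𝟙 _ ≫ F.tight.map s = F.tight.map s ≫ 𝟙 _)
    (h₂ : 𝟙 _ ≫ F.tight.map s' = F.tight.map s' ≫ 𝟙 _) :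
    E.comp (VDGraph.transCells F.loose F.loose (fun I => 𝟙 (F.tight.obj I))
      (fun α => E.idCell (F.loose α)) α) c₂ h₁ h₂ =
    E.comp (.single c₁) (E.idCell (F.loose β)) rfl rfl := by
  subst h
  refine (congrArg (fun c => E.comp c c₁ h₁ h₂) (transCells_id F _)).trans ?_
  exact (E.id_comp_cast _ _ _).trans (E.comp_id_cast _ _ _).symm

def id (F : VDFunctor D E) : VDTrans F F where
  tight := 𝟙 _
  cell α := E.idCell (F.loose α)
  naturality _ := id_naturality F rfl _ _

theorem transCells_comp (θ : VDTrans F G) (φ : VDTrans G H) {I J : D.Ob} (α : LPath D.Loose I J) :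
    VDGraph.transCells F.loose H.loose (fun I => θ.tight.app I ≫ φ.tight.app I)
      (fun α => E.comp (.single (θ.cell α)) (φ.cell α) rfl rfl) α =
        E.compCells (φ.cells α) (θ.cells α) rfl rfl := by
  induction α with
  | nil => rfl
  | cons α p ih =>
    refine (congrArg (fun c => VDGraph.Cells.cons _ c rfl) ih).trans ?_
    exact (E.compCells_cons (.single (θ.cell α)) (θ.cells p) rfl rfl (φ.cell α) (φ.cells p)
      rfl rfl rfl).symm

def comp (θ : VDTrans F G) (φ : VDTrans G H) : VDTrans F H where
  tight := θ.tight ≫ φ.tight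
  cell α := E.comp (.single (θ.cell α)) (φ.cell α) rfl rfl
  naturality {I J K M α s s' β} ξ := by
    refine (congrArg (fun c => E.comp c (H.cell ξ) _ _) (transCells_comp θ φ α)).trans ?_
    refine (E.assoc (θ.cells α) (φ.cells α) (H.cell ξ) rfl rfl (φ.tight.naturality s).symm
      (φ.tight.naturality s').symm _ _ ?_ ?_).trans ?_
    · rw [← Category.assoc, ← θ.tight.naturality, Category.assoc]; rfl
    · rw [← Category.assoc, ← θ.tight.naturality, Category.assoc]; rfl
    rw [φ.naturality]
    refine (E.assoc (θ.cells α) (.single (G.cell ξ)) (φ.cell β) (θ.tight.naturality s).symm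
      (θ.tight.naturality s').symm rfl rfl ?_ ?_ _ _).symm.trans ?_
    · simp
    · simp
    rw [E.compCells_single, θ.naturality, ← E.compCells_single]
    exact E.assoc _ _ _ _ _ _ _ _ _ _ _

/-- The component of a transformation at a loose arrow, with its boundary. -/
def vert (θ : VDTrans F G) (α : D.Vert) :
    (⟨_, _, F.loose α.loose⟩ : E.Vert) ⟶ ⟨_, _, G.loose α.loose⟩ :=
  ⟨θ.tight.app α.src, θ.tight.app α.tgt, θ.cell α.loose⟩

theorem ext_vert {θ φ : VDTrans F G} (h : ∀ I, θ.tight.app I = φ.tight.app I)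
    (h' : ∀ α, θ.vert α = φ.vert α) : θ = φ := by
  refine ext_cast (NatTrans.ext (funext h)) (fun α => ?_)
  have := h' ⟨_, _, α⟩
  simp only [vert] at this
  have H : ∀ {a b : E.Vert} {f g : VDC.VertHom a b} (e : f = g),
      E.cast rfl (congrArg VDC.VertHom.left e) (congrArg VDC.VertHom.right e) f.cell = g.cell := by
    rintro a b f g rfl; rfl
  exact H this

end VDTrans

namespace VDFunctor

variable {D E : VDC.{u, v, w, x}}

def vert (F : VDFunctor D E) : D.Vert ⥤ E.Vert where
  obj α := ⟨_, _, F.loose α.loose⟩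
  map f := ⟨F.tight.map f.left, F.tight.map f.right, F.cell f.cell⟩
  map_id α := VDC.VertHom.ext_cast (F.tight.map_id _) (F.tight.map_id _) (by
    refine (congrArg (E.cast _ _ _) (F.cell_id α.loose)).trans ?_
    exact VDGraph.cast_cast _ _ _ _ _ _ _)
  map_comp f g := VDC.VertHom.ext_cast (F.tight.map_comp _ _) (F.tight.map_comp _ _) (by
    refine (congrArg (E.cast _ _ _) (F.cell_comp (.single f.cell) g.cell rfl rfl)).trans ?_
    exact VDC.cast_comp _ _ _ _ _ _ _ _)

end VDFunctor

instance (D E : VDC.{u, v, w, x}) : Category (VDFunctor D E) where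
  Hom F G := VDTrans F G
  id F := VDTrans.id F
  comp θ φ := VDTrans.comp θ φ
  id_comp θ := VDTrans.ext_vert (fun _ => Category.id_comp _)
    (fun α => Category.id_comp (θ.vert α))
  comp_id θ := VDTrans.ext_vert (fun _ => Category.comp_id _)
    (fun α => Category.comp_id (θ.vert α))
  assoc θ φ ψ := VDTrans.ext_vert (fun _ => Category.assoc _ _ _)
    (fun α => Category.assoc (θ.vert α) (φ.vert α) (ψ.vert α))

namespace VDTrans

variable {D E F : VDC.{u, v, w, x}}

theorem transCells_whiskerLeft (f : VDGraphHom D.toVDGraph E.toVDGraph) {g h : VDFunctor E F}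
    (θ : VDTrans g h) {I J : D.Ob} (α : LPath D.Loose I J) :
    VDGraph.transCells (f.comp g.toVDGraphHom).loose (f.comp h.toVDGraphHom).loose
        (fun I => θ.tight.app (f.tight.obj I)) (fun α => θ.cell (f.loose α)) α =
      VDGraph.castCells (LPath.map_map _ _ _ _ _) rfl rfl (LPath.map_map _ _ _ _ _)
        (θ.cells (f.path α)) := by
  induction α with
  | nil => rfl
  | cons α p ih =>
    refine Eq.trans ?_ (VDGraph.castCells_cons (θ.cell (f.loose α)) (θ.cells (f.path p)) rfl _ rfl
      rfl _ rfl (LPath.map_map _ _ _ _ _) rfl (LPath.map_map _ _ _ _ _) rfl).symm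
    rw [← ih]; rfl

def whiskerLeft (f : VDFunctor D E) {g h : VDFunctor E F} (θ : VDTrans g h) :
    VDTrans (f.comp g) (f.comp h) where
  tight := Functor.whiskerLeft f.tight θ.tight
  cell α := θ.cell (f.loose α)
  naturality {I J K M α s s' β} ξ := by
    refine (congrArg (fun c => F.comp c _ _ _)
      (transCells_whiskerLeft f.toVDGraphHom θ α)).trans ?_
    refine (F.comp_cast _ (h.cell (f.cell ξ)) _ rfl rfl _ _).trans ?_
    rw [VDGraph.castCells_castCells]
    refine (F.cast_comp _ (h.cell (f.cell ξ)) (θ.tight.naturality _).symm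
      (θ.tight.naturality _).symm (LPath.map_map _ _ _ _ _) rfl rfl).symm.trans ?_
    refine (congrArg (F.cast _ rfl rfl) (θ.naturality (f.cell ξ))).trans ?_
    refine (F.cast_comp _ _ rfl rfl (LPath.map_map _ _ _ _ _) rfl rfl).trans ?_
    rw [VDGraph.castCells_single]

theorem transCells_whiskerRight {f g : VDFunctor D E} (θ : VDTrans f g)
    (h : VDGraphHom E.toVDGraph F.toVDGraph) {I J : D.Ob} (α : LPath D.Loose I J) :
    VDGraph.transCells (f.toVDGraphHom.comp h).loose (g.toVDGraphHom.comp h).loose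
        (fun I => h.tight.map (θ.tight.app I)) (fun α => h.cell (θ.cell α)) α =
      VDGraph.castCells (LPath.map_map _ _ _ _ _) rfl rfl (LPath.map_map _ _ _ _ _)
        (h.cells (θ.cells α)) := by
  induction α with
  | nil => rfl
  | cons α p ih =>
    refine Eq.trans ?_ (VDGraph.castCells_cons (h.cell (θ.cell α)) (h.cells (θ.cells p)) _ _ rfl
      rfl _ rfl (LPath.map_map _ _ _ _ _) rfl (LPath.map_map _ _ _ _ _) rfl).symm
    rw [← ih]; rfl

def whiskerRight {f g : VDFunctor D E} (θ : VDTrans f g) (h : VDFunctor E F) :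
    VDTrans (f.comp h) (g.comp h) where
  tight := Functor.whiskerRight θ.tight h.tight
  cell α := h.cell (θ.cell α)
  naturality {I J K M α s s' β} ξ := by
    refine (congrArg (fun c => F.comp c _ _ _)
      (transCells_whiskerRight θ h.toVDGraphHom α)).trans ?_
    refine (F.comp_cast _ (h.cell (g.cell ξ)) _ rfl rfl _ _).trans ?_
    rw [VDGraph.castCells_castCells]
    have e : ∀ {X Y : D.Ob} (r : X ⟶ Y),
        h.tight.map (θ.tight.app X) ≫ h.tight.map (g.tight.map r) =
          h.tight.map (f.tight.map r) ≫ h.tight.map (θ.tight.app Y) := fun r => by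
      rw [← h.tight.map_comp, ← θ.tight.naturality, h.tight.map_comp]
    have e' : ∀ {X Y : D.Ob} (r : X ⟶ Y),
        h.tight.map (f.tight.map r ≫ θ.tight.app Y) =
          h.tight.map (f.tight.map r) ≫ h.tight.map (θ.tight.app Y) := fun r =>
      h.tight.map_comp _ _
    refine (F.cast_comp (h.cells (θ.cells α)) (h.cell (g.cell ξ)) (e s)
      (e s') (LPath.map_map _ _ _ _ _) rfl rfl).symm.trans ?_
    have H := congrArg h.cell (θ.naturality ξ)
    rw [h.cell_comp, h.cell_comp] at H
    have H' := congrArg (F.cast (LPath.map_map _ _ _ _ _) (e' s) (e' s')) H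
    rw [VDC.cast_comp, VDC.cast_comp] at H'
    refine (F.cast_comp _ _ _ _ _ _ _).trans (H'.trans ?_)
    refine congrArg (fun c => F.comp c (h.cell (θ.cell β)) rfl rfl) ?_
    exact VDGraph.castCells_single _ _ _ _ _

end VDTrans

namespace VDFunctor

variable {D E F G : VDC.{u, v, w, x}}

theorem assoc_cell (f : VDFunctor D E) (g : VDFunctor E F) (h : VDFunctor F G)
    {I J K M : D.Ob} {α : LPath D.Loose I J} {s : I ⟶ K} {s' : J ⟶ M}
    {β : D.Loose K M} (ξ : D.Cell α s s' β) :
    ((f.comp g).comp h).cell ξ = (f.comp (g.comp h)).cell ξ := by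
  refine (congrArg (G.cast (LPath.map_map _ _ _ _ _) rfl rfl)
    (VDGraphHom.cell_cast h.toVDGraphHom (LPath.map_map _ _ _ _ _) rfl rfl
      (g.cell (f.cell ξ)))).trans ?_
  refine (VDGraph.cast_cast _ rfl rfl _ rfl rfl _).trans (Eq.symm ?_)
  exact VDGraph.cast_cast (LPath.map_map _ _ _ _ _) rfl rfl (LPath.map_map _ _ _ _ _) rfl rfl
    (h.cell (g.cell (f.cell ξ)))

theorem left_cell (f : VDFunctor D E) {I J K M : D.Ob} {α : LPath D.Loose I J} {s : I ⟶ K}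
    {s' : J ⟶ M} {β : D.Loose K M} (ξ : D.Cell α s s' β) :
    ((VDFunctor.id D).comp f).cell ξ = f.cell ξ := by
  refine (congrArg (E.cast (LPath.map_map _ _ _ _ _) rfl rfl)
    (VDGraphHom.cell_cast f.toVDGraphHom (LPath.map_id _).symm rfl rfl ξ)).trans ?_
  exact VDGraph.cast_cast _ rfl rfl _ rfl rfl _

theorem right_cell (f : VDFunctor D E) {I J K M : D.Ob} {α : LPath D.Loose I J} {s : I ⟶ K}
    {s' : J ⟶ M} {β : D.Loose K M} (ξ : D.Cell α s s' β) :
    (f.comp (VDFunctor.id E)).cell ξ = f.cell ξ := by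
  exact VDGraph.cast_cast (LPath.map_id _).symm rfl rfl (LPath.map_map _ _ _ _ _) rfl rfl
    (f.cell ξ)

def associator (f : VDFunctor D E) (g : VDFunctor E F) (h : VDFunctor F G) :
    (f.comp g).comp h ≅ f.comp (g.comp h) where
  hom := {
    tight := (Functor.associator f.tight g.tight h.tight).hom
    cell α := G.idCell (h.loose (g.loose (f.loose α)))
    naturality ξ := VDTrans.id_naturality ((f.comp g).comp h) (assoc_cell f g h ξ) _ _ }
  inv := {
    tight := (Functor.associator f.tight g.tight h.tight).inv
    cell α := G.idCell (h.loose (g.loose (f.loose α)))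
    naturality ξ := VDTrans.id_naturality (f.comp (g.comp h)) (assoc_cell f g h ξ).symm _ _ }
  hom_inv_id := VDTrans.ext_vert (fun _ => Category.id_comp _)
    (fun α => Category.id_comp (𝟙 (⟨_, _, h.loose (g.loose (f.loose α.loose))⟩ : G.Vert)))
  inv_hom_id := VDTrans.ext_vert (fun _ => Category.id_comp _)
    (fun α => Category.id_comp (𝟙 (⟨_, _, h.loose (g.loose (f.loose α.loose))⟩ : G.Vert)))

def leftUnitor (f : VDFunctor D E) : (VDFunctor.id D).comp f ≅ f where
  hom := {
    tight := (Functor.leftUnitor f.tight).hom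
    cell α := E.idCell (f.loose α)
    naturality ξ := VDTrans.id_naturality ((VDFunctor.id D).comp f) (left_cell f ξ) _ _ }
  inv := {
    tight := (Functor.leftUnitor f.tight).inv
    cell α := E.idCell (f.loose α)
    naturality ξ := VDTrans.id_naturality f (left_cell f ξ).symm _ _ }
  hom_inv_id := VDTrans.ext_vert (fun _ => Category.id_comp _)
    (fun α => Category.id_comp (𝟙 (⟨_, _, f.loose α.loose⟩ : E.Vert)))
  inv_hom_id := VDTrans.ext_vert (fun _ => Category.id_comp _)
    (fun α => Category.id_comp (𝟙 (⟨_, _, f.loose α.loose⟩ : E.Vert)))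

def rightUnitor (f : VDFunctor D E) : f.comp (VDFunctor.id E) ≅ f where
  hom := {
    tight := (Functor.rightUnitor f.tight).hom
    cell α := E.idCell (f.loose α)
    naturality ξ := VDTrans.id_naturality (f.comp (VDFunctor.id E)) (right_cell f ξ) _ _ }
  inv := {
    tight := (Functor.rightUnitor f.tight).inv
    cell α := E.idCell (f.loose α)
    naturality ξ := VDTrans.id_naturality f (right_cell f ξ).symm _ _ }
  hom_inv_id := VDTrans.ext_vert (fun _ => Category.id_comp _)
    (fun α => Category.id_comp (𝟙 (⟨_, _, f.loose α.loose⟩ : E.Vert)))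
  inv_hom_id := VDTrans.ext_vert (fun _ => Category.id_comp _)
    (fun α => Category.id_comp (𝟙 (⟨_, _, f.loose α.loose⟩ : E.Vert)))

end VDFunctor

theorem VDTrans.vert_naturality {D E : VDC.{u, v, w, x}} {F G : VDFunctor D E} (θ : VDTrans F G)
    {α β : D.Vert} (f : α ⟶ β) : F.vert.map f ≫ θ.vert β = θ.vert α ≫ G.vert.map f :=
  (VDC.VertHom.ext_cast (θ.tight.naturality f.left).symm (θ.tight.naturality f.right).symm (by
    refine (VDC.cast_comp _ _ _ _ _ _ _ _).trans ?_
    exact θ.naturality f.cell)).symm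

theorem VDTrans.eq_id_comp_id {C : Type*} [Category* C] {a b : C} (f : a ⟶ b) :
    f = 𝟙 a ≫ f ≫ 𝟙 b := by simp

instance : Bicategory VDC.{u, v, w, x} where
  Hom D E := VDFunctor D E
  id D := VDFunctor.id D
  comp F G := VDFunctor.comp F G
  whiskerLeft f _ _ θ := VDTrans.whiskerLeft f θ
  whiskerRight θ h := VDTrans.whiskerRight θ h
  associator f g h := VDFunctor.associator f g h
  leftUnitor f := VDFunctor.leftUnitor f
  rightUnitor f := VDFunctor.rightUnitor f
  whiskerLeft_id f g := VDTrans.ext_vert (fun _ => rfl) (fun _ => rfl)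
  whiskerLeft_comp f _ _ _ η θ := VDTrans.ext_vert (fun _ => rfl) (fun _ => rfl)
  id_whiskerLeft η := by
    refine VDTrans.ext_vert (fun I => VDTrans.eq_id_comp_id ((VDTrans.tight η).app I)) (fun α => ?_)
    exact VDTrans.eq_id_comp_id (VDTrans.vert η α)
  comp_whiskerLeft f g _ _ η := by
    refine VDTrans.ext_vert (fun I => VDTrans.eq_id_comp_id ((VDTrans.tight η).app (g.tight.obj (f.tight.obj I)))) (fun α => ?_)
    exact VDTrans.eq_id_comp_id (VDTrans.vert η (g.vert.obj (f.vert.obj α)))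
  id_whiskerRight f g := by
    refine VDTrans.ext_vert (fun I => g.tight.map_id (f.tight.obj I)) (fun α => ?_)
    exact g.vert.map_id (f.vert.obj α)
  comp_whiskerRight η θ i := by
    refine VDTrans.ext_vert (fun I => i.tight.map_comp ((VDTrans.tight η).app I) ((VDTrans.tight θ).app I)) (fun α => ?_)
    exact i.vert.map_comp (VDTrans.vert η α) (VDTrans.vert θ α)
  whiskerRight_id η := by
    refine VDTrans.ext_vert (fun I => VDTrans.eq_id_comp_id ((VDTrans.tight η).app I)) (fun α => ?_)
    exact VDTrans.eq_id_comp_id (VDTrans.vert η α)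
  whiskerRight_comp η g h := by
    refine VDTrans.ext_vert (fun I => VDTrans.eq_id_comp_id (h.tight.map (g.tight.map ((VDTrans.tight η).app I)))) (fun α => ?_)
    exact VDTrans.eq_id_comp_id (h.vert.map (g.vert.map (VDTrans.vert η α)))
  whisker_assoc f _ _ η h := by
    refine VDTrans.ext_vert (fun I => VDTrans.eq_id_comp_id (h.tight.map ((VDTrans.tight η).app (f.tight.obj I)))) (fun α => ?_)
    exact VDTrans.eq_id_comp_id (h.vert.map (VDTrans.vert η (f.vert.obj α)))
  whisker_exchange η θ := VDTrans.ext_vert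
    (fun I => ((VDTrans.tight θ).naturality ((VDTrans.tight η).app I)).symm)
    (fun α => (VDTrans.vert_naturality θ (VDTrans.vert η α)).symm)
  pentagon f g h i := VDTrans.ext_vert
    (fun I => (congrArg (· ≫ 𝟙 _ ≫ 𝟙 _)
      (i.tight.map_id (h.tight.obj (g.tight.obj (f.tight.obj I))))).trans (Category.id_comp _))
    (fun α => (congrArg (· ≫ 𝟙 _ ≫ 𝟙 _)
      (i.vert.map_id (h.vert.obj (g.vert.obj (f.vert.obj α))))).trans (Category.id_comp _))
  triangle f g := VDTrans.ext_vert
    (fun I => (Category.id_comp _).trans (g.tight.map_id (f.tight.obj I)).symm)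
    (fun α => (Category.id_comp _).trans (g.vert.map_id (f.vert.obj α)).symm)

theorem VDGraph.mk_cells_append {D : VDGraph.{u, v, w, x}} {I J I' K M K' : D.Ob}
    {α₁ : LPath D.Loose I J} {α₂ : LPath D.Loose J I'} {α α' : LPath D.Loose I I'} {s : I ⟶ K}
    {t : J ⟶ M} {s' : I' ⟶ K'} {β₁ : LPath D.Loose K M} {β₂ : LPath D.Loose M K'}
    {β : LPath D.Loose K K'} (χ₁ : D.Cells α₁ s t β₁) (χ₂ : D.Cells α₂ t s' β₂)
    (h : α₁.append α₂ = α) (h' : α₁.append α₂ = α') (hβ : β₁.append β₂ = β) (e : α = α') :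
    VDGraph.castCells e rfl rfl rfl (χ₁.append χ₂ h hβ) = χ₁.append χ₂ h' hβ := by
  subst e; rfl

theorem VDGraphHom.cells_append {D E : VDGraph.{u, v, w, x}} (F : VDGraphHom D E)
    {I J K M : D.Ob} {α₁ : LPath D.Loose I J} {s : I ⟶ K}
    {t : J ⟶ M} {β₁ : LPath D.Loose K M} (χ₁ : D.Cells α₁ s t β₁) {I' K' : D.Ob}
    {α₂ : LPath D.Loose J I'}
    {s' : I' ⟶ K'} {β₂ : LPath D.Loose M K'}
    (χ₂ : D.Cells α₂ t s' β₂) {α : LPath D.Loose I I'} {β : LPath D.Loose K K'}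
    (hα : α₁.append α₂ = α) (hβ : β₁.append β₂ = β)
    (hα' : (F.path α₁).append (F.path α₂) = F.path α)
    (hβ' : (F.path β₁).append (F.path β₂) = F.path β) :
    F.cells (χ₁.append χ₂ hα hβ) = (F.cells χ₁).append (F.cells χ₂) hα' hβ' := by
  subst hα hβ
  induction χ₁ with
  | nil s s' h => subst h; rfl
  | cons ξ ξs h ih =>
    subst h
    refine Eq.trans ?_ (VDGraph.Cells.cons_append (F.cell ξ) (F.cells ξs)
      (LPath.map_append _ _ _ _).symm (F.cells χ₂) hα' (LPath.map_append _ _ _ _).symm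
      (LPath.map_append _ _ _ _).symm).symm
    exact congrArg (fun c => VDGraph.Cells.cons (F.cell ξ) c _) (ih χ₂ _ _)

theorem VDGraphHom.cells_idCells {D E : VDStruct.{u, v, w, x}}
    (F : VDGraphHom D.toVDGraph E.toVDGraph)
    (hF : ∀ {I J : D.Ob} (α : D.Loose I J), F.cell (D.idCell α) =
      E.cast rfl (F.tight.map_id I).symm (F.tight.map_id J).symm (E.idCell (F.loose α)))
    {I J : D.Ob} (α : LPath D.Loose I J) :
    F.cells (D.idCells α) = VDGraph.castCells rfl (F.tight.map_id I).symm
      (F.tight.map_id J).symm rfl (E.idCells (F.path α)) := by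
  induction α with
  | nil => exact (VDGraph.castCells_nil _ _ _ _ _).symm
  | cons α p ih =>
    refine Eq.trans ?_ (VDGraph.castCells_cons (E.idCell (F.loose α)) (E.idCells (F.path p)) rfl rfl
      (F.tight.map_id _).symm (F.tight.map_id _).symm rfl rfl rfl (F.tight.map_id _).symm rfl
      rfl).symm
    rw [← ih, ← hF]; rfl

theorem VDGraphHom.cells_compCells {D E : VDStruct.{u, v, w, x}}
    (F : VDGraphHom D.toVDGraph E.toVDGraph)
    (hF : ∀ {I J K M P Q : D.Ob} {α : LPath D.Loose I J} {s : I ⟶ K} {s' : J ⟶ M}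
      {β : LPath D.Loose K M} {t : K ⟶ P} {t' : M ⟶ Q} {γ : D.Loose P Q} {u : I ⟶ P} {u' : J ⟶ Q}
      (χ : D.Cells α s s' β) (ζ : D.Cell β t t' γ) (h : s ≫ t = u) (h' : s' ≫ t' = u')
      (h₁ : F.tight.map s ≫ F.tight.map t = F.tight.map u)
      (h₁' : F.tight.map s' ≫ F.tight.map t' = F.tight.map u'),
      F.cell (D.comp χ ζ h h') = E.comp (F.cells χ) (F.cell ζ) h₁ h₁')
    {K M P Q : D.Ob} {β : LPath D.Loose K M} {t : K ⟶ P} {t' : M ⟶ Q}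
    {γ : LPath D.Loose P Q} (ζ : D.Cells β t t' γ) {I J : D.Ob} {α : LPath D.Loose I J}
    {s : I ⟶ K} {s' : J ⟶ M} {u : I ⟶ P} {u' : J ⟶ Q} (χ : D.Cells α s s' β)
    (h : s ≫ t = u) (h' : s' ≫ t' = u')
    (h₁ : F.tight.map s ≫ F.tight.map t = F.tight.map u)
    (h₁' : F.tight.map s' ≫ F.tight.map t' = F.tight.map u') :
    F.cells (D.compCells ζ χ h h') = E.compCells (F.cells ζ) (F.cells χ) h₁ h₁' := by
  induction ζ generalizing I J with
  | nil t t' h₀ =>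
    cases χ
    rfl
  | @cons _ N _ _ _ _ β₁ β₂ _ _ _ _ _ _ ζ ζs h₀ ih =>
    subst h₀
    have e := VDGraph.Cells.append_split β₁ β₂ χ
    generalize VDGraph.Cells.split β₁ β₂ χ = r at e
    subst e
    refine (congrArg F.cells (D.compCells_cons r.fst r.snd r.eq rfl ζ ζs h rfl h')).trans ?_
    refine Eq.trans ?_ (congrArg (fun c => E.compCells (F.cells (.cons ζ ζs rfl)) c h₁ h₁')
      (F.cells_append r.fst r.snd r.eq rfl
        ((LPath.map_append _ _ _ _).symm.trans (congrArg F.path r.eq))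
        (LPath.map_append _ _ _ _).symm)).symm
    refine Eq.trans ?_ (E.compCells_cons (F.cells r.fst) (F.cells r.snd) _ _ (F.cell ζ)
      (F.cells ζs) h₁ (F.tight.map_comp _ _).symm h₁').symm
    rw [← ih r.snd rfl h' (F.tight.map_comp _ _).symm h₁', ← hF _ _ h rfl]
    rfl

namespace VDC

/-- The product of two virtual double categories: everything is computed componentwise. -/
abbrev prodGraph (D E : VDC.{u, v, w, x}) : VDGraph.{u, v, w, x} where
  Ob := D.Ob × E.Ob
  cat := CategoryTheory.prod' D.Ob E.Ob
  Loose I J := D.Loose I.1 J.1 × E.Loose I.2 J.2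
  Cell α s t β :=
    D.Cell (α.map Prod.fst Prod.fst) s.1 t.1 β.1 × E.Cell (α.map Prod.snd Prod.snd) s.2 t.2 β.2

abbrev prodFst (D E : VDC.{u, v, w, x}) : VDGraphHom (prodGraph D E) D.toVDGraph where
  tight := CategoryTheory.Prod.fst D.Ob E.Ob
  loose α := α.1
  cell ξ := ξ.1

abbrev prodSnd (D E : VDC.{u, v, w, x}) : VDGraphHom (prodGraph D E) E.toVDGraph where
  tight := CategoryTheory.Prod.snd D.Ob E.Ob
  loose α := α.2
  cell ξ := ξ.2

abbrev prodStruct (D E : VDC.{u, v, w, x}) : VDStruct.{u, v, w, x} where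
  toVDGraph := prodGraph D E
  idCell α := (D.idCell α.1, E.idCell α.2)
  comp χ ζ h h' :=
    (D.comp ((prodFst D E).cells χ) ζ.1 (congrArg Prod.fst h) (congrArg Prod.fst h'),
      E.comp ((prodSnd D E).cells χ) ζ.2 (congrArg Prod.snd h) (congrArg Prod.snd h'))

/-- The product of two virtual double categories. -/
abbrev prod (D E : VDC.{u, v, w, x}) : VDC.{u, v, w, x} where
  toVDStruct := prodStruct D E
  id_comp {_ _ _ _ α _ _ _} ξ _ _ := Prod.ext
    ((congrArg (fun c => D.comp c ξ.1 _ _)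
      (VDGraphHom.cells_idCells (D := prodStruct D E) (E := D.toVDStruct) (prodFst D E)
        (fun _ => rfl) α)).trans (D.id_comp ξ.1 _ _))
    ((congrArg (fun c => E.comp c ξ.2 _ _)
      (VDGraphHom.cells_idCells (D := prodStruct D E) (E := E.toVDStruct) (prodSnd D E)
        (fun _ => rfl) α)).trans (E.id_comp ξ.2 _ _))
  comp_id ξ _ _ := Prod.ext (D.comp_id ξ.1 _ _) (E.comp_id ξ.2 _ _)
  assoc χ ξ ζ h₁ h₁' _ _ _ _ _ _ := Prod.ext
    ((congrArg (fun c => D.comp c ζ.1 _ _)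
      (VDGraphHom.cells_compCells (D := prodStruct D E) (E := D.toVDStruct) (prodFst D E)
        (fun _ _ _ _ _ _ => rfl) ξ χ h₁ h₁' (congrArg Prod.fst h₁) (congrArg Prod.fst h₁'))).trans
      (D.assoc _ _ ζ.1 _ _ _ _ _ _ _ _))
    ((congrArg (fun c => E.comp c ζ.2 _ _)
      (VDGraphHom.cells_compCells (D := prodStruct D E) (E := E.toVDStruct) (prodSnd D E)
        (fun _ _ _ _ _ _ => rfl) ξ χ h₁ h₁' (congrArg Prod.snd h₁) (congrArg Prod.snd h₁'))).trans
      (E.assoc _ _ ζ.2 _ _ _ _ _ _ _ _))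

def terminal : VDC.{u, v, w, x} where
  Ob := PUnit
  cat := { Hom := fun _ _ => PUnit, id := fun _ => ⟨⟩, comp := fun _ _ => ⟨⟩ }
  Loose _ _ := PUnit
  Cell _ _ _ _ := PUnit
  idCell _ := ⟨⟩
  comp _ _ _ _ := ⟨⟩
  id_comp _ _ _ := rfl
  comp_id _ _ _ := rfl
  assoc _ _ _ _ _ _ _ _ _ _ _ := rfl

def bang (D : VDC.{u, v, w, x}) : VDFunctor D terminal where
  tight := { obj := fun _ => PUnit.unit, map := fun _ => PUnit.unit }
  loose _ := ⟨⟩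
  cell _ := ⟨⟩
  cell_id _ := rfl
  cell_comp _ _ _ _ := rfl

abbrev diagHom (D : VDC.{u, v, w, x}) : VDGraphHom D.toVDGraph (prod D D).toVDGraph where
  tight := { obj := fun I => (I, I), map := fun f => (f, f) }
  loose α := (α, α)
  cell ξ := (D.cast ((LPath.map_map _ _ _ _ _).trans (LPath.map_id _)).symm rfl rfl ξ,
    D.cast ((LPath.map_map _ _ _ _ _).trans (LPath.map_id _)).symm rfl rfl ξ)

theorem diag_path_fst (D : VDC.{u, v, w, x}) {I J : D.Ob} (α : LPath D.Loose I J) :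
    α = (prodFst D D).path ((diagHom D).path α) := by
  induction α with
  | nil => rfl
  | cons β p ih => exact congrArg (LPath.cons β) ih

theorem diag_path_snd (D : VDC.{u, v, w, x}) {I J : D.Ob} (α : LPath D.Loose I J) :
    α = (prodSnd D D).path ((diagHom D).path α) := by
  induction α with
  | nil => rfl
  | cons β p ih => exact congrArg (LPath.cons β) ih

theorem diag_fst (D : VDC.{u, v, w, x}) {I J K M : D.Ob} {α : LPath D.Loose I J} {s : I ⟶ K}
    {s' : J ⟶ M} {β : LPath D.Loose K M} (χ : D.Cells α s s' β) :
    (prodFst D D).cells ((diagHom D).cells χ) =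
      VDGraph.castCells (diag_path_fst D α) rfl rfl (diag_path_fst D β) χ := by
  induction χ with
  | nil s s' h => rfl
  | cons ξ ξs h ih =>
    refine Eq.trans ?_ (VDGraph.castCells_cons ξ ξs h _ rfl rfl _ (diag_path_fst D _)
      (diag_path_fst D _) rfl (diag_path_fst D _) ?_).symm
    rw [← ih]; rfl

theorem diag_snd (D : VDC.{u, v, w, x}) {I J K M : D.Ob} {α : LPath D.Loose I J} {s : I ⟶ K}
    {s' : J ⟶ M} {β : LPath D.Loose K M} (χ : D.Cells α s s' β) :
    (prodSnd D D).cells ((diagHom D).cells χ) =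
      VDGraph.castCells (diag_path_snd D α) rfl rfl (diag_path_snd D β) χ := by
  induction χ with
  | nil s s' h => rfl
  | cons ξ ξs h ih =>
    refine Eq.trans ?_ (VDGraph.castCells_cons ξ ξs h _ rfl rfl _ (diag_path_snd D _)
      (diag_path_snd D _) rfl (diag_path_snd D _) ?_).symm
    rw [← ih]; rfl

theorem cast_comp_cast (D : VDC.{u, v, w, x}) {I J K M P Q : D.Ob} {α α' : LPath D.Loose I J}
    {s : I ⟶ K} {s' : J ⟶ M}
    {β β' : LPath D.Loose K M} {t : K ⟶ P} {t' : M ⟶ Q} {γ : D.Loose P Q} {u : I ⟶ P}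
    {u' : J ⟶ Q} (χ : D.Cells α s s' β) (ζ : D.Cell β t t' γ) (h : s ≫ t = u)
    (h' : s' ≫ t' = u') (hα : α = α') (hβ : β = β') :
    D.cast hα rfl rfl (D.comp χ ζ h h') =
      D.comp (VDGraph.castCells hα rfl rfl hβ χ) (D.cast hβ rfl rfl ζ) h h' := by
  subst hα hβ; rfl

def diag (D : VDC.{u, v, w, x}) : VDFunctor D (prod D D) where
  toVDGraphHom := diagHom D
  cell_id _ := rfl
  cell_comp χ ζ h h' := Prod.ext
    ((cast_comp_cast D χ ζ h h' (diag_path_fst D _) (diag_path_fst D _)).trans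
      (congrArg (fun c => D.comp c (D.cast (diag_path_fst D _) rfl rfl ζ) h h')
        (diag_fst D χ).symm))
    ((cast_comp_cast D χ ζ h h' (diag_path_snd D _) (diag_path_snd D _)).trans
      (congrArg (fun c => D.comp c (D.cast (diag_path_snd D _) rfl rfl ζ) h h')
        (diag_snd D χ).symm))

end VDC
open Bicategory

namespace VDC

section

variable {D : VDC.{u, v, w, x}}

/-- A cell with one-step domain is a restriction (is cartesian) if every cell into its codomain
whose boundary factors through its tight boundary factors uniquely through it. -/
def IsRestriction {I J K M : D.Ob} {r : D.Loose I J} {f : I ⟶ K} {g : J ⟶ M} {α : D.Loose K M}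
    (ρ : D.Cell (.single r) f g α) : Prop :=
  ∀ ⦃X Y : D.Ob⦄ (γ : LPath D.Loose X Y) (h : X ⟶ I) (k : Y ⟶ J)
    (ξ : D.Cell γ (h ≫ f) (k ≫ g) α),
    ∃! ζ : D.Cell γ h k r, D.comp (.single ζ) ρ rfl rfl = ξ

/-- The path of cells consisting of `κ`, with identity cells on both sides. -/
def whisker : ∀ {I J : D.Ob} (p : LPath D.Loose I J) {K M : D.Ob} {α : LPath D.Loose J K}
    {c : D.Loose J K} (_ : D.Cell α (𝟙 J) (𝟙 K) c) (q : LPath D.Loose K M),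
    D.Cells (p.append (α.append q)) (𝟙 I) (𝟙 M) (p.append (.cons c q))
  | _, _, .nil _, _, _, _, _, κ, q => .cons κ (D.idCells q) rfl
  | _, _, .cons a p, _, _, _, _, κ, q => .cons (D.idCell a) (whisker p κ q) rfl

/-- A cell with identity tight boundary exhibits its codomain as the composite of its domain (as
the unit, if the domain is empty) if cells factor uniquely through it, at any position of their
domain. -/
def IsComposite {J K : D.Ob} {α : LPath D.Loose J K} {c : D.Loose J K}
    (κ : D.Cell α (𝟙 J) (𝟙 K) c) : Prop :=
  ∀ ⦃I M : D.Ob⦄ (p : LPath D.Loose I J) (q : LPath D.Loose K M) ⦃X Y : D.Ob⦄ (s : I ⟶ X)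
    (t : M ⟶ Y) (γ : D.Loose X Y) (ν : D.Cell (p.append (α.append q)) s t γ),
    ∃! ζ : D.Cell (p.append (.cons c q)) s t γ,
      D.comp (whisker p κ q) ζ (Category.id_comp s) (Category.id_comp t) = ν

/-- A loose arrow between terminal objects which receives exactly one cell over any boundary. -/
structure IsTerminalLoose {T T' : D.Ob} (τ : D.Loose T T') : Prop where
  left : Nonempty (IsTerminal T)
  right : Nonempty (IsTerminal T')
  cell : ∀ ⦃X Y : D.Ob⦄ (γ : LPath D.Loose X Y) (s : X ⟶ T) (t : Y ⟶ T'),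
    Nonempty (D.Cell γ s t τ) ∧ Subsingleton (D.Cell γ s t τ)

/-- A pair of cells over product projections which exhibits its domain as the product of the two
codomains. -/
structure IsProductCone {P P' I I' J J' : D.Ob} {π : D.Loose P P'} {α : D.Loose I I'}
    {β : D.Loose J J'} {a : P ⟶ I} {a' : P' ⟶ I'} {b : P ⟶ J} {b' : P' ⟶ J'}
    (π₁ : D.Cell (.single π) a a' α) (π₂ : D.Cell (.single π) b b' β) : Prop where
  left : Nonempty (IsLimit (BinaryFan.mk a b))
  right : Nonempty (IsLimit (BinaryFan.mk a' b'))
  cell : ∀ ⦃X Y : D.Ob⦄ (γ : LPath D.Loose X Y) (s : X ⟶ P) (t : Y ⟶ P')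
    (ξ₁ : D.Cell γ (s ≫ a) (t ≫ a') α) (ξ₂ : D.Cell γ (s ≫ b) (t ≫ b') β),
    ∃! ζ : D.Cell γ s t π,
      D.comp (.single ζ) π₁ rfl rfl = ξ₁ ∧ D.comp (.single ζ) π₂ rfl rfl = ξ₂

end

/-- All restrictions exist: the virtual double category is fibrational. -/
def HasRestrictions (D : VDC.{u, v, w, x}) : Prop :=
  ∀ ⦃I J K M : D.Ob⦄ (f : I ⟶ K) (g : J ⟶ M) (α : D.Loose K M),
    ∃ (r : D.Loose I J) (ρ : D.Cell (.single r) f g α), IsRestriction ρ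

/-- All paths whose length belongs to `S` have a composite. -/
def HasComposites (S : Set ℕ) (D : VDC.{u, v, w, x}) : Prop :=
  ∀ ⦃I J : D.Ob⦄ (α : LPath D.Loose I J), α.length ∈ S →
    ∃ (c : D.Loose I J) (κ : D.Cell α (𝟙 I) (𝟙 J) c), IsComposite κ

end VDC

namespace VDFunctor

variable {D E F : VDC.{u, v, w, x}}

def PreservesRestrictions (f : VDFunctor D E) : Prop :=
  ∀ ⦃I J K M : D.Ob⦄ ⦃r : D.Loose I J⦄ ⦃s : I ⟶ K⦄ ⦃t : J ⟶ M⦄ ⦃α : D.Loose K M⦄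
    (ρ : D.Cell (.single r) s t α), VDC.IsRestriction ρ → VDC.IsRestriction (f.cell ρ)

def PreservesComposites (S : Set ℕ) (f : VDFunctor D E) : Prop :=
  ∀ ⦃J K : D.Ob⦄ ⦃α : LPath D.Loose J K⦄ ⦃c : D.Loose J K⦄ (κ : D.Cell α (𝟙 J) (𝟙 K) c),
    α.length ∈ S → VDC.IsComposite κ →
      VDC.IsComposite (E.cast rfl (f.tight.map_id J) (f.tight.map_id K) (f.cell κ))

/-- Preservation of finite products, on the tight part and on the loose part. -/
structure PreservesProducts (f : VDFunctor D E) : Prop where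
  tight : PreservesFiniteProducts f.tight
  terminal : ∀ {T T' : D.Ob} (τ : D.Loose T T'), VDC.IsTerminalLoose τ →
    VDC.IsTerminalLoose (f.loose τ)
  product : ∀ {P P' I I' J J' : D.Ob} {π : D.Loose P P'} {α : D.Loose I I'}
    {β : D.Loose J J'} {a : P ⟶ I} {a' : P' ⟶ I'} {b : P ⟶ J} {b' : P' ⟶ J'}
    (π₁ : D.Cell (.single π) a a' α) (π₂ : D.Cell (.single π) b b' β),
    VDC.IsProductCone π₁ π₂ → VDC.IsProductCone (f.cell π₁) (f.cell π₂)

theorem preservesRestrictions_id (D : VDC.{u, v, w, x}) :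
    (VDFunctor.id D).PreservesRestrictions := fun _ _ _ _ _ _ _ _ _ h => h

theorem preservesRestrictions_comp {f : VDFunctor D E} {g : VDFunctor E F}
    (hf : f.PreservesRestrictions) (hg : g.PreservesRestrictions) :
    (f.comp g).PreservesRestrictions := fun _ _ _ _ _ _ _ _ _ h => hg _ (hf _ h)

theorem isComposite_cast {J K : D.Ob} {α α' : LPath D.Loose J K} {c : D.Loose J K}
    {κ : D.Cell α (𝟙 J) (𝟙 K) c} (h : VDC.IsComposite κ) (e : α = α') :
    VDC.IsComposite (D.cast e rfl rfl κ) := by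
  subst e; exact h

theorem preservesComposites_id (S : Set ℕ) (D : VDC.{u, v, w, x}) :
    (VDFunctor.id D).PreservesComposites S := fun _ _ _ _ _ _ h =>
  isComposite_cast h (LPath.map_id _).symm

theorem preservesComposites_comp {S : Set ℕ} {f : VDFunctor D E} {g : VDFunctor E F}
    (hf : f.PreservesComposites S) (hg : g.PreservesComposites S) :
    (f.comp g).PreservesComposites S := fun J K α c κ hα h => by
  have h₁ := hg _ ((LPath.length_map _ _ α).symm ▸ hα) (hf κ hα h)
  have h₂ := isComposite_cast h₁ (LPath.map_map _ _ _ _ _)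
  refine cast (congrArg VDC.IsComposite ?_) h₂
  refine ((congrArg (F.cast _ _ _) (congrArg (F.cast _ _ _) (g.cell_cast rfl (f.tight.map_id J)
    (f.tight.map_id K) (f.cell κ)))).trans ?_)
  refine (congrArg (F.cast _ _ _) (VDGraph.cast_cast _ _ _ _ _ _ _)).trans ?_
  exact (VDGraph.cast_cast _ _ _ _ _ _ _).trans
    (VDGraph.cast_cast (LPath.map_map _ _ _ _ _) rfl rfl _ _ _ (g.cell (f.cell κ))).symm

theorem preservesProducts_id (D : VDC.{u, v, w, x}) : (VDFunctor.id D).PreservesProducts where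
  tight := inferInstanceAs (PreservesFiniteProducts (𝟭 D.Ob))
  terminal _ h := h
  product _ _ h := h

theorem preservesProducts_comp {f : VDFunctor D E} {g : VDFunctor E F}
    (hf : f.PreservesProducts) (hg : g.PreservesProducts) : (f.comp g).PreservesProducts where
  tight :=
    haveI := hf.tight
    haveI := hg.tight
    comp_preservesFiniteProducts f.tight g.tight
  terminal _ h := hg.terminal _ (hf.terminal _ h)
  product _ _ h := hg.product _ _ (hf.product _ _ h)

end VDFunctor

/-- A locally full sub-bicategory of `B`: a class of objects, and a class of 1-cells that contains
the identities and is closed under composition. -/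
structure SubBicat (B : Type u) [Bicategory.{w, v} B] where
  IsObj : B → Prop
  IsHom : ∀ {a b : B}, (a ⟶ b) → Prop
  id : ∀ a : B, IsHom (𝟙 a)
  comp : ∀ {a b c : B} {f : a ⟶ b} {g : b ⟶ c}, IsHom f → IsHom g → IsHom (f ≫ g)

namespace SubBicat

variable {B : Type u} [Bicategory.{w, v} B]

structure Obj (S : SubBicat B) where
  obj : B
  isObj : S.IsObj obj

structure Hom {S : SubBicat B} (a b : S.Obj) where
  hom : a.obj ⟶ b.obj
  isHom : S.IsHom hom

@[ext]
structure Hom₂ {S : SubBicat B} {a b : S.Obj} (f g : Hom a b) where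
  hom : f.hom ⟶ g.hom

variable (S : SubBicat B)

instance : CategoryStruct S.Obj where
  Hom a b := Hom a b
  id a := ⟨𝟙 a.obj, S.id _⟩
  comp f g := ⟨f.hom ≫ g.hom, S.comp f.isHom g.isHom⟩

instance (a b : S.Obj) : Category (a ⟶ b) where
  Hom f g := Hom₂ f g
  id f := ⟨𝟙 f.hom⟩
  comp η θ := ⟨η.hom ≫ θ.hom⟩
  id_comp η := Hom₂.ext (Category.id_comp η.hom)
  comp_id η := Hom₂.ext (Category.comp_id η.hom)
  assoc η θ ι := Hom₂.ext (Category.assoc η.hom θ.hom ι.hom)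

variable {S}

@[ext]
theorem hom₂_ext {a b : S.Obj} {f g : a ⟶ b} {η θ : f ⟶ g} (h : η.hom = θ.hom) : η = θ :=
  Hom₂.ext h

@[simp]
theorem id_hom₂ {a b : S.Obj} (f : a ⟶ b) : Hom₂.hom (𝟙 f) = 𝟙 f.hom := rfl

@[simp]
theorem comp_hom₂ {a b : S.Obj} {f g h : a ⟶ b} (η : f ⟶ g) (θ : g ⟶ h) :
    (η ≫ θ).hom = η.hom ≫ θ.hom := rfl

@[simp]
theorem id_hom (a : S.Obj) : Hom.hom (𝟙 a) = 𝟙 a.obj := rfl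

@[simp]
theorem comp_hom {a b c : S.Obj} (f : a ⟶ b) (g : b ⟶ c) : (f ≫ g).hom = f.hom ≫ g.hom := rfl

@[simps]
def isoMk {a b : S.Obj} {f g : a ⟶ b} (e : f.hom ≅ g.hom) : f ≅ g where
  hom := Hom₂.mk e.hom
  inv := Hom₂.mk e.inv
  hom_inv_id := Hom₂.ext e.hom_inv_id
  inv_hom_id := Hom₂.ext e.inv_hom_id

instance : Bicategory S.Obj where
  whiskerLeft {a b c} f g h η := Hom₂.mk (f := f ≫ g) (g := f ≫ h) (f.hom ◁ Hom₂.hom η)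
  whiskerRight {a b c} f g η h := Hom₂.mk (f := f ≫ h) (g := g ≫ h) (Hom₂.hom η ▷ h.hom)
  associator f g h := isoMk (f := (f ≫ g) ≫ h) (g := f ≫ g ≫ h) (α_ f.hom g.hom h.hom)
  leftUnitor f := isoMk (f := 𝟙 _ ≫ f) (g := f) (λ_ f.hom)
  rightUnitor f := isoMk (f := f ≫ 𝟙 _) (g := f) (ρ_ f.hom)
  whisker_exchange η θ := Hom₂.ext (Bicategory.whisker_exchange (Hom₂.hom η) (Hom₂.hom θ))

@[simp]
theorem whiskerLeft_hom {a b c : S.Obj} (f : a ⟶ b) {g h : b ⟶ c} (η : g ⟶ h) :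
    (f ◁ η).hom = f.hom ◁ η.hom := rfl

@[simp]
theorem whiskerRight_hom {a b c : S.Obj} {f g : a ⟶ b} (η : f ⟶ g) (h : b ⟶ c) :
    (η ▷ h).hom = η.hom ▷ h.hom := rfl

@[simp]
theorem associator_hom {a b c d : S.Obj} (f : a ⟶ b) (g : b ⟶ c) (h : c ⟶ d) :
    (α_ f g h).hom.hom = (α_ f.hom g.hom h.hom).hom := rfl

@[simp]
theorem leftUnitor_hom {a b : S.Obj} (f : a ⟶ b) : (λ_ f).hom.hom = (λ_ f.hom).hom := rfl

@[simp]
theorem rightUnitor_hom {a b : S.Obj} (f : a ⟶ b) : (ρ_ f).hom.hom = (ρ_ f.hom).hom := rfl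

variable (S)

/-- The inclusion of a locally full sub-bicategory. -/
def incl : Pseudofunctor S.Obj B where
  obj a := a.obj
  map f := f.hom
  map₂ η := η.hom
  mapId _ := Iso.refl _
  mapComp _ _ := Iso.refl _

end SubBicat

namespace VDC

/-- `D` is cartesian (relative to the composites of paths with length in `S`): the functors
`D ⟶ 1` and `D ⟶ D × D` have right adjoints, which preserve restrictions and these composites. -/
def IsCartesian (S : Set ℕ) (D : VDC.{u, v, w, x}) : Prop :=
  (∃ r : VDFunctor terminal D, r.PreservesRestrictions ∧ r.PreservesComposites S ∧
    Nonempty (Bicategory.Adjunction (show D ⟶ terminal from bang D) r)) ∧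
  ∃ r : VDFunctor (prod D D) D, r.PreservesRestrictions ∧ r.PreservesComposites S ∧
    Nonempty (Bicategory.Adjunction (show D ⟶ prod D D from diag D) r)

/-- The bicategory of cartesian fibrational virtual double categories with composites of the
paths with length in `S`. -/
def cartesianFVDC (S : Set ℕ) : SubBicat VDC.{u, v, w, x} where
  IsObj D := HasRestrictions D ∧ HasComposites S D ∧ IsCartesian S D
  IsHom f := VDFunctor.PreservesRestrictions f ∧ VDFunctor.PreservesComposites S f ∧
    VDFunctor.PreservesProducts f
  id D := ⟨VDFunctor.preservesRestrictions_id D, VDFunctor.preservesComposites_id S D,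
    VDFunctor.preservesProducts_id D⟩
  comp hf hg := ⟨VDFunctor.preservesRestrictions_comp hf.1 hg.1,
    VDFunctor.preservesComposites_comp hf.2.1 hg.2.1,
    VDFunctor.preservesProducts_comp hf.2.2 hg.2.2⟩

end VDC

namespace FibCat

open CategoryTheory.Functor

section

variable {B : Type u} [Category.{v} B] {E : Type w} [Category.{x} E] (p : E ⥤ B)

/-- Arrows of the total category over a given arrow of the base. -/
def HomOver {X Y : B} (f : X ⟶ Y) (a : p.Fiber X) (b : p.Fiber Y) : Type x :=
  {φ : a.1 ⟶ b.1 // p.IsHomLift f φ}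

variable {p}

namespace HomOver

variable {X Y Z W : B} {f : X ⟶ Y} {g : Y ⟶ Z} {k : X ⟶ Z} {a : p.Fiber X} {b : p.Fiber Y}
  {c : p.Fiber Z} {d : p.Fiber W}

@[ext]
theorem ext {φ ψ : HomOver p f a b} (h : φ.1 = ψ.1) : φ = ψ := Subtype.ext h

def comp (φ : HomOver p f a b) (ψ : HomOver p g b c) (h : f ≫ g = k) : HomOver p k a c :=
  ⟨φ.1 ≫ ψ.1, by
    have := φ.2
    have := ψ.2
    subst h
    infer_instance⟩

def cast (φ : HomOver p f a b) {f' : X ⟶ Y} (h : f = f') : HomOver p f' a b :=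
  ⟨φ.1, h ▸ φ.2⟩

@[simp] theorem comp_val (φ : HomOver p f a b) (ψ : HomOver p g b c) (h : f ≫ g = k) :
    (φ.comp ψ h).1 = φ.1 ≫ ψ.1 := rfl

@[simp] theorem cast_val (φ : HomOver p f a b) {f' : X ⟶ Y} (h : f = f') :
    (φ.cast h).1 = φ.1 := rfl

def ofFiber {a b : p.Fiber X} (φ : a ⟶ b) : HomOver p (𝟙 X) a b := φ

end HomOver

variable (p) [p.IsFibered]

/-- The chosen cartesian lift of `f` with codomain `b`. -/
noncomputable def pullback {X Y : B} (f : X ⟶ Y) (b : p.Fiber Y) : p.Fiber X :=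
  ⟨IsPreFibered.pullbackObj b.2 f, IsPreFibered.pullbackObj_proj b.2 f⟩

noncomputable def proj {X Y : B} (f : X ⟶ Y) (b : p.Fiber Y) : HomOver p f (pullback p f b) b :=
  ⟨IsPreFibered.pullbackMap b.2 f,
    (IsPreFibered.pullbackMap.IsCartesian b.2 f).toIsHomLift⟩

instance {X Y : B} (f : X ⟶ Y) (b : p.Fiber Y) : p.IsCartesian f (proj p f b).1 :=
  IsPreFibered.pullbackMap.IsCartesian b.2 f

variable {p}

/-- The factorization of an arrow over `g ≫ f` through a cartesian arrow over `f`. -/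
noncomputable def cartLift {X Y Z : B} {f : X ⟶ Y} {a : p.Fiber X} {b : p.Fiber Y}
    (κ : HomOver p f a b) [p.IsCartesian f κ.1] {g : Z ⟶ X} {k : Z ⟶ Y} {c : p.Fiber Z}
    (φ : HomOver p k c b) (h : g ≫ f = k) : HomOver p g c a :=
  haveI := φ.2
  ⟨IsStronglyCartesian.map p f κ.1 h.symm φ.1, inferInstance⟩

@[simp]
theorem cartLift_fac {X Y Z : B} {f : X ⟶ Y} {a : p.Fiber X} {b : p.Fiber Y}
    (κ : HomOver p f a b) [p.IsCartesian f κ.1] {g : Z ⟶ X} {k : Z ⟶ Y} {c : p.Fiber Z}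
    (φ : HomOver p k c b) (h : g ≫ f = k) : (cartLift κ φ h).1 ≫ κ.1 = φ.1 :=
  haveI := φ.2
  IsStronglyCartesian.fac p f κ.1 h.symm φ.1

theorem cart_ext {X Y Z : B} {f : X ⟶ Y} {a : p.Fiber X} {b : p.Fiber Y}
    (κ : HomOver p f a b) [p.IsCartesian f κ.1] {g : Z ⟶ X} {c : p.Fiber Z}
    {φ ψ : HomOver p g c a} (h : φ.1 ≫ κ.1 = ψ.1 ≫ κ.1) : φ = ψ :=
  haveI := φ.2
  haveI := ψ.2
  HomOver.ext (IsStronglyCartesian.ext p f κ.1 g h)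

variable (p) in
/-- The base change functor between fibres. -/
noncomputable def baseChange {X Y : B} (f : X ⟶ Y) : p.Fiber Y ⥤ p.Fiber X where
  obj b := pullback p f b
  map {b c} φ := cartLift (proj p f c) ((proj p f b).comp (HomOver.ofFiber φ) (Category.comp_id f))
    (Category.id_comp f)
  map_id b := cart_ext (p := p) (proj p f b) (by
    rw [cartLift_fac]
    exact (Category.comp_id _).trans (Category.id_comp _).symm)
  map_comp {b c d} φ ψ := cart_ext (p := p) (proj p f d) (by
    rw [cartLift_fac]
    refine Eq.trans ?_ (Category.assoc _ _ _).symm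
    rw [cartLift_fac]
    refine Eq.trans ?_ (Category.assoc _ _ _)
    erw [cartLift_fac]
    exact (Category.assoc _ _ _).symm)

/-- Arrows over `f` are the same as vertical arrows into the base change along `f`. -/
noncomputable def toVert {X Y : B} {f : X ⟶ Y} {a : p.Fiber X} {b : p.Fiber Y}
    (φ : HomOver p f a b) : a ⟶ (baseChange p f).obj b :=
  cartLift (proj p f b) φ (Category.id_comp f)

noncomputable def ofVert {X Y : B} {f : X ⟶ Y} {a : p.Fiber X} {b : p.Fiber Y}
    (φ : a ⟶ (baseChange p f).obj b) : HomOver p f a b :=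
  (HomOver.ofFiber φ).comp (proj p f b) (Category.id_comp f)

@[simp] theorem ofVert_toVert {X Y : B} {f : X ⟶ Y} {a : p.Fiber X} {b : p.Fiber Y}
    (φ : HomOver p f a b) : ofVert (toVert φ) = φ := 
  HomOver.ext (cartLift_fac (proj p f b) φ (Category.id_comp f))

theorem ofVert_injective {X Y : B} {f : X ⟶ Y} {a : p.Fiber X} {b : p.Fiber Y}
    {φ ψ : a ⟶ (baseChange p f).obj b} (h : ofVert φ = ofVert ψ) : φ = ψ :=
  cart_ext (p := p) (proj p f b) (congrArg Subtype.val h)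

@[simp] theorem toVert_ofVert {X Y : B} {f : X ⟶ Y} {a : p.Fiber X} {b : p.Fiber Y}
    (φ : a ⟶ (baseChange p f).obj b) : toVert (ofVert φ) = φ :=
  ofVert_injective (ofVert_toVert _)

theorem ofVert_comp_map {X Y : B} {f : X ⟶ Y} {a : p.Fiber X} {b c : p.Fiber Y}
    (φ : a ⟶ (baseChange p f).obj b) (ψ : b ⟶ c) :
    ofVert (φ ≫ (baseChange p f).map ψ) =
      (ofVert φ).comp (HomOver.ofFiber ψ) (Category.comp_id f) :=
  HomOver.ext ((Category.assoc _ _ _).trans ((congrArg (φ.1 ≫ ·)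
    (cartLift_fac (proj p f c) ((proj p f b).comp (HomOver.ofFiber ψ) (Category.comp_id f))
      (Category.id_comp f))).trans (Category.assoc _ _ _).symm))

section Products

variable [∀ {X Y : B} (f : X ⟶ Y), PreservesFiniteProducts (baseChange p f)]

theorem exists_pair {X Z : B} {a b c : p.Fiber X} {π₁ : c ⟶ a} {π₂ : c ⟶ b}
    (hc : Nonempty (IsLimit (BinaryFan.mk π₁ π₂))) {z : Z ⟶ X} {e : p.Fiber Z}
    (φ : HomOver p z e a) (ψ : HomOver p z e b) :
    ∃ χ : HomOver p z e c, χ.1 ≫ π₁.1 = φ.1 ∧ χ.1 ≫ π₂.1 = ψ.1 := by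
  obtain ⟨hc⟩ := hc
  have h := mapIsLimitOfPreservesOfIsLimit (baseChange p z) π₁ π₂ hc
  obtain ⟨l, h₁, h₂⟩ := BinaryFan.IsLimit.lift' h (toVert φ) (toVert ψ)
  have e₁ := (ofVert_comp_map l π₁).symm.trans ((congrArg ofVert h₁).trans (ofVert_toVert φ))
  have e₂ := (ofVert_comp_map l π₂).symm.trans ((congrArg ofVert h₂).trans (ofVert_toVert ψ))
  exact ⟨ofVert l, congrArg Subtype.val e₁, congrArg Subtype.val e₂⟩

theorem pair_ext {X Z : B} {a b c : p.Fiber X} {π₁ : c ⟶ a} {π₂ : c ⟶ b}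
    (hc : Nonempty (IsLimit (BinaryFan.mk π₁ π₂))) {z : Z ⟶ X} {e : p.Fiber Z}
    {χ χ' : HomOver p z e c} (h₁ : χ.1 ≫ π₁.1 = χ'.1 ≫ π₁.1) (h₂ : χ.1 ≫ π₂.1 = χ'.1 ≫ π₂.1) :
    χ = χ' := by
  obtain ⟨hc⟩ := hc
  have h := mapIsLimitOfPreservesOfIsLimit (baseChange p z) π₁ π₂ hc
  have key : toVert χ = toVert χ' := by
    refine BinaryFan.IsLimit.hom_ext h (ofVert_injective ?_) (ofVert_injective ?_)
    · refine (ofVert_comp_map _ π₁).trans (Eq.trans ?_ (ofVert_comp_map _ π₁).symm)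
      rw [ofVert_toVert, ofVert_toVert]
      exact HomOver.ext h₁
    · refine (ofVert_comp_map _ π₂).trans (Eq.trans ?_ (ofVert_comp_map _ π₂).symm)
      rw [ofVert_toVert, ofVert_toVert]
      exact HomOver.ext h₂
  rw [← ofVert_toVert χ, key, ofVert_toVert]

noncomputable def homTerminal {X Z : B} {c : p.Fiber X} (hc : IsTerminal c) (z : Z ⟶ X)
    (e : p.Fiber Z) : HomOver p z e c :=
  ofVert ((hc.isTerminalObj (baseChange p z) c).from e)

theorem terminal_ext {X Z : B} {c : p.Fiber X} (hc : IsTerminal c) {z : Z ⟶ X}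
    {e : p.Fiber Z} (χ χ' : HomOver p z e c) : χ = χ' := by
  have : toVert χ = toVert χ' := (hc.isTerminalObj (baseChange p z) c).hom_ext _ _
  rw [← ofVert_toVert χ, this, ofVert_toVert]

end Products

end

end FibCat

noncomputable section

namespace FibCat

open CategoryTheory.Functor

variable {B : Type u} [Category.{v} B] {E : Type w} [Category.{x} E]

section

variable (p : E ⥤ B) [HasFiniteProducts B]

/-- The loose arrows `I ⇸ J` are the objects of the total category over `I × J`. -/
abbrev Rel (I J : B) : Type w := p.Fiber (I ⨯ J)

/-- The product of all the objects along a path, bracketed to the right. -/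
def base : ∀ {I J : B}, LPath (Rel p) I J → B
  | I, _, .nil _ => I
  | I, _, .cons _ q => I ⨯ base q

def first : ∀ {I J : B} (α : LPath (Rel p) I J), base p α ⟶ I
  | I, _, .nil _ => 𝟙 I
  | _, _, .cons _ _ => prod.fst

def last : ∀ {I J : B} (α : LPath (Rel p) I J), base p α ⟶ J
  | I, _, .nil _ => 𝟙 I
  | _, _, .cons _ q => prod.snd ≫ last q

/-- The two projections from the product along a path. -/
abbrev bfst {I J K : B} (α : Rel p I J) (q : LPath (Rel p) J K) : base p (.cons α q) ⟶ I :=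
  prod.fst

abbrev bsnd {I J K : B} (α : Rel p I J) (q : LPath (Rel p) J K) :
    base p (.cons α q) ⟶ base p q :=
  prod.snd

/-- A generalized element with domain `e` of a path of loose arrows: a tuple of generalized
elements of the objects along the path, the first and the last of which are prescribed, together
with an arrow from `e` to every loose arrow of the path over the corresponding pair. -/
inductive Pts {p : E ⥤ B} {Z : B} (e : p.Fiber Z) :
    ∀ {I J : B}, LPath (Rel p) I J → (Z ⟶ I) → (Z ⟶ J) → Type (max u v w x)
  | nil {I : B} (s t : Z ⟶ I) (h : s = t) : Pts e (.nil I) s t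
  | cons {I J K : B} {α : Rel p I J} {q : LPath (Rel p) J K} {s : Z ⟶ I} {m : Z ⟶ J} {t : Z ⟶ K}
      (a : HomOver p (prod.lift s m) e α) (as : Pts e q m t) : Pts e (.cons α q) s t

variable {p}

namespace Pts

variable {Z Z' Z'' : B} {e : p.Fiber Z} {e' : p.Fiber Z'} {e'' : p.Fiber Z''}

def pt : ∀ {I J : B} {α : LPath (Rel p) I J} {s : Z ⟶ I} {t : Z ⟶ J},
    Pts e α s t → (Z ⟶ base p α)
  | _, _, _, s, _, .nil _ _ _ => s
  | _, _, _, s, _, .cons _ as => prod.lift s as.pt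

theorem pt_first {I J : B} {α : LPath (Rel p) I J} {s : Z ⟶ I} {t : Z ⟶ J} (P : Pts e α s t) :
    P.pt ≫ first p α = s := by
  cases P with
  | nil => exact Category.comp_id _
  | cons a as => exact prod.lift_fst _ _

theorem pt_last {I J : B} {α : LPath (Rel p) I J} {s : Z ⟶ I} {t : Z ⟶ J} (P : Pts e α s t) :
    P.pt ≫ last p α = t := by
  induction P with
  | nil _ _ h => exact (Category.comp_id _).trans h
  | cons a as ih =>
    refine (Category.assoc _ _ _).symm.trans ?_
    exact (congrArg (· ≫ _) (prod.lift_snd _ _)).trans ih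

theorem lift_eq {z : Z' ⟶ Z} {I J : B} {s : Z ⟶ I} {m : Z ⟶ J} {s' : Z' ⟶ I} {m' : Z' ⟶ J}
    (hs : z ≫ s = s') (hm : z ≫ m = m') : z ≫ prod.lift s m = prod.lift s' m' := by
  rw [prod.comp_lift, hs, hm]

def pre {z : Z' ⟶ Z} (φ : HomOver p z e' e) : ∀ {I J : B} {α : LPath (Rel p) I J} {s : Z ⟶ I}
    {t : Z ⟶ J} (_ : Pts e α s t) {s' : Z' ⟶ I} {t' : Z' ⟶ J} (_ : z ≫ s = s') (_ : z ≫ t = t'),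
    Pts e' α s' t'
  | _, _, _, _, _, .nil _ _ h, _, _, hs, ht => .nil _ _ (by rw [← hs, ← ht, h])
  | _, _, _, _, _, .cons a as, _, _, hs, ht =>
    .cons (φ.comp a (lift_eq hs rfl)) (pre φ as rfl ht)

theorem pre_cons {z : Z' ⟶ Z} (φ : HomOver p z e' e) {I J K : B} {α : Rel p I J}
    {q : LPath (Rel p) J K} {s : Z ⟶ I} {m : Z ⟶ J} {t : Z ⟶ K}
    (a : HomOver p (prod.lift s m) e α) (as : Pts e q m t) {s' : Z' ⟶ I} {t' : Z' ⟶ K}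
    (hs : z ≫ s = s') (ht : z ≫ t = t') {m' : Z' ⟶ J} (hm : z ≫ m = m') :
    pre φ (.cons a as) hs ht = .cons (φ.comp a (lift_eq hs hm)) (pre φ as hm ht) := by
  subst hm; rfl

theorem pre_pre {z : Z' ⟶ Z} (φ : HomOver p z e' e) {z' : Z'' ⟶ Z'} (ψ : HomOver p z' e'' e')
    {I J : B} {α : LPath (Rel p) I J} {s : Z ⟶ I} {t : Z ⟶ J} (P : Pts e α s t) {s' : Z' ⟶ I}
    {t' : Z' ⟶ J} (hs : z ≫ s = s') (ht : z ≫ t = t') {s'' : Z'' ⟶ I} {t'' : Z'' ⟶ J}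
    (hs' : z' ≫ s' = s'') (ht' : z' ≫ t' = t'') {z₁ : Z'' ⟶ Z} (hz : z' ≫ z = z₁)
    (hs₁ : z₁ ≫ s = s'') (ht₁ : z₁ ≫ t = t'') :
    pre ψ (pre φ P hs ht) hs' ht' = pre (ψ.comp φ hz) P hs₁ ht₁ := by
  induction P with
  | nil => rfl
  | @cons _ _ _ _ _ _ m _ a as ih =>
    have hm : z' ≫ z ≫ m = z₁ ≫ m := by rw [← Category.assoc, hz]
    rw [pre_cons φ a as hs ht rfl, pre_cons ψ _ _ hs' ht' hm, pre_cons _ a as hs₁ ht₁ rfl,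
      ih rfl ht hm ht' rfl ht₁]
    congr 1
    exact HomOver.ext (Category.assoc _ _ _).symm

theorem pt_pre {z : Z' ⟶ Z} (φ : HomOver p z e' e) {I J : B} {α : LPath (Rel p) I J} {s : Z ⟶ I}
    {t : Z ⟶ J} (P : Pts e α s t) {s' : Z' ⟶ I} {t' : Z' ⟶ J} (hs : z ≫ s = s')
    (ht : z ≫ t = t') : (pre φ P hs ht).pt = z ≫ P.pt := by
  induction P with
  | nil => exact hs.symm
  | cons a as ih =>
    refine Eq.trans ?_ (prod.comp_lift _ _ _).symm
    rw [hs, ← ih rfl ht]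
    rfl

def append : ∀ {I J : B} {α₁ : LPath (Rel p) I J} {s : Z ⟶ I} {m : Z ⟶ J} (_ : Pts e α₁ s m)
    {K : B} {α₂ : LPath (Rel p) J K} {t : Z ⟶ K} (_ : Pts e α₂ m t) {α : LPath (Rel p) I K}
    (_ : α₁.append α₂ = α), Pts e α s t
  | _, _, _, _, _, .nil _ _ rfl, _, _, _, Q, _, rfl => Q
  | _, _, _, _, _, .cons a as, _, _, _, Q, _, rfl => .cons a (append as Q rfl)

theorem pre_append {z : Z' ⟶ Z} (φ : HomOver p z e' e) {I J : B} {α₁ : LPath (Rel p) I J}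
    {s : Z ⟶ I} {m : Z ⟶ J} (P : Pts e α₁ s m) {K : B} {α₂ : LPath (Rel p) J K} {t : Z ⟶ K}
    (Q : Pts e α₂ m t) {α : LPath (Rel p) I K} (h : α₁.append α₂ = α) {s' : Z' ⟶ I} {m' : Z' ⟶ J}
    {t' : Z' ⟶ K} (hs : z ≫ s = s') (hm : z ≫ m = m') (ht : z ≫ t = t') :
    pre φ (P.append Q h) hs ht = (pre φ P hs hm).append (pre φ Q hm ht) h := by
  subst h
  induction P with
  | nil _ _ h =>
    subst h hs hm
    rfl
  | cons a as ih => exact congrArg (Pts.cons _) (ih _ rfl hm)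

end Pts

/-- A generalized element of a concatenation, cut into two pieces. -/
structure PtsSplit {Z : B} (e : p.Fiber Z) {I J K : B} (α₁ : LPath (Rel p) I J)
    (α₂ : LPath (Rel p) J K) (s : Z ⟶ I) (t : Z ⟶ K) where
  mid : Z ⟶ J
  fst : Pts e α₁ s mid
  snd : Pts e α₂ mid t

namespace Pts

variable {Z Z' Z'' : B} {e : p.Fiber Z} {e' : p.Fiber Z'} {e'' : p.Fiber Z''}

def splitAux : ∀ {I J : B} (α₁ : LPath (Rel p) I J) {K : B} {α₂ : LPath (Rel p) J K}
    {s : Z ⟶ I} {t : Z ⟶ K} (_ : Pts e (α₁.append α₂) s t), PtsSplit e α₁ α₂ s t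
  | _, _, .nil _, _, _, s, _, P => ⟨s, .nil s s rfl, P⟩
  | _, _, .cons _ β₁, _, _, _, _, P =>
    match P with
    | .cons a as => ⟨(splitAux β₁ as).mid, .cons a (splitAux β₁ as).fst, (splitAux β₁ as).snd⟩

def split {I J : B} (α₁ : LPath (Rel p) I J) {K : B} {α₂ : LPath (Rel p) J K}
    {α : LPath (Rel p) I K} (h : α₁.append α₂ = α) {s : Z ⟶ I} {t : Z ⟶ K} (P : Pts e α s t) :
    PtsSplit e α₁ α₂ s t :=
  splitAux α₁ (h.symm ▸ P)

theorem split_append {I J : B} {α₁ : LPath (Rel p) I J} {s : Z ⟶ I} {m : Z ⟶ J}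
    (P : Pts e α₁ s m) {K : B} {α₂ : LPath (Rel p) J K} {t : Z ⟶ K} (Q : Pts e α₂ m t)
    {α : LPath (Rel p) I K} (h : α₁.append α₂ = α) : (P.append Q h).split α₁ h = ⟨m, P, Q⟩ := by
  subst h
  induction P with
  | nil _ _ h => subst h; rfl
  | cons a as ih =>
    exact congrArg (fun r : PtsSplit e _ _ _ _ => (⟨r.mid, Pts.cons a r.fst, r.snd⟩ :
      PtsSplit e _ _ _ _)) (ih Q)

theorem append_split {I J : B} {α₁ : LPath (Rel p) I J} {K : B} {α₂ : LPath (Rel p) J K}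
    {α : LPath (Rel p) I K} (h : α₁.append α₂ = α) {s : Z ⟶ I} {t : Z ⟶ K} (P : Pts e α s t) :
    (P.split α₁ h).fst.append (P.split α₁ h).snd h = P := by
  subst h
  induction α₁ with
  | nil => rfl
  | cons β α₁ ih =>
    obtain _ | ⟨a, as⟩ := P
    exact congrArg (Pts.cons a) (ih as)

theorem nil_eq {I : B} {s t : Z ⟶ I} : Pts e (.nil I) s t → s = t
  | .nil _ _ h => h

/-- The arrow which makes up a generalized element of a path of length one. -/
def arrow {I J : B} {α : Rel p I J} {s : Z ⟶ I} {t : Z ⟶ J} : Pts e (.single α) s t →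
    HomOver p (prod.lift s t) e α
  | .cons a (.nil _ _ h) => a.cast (by rw [h])

theorem cons_arrow {I J : B} {α : Rel p I J} {s : Z ⟶ I} {t : Z ⟶ J} (P : Pts e (.single α) s t) :
    .cons P.arrow (.nil t t rfl) = P := by
  obtain _ | ⟨a, ⟨_, _, h⟩⟩ := P
  subst h
  rfl

end Pts

variable (p) in
/-- The conjunction `∧ αᵢ[⟨uᵢ₋₁, uᵢ⟩]` over `X`, for a tuple `u` of generalized elements. -/
def conj [p.IsFibered] [∀ X : B, HasFiniteProducts (p.Fiber X)] :
    ∀ {I J : B} (α : LPath (Rel p) I J) {X : B} (_ : X ⟶ base p α), p.Fiber X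
  | _, _, .nil _, X, _ => ⊤_ (p.Fiber X)
  | _, _, .cons α q, _, u =>
    pullback p (prod.lift (u ≫ bfst p α q) ((u ≫ bsnd p α q) ≫ first p q)) α ⨯
      conj q (u ≫ bsnd p α q)

end

section

variable {p : E ⥤ B} [HasFiniteProducts B] [p.IsFibered]
  [∀ X : B, HasFiniteProducts (p.Fiber X)]

/-- The first conjunct, and the conjunction of the others. -/
def chead {I J K : B} (α : Rel p I J) (q : LPath (Rel p) J K) {X : B}
    (u : X ⟶ base p (.cons α q)) {s : X ⟶ I} (hs : u ≫ bfst p α q = s) :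
    HomOver p (prod.lift s ((u ≫ bsnd p α q) ≫ first p q)) (conj p (.cons α q) u) α :=
  (HomOver.ofFiber (p := p) prod.fst).comp
    (proj p (prod.lift (u ≫ bfst p α q) ((u ≫ bsnd p α q) ≫ first p q)) α)
    ((Category.id_comp _).trans (congrArg (prod.lift · _) hs))

def ctail {I J K : B} (α : Rel p I J) (q : LPath (Rel p) J K) {X : B}
    (u : X ⟶ base p (.cons α q)) :
    HomOver p (𝟙 X) (conj p (.cons α q) u) (conj p q (u ≫ bsnd p α q)) :=
  HomOver.ofFiber (p := p) prod.snd

/-- The tuple of the projections of a conjunction. -/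
def genAt : ∀ {I J : B} (α : LPath (Rel p) I J) {X : B} (u : X ⟶ base p α)
    {s : X ⟶ I} {t : X ⟶ J} (_ : u ≫ first p α = s) (_ : u ≫ last p α = t),
    Pts (conj p α u) α s t
  | _, _, .nil _, _, _, _, _, hs, ht => .nil _ _ (hs.symm.trans ht)
  | _, _, .cons α q, _, u, _, _, hs, ht =>
    .cons (chead α q u hs)
      ((genAt q (u ≫ bsnd p α q) rfl ((Category.assoc _ _ _).trans ht)).pre
        (ctail α q u) (Category.id_comp _) (Category.id_comp _))

theorem pt_genAt {I J : B} (α : LPath (Rel p) I J) {X : B} (u : X ⟶ base p α) {s : X ⟶ I}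
    {t : X ⟶ J} (hs : u ≫ first p α = s) (ht : u ≫ last p α = t) : (genAt α u hs ht).pt = u := by
  induction α generalizing X with
  | nil => exact hs.symm.trans (Category.comp_id _)
  | cons α q ih =>
    refine Limits.prod.hom_ext ?_ ?_
    · exact (prod.lift_fst _ _).trans hs.symm
    · refine (prod.lift_snd _ _).trans ?_
      refine (Pts.pt_pre _ _ _ _).trans ((Category.id_comp _).trans ?_)
      exact ih _ _ _

variable [∀ {X Y : B} (f : X ⟶ Y), PreservesFiniteProducts (baseChange p f)]

/-- The arrow to a conjunction which corresponds to a tuple. -/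
def toConj {Z : B} {e : p.Fiber Z} : ∀ {I J : B} {α : LPath (Rel p) I J} {s : Z ⟶ I}
    {t : Z ⟶ J} (P : Pts e α s t) {X : B} (u : X ⟶ base p α) (z : Z ⟶ X) (_ : z ≫ u = P.pt),
    HomOver p z e (conj p α u)
  | _, _, _, _, _, .nil _ _ _, _, _, z, _ => homTerminal terminalIsTerminal z e
  | _, _, .cons α q, _, _, .cons a as, _, u, z, h =>
    have h₂ : z ≫ u ≫ bsnd p α q = as.pt := by
      refine (Category.assoc _ _ _).symm.trans ?_
      exact (congrArg (· ≫ bsnd p α q) h).trans (prod.lift_snd _ _)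
    (exists_pair ⟨prodIsProd (pullback p (prod.lift (u ≫ bfst p α q)
        ((u ≫ bsnd p α q) ≫ first p q)) α) (conj p q (u ≫ bsnd p α q))⟩
      (cartLift (proj p (prod.lift (u ≫ bfst p α q) ((u ≫ bsnd p α q) ≫ first p q)) α) a
        (Pts.lift_eq ((Category.assoc _ _ _).symm.trans ((congrArg (· ≫ bfst p α q) h).trans
          (prod.lift_fst _ _))) (by rw [← Category.assoc, h₂, Pts.pt_first])))
      (toConj as (u ≫ bsnd p α q) z h₂)).choose

theorem pre_toConj {Z : B} {e : p.Fiber Z} {I J : B} {α : LPath (Rel p) I J} {s : Z ⟶ I}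
    {t : Z ⟶ J} (P : Pts e α s t) {X : B} (u : X ⟶ base p α) (z : Z ⟶ X) (h : z ≫ u = P.pt)
    {s' : X ⟶ I} {t' : X ⟶ J} (hs : u ≫ first p α = s') (ht : u ≫ last p α = t')
    (hs' : z ≫ s' = s) (ht' : z ≫ t' = t) :
    (genAt α u hs ht).pre (toConj P u z h) hs' ht' = P := by
  induction P generalizing X with
  | nil => rfl
  | @cons _ _ _ α q _ m _ a as ih =>
    have h₂ : z ≫ u ≫ bsnd p α q = as.pt := by
      refine (Category.assoc _ _ _).symm.trans ?_
      exact (congrArg (· ≫ bsnd p α q) h).trans (prod.lift_snd _ _)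
    have hm : z ≫ (u ≫ bsnd p α q) ≫ first p q = m := by rw [← Category.assoc, h₂, Pts.pt_first]
    have hs₀ : z ≫ u ≫ bfst p α q = _ := (Category.assoc _ _ _).symm.trans
      ((congrArg (· ≫ bfst p α q) h).trans (prod.lift_fst _ _))
    have spec := (exists_pair ⟨prodIsProd (pullback p (prod.lift (u ≫ bfst p α q)
        ((u ≫ bsnd p α q) ≫ first p q)) α) (conj p q (u ≫ bsnd p α q))⟩
      (cartLift (proj p (prod.lift (u ≫ bfst p α q) ((u ≫ bsnd p α q) ≫ first p q)) α) a
        (Pts.lift_eq hs₀ hm)) (toConj as (u ≫ bsnd p α q) z h₂)).choose_spec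
    refine (Pts.pre_cons _ _ _ _ _ hm).trans ?_
    have e₁ : ((toConj (.cons a as) u z h).comp (ctail α q u) (Category.comp_id z)) = toConj as (u ≫ bsnd p α q) z h₂ := HomOver.ext spec.2
    rw [Pts.pre_pre _ _ _ _ _ _ _ (Category.comp_id z) hm ht', e₁, ih]
    congr 1
    refine HomOver.ext ((Category.assoc _ _ _).symm.trans ?_)
    refine (congrArg (· ≫ _) spec.1).trans ?_
    exact cartLift_fac _ _ _

theorem gen_ext {Z X : B} {e : p.Fiber Z} {I J : B} (α : LPath (Rel p) I J) (u : X ⟶ base p α)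
    {z : Z ⟶ X} (φ ψ : HomOver p z e (conj p α u)) {s : X ⟶ I} {t : X ⟶ J}
    (hs : u ≫ first p α = s) (ht : u ≫ last p α = t) {s' : Z ⟶ I} {t' : Z ⟶ J} (hs' : z ≫ s = s')
    (ht' : z ≫ t = t')
    (h : (genAt α u hs ht).pre φ hs' ht' = (genAt α u hs ht).pre ψ hs' ht') : φ = ψ := by
  induction α generalizing X with
  | nil => exact terminal_ext terminalIsTerminal φ ψ
  | cons α q ih =>
    have h₁ := Pts.cons.inj h
    refine pair_ext ⟨prodIsProd (pullback p (prod.lift (u ≫ bfst p α q)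
        ((u ≫ bsnd p α q) ≫ first p q)) α) (conj p q (u ≫ bsnd p α q))⟩ ?_ ?_
    · refine congrArg Subtype.val (cart_ext (p := p) (proj p (prod.lift (u ≫ bfst p α q)
        ((u ≫ bsnd p α q) ≫ first p q)) α)
        (φ := φ.comp (HomOver.ofFiber prod.fst) (Category.comp_id z))
        (ψ := ψ.comp (HomOver.ofFiber prod.fst) (Category.comp_id z)) ?_)
      have := congrArg Subtype.val (eq_of_heq h₁.2.1)
      exact (Category.assoc _ _ _).trans (this.trans (Category.assoc _ _ _).symm)
    · have h₂ := eq_of_heq h₁.2.2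
      rw [Pts.pre_pre _ _ _ _ _ _ _ (Category.comp_id z) rfl ht',
        Pts.pre_pre _ _ _ _ _ _ _ (Category.comp_id z) rfl ht'] at h₂
      exact congrArg Subtype.val (ih _ _ _ _ _ _ _ h₂)

end

end FibCat

end

noncomputable section

namespace FibCat

open CategoryTheory.Functor

variable {B : Type u} [Category.{v} B] {E : Type w} [Category.{x} E]

section

variable (p : E ⥤ B) [HasFiniteProducts B] [p.IsFibered]
  [∀ X : B, HasFiniteProducts (p.Fiber X)]

/-- The conjunction of a path of loose arrows over the product of all the objects along it. -/
abbrev ctx {I J : B} (α : LPath (Rel p) I J) : p.Fiber (base p α) := conj p α (𝟙 _)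

/-- Objects and tight arrows are those of the base, the loose arrows `I ⇸ J` are the objects over
`I × J`, and the cells are the vertical arrows from the conjunction of the domain to the base
change of the codomain. -/
abbrev bilGraph : VDGraph.{u, v, w, x} where
  Ob := B
  Loose := Rel p
  Cell α s t β := ctx p α ⟶ (baseChange p (prod.lift (first p α ≫ s) (last p α ≫ t))).obj β

end

section

variable {p : E ⥤ B} [HasFiniteProducts B] [p.IsFibered]
  [∀ X : B, HasFiniteProducts (p.Fiber X)]

def gen {I J : B} (α : LPath (Rel p) I J) : Pts (ctx p α) α (first p α) (last p α) :=
  genAt α (𝟙 _) (Category.id_comp _) (Category.id_comp _)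

theorem pt_gen {I J : B} (α : LPath (Rel p) I J) : (gen α).pt = 𝟙 _ := pt_genAt _ _ _ _

theorem arrow_pre {Z Z' : B} {e : p.Fiber Z} {e' : p.Fiber Z'} {z : Z' ⟶ Z} (φ : HomOver p z e' e)
    {I J : B} {α : Rel p I J} {s : Z ⟶ I} {t : Z ⟶ J} (P : Pts e (.single α) s t)
    {s' : Z' ⟶ I} {t' : Z' ⟶ J} (hs : z ≫ s = s') (ht : z ≫ t = t') :
    (P.pre φ hs ht).arrow.1 = φ.1 ≫ P.arrow.1 := by
  obtain _ | ⟨a, ⟨_, _, h⟩⟩ := P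
  subst h
  rfl

variable [∀ {X Y : B} (f : X ⟶ Y), PreservesFiniteProducts (baseChange p f)]

def toCtx {Z : B} {e : p.Fiber Z} {I J : B} {α : LPath (Rel p) I J} {s : Z ⟶ I} {t : Z ⟶ J}
    (P : Pts e α s t) : HomOver p P.pt e (ctx p α) :=
  toConj P (𝟙 _) P.pt (Category.comp_id _)

theorem pre_toCtx {Z : B} {e : p.Fiber Z} {I J : B} {α : LPath (Rel p) I J} {s : Z ⟶ I}
    {t : Z ⟶ J} (P : Pts e α s t) : (gen α).pre (toCtx P) P.pt_first P.pt_last = P :=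
  pre_toConj _ _ _ _ _ _ _ _

theorem toCtx_pre {Z Z' : B} {e : p.Fiber Z} {e' : p.Fiber Z'} {z : Z' ⟶ Z} (φ : HomOver p z e' e)
    {I J : B} {α : LPath (Rel p) I J} {s : Z ⟶ I}
    {t : Z ⟶ J} (P : Pts e α s t) {s' : Z' ⟶ I} {t' : Z' ⟶ J} (hs : z ≫ s = s')
    (ht : z ≫ t = t') : (toCtx (P.pre φ hs ht)).1 = φ.1 ≫ (toCtx P).1 := by
  have e : z ≫ P.pt = (P.pre φ hs ht).pt := (Pts.pt_pre φ P hs ht).symm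
  refine congrArg Subtype.val (gen_ext α (𝟙 _) (toCtx (P.pre φ hs ht)) (φ.comp (toCtx P) e)
    (Category.id_comp _) (Category.id_comp _) (Pts.pt_first _) (Pts.pt_last _) ?_)
  refine (pre_toCtx (P.pre φ hs ht)).trans ?_
  refine Eq.trans ?_ (Pts.pre_pre (toCtx P) φ (gen α) P.pt_first P.pt_last hs ht e _ _)
  rw [pre_toCtx]

theorem toCtx_gen {I J : B} (α : LPath (Rel p) I J) : (toCtx (gen α)).1 = 𝟙 (ctx p α).1 := by
  have e : (𝟙 _ : base p α ⟶ base p α) = (gen α).pt := (pt_gen α).symm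
  refine congrArg Subtype.val (gen_ext α (𝟙 _) (toCtx (gen α))
    ((HomOver.ofFiber (𝟙 (ctx p α))).cast e)
    (Category.id_comp _) (Category.id_comp _) (Pts.pt_first _) (Pts.pt_last _) ?_)
  refine (pre_toCtx (gen α)).trans ?_
  have H : ∀ {Z I J : B} {e : p.Fiber Z} {α : LPath (Rel p) I J} {s : Z ⟶ I} {t : Z ⟶ J}
      (P : Pts e α s t) {z : Z ⟶ Z} (hz : 𝟙 Z = z) (hs : z ≫ s = s) (ht : z ≫ t = t),
      P = P.pre ((HomOver.ofFiber (𝟙 e)).cast hz) hs ht := by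
    intro Z I J e α s t P
    induction P with
    | nil => intros; rfl
    | cons a as ih =>
      intro z hz hs ht
      have hm : ∀ {W : B} (m : Z ⟶ W), z ≫ m = m := fun m => by rw [← hz, Category.id_comp]
      rw [Pts.pre_cons _ a as hs ht (hm _), ← ih hz (hm _) ht]
      congr 1
      exact HomOver.ext (Category.id_comp _).symm
  exact H _ _ _ _

/-- The action of a cell on generalized elements. -/
def act {I J K M : B} {α : LPath (Rel p) I J} {s : I ⟶ K} {t : J ⟶ M} {β : Rel p K M}
    (ξ : (bilGraph p).Cell α s t β) {Z : B} {e : p.Fiber Z} {a : Z ⟶ I} {b : Z ⟶ J}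
    (P : Pts e α a b) {a' : Z ⟶ K} {b' : Z ⟶ M} (ha : a ≫ s = a') (hb : b ≫ t = b') :
    HomOver p (prod.lift a' b') e β :=
  (toCtx P).comp (ofVert ξ) (Pts.lift_eq (by rw [← Category.assoc, Pts.pt_first, ha])
    (by rw [← Category.assoc, Pts.pt_last, hb]))

theorem act_pre {I J K M : B} {α : LPath (Rel p) I J} {s : I ⟶ K} {t : J ⟶ M} {β : Rel p K M}
    (ξ : (bilGraph p).Cell α s t β) {Z Z' : B} {e : p.Fiber Z} {e' : p.Fiber Z'} {z : Z' ⟶ Z}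
    (φ : HomOver p z e' e) {a : Z ⟶ I} {b : Z ⟶ J}
    (P : Pts e α a b) {a' : Z ⟶ K} {b' : Z ⟶ M} (ha : a ≫ s = a') (hb : b ≫ t = b')
    {c : Z' ⟶ I} {d : Z' ⟶ J} {c' : Z' ⟶ K} {d' : Z' ⟶ M} (hc : z ≫ a = c) (hd : z ≫ b = d)
    (hc' : c ≫ s = c') (hd' : d ≫ t = d') (hc'' : z ≫ a' = c') (hd'' : z ≫ b' = d') :
    act ξ (P.pre φ hc hd) hc' hd' = φ.comp (act ξ P ha hb) (Pts.lift_eq hc'' hd'') :=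
  HomOver.ext ((congrArg (· ≫ (ofVert ξ).1) (toCtx_pre φ P hc hd)).trans (Category.assoc _ _ _))

theorem cell_ext {I J K M : B} {α : LPath (Rel p) I J} {s : I ⟶ K} {t : J ⟶ M} {β : Rel p K M}
    {ξ ζ : (bilGraph p).Cell α s t β} (h : act ξ (gen α) rfl rfl = act ζ (gen α) rfl rfl) :
    ξ = ζ := by
  refine ofVert_injective (HomOver.ext ?_)
  have := congrArg Subtype.val h
  have H : ∀ ξ : (bilGraph p).Cell α s t β, (ofVert ξ).1 = (act ξ (gen α) rfl rfl).1 := fun ξ =>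
    (Category.id_comp _).symm.trans (congrArg (· ≫ (ofVert ξ).1) (toCtx_gen α).symm)
  exact (H ξ).trans (this.trans (H ζ).symm)

/-- The cell with a given action on the generic generalized element. -/
def mkCell {I J K M : B} {α : LPath (Rel p) I J} {s : I ⟶ K} {t : J ⟶ M} {β : Rel p K M}
    (a : HomOver p (prod.lift (first p α ≫ s) (last p α ≫ t)) (ctx p α) β) :
    (bilGraph p).Cell α s t β :=
  toVert a

theorem act_mkCell {I J K M : B} {α : LPath (Rel p) I J} {s : I ⟶ K} {t : J ⟶ M} {β : Rel p K M}
    (x : HomOver p (prod.lift (first p α ≫ s) (last p α ≫ t)) (ctx p α) β)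
    {Z : B} {e : p.Fiber Z} {a : Z ⟶ I} {b : Z ⟶ J}
    (P : Pts e α a b) {a' : Z ⟶ K} {b' : Z ⟶ M} (ha : a ≫ s = a') (hb : b ≫ t = b') :
    (act (mkCell x) P ha hb).1 = (toCtx P).1 ≫ x.1 :=
  congrArg (fun y : HomOver p _ _ _ => (toCtx P).1 ≫ y.1) (ofVert_toVert x)

theorem act_mkCell_gen {I J K M : B} {α : LPath (Rel p) I J} {s : I ⟶ K} {t : J ⟶ M}
    {β : Rel p K M} (x : HomOver p (prod.lift (first p α ≫ s) (last p α ≫ t)) (ctx p α) β) :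
    act (mkCell x) (gen α) rfl rfl = x :=
  HomOver.ext ((act_mkCell x _ _ _).trans
    ((congrArg (· ≫ x.1) (toCtx_gen α)).trans (Category.id_comp _)))

/-- The action of a path of cells on generalized elements. -/
def actCells : ∀ {I J K M : B} {α : LPath (Rel p) I J} {s : I ⟶ K} {t : J ⟶ M}
    {β : LPath (Rel p) K M} (_ : (bilGraph p).Cells α s t β) {Z : B} {e : p.Fiber Z} {a : Z ⟶ I}
    {b : Z ⟶ J} (_ : Pts e α a b) {a' : Z ⟶ K} {b' : Z ⟶ M} (_ : a ≫ s = a') (_ : b ≫ t = b'),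
    Pts e β a' b'
  | _, _, _, _, _, _, _, _, .nil _ _ h, _, _, _, _, P, _, _, ha, hb =>
    .nil _ _ (by rw [← ha, ← hb, h, P.nil_eq])
  | _, _, _, _, _, _, _, _, .cons (α₁ := α₁) ξ ξs h, _, _, _, _, P, _, _, ha, hb =>
    .cons (act ξ (P.split α₁ h).fst ha rfl) (actCells ξs (P.split α₁ h).snd rfl hb)

theorem actCells_cons {I J I' K M K' : B} {α₁ : LPath (Rel p) I J} {α₂ : LPath (Rel p) J I'}
    {α : LPath (Rel p) I I'} {s : I ⟶ K} {t : J ⟶ M} {s' : I' ⟶ K'} {β : Rel p K M}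
    {q : LPath (Rel p) M K'} (ξ : (bilGraph p).Cell α₁ s t β)
    (ξs : (bilGraph p).Cells α₂ t s' q) (h : α₁.append α₂ = α) {Z : B} {e : p.Fiber Z} {a : Z ⟶ I}
    {m : Z ⟶ J} {b : Z ⟶ I'} (P : Pts e α₁ a m) (Q : Pts e α₂ m b) {a' : Z ⟶ K} {m' : Z ⟶ M}
    {b' : Z ⟶ K'} (ha : a ≫ s = a') (hm : m ≫ t = m') (hb : b ≫ s' = b') :
    actCells (.cons ξ ξs h) (P.append Q h) ha hb =
      .cons (act ξ P ha hm) (actCells ξs Q hm hb) := by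
  subst hm
  exact congrArg (fun r : PtsSplit e α₁ α₂ a b => Pts.cons (act ξ r.fst ha rfl)
    (actCells ξs r.snd rfl hb)) (Pts.split_append P Q h)

theorem actCells_pre : ∀ {I J K M : B} {α : LPath (Rel p) I J} {s : I ⟶ K} {t : J ⟶ M}
    {β : LPath (Rel p) K M} (χ : (bilGraph p).Cells α s t β) {Z Z' : B} {e : p.Fiber Z}
    {e' : p.Fiber Z'} {z : Z' ⟶ Z} (φ : HomOver p z e' e) {a : Z ⟶ I} {b : Z ⟶ J}
    (P : Pts e α a b) {a' : Z ⟶ K} {b' : Z ⟶ M} (ha : a ≫ s = a') (hb : b ≫ t = b')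
    {c : Z' ⟶ I} {d : Z' ⟶ J} {c' : Z' ⟶ K} {d' : Z' ⟶ M} (hc : z ≫ a = c) (hd : z ≫ b = d)
    (hc' : c ≫ s = c') (hd' : d ≫ t = d') (hc'' : z ≫ a' = c') (hd'' : z ≫ b' = d'),
    actCells χ (P.pre φ hc hd) hc' hd' = (actCells χ P ha hb).pre φ hc'' hd''
  | _, _, _, _, _, _, _, _, .nil _ _ _, _, _, _, _, _, _, _, _, _, _, _, _, _, _, _, _, _, _, _, _,
    _, _, _ => rfl
  | _, _, _, _, _, _, _, _, .cons (α₁ := α₁) ξ ξs h, _, _, _, _, _, φ, _, _, P, _, _, ha, hb,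
    _, _, _, _, hc, hd, hc', hd', hc'', hd'' => by
    have e := Pts.append_split h P
    generalize P.split α₁ h = r at e
    subst e
    rw [Pts.pre_append φ r.fst r.snd h hc rfl hd,
      actCells_cons ξ ξs h _ _ hc' (Category.assoc _ _ _) hd',
      actCells_cons ξ ξs h _ _ ha rfl hb, Pts.pre_cons _ _ _ _ _ rfl,
      actCells_pre ξs φ r.snd rfl hb rfl hd (Category.assoc _ _ _) hd' rfl hd'',
      act_pre ξ φ r.fst ha rfl hc rfl hc' (Category.assoc _ _ _) hc'' rfl]

theorem act_cast {I J K M : B} {α : LPath (Rel p) I J} {s : I ⟶ K} {t : J ⟶ M} {β : Rel p K M}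
    (ξ : (bilGraph p).Cell α s t β) {s' : I ⟶ K} {t' : J ⟶ M} (hs : s = s') (ht : t = t') {Z : B}
    {e : p.Fiber Z} {a : Z ⟶ I} {b : Z ⟶ J} (P : Pts e α a b) {a' : Z ⟶ K} {b' : Z ⟶ M}
    (ha : a ≫ s = a') (hb : b ≫ t = b') (ha' : a ≫ s' = a') (hb' : b ≫ t' = b') :
    act ((bilGraph p).cast rfl hs ht ξ) P ha' hb' = act ξ P ha hb := by
  subst hs ht; rfl

/-- Identity cells, and the composition of cells. A cell `ξ` sends an arrow `e ⟶ ∧ αᵢ[⟨i-1, i⟩]`,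
given as a tuple of arrows `e ⟶ αᵢ` over the projections, to an arrow `e ⟶ β` (its action `act`);
the composite of `χ` and `ζ` acts by `χ` followed by `ζ`, starting from the generic tuple. -/
abbrev bilStr (p : E ⥤ B) [p.IsFibered] [∀ X : B, HasFiniteProducts (p.Fiber X)]
    [∀ {X Y : B} (f : X ⟶ Y), PreservesFiniteProducts (baseChange p f)] :
    VDStruct.{u, v, w, x} where
  toVDGraph := bilGraph p
  idCell α := mkCell ((gen (.single α)).arrow.cast (by simp only [Category.comp_id]))
  comp {_ _ _ _ _ _ α} _ _ _ _ _ _ _ _ χ ζ h h' :=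
    mkCell (act ζ (actCells χ (gen α) rfl rfl) (by rw [Category.assoc, h])
      (by rw [Category.assoc, h']))

theorem act_idCell {I J : B} {α : Rel p I J} {Z : B} {e : p.Fiber Z} {s : Z ⟶ I} {t : Z ⟶ J}
    (P : Pts e (.single α) s t) {s' : Z ⟶ I} {t' : Z ⟶ J} (hs : s ≫ 𝟙 I = s') (ht : t ≫ 𝟙 J = t') :
    act ((bilStr p).idCell α) P hs ht = P.arrow.cast
      (by rw [← hs, ← ht, Category.comp_id, Category.comp_id]) := by
  refine HomOver.ext ((act_mkCell _ _ _ _).trans ?_)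
  exact (arrow_pre (toCtx P) (gen (.single α)) P.pt_first P.pt_last).symm.trans
    (congrArg (fun Q => (Pts.arrow Q).1) (pre_toCtx P))

theorem act_comp {I J K M P Q : B} {α : LPath (Rel p) I J} {s : I ⟶ K} {s' : J ⟶ M}
    {β : LPath (Rel p) K M} {t : K ⟶ P} {t' : M ⟶ Q} {γ : Rel p P Q} {u : I ⟶ P} {u' : J ⟶ Q}
    (χ : (bilGraph p).Cells α s s' β) (ζ : (bilGraph p).Cell β t t' γ) (h : s ≫ t = u)
    (h' : s' ≫ t' = u') {Z : B} {e : p.Fiber Z} {a : Z ⟶ I} {b : Z ⟶ J} (R : Pts e α a b)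
    {a' : Z ⟶ K} {b' : Z ⟶ M} (ha : a ≫ s = a') (hb : b ≫ s' = b') {a'' : Z ⟶ P} {b'' : Z ⟶ Q}
    (ha' : a' ≫ t = a'') (hb' : b' ≫ t' = b'') (ha'' : a ≫ u = a'') (hb'' : b ≫ u' = b'') :
    act ((bilStr p).comp χ ζ h h') R ha'' hb'' = act ζ (actCells χ R ha hb) ha' hb' := by
  refine HomOver.ext ((act_mkCell _ _ _ _).trans ?_)
  have e₁ : R.pt ≫ first p α ≫ s = a' := by rw [← Category.assoc, R.pt_first, ha]
  have e₂ : R.pt ≫ last p α ≫ s' = b' := by rw [← Category.assoc, R.pt_last, hb]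
  have e₃ : R.pt ≫ first p α ≫ u = a'' := by rw [← Category.assoc, R.pt_first, ha'']
  have e₄ : R.pt ≫ last p α ≫ u' = b'' := by rw [← Category.assoc, R.pt_last, hb'']
  have H := actCells_pre χ (toCtx R) (gen α) rfl rfl R.pt_first R.pt_last ha hb e₁ e₂
  rw [pre_toCtx] at H
  rw [H, act_pre ζ (toCtx R) (actCells χ (gen α) rfl rfl) (by rw [Category.assoc, h])
    (by rw [Category.assoc, h']) e₁ e₂ ha' hb' e₃ e₄]
  rfl

theorem actCells_id {I J : B} (α : LPath (Rel p) I J) {Z : B} {e : p.Fiber Z} {a : Z ⟶ I}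
    {b : Z ⟶ J} (P : Pts e α a b) {a' : Z ⟶ I} {b' : Z ⟶ J} (ha : a ≫ 𝟙 I = a') (hb : b ≫ 𝟙 J = b')
    (ha' : a = a') (hb' : b = b') :
    actCells ((bilStr p).idCells α) P ha hb = ha' ▸ hb' ▸ P := by
  subst ha' hb'
  induction P with
  | nil => rfl
  | cons x xs ih =>
    refine (actCells_cons ((bilStr p).idCell _) ((bilStr p).idCells _) rfl
      (.cons x (.nil _ _ rfl)) xs ha (Category.comp_id _) hb).trans ?_
    rw [ih, act_idCell]
    rfl

theorem Pts.cons_append {Z : B} {e : p.Fiber Z} {I J K M : B} {α : Rel p I J}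
    {q : LPath (Rel p) J K} {α₂ : LPath (Rel p) K M} {r : LPath (Rel p) J M} {s : Z ⟶ I}
    {m : Z ⟶ J} {t : Z ⟶ K} {b : Z ⟶ M} (a : HomOver p (prod.lift s m) e α) (as : Pts e q m t)
    (Q : Pts e α₂ t b) (h : (LPath.cons α q).append α₂ = .cons α r) (h₀ : q.append α₂ = r) :
    (Pts.cons a as).append Q h = .cons a (as.append Q h₀) := by
  subst h₀; rfl

theorem Pts.append_assoc {Z : B} {e : p.Fiber Z} {I J K M : B} {α₁ : LPath (Rel p) I J}
    {α₂ : LPath (Rel p) J K} {α₃ : LPath (Rel p) K M} {a : Z ⟶ I} {b : Z ⟶ J} {c : Z ⟶ K}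
    {d : Z ⟶ M} (P : Pts e α₁ a b) (Q : Pts e α₂ b c) (R : Pts e α₃ c d)
    (h : α₁.append (α₂.append α₃) = (α₁.append α₂).append α₃) :
    (P.append Q rfl).append R rfl = P.append (Q.append R rfl) h := by
  induction P with
  | nil _ _ h₀ => subst h₀; rfl
  | cons a as ih =>
    refine Eq.trans ?_ (Pts.cons_append a as (Q.append R rfl) _
      (LPath.append_assoc _ _ _).symm).symm
    exact congrArg (Pts.cons a) (ih Q _)

theorem actCells_append : ∀ {I J K M : B} {α₁ : LPath (Rel p) I J} {s : I ⟶ K} {t : J ⟶ M}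
    {β₁ : LPath (Rel p) K M} (χ₁ : (bilGraph p).Cells α₁ s t β₁) {I' K' : B}
    {α₂ : LPath (Rel p) J I'} {s' : I' ⟶ K'} {β₂ : LPath (Rel p) M K'}
    (χ₂ : (bilGraph p).Cells α₂ t s' β₂) {α : LPath (Rel p) I I'} {β : LPath (Rel p) K K'}
    (hα : α₁.append α₂ = α) (hβ : β₁.append β₂ = β) {Z : B} {e : p.Fiber Z} {a : Z ⟶ I}
    {m : Z ⟶ J} {b : Z ⟶ I'} (P : Pts e α₁ a m) (Q : Pts e α₂ m b) {a' : Z ⟶ K} {m' : Z ⟶ M}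
    {b' : Z ⟶ K'} (ha : a ≫ s = a') (hm : m ≫ t = m') (hb : b ≫ s' = b'),
    actCells (χ₁.append χ₂ hα hβ) (P.append Q hα) ha hb =
      (actCells χ₁ P ha hm).append (actCells χ₂ Q hm hb) hβ
  | _, _, _, _, _, _, _, _, .nil s s' h, _, _, _, _, _, χ₂, _, _, hα, hβ, _, _, _, _, _, P, Q,
    _, _, _, ha, hm, hb => by
    subst h hα hβ
    obtain rfl := P.nil_eq
    obtain rfl := ha.symm.trans hm
    obtain ⟨⟩ := P
    rfl
  | _, _, _, _, _, _, _, _, .cons (α₁ := δ₁) ξ ξs h, _, _, _, _, _, χ₂, _, _, hα, hβ, _, _, _, _, _,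
    P, Q, _, _, _, ha, hm, hb => by
    subst h hα hβ
    have e := Pts.append_split rfl P
    generalize P.split δ₁ rfl = r at e
    subst e
    rw [Pts.append_assoc r.fst r.snd Q (LPath.append_assoc _ _ _).symm]
    refine (actCells_cons ξ _ _ r.fst _ ha rfl hb).trans ?_
    refine Eq.trans ?_ (congrArg (fun c => Pts.append c (actCells χ₂ Q hm hb) rfl)
      (actCells_cons ξ ξs rfl r.fst r.snd ha rfl hm)).symm
    exact congrArg (Pts.cons _) (actCells_append ξs χ₂ rfl rfl r.snd Q rfl hm hb)

theorem Pts.append_nil {Z : B} {e : p.Fiber Z} {I J : B} {α : LPath (Rel p) I J} {a : Z ⟶ I}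
    {b : Z ⟶ J} (P : Pts e α a b) : P.append (.nil b b rfl) α.append_nil = P := by
  induction P with
  | nil _ _ h => subst h; rfl
  | cons a as ih =>
    exact (Pts.cons_append a as _ _ (LPath.append_nil _)).trans (congrArg (Pts.cons a) ih)

theorem actCells_single {I J K M : B} {α : LPath (Rel p) I J} {s : I ⟶ K} {t : J ⟶ M}
    {β : Rel p K M} (ξ : (bilGraph p).Cell α s t β) {Z : B} {e : p.Fiber Z} {a : Z ⟶ I}
    {b : Z ⟶ J} (P : Pts e α a b) {a' : Z ⟶ K} {b' : Z ⟶ M} (ha : a ≫ s = a') (hb : b ≫ t = b') :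
    actCells (VDGraph.Cells.single ξ) P ha hb = .cons (act ξ P ha hb) (.nil _ _ rfl) :=
  (congrArg (fun R => actCells (VDGraph.Cells.single ξ) R ha hb) P.append_nil.symm).trans
    (actCells_cons (q := .nil M) ξ (VDGraph.Cells.nil (D := bilGraph p) t t rfl) α.append_nil P (.nil b b rfl) ha hb hb)

theorem actCells_comp : ∀ {K M P Q : B} {β : LPath (Rel p) K M} {t : K ⟶ P} {t' : M ⟶ Q}
    {γ : LPath (Rel p) P Q} (ζ : (bilGraph p).Cells β t t' γ) {I J : B} {α : LPath (Rel p) I J}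
    {s : I ⟶ K} {s' : J ⟶ M} {u : I ⟶ P} {u' : J ⟶ Q} (χ : (bilGraph p).Cells α s s' β)
    (h : s ≫ t = u) (h' : s' ≫ t' = u') {Z : B} {e : p.Fiber Z} {a : Z ⟶ I} {b : Z ⟶ J}
    (R : Pts e α a b) {a' : Z ⟶ K} {b' : Z ⟶ M} (ha : a ≫ s = a') (hb : b ≫ s' = b')
    {a'' : Z ⟶ P} {b'' : Z ⟶ Q} (ha' : a' ≫ t = a'') (hb' : b' ≫ t' = b'') (ha'' : a ≫ u = a'')
    (hb'' : b ≫ u' = b''),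
    actCells ((bilStr p).compCells ζ χ h h') R ha'' hb'' =
      actCells ζ (actCells χ R ha hb) ha' hb'
  | _, _, _, _, _, _, _, _, .nil _ _ _, _, _, _, _, _, _, _, .nil _ _ _, _, _, _, _, _, _, _, _, _,
    _, _, _, _, _, _, _, _ => rfl
  | _, _, _, _, _, _, _, _, .cons (α₁ := β₁) (α₂ := β₂) ζ ζs h₀, _, _, _, _, _, _, _, χ, h, h', _,
    _, _, _, R, _, _, ha, hb, _, _, ha', hb', ha'', hb'' => by
    subst h₀
    have e := VDGraph.Cells.append_split β₁ β₂ χ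
    generalize VDGraph.Cells.split β₁ β₂ χ = r at e
    subst e
    have e := Pts.append_split r.eq R
    generalize R.split r.α₁ r.eq = T at e
    subst e
    refine (congrArg (fun c => actCells c _ _ _)
      ((bilStr p).compCells_cons r.fst r.snd r.eq rfl ζ ζs h rfl h')).trans ?_
    refine (actCells_cons _ _ r.eq T.fst T.snd ha'' rfl hb'').trans ?_
    rw [actCells_append r.fst r.snd r.eq rfl T.fst T.snd ha rfl hb,
      actCells_cons ζ ζs rfl _ _ ha' (Category.assoc _ _ _) hb',
      actCells_comp ζs r.snd rfl h' T.snd rfl hb (Category.assoc _ _ _) hb' rfl hb'',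
      act_comp r.fst ζ h rfl T.fst ha rfl ha' (Category.assoc _ _ _) ha'' rfl]

end

/-- The virtual double category of binary predicates of a cartesian fibration. -/
abbrev bil (p : E ⥤ B) [HasFiniteProducts B] [p.IsFibered]
    [∀ X : B, HasFiniteProducts (p.Fiber X)]
    [∀ {X Y : B} (f : X ⟶ Y), PreservesFiniteProducts (baseChange p f)] : VDC.{u, v, w, x} where
  toVDStruct := bilStr p
  id_comp {_ _ _ _ α s s' _} ξ h h' := cell_ext (by
    rw [act_comp _ _ _ _ (gen α) (Category.comp_id _) (Category.comp_id _) rfl rfl,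
      actCells_id α (gen α) _ _ rfl rfl])
  comp_id {_ _ _ _ α s s' _} ξ h h' := cell_ext (by
    refine (act_comp _ _ _ _ (gen α) rfl rfl ((Category.assoc _ _ _).trans
      (congrArg (first p α ≫ ·) h)) ((Category.assoc _ _ _).trans
        (congrArg (last p α ≫ ·) h')) _ _).trans ?_
    rw [actCells_single]
    exact act_idCell (.cons (act ξ (gen α) rfl rfl) (.nil _ _ rfl)) _ _)
  assoc {_ _ _ _ _ _ _ _ α _ _ _ _ _ _ _ _ _ _ _ _ _ _ _} χ ξ ζ h₁ h₁' h₂ h₂' h₃ h₃' h₄ h₄' :=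
    cell_ext (by
      subst h₂ h₂'
      have e := (Category.assoc (first p α) _ _).trans (congrArg (first p α ≫ ·) h₁)
      have e' := (Category.assoc (last p α) _ _).trans (congrArg (last p α ≫ ·) h₁')
      have f := (Category.assoc (first p α) _ _).trans (congrArg (first p α ≫ ·) h₃)
      have f' := (Category.assoc (last p α) _ _).trans (congrArg (last p α ≫ ·) h₃')
      have g := (Category.assoc (first p α) _ _).trans (congrArg (first p α ≫ ·) h₄)
      have g' := (Category.assoc (last p α) _ _).trans (congrArg (last p α ≫ ·) h₄')
      rw [act_comp _ ζ h₃ h₃' (gen α) rfl rfl f f' rfl rfl,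
        act_comp χ _ h₄ h₄' (gen α) rfl rfl g g' rfl rfl,
        actCells_comp ξ χ h₁ h₁' (gen α) rfl rfl e e' rfl rfl,
        act_comp ξ ζ rfl rfl _ e e' f f' g g'])

end FibCat

end

noncomputable section

namespace FibCat

open CategoryTheory.Functor

/-- The functor between fibres induced by a strictly commutative square of functors. -/
def fiberMap {B B' : Type u} [Category.{v} B] [Category.{v} B'] {E E' : Type w} [Category.{x} E]
    [Category.{x} E'] {p : E ⥤ B} {p' : E' ⥤ B'} (F₀ : B ⥤ B') (F₁ : E ⥤ E')
    (h : F₁ ⋙ p' = p ⋙ F₀) (X : B) : p.Fiber X ⥤ p'.Fiber (F₀.obj X) :=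
  Fiber.inducedFunctor (F := Fiber.fiberInclusion ⋙ F₁) (by
    rw [Functor.assoc, h, ← Functor.assoc, Fiber.fiberInclusion_comp_eq_const]
    exact CategoryTheory.Functor.ext (fun _ => rfl) (fun _ _ _ => by simp))

theorem isHomLift_map {B B' : Type u} [Category.{v} B] [Category.{v} B'] {E E' : Type w}
    [Category.{x} E] [Category.{x} E'] {p : E ⥤ B} {p' : E' ⥤ B'} {F₀ : B ⥤ B'} {F₁ : E ⥤ E'}
    (h : F₁ ⋙ p' = p ⋙ F₀) {X Y : B} (f : X ⟶ Y) {a b : E} (φ : a ⟶ b) (hφ : p.IsHomLift f φ) :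
    p'.IsHomLift (F₀.map f) (F₁.map φ) := by
  obtain ⟨⟩ := hφ
  exact IsHomLift.of_fac' (p := p') (F₀.map (p.map φ)) (F₁.map φ) (Functor.congr_obj h _)
    (Functor.congr_obj h _) (Functor.congr_hom h _)

end FibCat

/-- A cartesian fibration: a fibration over a category with finite products, whose fibres have
finite products that are preserved by base change. -/
structure CartFib where
  Base : Type u
  [catBase : Category.{v} Base]
  Total : Type w
  [catTotal : Category.{x} Total]
  p : Total ⥤ Base
  [isFibered : p.IsFibered]
  [baseProducts : HasFiniteProducts Base]
  [fiberProducts : ∀ X : Base, HasFiniteProducts (p.Fiber X)]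
  [preservesProducts : ∀ {X Y : Base} (f : X ⟶ Y),
    PreservesFiniteProducts (FibCat.baseChange p f)]

attribute [instance] CartFib.catBase CartFib.catTotal CartFib.isFibered CartFib.baseProducts
  CartFib.fiberProducts CartFib.preservesProducts

namespace CartFib

/-- A morphism of cartesian fibrations: a strictly commutative square of functors which preserves
cartesian arrows, finite products in the base, and finite products in the fibres. -/
structure Mor (P Q : CartFib.{u, v, w, x}) where
  base : P.Base ⥤ Q.Base
  total : P.Total ⥤ Q.Total
  comm : total ⋙ Q.p = P.p ⋙ base
  cartesian : ∀ {X Y : P.Base} (f : X ⟶ Y) {a b : P.Total} (φ : a ⟶ b),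
    P.p.IsCartesian f φ → Q.p.IsCartesian (base.map f) (total.map φ)
  [preservesBase : PreservesFiniteProducts base]
  [preservesFiber : ∀ X : P.Base, PreservesFiniteProducts (FibCat.fiberMap base total comm X)]

attribute [instance] Mor.preservesBase Mor.preservesFiber

/-- A transformation of morphisms of fibrations: a pair of natural transformations, one of which
lies over the other. -/
@[ext]
structure Trans {P Q : CartFib.{u, v, w, x}} (F G : Mor P Q) where
  base : F.base ⟶ G.base
  total : F.total ⟶ G.total
  lies : ∀ a : P.Total, Q.p.IsHomLift (base.app (P.p.obj a)) (total.app a)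

theorem Trans.lies_of_eq {P Q : CartFib.{u, v, w, x}} {F G : Mor P Q} (θ : Trans F G) {X : P.Base}
    {a : P.Total} (h : P.p.obj a = X) : Q.p.IsHomLift (θ.base.app X) (θ.total.app a) := by
  subst h; exact θ.lies a

namespace Mor

def id (P : CartFib.{u, v, w, x}) : Mor P P where
  base := 𝟭 _
  total := 𝟭 _
  comm := rfl
  cartesian _ _ _ _ h := h
  preservesFiber X := inferInstanceAs (PreservesFiniteProducts (𝟭 (P.p.Fiber X)))

def comp {P Q R : CartFib.{u, v, w, x}} (F : Mor P Q) (G : Mor Q R) : Mor P R where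
  base := F.base ⋙ G.base
  total := F.total ⋙ G.total
  comm := (congrArg (F.total ⋙ ·) G.comm).trans (congrArg (· ⋙ G.base) F.comm)
  cartesian f _ _ φ h := G.cartesian _ _ (F.cartesian f φ h)
  preservesBase := comp_preservesFiniteProducts _ _
  preservesFiber X := inferInstanceAs (PreservesFiniteProducts
    (FibCat.fiberMap F.base F.total F.comm X ⋙
      FibCat.fiberMap G.base G.total G.comm (F.base.obj X)))

end Mor

namespace Trans

variable {P Q R S : CartFib.{u, v, w, x}}

instance : Category (Mor P Q) where
  Hom F G := Trans F G
  id F := ⟨𝟙 _, 𝟙 _, fun a => IsHomLift.id (Functor.congr_obj F.comm a)⟩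
  comp θ φ := ⟨θ.base ≫ φ.base, θ.total ≫ φ.total, fun a =>
    haveI := θ.lies a
    haveI := φ.lies a
    IsHomLift.comp Q.p _ _ (θ.total.app a) (φ.total.app a)⟩
  id_comp θ := Trans.ext (Category.id_comp θ.base) (Category.id_comp θ.total)
  comp_id θ := Trans.ext (Category.comp_id θ.base) (Category.comp_id θ.total)
  assoc θ φ ψ := Trans.ext (Category.assoc θ.base φ.base ψ.base)
    (Category.assoc θ.total φ.total ψ.total)

def whiskerLeft (F : Mor P Q) {G H : Mor Q R} (θ : Trans G H) : Trans (F.comp G) (F.comp H) where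
  base := Functor.whiskerLeft F.base θ.base
  total := Functor.whiskerLeft F.total θ.total
  lies a := θ.lies_of_eq (Functor.congr_obj F.comm a)

def whiskerRight {F G : Mor P Q} (θ : Trans F G) (H : Mor Q R) : Trans (F.comp H) (G.comp H) where
  base := Functor.whiskerRight θ.base H.base
  total := Functor.whiskerRight θ.total H.total
  lies a := FibCat.isHomLift_map H.comm _ _ (θ.lies a)

/-- An invertible transformation whose components are identities. -/
def idIso {F G : Mor P Q} (b : F.base ≅ G.base) (t : F.total ≅ G.total)
    (h : ∀ a, Q.p.IsHomLift (b.hom.app (P.p.obj a)) (t.hom.app a))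
    (h' : ∀ a, Q.p.IsHomLift (b.inv.app (P.p.obj a)) (t.inv.app a)) : F ≅ G where
  hom := Trans.mk b.hom t.hom h
  inv := Trans.mk b.inv t.inv h'
  hom_inv_id := Trans.ext b.hom_inv_id t.hom_inv_id
  inv_hom_id := Trans.ext b.inv_hom_id t.inv_hom_id

def associator (F : Mor P Q) (G : Mor Q R) (H : Mor R S) :
    (F.comp G).comp H ≅ F.comp (G.comp H) :=
  idIso (Functor.associator _ _ _) (Functor.associator _ _ _)
    (fun a => IsHomLift.id (Functor.congr_obj ((F.comp G).comp H).comm a))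
    (fun a => IsHomLift.id (Functor.congr_obj ((F.comp G).comp H).comm a))

def leftUnitor (F : Mor P Q) : (Mor.id P).comp F ≅ F :=
  idIso (Functor.leftUnitor _) (Functor.leftUnitor _)
    (fun a => IsHomLift.id (Functor.congr_obj F.comm a))
    (fun a => IsHomLift.id (Functor.congr_obj F.comm a))

def rightUnitor (F : Mor P Q) : F.comp (Mor.id Q) ≅ F :=
  idIso (Functor.rightUnitor _) (Functor.rightUnitor _)
    (fun a => IsHomLift.id (Functor.congr_obj F.comm a))
    (fun a => IsHomLift.id (Functor.congr_obj F.comm a))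

/-- To prove an equation of transformations it is enough to do so for the components. -/
theorem ext_app {F G : Mor P Q} {θ φ : Trans F G} (h : ∀ X, θ.base.app X = φ.base.app X)
    (h' : ∀ a, θ.total.app a = φ.total.app a) : θ = φ :=
  Trans.ext (NatTrans.ext (funext h)) (NatTrans.ext (funext h'))

end Trans

instance : Bicategory CartFib.{u, v, w, x} where
  Hom P Q := Mor P Q
  id P := Mor.id P
  comp F G := Mor.comp F G
  whiskerLeft F _ _ θ := Trans.whiskerLeft F θ
  whiskerRight θ H := Trans.whiskerRight θ H
  associator F G H := Trans.associator F G H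
  leftUnitor F := Trans.leftUnitor F
  rightUnitor F := Trans.rightUnitor F
  whiskerLeft_id F G := Trans.ext_app (fun _ => rfl) (fun _ => rfl)
  whiskerLeft_comp F _ _ _ η θ := Trans.ext_app (fun _ => rfl) (fun _ => rfl)
  id_whiskerLeft η := Trans.ext_app
    (fun X => VDTrans.eq_id_comp_id ((Trans.base η).app X))
    (fun a => VDTrans.eq_id_comp_id ((Trans.total η).app a))
  comp_whiskerLeft F G _ _ η := Trans.ext_app
    (fun X => VDTrans.eq_id_comp_id ((Trans.base η).app (G.base.obj (F.base.obj X))))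
    (fun a => VDTrans.eq_id_comp_id ((Trans.total η).app (G.total.obj (F.total.obj a))))
  id_whiskerRight F G := Trans.ext_app (fun X => G.base.map_id (F.base.obj X))
    (fun a => G.total.map_id (F.total.obj a))
  comp_whiskerRight η θ H := Trans.ext_app
    (fun X => H.base.map_comp ((Trans.base η).app X) ((Trans.base θ).app X))
    (fun a => H.total.map_comp ((Trans.total η).app a) ((Trans.total θ).app a))
  whiskerRight_id η := Trans.ext_app
    (fun X => VDTrans.eq_id_comp_id ((Trans.base η).app X))
    (fun a => VDTrans.eq_id_comp_id ((Trans.total η).app a))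
  whiskerRight_comp η G H := Trans.ext_app
    (fun X => VDTrans.eq_id_comp_id (H.base.map (G.base.map ((Trans.base η).app X))))
    (fun a => VDTrans.eq_id_comp_id (H.total.map (G.total.map ((Trans.total η).app a))))
  whisker_assoc F _ _ η H := Trans.ext_app
    (fun X => VDTrans.eq_id_comp_id (H.base.map ((Trans.base η).app (F.base.obj X))))
    (fun a => VDTrans.eq_id_comp_id (H.total.map ((Trans.total η).app (F.total.obj a))))
  whisker_exchange η θ := Trans.ext_app
    (fun X => ((Trans.base θ).naturality ((Trans.base η).app X)).symm)
    (fun a => ((Trans.total θ).naturality ((Trans.total η).app a)).symm)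
  pentagon F G H K := Trans.ext_app
    (fun X => (congrArg (· ≫ 𝟙 _ ≫ 𝟙 _)
      (K.base.map_id (H.base.obj (G.base.obj (F.base.obj X))))).trans (Category.id_comp _))
    (fun a => (congrArg (· ≫ 𝟙 _ ≫ 𝟙 _)
      (K.total.map_id (H.total.obj (G.total.obj (F.total.obj a))))).trans (Category.id_comp _))
  triangle F G := Trans.ext_app
    (fun X => (Category.id_comp _).trans (G.base.map_id (F.base.obj X)).symm)
    (fun a => (Category.id_comp _).trans (G.total.map_id (F.total.obj a)).symm)

end CartFib

end

noncomputable section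

namespace FibCat

variable {B : Type u} [Category.{v} B] {E : Type w} [Category.{x} E] {p : E ⥤ B}
  [HasFiniteProducts B]

theorem Pts.nil_uniq {Z I : B} {e : p.Fiber Z} {s t : Z ⟶ I} :
    ∀ R S : Pts e (.nil I) s t, R = S
  | .nil _ _ _, .nil _ _ _ => rfl

theorem Pts.exists_cons {Z I J K : B} {e : p.Fiber Z} {α : Rel p I J} {q : LPath (Rel p) J K}
    {s : Z ⟶ I} {t : Z ⟶ K} : ∀ R : Pts e (.cons α q) s t,
    ∃ (m : Z ⟶ J) (a : HomOver p (prod.lift s m) e α) (as : Pts e q m t), R = .cons a as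
  | .cons a as => ⟨_, a, as, rfl⟩

end FibCat

namespace CartFib.Mor

open FibCat

section

variable {P Q : CartFib.{u, v, w, x}} (F : Mor P Q)

abbrev fib {X : P.Base} (a : P.p.Fiber X) : Q.p.Fiber (F.base.obj X) :=
  (fiberMap F.base F.total F.comm X).obj a

/-- The action of a morphism of fibrations on arrows over a given arrow. -/
def homMap {X Y : P.Base} {f : X ⟶ Y} {a : P.p.Fiber X} {b : P.p.Fiber Y}
    (φ : HomOver P.p f a b) : HomOver Q.p (F.base.map f) (F.fib a) (F.fib b) :=
  ⟨F.total.map φ.1, isHomLift_map F.comm f φ.1 φ.2⟩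

instance {X Y : P.Base} {f : X ⟶ Y} {a : P.p.Fiber X} {b : P.p.Fiber Y}
    (φ : HomOver P.p f a b) [h : P.p.IsCartesian f φ.1] :
    Q.p.IsCartesian (F.base.map f) (F.homMap φ).1 :=
  F.cartesian f φ.1 h

/-- The inverse of the comparison of products. -/
abbrev pcInv (I J : P.Base) : F.base.obj I ⨯ F.base.obj J ⟶ F.base.obj (I ⨯ J) :=
  inv (prodComparison F.base I J)

/-- The action on loose arrows: base change of the action on objects along the comparison of
products. -/
def rel {I J : P.Base} (α : Rel P.p I J) : Rel Q.p (F.base.obj I) (F.base.obj J) :=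
  pullback Q.p (F.pcInv I J) (F.fib α)

def relProj {I J : P.Base} (α : Rel P.p I J) :
    HomOver Q.p (F.pcInv I J) (F.rel α) (F.fib α) :=
  proj Q.p (F.pcInv I J) (F.fib α)

instance {I J : P.Base} (α : Rel P.p I J) :
    Q.p.IsCartesian (F.pcInv I J) (F.relProj α).1 :=
  inferInstanceAs (Q.p.IsCartesian _ (proj Q.p _ (F.fib α)).1)

theorem pcInv_fst (I J : P.Base) : F.pcInv I J ≫ F.base.map prod.fst = prod.fst := by
  rw [pcInv, IsIso.inv_comp_eq, prodComparison_fst]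

theorem pcInv_snd (I J : P.Base) : F.pcInv I J ≫ F.base.map prod.snd = prod.snd := by
  rw [pcInv, IsIso.inv_comp_eq, prodComparison_snd]

theorem lift_inv {Z I J : P.Base} (s : Z ⟶ I) (m : Z ⟶ J) :
    prod.lift (F.base.map s) (F.base.map m) ≫ F.pcInv I J =
      F.base.map (prod.lift s m) := by
  rw [pcInv, IsIso.comp_inv_eq]
  refine Limits.prod.hom_ext ?_ ?_
  · rw [prod.lift_fst, Category.assoc, prodComparison_fst, ← F.base.map_comp, prod.lift_fst]
  · rw [prod.lift_snd, Category.assoc, prodComparison_snd, ← F.base.map_comp, prod.lift_snd]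

def mapPt {Z I J : P.Base} {e : P.p.Fiber Z} {s : Z ⟶ I} {m : Z ⟶ J} {α : Rel P.p I J}
    (a : HomOver P.p (prod.lift s m) e α) :
    HomOver Q.p (prod.lift (F.base.map s) (F.base.map m)) (F.fib e) (F.rel α) :=
  cartLift (F.relProj α) (F.homMap a) (F.lift_inv s m)

theorem mapPt_proj {Z I J : P.Base} {e : P.p.Fiber Z} {s : Z ⟶ I} {m : Z ⟶ J} {α : Rel P.p I J}
    (a : HomOver P.p (prod.lift s m) e α) :
    (F.mapPt a).1 ≫ (F.relProj α).1 = F.total.map a.1 :=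
  cartLift_fac _ _ _

theorem mapPt_comp {Z Z' I J : P.Base} {e : P.p.Fiber Z} {e' : P.p.Fiber Z'} {z : Z' ⟶ Z}
    (φ : HomOver P.p z e' e) {s : Z ⟶ I} {m : Z ⟶ J} {s' : Z' ⟶ I} {m' : Z' ⟶ J}
    {α : Rel P.p I J} (a : HomOver P.p (prod.lift s m) e α)
    (h : z ≫ prod.lift s m = prod.lift s' m')
    (h' : F.base.map z ≫ prod.lift (F.base.map s) (F.base.map m) =
      prod.lift (F.base.map s') (F.base.map m')) :
    F.mapPt (φ.comp a h) = (F.homMap φ).comp (F.mapPt a) h' := by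
  refine cart_ext (F.relProj α) ?_
  refine (F.mapPt_proj _).trans ((F.total.map_comp _ _).trans ?_)
  exact (congrArg (F.total.map φ.1 ≫ ·) (F.mapPt_proj a).symm).trans (Category.assoc _ _ _).symm

theorem mapPt_cast {Z I J : P.Base} {e : P.p.Fiber Z} {s s' : Z ⟶ I} {m m' : Z ⟶ J}
    {α : Rel P.p I J} (a : HomOver P.p (prod.lift s m) e α) (hs : s = s') (hm : m = m')
    (h : prod.lift s m = prod.lift s' m') : (F.mapPt (a.cast h)).1 = (F.mapPt a).1 := by
  subst hs hm; rfl

abbrev path {I J : P.Base} (α : LPath (Rel P.p) I J) :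
    LPath (Rel Q.p) (F.base.obj I) (F.base.obj J) :=
  α.map F.base.obj F.rel

/-- The action on generalized elements. -/
def mapPts {Z : P.Base} {e : P.p.Fiber Z} : ∀ {I J : P.Base} {α : LPath (Rel P.p) I J} {s : Z ⟶ I}
    {t : Z ⟶ J} (_ : Pts e α s t), Pts (F.fib e) (F.path α) (F.base.map s) (F.base.map t)
  | _, _, _, _, _, .nil _ _ h => .nil _ _ (congrArg F.base.map h)
  | _, _, _, _, _, .cons a as => .cons (F.mapPt a) (mapPts as)

theorem map_eq {X Y Z : P.Base} {f : X ⟶ Y} {g : Y ⟶ Z} {h : X ⟶ Z} (e : f ≫ g = h) :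
    F.base.map f ≫ F.base.map g = F.base.map h := by rw [← F.base.map_comp, e]

theorem mapPts_pre {Z Z' : P.Base} {e : P.p.Fiber Z} {e' : P.p.Fiber Z'} {z : Z' ⟶ Z}
    (φ : HomOver P.p z e' e) {I J : P.Base} {α : LPath (Rel P.p) I J} {s : Z ⟶ I}
    {t : Z ⟶ J} (R : Pts e α s t) {s' : Z' ⟶ I} {t' : Z' ⟶ J} (hs : z ≫ s = s')
    (ht : z ≫ t = t') :
    F.mapPts (R.pre φ hs ht) = (F.mapPts R).pre (F.homMap φ) (F.map_eq hs) (F.map_eq ht) := by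
  induction R with
  | nil => rfl
  | cons a as ih =>
    refine Eq.trans ?_ (Pts.pre_cons (F.homMap φ) (F.mapPt a) (F.mapPts as) (F.map_eq hs)
      (F.map_eq ht) (F.map_eq rfl)).symm
    rw [← ih rfl ht, ← F.mapPt_comp]
    rfl

theorem mapPts_append {Z : P.Base} {e : P.p.Fiber Z} {I J K : P.Base} {α₁ : LPath (Rel P.p) I J}
    {s : Z ⟶ I} {m : Z ⟶ J} (R : Pts e α₁ s m) {α₂ : LPath (Rel P.p) J K} {t : Z ⟶ K}
    (S : Pts e α₂ m t) {α : LPath (Rel P.p) I K} (h : α₁.append α₂ = α)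
    (h' : (F.path α₁).append (F.path α₂) = F.path α) :
    F.mapPts (R.append S h) = (F.mapPts R).append (F.mapPts S) h' := by
  subst h
  induction R with
  | nil _ _ h => subst h; rfl
  | cons a as ih =>
    refine Eq.trans ?_ (Pts.cons_append (F.mapPt a) (F.mapPts as) (F.mapPts S) h'
      (LPath.map_append _ _ _ _).symm).symm
    exact congrArg (Pts.cons (F.mapPt a)) (ih S _)

/-- The comparison between the products along a path. -/
def bmap : ∀ {I J : P.Base} (α : LPath (Rel P.p) I J),
    FibCat.base Q.p (F.path α) ⟶ F.base.obj (FibCat.base P.p α)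
  | _, _, .nil _ => 𝟙 _
  | I, _, .cons _ q => prod.map (𝟙 _) (bmap q) ≫ F.pcInv I (FibCat.base P.p q)

theorem bmap_bfst {I J K : P.Base} (α : Rel P.p I J) (q : LPath (Rel P.p) J K) :
    F.bmap (.cons α q) ≫ F.base.map (bfst P.p α q) = bfst Q.p (F.rel α) (F.path q) := by
  refine (Category.assoc _ _ _).trans ?_
  exact (congrArg (_ ≫ ·) (F.pcInv_fst _ _)).trans ((prod.map_fst _ _).trans (Category.comp_id _))

theorem bmap_bsnd {I J K : P.Base} (α : Rel P.p I J) (q : LPath (Rel P.p) J K) :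
    F.bmap (.cons α q) ≫ F.base.map (bsnd P.p α q) =
      bsnd Q.p (F.rel α) (F.path q) ≫ F.bmap q := by
  refine (Category.assoc _ _ _).trans ?_
  exact (congrArg (_ ≫ ·) (F.pcInv_snd _ _)).trans (prod.map_snd _ _)

theorem bmap_first {I J : P.Base} (α : LPath (Rel P.p) I J) :
    F.bmap α ≫ F.base.map (first P.p α) = first Q.p (F.path α) := by
  cases α with
  | nil => exact (Category.id_comp _).trans (F.base.map_id _)
  | cons α q => exact F.bmap_bfst α q

theorem bmap_last {I J : P.Base} (α : LPath (Rel P.p) I J) :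
    F.bmap α ≫ F.base.map (last P.p α) = last Q.p (F.path α) := by
  induction α with
  | nil => exact (Category.id_comp _).trans (F.base.map_id _)
  | cons α q ih =>
    refine (congrArg (_ ≫ ·) (F.base.map_comp (bsnd P.p α q) (last P.p q))).trans ?_
    refine (Category.assoc _ _ _).symm.trans ?_
    refine (congrArg (· ≫ _) (F.bmap_bsnd α q)).trans ((Category.assoc _ _ _).trans ?_)
    exact congrArg (_ ≫ ·) ih

theorem pt_mapPts {Z : P.Base} {e : P.p.Fiber Z} {I J : P.Base} {α : LPath (Rel P.p) I J}
    {s : Z ⟶ I} {t : Z ⟶ J} (R : Pts e α s t) :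
    (F.mapPts R).pt ≫ F.bmap α = F.base.map R.pt := by
  induction R with
  | nil => exact Category.comp_id _
  | @cons _ _ _ α q s _ _ a as ih =>
    refine (Category.assoc _ _ _).symm.trans ?_
    refine (congrArg (· ≫ _) (prod.lift_map _ _ _ _)).trans ?_
    refine Eq.trans ?_ (F.lift_inv s as.pt)
    refine congrArg (· ≫ _) ?_
    exact congrArg₂ prod.lift (Category.comp_id _) ih

theorem prodIsLimit {X : P.Base} (a b : P.p.Fiber X) :
    Nonempty (IsLimit (BinaryFan.mk
      ((fiberMap F.base F.total F.comm X).map (prod.fst : a ⨯ b ⟶ a))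
      ((fiberMap F.base F.total F.comm X).map (prod.snd : a ⨯ b ⟶ b)))) :=
  ⟨mapIsLimitOfPreservesOfIsLimit _ _ _ (prodIsProd a b)⟩

theorem exists_desc {I J : P.Base} (α : LPath (Rel P.p) I J) {X : P.Base} (u : X ⟶ FibCat.base P.p α)
    {s : X ⟶ I} {t : X ⟶ J} (hs : u ≫ first P.p α = s) (ht : u ≫ last P.p α = t) {Z : Q.Base}
    {e : Q.p.Fiber Z} (z : Z ⟶ F.base.obj X) {s' : Z ⟶ F.base.obj I} {t' : Z ⟶ F.base.obj J}
    (R : Pts e (F.path α) s' t') (h : R.pt ≫ F.bmap α = z ≫ F.base.map u)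
    (hs' : z ≫ F.base.map s = s') (ht' : z ≫ F.base.map t = t') :
    ∃ φ : HomOver Q.p z e (F.fib (conj P.p α u)),
      (F.mapPts (genAt α u hs ht)).pre φ hs' ht' = R := by
  induction α generalizing X with
  | nil I =>
    exact ⟨homTerminal ((terminalIsTerminal (C := P.p.Fiber X)).isTerminalObj
      (fiberMap F.base F.total F.comm X) _) z e, Pts.nil_uniq _ _⟩
  | @cons I M J α q ih =>
    obtain ⟨m, a, as, rfl⟩ := Pts.exists_cons R
    have h₂ : as.pt ≫ F.bmap q = z ≫ F.base.map (u ≫ bsnd P.p α q) := by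
      rw [F.base.map_comp, ← Category.assoc]
      refine Eq.trans ?_ (congrArg (· ≫ F.base.map (bsnd P.p α q)) h)
      refine Eq.trans ?_ ((congrArg (_ ≫ ·) (F.bmap_bsnd α q)).symm.trans
        (Category.assoc _ _ _).symm)
      refine Eq.trans ?_ (Category.assoc _ _ _)
      exact congrArg (· ≫ F.bmap q) (prod.lift_snd _ _).symm
    have hm : z ≫ F.base.map ((u ≫ bsnd P.p α q) ≫ first P.p q) = m := by
      rw [F.base.map_comp, ← Category.assoc, ← h₂, Category.assoc, F.bmap_first, Pts.pt_first]
    obtain ⟨ψ, hψ⟩ := ih (u ≫ bsnd P.p α q) rfl ((Category.assoc _ _ _).trans ht) z as h₂ hm ht'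
    have hs₀ : z ≫ F.base.map (u ≫ bfst P.p α q) = s' := (congrArg (z ≫ F.base.map ·) hs).trans hs'
    let κ := proj P.p (prod.lift (u ≫ bfst P.p α q) ((u ≫ bsnd P.p α q) ≫ first P.p q)) α
    obtain ⟨φ, h₁, h₃⟩ := exists_pair (F.prodIsLimit (pullback P.p (prod.lift (u ≫ bfst P.p α q)
        ((u ≫ bsnd P.p α q) ≫ first P.p q)) α) (conj P.p q (u ≫ bsnd P.p α q)))
      (cartLift (F.homMap κ) (a.comp (F.relProj α) rfl) (by
        rw [← F.lift_inv, ← Category.assoc, Pts.lift_eq hs₀ hm])) ψ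
    refine ⟨φ, ?_⟩
    refine (Pts.pre_cons φ (F.mapPt (chead α q u hs)) (F.mapPts ((genAt q (u ≫ bsnd P.p α q) rfl
      ((Category.assoc _ _ _).trans ht)).pre (ctail α q u) (Category.id_comp _)
        (Category.id_comp _))) hs' ht' hm).trans ?_
    have hz : z ≫ F.base.map (𝟙 X) = z :=
      (congrArg (z ≫ ·) (F.base.map_id X)).trans (Category.comp_id z)
    have e₁ : φ.comp (F.homMap (ctail α q u)) hz = ψ := HomOver.ext h₃
    have hy := congrArg (fun S => Pts.pre φ S hm ht') (F.mapPts_pre (ctail α q u)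
      (genAt q (u ≫ bsnd P.p α q) rfl ((Category.assoc _ _ _).trans ht)) (Category.id_comp _)
      (Category.id_comp _))
    refine congrArg₂ Pts.cons ?_ (hy.trans ((Pts.pre_pre (F.homMap (ctail α q u)) φ _ _ _ _ _
      hz hm ht').trans ((congrArg (fun χ => Pts.pre χ _ hm ht') e₁).trans hψ)))
    refine cart_ext (F.relProj α) ?_
    refine (Category.assoc _ _ _).trans ((congrArg (φ.1 ≫ ·) (F.mapPt_proj _)).trans ?_)
    refine (congrArg (φ.1 ≫ ·) (F.total.map_comp _ _)).trans ((Category.assoc _ _ _).symm.trans ?_)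
    refine (congrArg (· ≫ F.total.map κ.1) h₁).trans ?_
    exact cartLift_fac (F.homMap κ) (a.comp (F.relProj α) rfl) _

theorem desc_ext {I J : P.Base} (α : LPath (Rel P.p) I J) {X : P.Base} (u : X ⟶ FibCat.base P.p α)
    {s : X ⟶ I} {t : X ⟶ J} (hs : u ≫ first P.p α = s) (ht : u ≫ last P.p α = t) {Z : Q.Base}
    {e : Q.p.Fiber Z} {z : Z ⟶ F.base.obj X} {s' : Z ⟶ F.base.obj I} {t' : Z ⟶ F.base.obj J}
    (hs' : z ≫ F.base.map s = s') (ht' : z ≫ F.base.map t = t')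
    (φ ψ : HomOver Q.p z e (F.fib (conj P.p α u)))
    (h : (F.mapPts (genAt α u hs ht)).pre φ hs' ht' =
      (F.mapPts (genAt α u hs ht)).pre ψ hs' ht') : φ = ψ := by
  induction α generalizing X with
  | nil I =>
    exact terminal_ext ((terminalIsTerminal (C := P.p.Fiber X)).isTerminalObj
      (fiberMap F.base F.total F.comm X) _) φ ψ
  | @cons I M J α q ih =>
    let κ := proj P.p (prod.lift (u ≫ bfst P.p α q) ((u ≫ bsnd P.p α q) ≫ first P.p q)) α
    have h₁ := Pts.cons.inj h
    refine pair_ext (F.prodIsLimit (pullback P.p (prod.lift (u ≫ bfst P.p α q)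
        ((u ≫ bsnd P.p α q) ≫ first P.p q)) α) (conj P.p q (u ≫ bsnd P.p α q))) ?_ ?_
    · have hz : z ≫ F.base.map (𝟙 X) = z :=
        (congrArg (z ≫ ·) (F.base.map_id X)).trans (Category.comp_id z)
      refine congrArg Subtype.val (cart_ext (F.homMap κ)
        (φ := φ.comp (F.homMap (HomOver.ofFiber prod.fst)) hz)
        (ψ := ψ.comp (F.homMap (HomOver.ofFiber prod.fst)) hz) ?_)
      have e₁ := congrArg (fun y => y ≫ (F.relProj α).1)
        (congrArg Subtype.val (eq_of_heq h₁.2.1))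
      have H : ∀ χ : HomOver Q.p z e (F.fib (conj P.p (.cons α q) u)),
          (χ.1 ≫ (F.homMap (HomOver.ofFiber (p := P.p) (prod.fst : pullback P.p (prod.lift (u ≫ bfst P.p α q)
        ((u ≫ bsnd P.p α q) ≫ first P.p q)) α ⨯ conj P.p q (u ≫ bsnd P.p α q) ⟶ _))).1) ≫ (F.homMap κ).1 =
          (χ.1 ≫ (F.mapPt (chead α q u hs)).1) ≫ (F.relProj α).1 := fun χ => by
        refine (Category.assoc _ _ _).trans (Eq.trans ?_ (Category.assoc _ _ _).symm)
        refine congrArg (χ.1 ≫ ·) (Eq.trans ?_ (F.mapPt_proj (chead α q u hs)).symm)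
        exact (F.total.map_comp _ _).symm
      exact (H φ).trans (Eq.trans e₁ (H ψ).symm)
    · have h₂ := eq_of_heq h₁.2.2
      have hz : z ≫ F.base.map (𝟙 X) = z :=
        (congrArg (z ≫ ·) (F.base.map_id X)).trans (Category.comp_id z)
      have H := fun χ : HomOver Q.p z e (F.fib (conj P.p (.cons α q) u)) =>
        (congrArg (fun S => Pts.pre χ S rfl ht') (F.mapPts_pre (ctail α q u)
        (genAt q (u ≫ bsnd P.p α q) rfl ((Category.assoc _ _ _).trans ht)) (Category.id_comp _)
        (Category.id_comp _))).trans (Pts.pre_pre (F.homMap (ctail α q u)) χ _ _ _ _ _ hz rfl ht')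
      have h₂ := (H φ).symm.trans (h₂.trans (H ψ))
      exact congrArg Subtype.val (ih _ _ _ _ _ _ _ h₂)

end

end CartFib.Mor

end

noncomputable section

namespace CartFib.Mor

open FibCat

section

variable {P Q : CartFib.{u, v, w, x}} (F : Mor P Q)

theorem desc_h {I J : P.Base} (α : LPath (Rel P.p) I J) :
    (gen (F.path α)).pt ≫ F.bmap α = F.bmap α ≫ F.base.map (𝟙 (FibCat.base P.p α)) := by
  rw [pt_gen, Category.id_comp, F.base.map_id, Category.comp_id]

/-- The comparison of the conjunctions of a path and of its image. -/
def desc {I J : P.Base} (α : LPath (Rel P.p) I J) :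
    HomOver Q.p (F.bmap α) (ctx Q.p (F.path α)) (F.fib (ctx P.p α)) :=
  (F.exists_desc α (𝟙 _) (Category.id_comp _) (Category.id_comp _) (F.bmap α) (gen (F.path α))
    (F.desc_h α) (F.bmap_first α) (F.bmap_last α)).choose

theorem pre_desc {I J : P.Base} (α : LPath (Rel P.p) I J) :
    (F.mapPts (gen α)).pre (F.desc α) (F.bmap_first α) (F.bmap_last α) = gen (F.path α) :=
  (F.exists_desc α (𝟙 _) (Category.id_comp _) (Category.id_comp _) (F.bmap α) (gen (F.path α))
    (F.desc_h α) (F.bmap_first α) (F.bmap_last α)).choose_spec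

theorem toCtx_desc {I J : P.Base} {α : LPath (Rel P.p) I J} {Z : P.Base} {e : P.p.Fiber Z}
    {s : Z ⟶ I} {t : Z ⟶ J} (R : Pts e α s t) :
    (toCtx (F.mapPts R)).comp (F.desc α) (F.pt_mapPts R) = F.homMap (toCtx R) := by
  refine F.desc_ext α (𝟙 _) (Category.id_comp _) (Category.id_comp _) (F.map_eq R.pt_first)
    (F.map_eq R.pt_last) _ _ ?_
  refine (Pts.pre_pre (F.desc α) (toCtx (F.mapPts R)) (F.mapPts (gen α)) (F.bmap_first α)
    (F.bmap_last α) (Pts.pt_first _) (Pts.pt_last _) (F.pt_mapPts R) _ _).symm.trans ?_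
  refine (congrArg (fun S => Pts.pre (toCtx (F.mapPts R)) S (Pts.pt_first _) (Pts.pt_last _))
    (F.pre_desc α)).trans ?_
  refine (pre_toCtx (F.mapPts R)).trans ?_
  exact (congrArg F.mapPts (pre_toCtx R)).symm.trans (F.mapPts_pre _ _ _ _)

theorem cellAux {I J K M : P.Base} {α : LPath (Rel P.p) I J} {s : I ⟶ K} {t : J ⟶ M} :
    F.bmap α ≫ prod.lift (F.base.map (first P.p α ≫ s)) (F.base.map (last P.p α ≫ t)) =
      prod.lift (first Q.p (F.path α) ≫ F.base.map s) (last Q.p (F.path α) ≫ F.base.map t) :=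
  Pts.lift_eq (by rw [F.base.map_comp, ← Category.assoc, F.bmap_first])
    (by rw [F.base.map_comp, ← Category.assoc, F.bmap_last])

/-- The action on cells. -/
def cell {I J K M : P.Base} {α : LPath (Rel P.p) I J} {s : I ⟶ K} {t : J ⟶ M} {β : Rel P.p K M}
    (ξ : (bilGraph P.p).Cell α s t β) :
    (bilGraph Q.p).Cell (F.path α) (F.base.map s) (F.base.map t) (F.rel β) :=
  mkCell ((F.desc α).comp (F.mapPt (act ξ (gen α) rfl rfl)) F.cellAux)

abbrev hom : VDGraphHom (bilGraph P.p) (bilGraph Q.p) where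
  tight := F.base
  loose α := F.rel α
  cell ξ := F.cell ξ

theorem act_cell {I J K M : P.Base} {α : LPath (Rel P.p) I J} {s : I ⟶ K} {t : J ⟶ M}
    {β : Rel P.p K M} (ξ : (bilGraph P.p).Cell α s t β) {Z : P.Base} {e : P.p.Fiber Z}
    {a : Z ⟶ I} {b : Z ⟶ J} (R : Pts e α a b) {a' : Z ⟶ K} {b' : Z ⟶ M} (ha : a ≫ s = a')
    (hb : b ≫ t = b') :
    act (F.cell ξ) (F.mapPts R) (F.map_eq ha) (F.map_eq hb) = F.mapPt (act ξ R ha hb) := by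
  refine HomOver.ext ((act_mkCell _ _ _ _).trans ?_)
  refine (Category.assoc _ _ _).symm.trans ?_
  refine (congrArg (· ≫ (F.mapPt (act ξ (gen α) rfl rfl)).1)
    (congrArg Subtype.val (F.toCtx_desc R))).trans ?_
  have e₁ : R.pt ≫ first P.p α ≫ s = a' := by rw [← Category.assoc, R.pt_first, ha]
  have e₂ : R.pt ≫ last P.p α ≫ t = b' := by rw [← Category.assoc, R.pt_last, hb]
  have H := act_pre ξ (toCtx R) (gen α) rfl rfl R.pt_first R.pt_last ha hb e₁ e₂
  rw [pre_toCtx] at H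
  rw [H]
  exact (congrArg Subtype.val (F.mapPt_comp (toCtx R) (act ξ (gen α) rfl rfl) (Pts.lift_eq e₁ e₂)
    (Pts.lift_eq (F.map_eq e₁) (F.map_eq e₂)))).symm

theorem actCells_cells : ∀ {I J K M : P.Base} {α : LPath (Rel P.p) I J} {s : I ⟶ K} {t : J ⟶ M}
    {β : LPath (Rel P.p) K M} (χ : (bilGraph P.p).Cells α s t β) {Z : P.Base} {e : P.p.Fiber Z}
    {a : Z ⟶ I} {b : Z ⟶ J} (R : Pts e α a b) {a' : Z ⟶ K} {b' : Z ⟶ M} (ha : a ≫ s = a')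
    (hb : b ≫ t = b'),
    actCells (F.hom.cells χ) (F.mapPts R) (F.map_eq ha) (F.map_eq hb) = F.mapPts (actCells χ R ha hb)
  | _, _, _, _, _, _, _, _, .nil _ _ _, _, _, _, _, _, _, _, _, _ => rfl
  | _, _, _, _, _, _, _, _, .cons (α₁ := α₁) ξ ξs h, _, _, _, _, R, _, _, ha, hb => by
    have e := Pts.append_split h R
    generalize R.split α₁ h = r at e
    subst e
    have h' := (LPath.map_append F.base.obj F.rel α₁ _).symm.trans (congrArg F.path h)
    refine (congrArg (fun S => actCells (F.hom.cells (.cons ξ ξs h)) S (F.map_eq ha) (F.map_eq hb))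
      (F.mapPts_append r.fst r.snd h h')).trans ?_
    refine (actCells_cons (F.cell ξ) (F.hom.cells ξs) h' (F.mapPts r.fst) (F.mapPts r.snd)
      (F.map_eq ha) (F.map_eq rfl) (F.map_eq hb)).trans ?_
    refine Eq.trans ?_ (congrArg F.mapPts (actCells_cons ξ ξs h r.fst r.snd ha rfl hb)).symm
    exact congrArg₂ Pts.cons (F.act_cell ξ r.fst ha rfl) (actCells_cells ξs r.snd rfl hb)

theorem arrow_mapPts {I J : P.Base} {α : Rel P.p I J} {Z : P.Base} {e : P.p.Fiber Z}
    {s : Z ⟶ I} {t : Z ⟶ J} (R : Pts e (.single α) s t) :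
    Pts.arrow (α := F.rel α) (F.mapPts R) = F.mapPt R.arrow := by
  obtain _ | ⟨a, ⟨_, _, h⟩⟩ := R
  subst h
  rfl

theorem act_val {p : Q.Total ⥤ Q.Base} [p.IsFibered] [∀ X, HasFiniteProducts (p.Fiber X)]
    [∀ {X Y : Q.Base} (f : X ⟶ Y), PreservesFiniteProducts (baseChange p f)]
    {I J K M : Q.Base} {α : LPath (Rel p) I J}
    {s : I ⟶ K} {t : J ⟶ M} {β : Rel p K M} (ξ : (bilGraph p).Cell α s t β) {Z : Q.Base}
    {e : p.Fiber Z} {a : Z ⟶ I} {b : Z ⟶ J} (R : Pts e α a b) {a' a'' : Z ⟶ K}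
    {b' b'' : Z ⟶ M} (ha : a ≫ s = a') (hb : b ≫ t = b') (ha' : a ≫ s = a'') (hb' : b ≫ t = b'') :
    (act ξ R ha hb).1 = (act ξ R ha' hb').1 := rfl

theorem cell_ext {I J : P.Base} {α : LPath (Rel P.p) I J} {K M : Q.Base} {s : F.base.obj I ⟶ K}
    {t : F.base.obj J ⟶ M} {β : Rel Q.p K M} {ξ ζ : (bilGraph Q.p).Cell (F.path α) s t β}
    (h : act ξ (F.mapPts (gen α)) rfl rfl = act ζ (F.mapPts (gen α)) rfl rfl) : ξ = ζ := by
  refine FibCat.cell_ext ?_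
  have H : ∀ ξ : (bilGraph Q.p).Cell (F.path α) s t β, act ξ (gen (F.path α)) rfl rfl =
      (F.desc α).comp (act ξ (F.mapPts (gen α)) rfl rfl) (Pts.lift_eq
        (by rw [← Category.assoc, F.bmap_first]) (by rw [← Category.assoc, F.bmap_last])) :=
    fun ξ => (congrArg (fun S => act ξ S rfl rfl) (F.pre_desc α)).symm.trans
      (act_pre ξ (F.desc α) (F.mapPts (gen α)) rfl rfl (F.bmap_first α) (F.bmap_last α) rfl rfl
        (by rw [← Category.assoc, F.bmap_first]) (by rw [← Category.assoc, F.bmap_last]))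
  rw [H, H, h]

/-- The functor of virtual double categories induced by a morphism of cartesian fibrations. -/
def bil : VDFunctor (FibCat.bil P.p) (FibCat.bil Q.p) where
  toVDGraphHom := F.hom
  cell_id {I J} α := by
    refine F.cell_ext (α := .single α) ?_
    have e₁ := Category.comp_id (first P.p (.single α))
    have e₂ := Category.comp_id (last P.p (.single α))
    have f₁ : F.base.map (first P.p (.single α)) ≫ 𝟙 (F.base.obj I) =
      F.base.map (first P.p (.single α)) ≫ F.base.map (𝟙 I) := by rw [F.base.map_id]
    have f₂ : F.base.map (last P.p (.single α)) ≫ 𝟙 (F.base.obj J) =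
      F.base.map (last P.p (.single α)) ≫ F.base.map (𝟙 J) := by rw [F.base.map_id]
    refine Eq.trans ?_ (act_cast (p := Q.p) ((bilStr Q.p).idCell (F.rel α))
      (F.base.map_id I).symm (F.base.map_id J).symm (F.mapPts (gen (.single α))) f₁ f₂ rfl rfl).symm
    refine Eq.trans ?_ (act_idCell (F.mapPts (gen (.single α))) f₁ f₂).symm
    refine HomOver.ext ?_
    refine Eq.trans ?_ (congrArg Subtype.val (F.arrow_mapPts (gen (.single α)))).symm
    refine (act_val (F.cell ((bilStr P.p).idCell α)) (F.mapPts (gen (.single α))) rfl rfl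
      (F.map_eq rfl) (F.map_eq rfl)).trans ?_
    rw [F.act_cell ((bilStr P.p).idCell α) (gen (.single α)) rfl rfl, act_idCell]
    exact F.mapPt_cast _ e₁.symm e₂.symm _
  cell_comp {_ _ _ _ _ _ α s s' β t t' γ u u'} χ ζ h h' := by
    refine F.cell_ext (HomOver.ext ?_)
    have e := (Category.assoc (first P.p α) _ _).trans (congrArg (first P.p α ≫ ·) h)
    have e' := (Category.assoc (last P.p α) _ _).trans (congrArg (last P.p α ≫ ·) h')
    refine (act_val (F.cell ((bilStr P.p).comp χ ζ h h')) (F.mapPts (gen α)) rfl rfl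
      (F.map_eq rfl) (F.map_eq rfl)).trans ?_
    rw [F.act_cell ((bilStr P.p).comp χ ζ h h') (gen α) rfl rfl,
      act_comp χ ζ h h' (gen α) rfl rfl e e' rfl rfl]
    refine Eq.trans ?_ (congrArg Subtype.val (act_comp (F.hom.cells χ) (F.cell ζ) (F.map_eq h)
      (F.map_eq h') (F.mapPts (gen α)) (F.map_eq rfl) (F.map_eq rfl) (F.map_eq e) (F.map_eq e')
      (F.map_eq rfl) (F.map_eq rfl))).symm
    refine Eq.trans ?_ (congrArg (fun S => (act (F.cell ζ) S (F.map_eq e) (F.map_eq e')).1)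
      (F.actCells_cells χ (gen α) rfl rfl)).symm
    exact (congrArg Subtype.val (F.act_cell ζ (actCells χ (gen α) rfl rfl) e e')).symm

end

end CartFib.Mor

end

noncomputable section

namespace CartFib.Trans

open FibCat

section

variable {P Q : CartFib.{u, v, w, x}} {F G : Mor P Q} (θ : Trans F G)

/-- The component of a transformation at an object of a fibre. -/
def hom {X : P.Base} (a : P.p.Fiber X) : HomOver Q.p (θ.base.app X) (F.fib a) (G.fib a) :=
  ⟨θ.total.app a.1, θ.lies_of_eq a.2⟩

theorem prod_nat (I J : P.Base) :
    F.pcInv I J ≫ θ.base.app (I ⨯ J) =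
      prod.map (θ.base.app I) (θ.base.app J) ≫ G.pcInv I J := by
  rw [Mor.pcInv, Mor.pcInv, IsIso.inv_comp_eq, ← Category.assoc, IsIso.eq_comp_inv]
  refine Limits.prod.hom_ext ?_ ?_
  · rw [Category.assoc, Category.assoc, prodComparison_fst, prod.map_fst, ← Category.assoc,
      prodComparison_fst, θ.base.naturality]
  · rw [Category.assoc, Category.assoc, prodComparison_snd, prod.map_snd, ← Category.assoc,
      prodComparison_snd, θ.base.naturality]

theorem pt_aux {Z : Q.Base} {I J : P.Base} {s : Z ⟶ F.base.obj I} {t : Z ⟶ F.base.obj J}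
    {s' : Z ⟶ G.base.obj I} {t' : Z ⟶ G.base.obj J} (hs : s ≫ θ.base.app I = s')
    (ht : t ≫ θ.base.app J = t') :
    prod.lift s' t' ≫ G.pcInv I J =
      (prod.lift s t ≫ F.pcInv I J) ≫ θ.base.app (I ⨯ J) := by
  rw [Category.assoc, θ.prod_nat, ← Category.assoc, prod.lift_map, hs, ht]

/-- The factorization, through the base change, of the component of a transformation. -/
def pt {Z : Q.Base} {e : Q.p.Fiber Z} {I J : P.Base} {α : Rel P.p I J} {s : Z ⟶ F.base.obj I}
    {t : Z ⟶ F.base.obj J} (a : HomOver Q.p (prod.lift s t) e (F.rel α)) {s' : Z ⟶ G.base.obj I}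
    {t' : Z ⟶ G.base.obj J} (hs : s ≫ θ.base.app I = s') (ht : t ≫ θ.base.app J = t') :
    HomOver Q.p (prod.lift s' t') e (G.rel α) :=
  cartLift (G.relProj α) ((a.comp (F.relProj α) rfl).comp (θ.hom α) rfl) (θ.pt_aux hs ht)

theorem pt_proj {Z : Q.Base} {e : Q.p.Fiber Z} {I J : P.Base} {α : Rel P.p I J}
    {s : Z ⟶ F.base.obj I}
    {t : Z ⟶ F.base.obj J} (a : HomOver Q.p (prod.lift s t) e (F.rel α)) {s' : Z ⟶ G.base.obj I}
    {t' : Z ⟶ G.base.obj J} (hs : s ≫ θ.base.app I = s') (ht : t ≫ θ.base.app J = t') :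
    (θ.pt a hs ht).1 ≫ (G.relProj α).1 = (a.1 ≫ (F.relProj α).1) ≫ θ.total.app α.1 :=
  cartLift_fac _ _ _

theorem pt_mapPt {Z I J : P.Base} {e : P.p.Fiber Z} {α : Rel P.p I J} {s : Z ⟶ I} {t : Z ⟶ J}
    (a : HomOver P.p (prod.lift s t) e α) :
    θ.pt (F.mapPt a) (θ.base.naturality s) (θ.base.naturality t) =
      (θ.hom e).comp (G.mapPt a) (Pts.lift_eq rfl rfl) := by
  refine cart_ext (G.relProj α) ((θ.pt_proj _ _ _).trans ?_)
  refine (congrArg (· ≫ _) (F.mapPt_proj a)).trans ((θ.total.naturality a.1).trans ?_)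
  exact (congrArg (θ.total.app e.1 ≫ ·) (G.mapPt_proj a).symm).trans (Category.assoc _ _ _).symm

/-- The component of the induced transformation at a loose arrow. -/
def cell {I J : P.Base} (α : Rel P.p I J) :
    (bilGraph Q.p).Cell (.single (F.rel α)) (θ.base.app I) (θ.base.app J) (G.rel α) :=
  mkCell (θ.pt (gen (.single (F.rel α))).arrow rfl rfl)

theorem act_cell {I J : P.Base} (α : Rel P.p I J) {Z : Q.Base} {e : Q.p.Fiber Z}
    {s : Z ⟶ F.base.obj I} {t : Z ⟶ F.base.obj J} (R : Pts e (.single (F.rel α)) s t)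
    {s' : Z ⟶ G.base.obj I} {t' : Z ⟶ G.base.obj J} (hs : s ≫ θ.base.app I = s')
    (ht : t ≫ θ.base.app J = t') : act (θ.cell α) R hs ht = θ.pt R.arrow hs ht := by
  refine cart_ext (G.relProj α) ?_
  refine Eq.trans ?_ (θ.pt_proj R.arrow hs ht).symm
  refine (congrArg (· ≫ (G.relProj α).1) (act_mkCell _ R hs ht)).trans ?_
  refine (Category.assoc _ _ _).trans ?_
  refine (congrArg (_ ≫ ·) (θ.pt_proj _ _ _)).trans ?_
  refine (Category.assoc _ _ _).symm.trans ?_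
  refine congrArg (· ≫ _) ((Category.assoc _ _ _).symm.trans ?_)
  refine congrArg (· ≫ _) ?_
  exact (arrow_pre (toCtx R) (gen (.single (F.rel α))) R.pt_first R.pt_last).symm.trans
    (congrArg (fun S => (Pts.arrow S).1) (pre_toCtx R))

theorem actCells_cells {Z : P.Base} {e : P.p.Fiber Z} {I J : P.Base} {α : LPath (Rel P.p) I J}
    {s : Z ⟶ I} {t : Z ⟶ J} (R : Pts e α s t) :
    actCells (VDGraph.transCells (D := bilGraph P.p) (E := bilGraph Q.p) F.hom.loose G.hom.loose
        θ.base.app θ.cell α) (F.mapPts R) (θ.base.naturality s) (θ.base.naturality t) =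
      (G.mapPts R).pre (θ.hom e) rfl rfl := by
  induction R with
  | nil => rfl
  | cons a as ih =>
    refine (actCells_cons (θ.cell _) _ rfl (.cons (F.mapPt a) (.nil _ _ rfl)) (F.mapPts as)
      (θ.base.naturality _) (θ.base.naturality _) (θ.base.naturality _)).trans ?_
    refine Eq.trans ?_ (Pts.pre_cons (θ.hom e) (G.mapPt a) (G.mapPts as) rfl rfl rfl).symm
    refine congrArg₂ Pts.cons ?_ ih
    exact (θ.act_cell _ _ _ _).trans (θ.pt_mapPt a)

/-- The transformation induced by a transformation of morphisms of cartesian fibrations. -/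
def bil : VDTrans F.bil G.bil where
  tight := θ.base
  cell α := θ.cell α
  naturality {I J K M α s s' β} ξ := by
    refine F.cell_ext (HomOver.ext ?_)
    have e₁ : ∀ {X Y Z : P.Base} (f : X ⟶ Y) (g : Y ⟶ Z),
        (θ.base.app X ≫ G.base.map f) ≫ G.base.map g = θ.base.app X ≫ G.base.map (f ≫ g) :=
      fun f g => by rw [Category.assoc, G.base.map_comp]
    have e₂ : ∀ {X Y Z : P.Base} (f : X ⟶ Y) (g : Y ⟶ Z),
        F.base.map f ≫ F.base.map g ≫ θ.base.app Z = θ.base.app X ≫ G.base.map (f ≫ g) :=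
      fun f g => by rw [← Category.assoc, ← F.base.map_comp, θ.base.naturality]
    refine (congrArg Subtype.val (act_comp (VDGraph.transCells (D := bilGraph P.p)
      (E := bilGraph Q.p) F.hom.loose G.hom.loose θ.base.app θ.cell α) (G.cell ξ)
      (θ.base.naturality s).symm (θ.base.naturality s').symm (F.mapPts (gen α))
      (θ.base.naturality _) (θ.base.naturality _) (e₁ _ s) (e₁ _ s') (e₂ _ s) (e₂ _ s'))).trans ?_
    refine (congrArg (fun S => (act (G.cell ξ) S (e₁ _ s) (e₁ _ s')).1)
      (θ.actCells_cells (gen α))).trans ?_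
    refine (congrArg Subtype.val (act_pre (G.cell ξ) (θ.hom _) (G.mapPts (gen α)) (G.map_eq rfl)
      (G.map_eq rfl) rfl rfl (e₁ _ s) (e₁ _ s') rfl rfl)).trans ?_
    refine (congrArg (fun y => (θ.hom (ctx P.p α)).1 ≫ y) (congrArg Subtype.val
      (G.act_cell ξ (gen α) rfl rfl))).trans ?_
    refine Eq.trans ?_ (congrArg Subtype.val (act_comp (VDGraph.Cells.single (F.cell ξ)) (θ.cell β)
      rfl rfl (F.mapPts (gen α)) (F.map_eq rfl) (F.map_eq rfl) (θ.base.naturality _)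
      (θ.base.naturality _) (e₂ _ s) (e₂ _ s'))).symm
    refine Eq.trans ?_ (congrArg (fun S => (act (θ.cell β) S (θ.base.naturality _)
      (θ.base.naturality _)).1) (actCells_single (F.cell ξ) (F.mapPts (gen α)) (F.map_eq rfl)
        (F.map_eq rfl))).symm
    refine Eq.trans ?_ (congrArg Subtype.val (θ.act_cell β _ _ _)).symm
    refine Eq.trans ?_ (congrArg (fun y => (θ.pt y (θ.base.naturality _)
      (θ.base.naturality _)).1) (F.act_cell ξ (gen α) rfl rfl)).symm
    exact (congrArg Subtype.val (θ.pt_mapPt (act ξ (gen α) rfl rfl))).symm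

end

end CartFib.Trans

namespace CartFib

/-- The assignment of the virtual double category of binary predicates, on objects, 1-cells and
2-cells. -/
def bilStruct : PrelaxFunctorStruct CartFib.{u, v, w, x} VDC.{u, v, w, x} where
  obj P := FibCat.bil P.p
  map F := Mor.bil F
  map₂ θ := Trans.bil θ

end CartFib

end

noncomputable section

namespace FibCat

section

variable {B : Type u} [Category.{v} B] {E : Type w} [Category.{x} E] (p : E ⥤ B) [p.IsFibered]

/-- The Frobenius reciprocity `Σ_f (a ∧ b[f]) ≅ Σ_f a ∧ b` for the left adjoint of base change. -/
def Frobenius [∀ X : B, HasFiniteProducts (p.Fiber X)] {X Y : B} (f : X ⟶ Y) : Prop :=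
  ∀ (L : p.Fiber X ⥤ p.Fiber Y) (adj : L ⊣ baseChange p f) (a : p.Fiber X) (b : p.Fiber Y),
    IsIso (prod.lift (L.map (prod.fst : a ⨯ (baseChange p f).obj b ⟶ a))
      (L.map (prod.snd : a ⨯ (baseChange p f).obj b ⟶ _) ≫ adj.counit.app b) :
        L.obj (a ⨯ (baseChange p f).obj b) ⟶ L.obj a ⨯ b)

/-- The Beck-Chevalley condition for a commutative square: the canonical arrow
`Σ_f' (a[h]) ⟶ (Σ_f a)[k]`, which corresponds to the composite `a[h] ⟶ a ⟶ Σ_f a` over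
`h ≫ f = f' ≫ k`, is invertible. -/
def BeckChevalley {X Y X' Y' : B} {f' : X' ⟶ Y'} {h : X' ⟶ X} {k : Y' ⟶ Y} {f : X ⟶ Y}
    (sq : CommSq f' h k f) : Prop :=
  ∀ (L : p.Fiber X ⥤ p.Fiber Y) (adj : L ⊣ baseChange p f)
    (L' : p.Fiber X' ⥤ p.Fiber Y') (adj' : L' ⊣ baseChange p f') (a : p.Fiber X),
    IsIso ((adj'.homEquiv ((baseChange p h).obj a) ((baseChange p k).obj (L.obj a))).symm
      (toVert (cartLift (proj p k (L.obj a))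
        ((proj p h a).comp (ofVert (adj.unit.app a)) rfl) sq.w)))

end

section

variable {B : Type u} [Category.{v} B]

/-- The arrow `I × K ⟶ I × I × K` which duplicates the first variable. -/
abbrev delta [HasFiniteProducts B] (I K : B) : I ⨯ K ⟶ I ⨯ (I ⨯ K) :=
  prod.lift prod.fst (𝟙 (I ⨯ K))

theorem delta_sq [HasFiniteProducts B] (I : B) {K K' : B} (u : K' ⟶ K) :
    CommSq (delta I K') (prod.map (𝟙 I) u) (prod.map (𝟙 I) (prod.map (𝟙 I) u)) (delta I K) :=
  ⟨by
    rw [prod.lift_map, prod.comp_lift, prod.map_fst, Category.comp_id, Category.comp_id,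
      Category.id_comp]⟩

theorem snd_sq [HasFiniteProducts B] (I : B) {K K' : B} (u : K' ⟶ K) :
    CommSq (prod.snd : I ⨯ K' ⟶ K') (prod.map (𝟙 I) u) u (prod.snd : I ⨯ K ⟶ K) :=
  ⟨(prod.map_snd _ _).symm⟩

/-- Product projections. -/
def IsProjection {X Y : B} (f : X ⟶ Y) : Prop :=
  ∃ (I : B) (a : X ⟶ I), Nonempty (IsLimit (BinaryFan.mk a f))

/-- Arrows of the form `I × K ⟶ I × I × K`, for any choice of the products. -/
def IsDelta {X Y : B} (f : X ⟶ Y) : Prop :=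
  ∃ (I K : B) (a : X ⟶ I) (k : X ⟶ K) (b : Y ⟶ I) (c : Y ⟶ X),
    Nonempty (IsLimit (BinaryFan.mk a k)) ∧ Nonempty (IsLimit (BinaryFan.mk b c)) ∧
      f ≫ b = a ∧ f ≫ c = 𝟙 X

theorem IsProjection.map {C : Type u} [Category.{v} C] (F : B ⥤ C) [PreservesFiniteProducts F]
    {X Y : B} {f : X ⟶ Y} (h : IsProjection f) : IsProjection (F.map f) := by
  obtain ⟨I, a, ⟨h⟩⟩ := h
  exact ⟨F.obj I, F.map a, ⟨mapIsLimitOfPreservesOfIsLimit F a f h⟩⟩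

theorem IsDelta.map {C : Type u} [Category.{v} C] (F : B ⥤ C) [PreservesFiniteProducts F]
    {X Y : B} {f : X ⟶ Y} (h : IsDelta f) : IsDelta (F.map f) := by
  obtain ⟨I, K, a, k, b, c, ⟨h₁⟩, ⟨h₂⟩, h₃, h₄⟩ := h
  exact ⟨F.obj I, F.obj K, F.map a, F.map k, F.map b, F.map c,
    ⟨mapIsLimitOfPreservesOfIsLimit F a k h₁⟩, ⟨mapIsLimitOfPreservesOfIsLimit F b c h₂⟩,
    by rw [← F.map_comp, h₃], by rw [← F.map_comp, h₄, F.map_id]⟩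

end

end FibCat

namespace CartFib

open FibCat

/-- An elementary fibration: base change along the arrows `I × K ⟶ I × I × K` has left adjoints,
subject to Frobenius reciprocity and to the Beck-Chevalley condition (in `K`). -/
structure IsElementary (P : CartFib.{u, v, w, x}) : Prop where
  adjoint : ∀ I K : P.Base, (baseChange P.p (delta I K)).IsRightAdjoint
  frobenius : ∀ I K : P.Base, Frobenius P.p (delta I K)
  beckChevalley : ∀ (I : P.Base) {K K' : P.Base} (u : K' ⟶ K), BeckChevalley P.p (delta_sq I u)

/-- An existential fibration: base change along the projections `I × K ⟶ K` has left adjoints,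
subject to Frobenius reciprocity and to the Beck-Chevalley condition (in `K`). -/
structure IsExistential (P : CartFib.{u, v, w, x}) : Prop where
  adjoint : ∀ I K : P.Base, (baseChange P.p (prod.snd : I ⨯ K ⟶ K)).IsRightAdjoint
  frobenius : ∀ I K : P.Base, Frobenius P.p (prod.snd : I ⨯ K ⟶ K)
  beckChevalley : ∀ (I : P.Base) {K K' : P.Base} (u : K' ⟶ K), BeckChevalley P.p (snd_sq I u)

namespace Mor

/-- The morphism preserves the left adjoints of base change along the duplications
`I × K ⟶ I × I × K`, i.e. the cocartesian arrows over them. -/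
def IsElementary {P Q : CartFib.{u, v, w, x}} (F : Mor P Q) : Prop :=
  ∀ {X Y : P.Base} (f : X ⟶ Y), IsDelta f → ∀ {a b : P.Total} (φ : a ⟶ b),
    P.p.IsCocartesian f φ → Q.p.IsCocartesian (F.base.map f) (F.total.map φ)

/-- The morphism preserves the left adjoints of base change along product projections, i.e. the
cocartesian arrows over them. -/
def IsExistential {P Q : CartFib.{u, v, w, x}} (F : Mor P Q) : Prop :=
  ∀ {X Y : P.Base} (f : X ⟶ Y), IsProjection f → ∀ {a b : P.Total} (φ : a ⟶ b),
    P.p.IsCocartesian f φ → Q.p.IsCocartesian (F.base.map f) (F.total.map φ)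

theorem isElementary_id (P : CartFib.{u, v, w, x}) : (Mor.id P).IsElementary :=
  fun _ _ _ _ _ h => h

theorem isExistential_id (P : CartFib.{u, v, w, x}) : (Mor.id P).IsExistential :=
  fun _ _ _ _ _ h => h

theorem isElementary_comp {P Q R : CartFib.{u, v, w, x}} {F : Mor P Q} {G : Mor Q R}
    (hF : F.IsElementary) (hG : G.IsElementary) : (F.comp G).IsElementary :=
  fun f hf _ _ φ h => hG (F.base.map f) (hf.map F.base) (F.total.map φ) (hF f hf φ h)

theorem isExistential_comp {P Q R : CartFib.{u, v, w, x}} {F : Mor P Q} {G : Mor Q R}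
    (hF : F.IsExistential) (hG : G.IsExistential) : (F.comp G).IsExistential :=
  fun f hf _ _ φ h => hG (F.base.map f) (hf.map F.base) (F.total.map φ) (hF f hf φ h)

end Mor

/-- Elementary fibrations, with the morphisms that preserve the relevant left adjoints. -/
def elementary : SubBicat CartFib.{u, v, w, x} where
  IsObj P := P.IsElementary
  IsHom F := Mor.IsElementary F
  id P := Mor.isElementary_id P
  comp hF hG := Mor.isElementary_comp hF hG

/-- Existential fibrations, with the morphisms that preserve the relevant left adjoints. -/
def existential : SubBicat CartFib.{u, v, w, x} where
  IsObj P := P.IsExistential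
  IsHom F := Mor.IsExistential F
  id P := Mor.isExistential_id P
  comp hF hG := Mor.isExistential_comp hF hG

/-- Elementary existential fibrations, with the morphisms that preserve the relevant left
adjoints. -/
def elementaryExistential : SubBicat CartFib.{u, v, w, x} where
  IsObj P := P.IsElementary ∧ P.IsExistential
  IsHom F := Mor.IsElementary F ∧ Mor.IsExistential F
  id P := ⟨Mor.isElementary_id P, Mor.isExistential_id P⟩
  comp hF hG := ⟨Mor.isElementary_comp hF.1 hG.1, Mor.isExistential_comp hF.2 hG.2⟩

end CartFib

end

noncomputable section

namespace FibCat

open CategoryTheory.Functor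

variable {B : Type u} [Category.{v} B] {E : Type w} [Category.{x} E] {p : E ⥤ B}

namespace HomOver

variable {X Y Z W : B} {f : X ⟶ Y} {g : Y ⟶ Z} {a : p.Fiber X} {b : p.Fiber Y}
  {c : p.Fiber Z}

theorem over_unique {f f' : X ⟶ Y} (φ : HomOver p f a b) (ψ : HomOver p f' a b)
    (h : φ.1 = ψ.1) : f = f' := by
  obtain ⟨φ, hφ⟩ := φ
  obtain ⟨ψ, hψ⟩ := ψ
  dsimp only at h
  subst h
  rw [IsHomLift.fac p f φ, IsHomLift.fac p f' φ]

/-- The identity, as an arrow over the identity. -/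
def id (a : p.Fiber X) : HomOver p (𝟙 X) a a := ofFiber (𝟙 a)

@[simp] theorem id_val (a : p.Fiber X) : (id a).1 = 𝟙 a.1 := rfl

/-- Two arrows of the total category, over arrows of the base, which are inverse to each other. -/
structure IsInv {f' : Y ⟶ X} (i : HomOver p f a b) (j : HomOver p f' b a) : Prop where
  hom_inv : i.1 ≫ j.1 = 𝟙 a.1
  inv_hom : j.1 ≫ i.1 = 𝟙 b.1

namespace IsInv

variable {f' : Y ⟶ X} {i : HomOver p f a b} {j : HomOver p f' b a}

theorem symm (h : IsInv i j) : IsInv j i := ⟨h.2, h.1⟩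

theorem base_hom_inv (h : IsInv i j) : f ≫ f' = 𝟙 X :=
  over_unique (i.comp j rfl) (HomOver.id a) h.1

theorem base_inv_hom (h : IsInv i j) : f' ≫ f = 𝟙 Y :=
  over_unique (j.comp i rfl) (HomOver.id b) h.2

theorem hom_inv_assoc (h : IsInv i j) {e : E} (k : a.1 ⟶ e) : i.1 ≫ j.1 ≫ k = k := by
  rw [← Category.assoc, h.1, Category.id_comp]

theorem inv_hom_assoc (h : IsInv i j) {e : E} (k : b.1 ⟶ e) : j.1 ≫ i.1 ≫ k = k := by
  rw [← Category.assoc, h.2, Category.id_comp]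

end IsInv

end HomOver

/-- The strong form of the universal property of cocartesian arrows. -/
def Cocart {X Y : B} {f : X ⟶ Y} {a : p.Fiber X} {b : p.Fiber Y} (φ : HomOver p f a b) : Prop :=
  ∀ ⦃T : B⦄ (g : Y ⟶ T) (c : p.Fiber T) (ψ : HomOver p (f ≫ g) a c),
    ∃! χ : HomOver p g b c, φ.1 ≫ χ.1 = ψ.1

namespace Cocart

variable {X Y T : B} {f : X ⟶ Y} {g : Y ⟶ T} {a : p.Fiber X} {b : p.Fiber Y} {c : p.Fiber T}
  {φ : HomOver p f a b}

theorem exists_fac (h : Cocart φ) {k : X ⟶ T} (ψ : HomOver p k a c) (e : f ≫ g = k) :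
    ∃ χ : HomOver p g b c, φ.1 ≫ χ.1 = ψ.1 := by
  subst e
  exact (h g c ψ).exists

theorem hom_ext (h : Cocart φ) {χ χ' : HomOver p g b c} (e : φ.1 ≫ χ.1 = φ.1 ≫ χ'.1) : χ = χ' :=
  (h g c (φ.comp χ' rfl)).unique e rfl

theorem of_inv {X' Y' : B} {f' : X' ⟶ Y'} {i₀ : X' ⟶ X} {j₀ : X ⟶ X'} {k₀ : Y ⟶ Y'} {l₀ : Y' ⟶ Y}
    {a' : p.Fiber X'} {b' : p.Fiber Y'} (h : Cocart φ) {i : HomOver p i₀ a' a}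
    {j : HomOver p j₀ a a'} (hi : HomOver.IsInv i j) {k : HomOver p k₀ b b'}
    {l : HomOver p l₀ b' b} (hk : HomOver.IsInv k l) {φ' : HomOver p f' a' b'}
    (e : φ'.1 = i.1 ≫ φ.1 ≫ k.1) : Cocart φ' := by
  have e₀ : f' = i₀ ≫ f ≫ k₀ := HomOver.over_unique φ' (i.comp (φ.comp k rfl) rfl) e
  intro T g c ψ
  obtain ⟨χ, hχ⟩ := h.exists_fac (g := k₀ ≫ g) (j.comp ψ rfl) (by
    rw [e₀]; simp only [Category.assoc]
    rw [← Category.assoc j₀, hi.base_inv_hom, Category.id_comp])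
  refine ⟨l.comp χ (by rw [← Category.assoc, hk.base_inv_hom, Category.id_comp]), ?_, ?_⟩
  · simp only [HomOver.comp_val] at hχ ⊢
    rw [e, Category.assoc, Category.assoc, hk.hom_inv_assoc, hχ, hi.hom_inv_assoc]
  · intro χ' hχ'
    refine HomOver.ext ?_
    have : k.comp χ' rfl = χ := h.hom_ext (by
      rw [hχ, HomOver.comp_val, HomOver.comp_val, ← hχ', e, Category.assoc, Category.assoc,
        hi.inv_hom_assoc])
    rw [HomOver.comp_val, ← this, HomOver.comp_val, hk.inv_hom_assoc]

theorem isCocartesian (h : Cocart φ) : p.IsCocartesian f φ.1 where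
  toIsHomLift := φ.2
  universal_property {b'} φ' hφ' := by
    have hb : p.obj b' = Y := IsHomLift.codomain_eq p f φ'
    obtain ⟨χ, h₁, h₂⟩ := h (𝟙 Y) ⟨b', hb⟩ ⟨φ', by rw [Category.comp_id]; exact hφ'⟩
    exact ⟨χ.1, ⟨χ.2, h₁⟩, fun χ' hχ' => congrArg Subtype.val (h₂ ⟨χ', hχ'.1⟩ hχ'.2)⟩

theorem exists_iso (h : Cocart φ) {b' : p.Fiber Y} {φ' : HomOver p f a b'} (h' : Cocart φ') :
    ∃ (i : HomOver p (𝟙 Y) b b') (j : HomOver p (𝟙 Y) b' b), HomOver.IsInv i j ∧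
      φ.1 ≫ i.1 = φ'.1 := by
  obtain ⟨i, hi⟩ := h.exists_fac (g := 𝟙 Y) φ' (Category.comp_id _)
  obtain ⟨j, hj⟩ := h'.exists_fac (g := 𝟙 Y) φ (Category.comp_id _)
  refine ⟨i, j, ⟨?_, ?_⟩, hi⟩
  · refine congrArg Subtype.val
      (h.hom_ext (χ := i.comp j (Category.comp_id _)) (χ' := HomOver.id b) ?_)
    simp only [HomOver.comp_val, HomOver.id_val, Category.comp_id]
    rw [← Category.assoc, hi, hj]
  · refine congrArg Subtype.val
      (h'.hom_ext (χ := j.comp i (Category.comp_id _)) (χ' := HomOver.id b') ?_)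
    simp only [HomOver.comp_val, HomOver.id_val, Category.comp_id]
    rw [← Category.assoc, hj, hi]

end Cocart

section

variable [p.IsFibered]

theorem cocart_of_isCocartesian {X Y : B} {f : X ⟶ Y} {a : p.Fiber X} {b : p.Fiber Y}
    (φ : HomOver p f a b) (h : p.IsCocartesian f φ.1) : Cocart φ := by
  intro T g c ψ
  let ψ₀ := cartLift (proj p g c) ψ rfl
  have hψ₀ : ψ₀.1 ≫ (proj p g c).1 = ψ.1 := cartLift_fac _ _ _
  have := ψ₀.2
  obtain ⟨χ, ⟨hχ, hχ'⟩, hu⟩ := h.universal_property ψ₀.1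
  obtain ⟨χ₁, rfl⟩ : ∃ χ₁ : HomOver p (𝟙 Y) b (pullback p g c), χ₁.1 = χ := ⟨⟨χ, hχ⟩, rfl⟩
  refine ⟨χ₁.comp (proj p g c) (Category.id_comp g), ?_, ?_⟩
  · exact (Category.assoc _ _ _).symm.trans ((congrArg (· ≫ (proj p g c).1) hχ').trans hψ₀)
  · intro χ' hχ''
    let χ₀ := cartLift (proj p g c) χ' (Category.id_comp g)
    have e₀ : χ₀.1 ≫ (proj p g c).1 = χ'.1 := cartLift_fac _ _ _
    have : χ₀.1 = χ₁.1 := hu χ₀.1 ⟨χ₀.2, congrArg Subtype.val (cart_ext (proj p g c)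
      (φ := φ.comp χ₀ (Category.comp_id f)) (ψ := ψ₀) (by
        rw [HomOver.comp_val, Category.assoc, e₀, hψ₀, hχ'']))⟩
    refine HomOver.ext ?_
    rw [HomOver.comp_val, ← e₀, this]

theorem exists_inv_of_cartesian {X Y : B} {f : X ⟶ Y} {g : Y ⟶ X} {a : p.Fiber X} {b : p.Fiber Y}
    (φ : HomOver p f a b) [p.IsCartesian f φ.1] (h : f ≫ g = 𝟙 X) (h' : g ≫ f = 𝟙 Y) :
    ∃ ψ : HomOver p g b a, HomOver.IsInv φ ψ := by
  refine ⟨cartLift φ (HomOver.id b) h', ?_, cartLift_fac _ _ _⟩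
  refine congrArg Subtype.val (cart_ext φ (φ := φ.comp (cartLift φ (HomOver.id b) h') h)
    (ψ := HomOver.id a) ?_)
  rw [HomOver.comp_val, Category.assoc, cartLift_fac, HomOver.id_val, HomOver.id_val,
    Category.id_comp, Category.comp_id]

end

section Meet

variable [p.IsFibered] [∀ X : B, HasFiniteProducts (p.Fiber X)]

/-- The conjunction `a[x] ∧ b[y]`. -/
def meet {W X Y : B} (x : W ⟶ X) (a : p.Fiber X) (y : W ⟶ Y) (b : p.Fiber Y) : p.Fiber W :=
  pullback p x a ⨯ pullback p y b

variable {W X Y : B} {x : W ⟶ X} {a : p.Fiber X} {y : W ⟶ Y} {b : p.Fiber Y}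

variable (x a y b) in
def meetFst : HomOver p x (meet x a y b) a :=
  (HomOver.ofFiber (p := p) (prod.fst : pullback p x a ⨯ pullback p y b ⟶ _)).comp (proj p x a)
    (Category.id_comp x)

variable (x a y b) in
def meetSnd : HomOver p y (meet x a y b) b :=
  (HomOver.ofFiber (p := p) (prod.snd : pullback p x a ⨯ pullback p y b ⟶ _)).comp (proj p y b)
    (Category.id_comp y)

variable [∀ {X Y : B} (f : X ⟶ Y), PreservesFiniteProducts (baseChange p f)]

theorem exists_meetLift {Z : B} {e : p.Fiber Z} {z : Z ⟶ W} {z₁ : Z ⟶ X} {z₂ : Z ⟶ Y}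
    (A : HomOver p z₁ e a) (C : HomOver p z₂ e b) (h₁ : z ≫ x = z₁) (h₂ : z ≫ y = z₂) :
    ∃ D : HomOver p z e (meet x a y b), D.1 ≫ (meetFst x a y b).1 = A.1 ∧
      D.1 ≫ (meetSnd x a y b).1 = C.1 := by
  obtain ⟨D, h, h'⟩ := exists_pair ⟨prodIsProd (pullback p x a) (pullback p y b)⟩
    (cartLift (proj p x a) A h₁) (cartLift (proj p y b) C h₂)
  refine ⟨D, ?_, ?_⟩
  · refine (Category.assoc _ _ _).symm.trans ((congrArg (· ≫ _) h).trans (cartLift_fac _ _ _))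
  · refine (Category.assoc _ _ _).symm.trans ((congrArg (· ≫ _) h').trans (cartLift_fac _ _ _))

/-- The arrow to a conjunction with the given components. -/
def meetLift {Z : B} {e : p.Fiber Z} {z : Z ⟶ W} {z₁ : Z ⟶ X} {z₂ : Z ⟶ Y}
    (A : HomOver p z₁ e a) (C : HomOver p z₂ e b) (h₁ : z ≫ x = z₁) (h₂ : z ≫ y = z₂) :
    HomOver p z e (meet x a y b) := (exists_meetLift A C h₁ h₂).choose

@[simp] theorem meetLift_fst {Z : B} {e : p.Fiber Z} {z : Z ⟶ W} {z₁ : Z ⟶ X} {z₂ : Z ⟶ Y}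
    (A : HomOver p z₁ e a) (C : HomOver p z₂ e b) (h₁ : z ≫ x = z₁) (h₂ : z ≫ y = z₂) :
    (meetLift A C h₁ h₂).1 ≫ (meetFst x a y b).1 = A.1 := (exists_meetLift A C h₁ h₂).choose_spec.1

@[simp] theorem meetLift_snd {Z : B} {e : p.Fiber Z} {z : Z ⟶ W} {z₁ : Z ⟶ X} {z₂ : Z ⟶ Y}
    (A : HomOver p z₁ e a) (C : HomOver p z₂ e b) (h₁ : z ≫ x = z₁) (h₂ : z ≫ y = z₂) :
    (meetLift A C h₁ h₂).1 ≫ (meetSnd x a y b).1 = C.1 := (exists_meetLift A C h₁ h₂).choose_spec.2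

@[simp] theorem meetLift_fst_assoc {Z : B} {e : p.Fiber Z} {z : Z ⟶ W} {z₁ : Z ⟶ X} {z₂ : Z ⟶ Y}
    (A : HomOver p z₁ e a) (C : HomOver p z₂ e b) (h₁ : z ≫ x = z₁) (h₂ : z ≫ y = z₂) {t : E}
    (k : a.1 ⟶ t) : (meetLift A C h₁ h₂).1 ≫ (meetFst x a y b).1 ≫ k = A.1 ≫ k := by
  rw [← Category.assoc, meetLift_fst]

@[simp] theorem meetLift_snd_assoc {Z : B} {e : p.Fiber Z} {z : Z ⟶ W} {z₁ : Z ⟶ X} {z₂ : Z ⟶ Y}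
    (A : HomOver p z₁ e a) (C : HomOver p z₂ e b) (h₁ : z ≫ x = z₁) (h₂ : z ≫ y = z₂) {t : E}
    (k : b.1 ⟶ t) : (meetLift A C h₁ h₂).1 ≫ (meetSnd x a y b).1 ≫ k = C.1 ≫ k := by
  rw [← Category.assoc, meetLift_snd]

theorem meet_ext {Z : B} {e : p.Fiber Z} {z : Z ⟶ W} {D D' : HomOver p z e (meet x a y b)}
    (h₁ : D.1 ≫ (meetFst x a y b).1 = D'.1 ≫ (meetFst x a y b).1)
    (h₂ : D.1 ≫ (meetSnd x a y b).1 = D'.1 ≫ (meetSnd x a y b).1) : D = D' := by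
  have k₁ : D.comp (HomOver.ofFiber (p := p) (prod.fst : pullback p x a ⨯ pullback p y b ⟶ _))
      (Category.comp_id z) = D'.comp (HomOver.ofFiber (p := p) prod.fst) (Category.comp_id z) :=
    cart_ext (proj p x a) ((Category.assoc _ _ _).trans (h₁.trans (Category.assoc _ _ _).symm))
  have k₂ : D.comp (HomOver.ofFiber (p := p) (prod.snd : pullback p x a ⨯ pullback p y b ⟶ _))
      (Category.comp_id z) = D'.comp (HomOver.ofFiber (p := p) prod.snd) (Category.comp_id z) :=
    cart_ext (proj p y b) ((Category.assoc _ _ _).trans (h₂.trans (Category.assoc _ _ _).symm))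
  exact pair_ext ⟨prodIsProd (pullback p x a) (pullback p y b)⟩ (congrArg Subtype.val k₁)
    (congrArg Subtype.val k₂)

theorem meet_ext' {Z : B} {e : p.Fiber Z} {z z' : Z ⟶ W} {D : HomOver p z e (meet x a y b)}
    {D' : HomOver p z' e (meet x a y b)} (hz : z = z')
    (h₁ : D.1 ≫ (meetFst x a y b).1 = D'.1 ≫ (meetFst x a y b).1)
    (h₂ : D.1 ≫ (meetSnd x a y b).1 = D'.1 ≫ (meetSnd x a y b).1) : D.1 = D'.1 := by
  subst hz
  exact congrArg Subtype.val (meet_ext h₁ h₂)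

/-- The arrow `a[h] ∧ d[f'] ⟶ b[k] ∧ d` over `f'` which is induced by an arrow `a ⟶ b` over `f`,
for a commutative square. -/
def canon {X Y X' Y' : B} {f' : X' ⟶ Y'} {h : X' ⟶ X} {k : Y' ⟶ Y} {f : X ⟶ Y}
    (sq : CommSq f' h k f) {a : p.Fiber X} {b : p.Fiber Y} (φ : HomOver p f a b)
    (d : p.Fiber Y') : HomOver p f' (meet h a f' d) (meet k b (𝟙 Y') d) :=
  meetLift ((meetFst h a f' d).comp φ rfl) (meetSnd h a f' d) sq.w (Category.comp_id f')

theorem exists_meet_inv {W' X' Y' : B} {x' : W' ⟶ X'} {a' : p.Fiber X'} {y' : W' ⟶ Y'}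
    {b' : p.Fiber Y'} {i₀ : X ⟶ X'} {i₀' : X' ⟶ X} {i : HomOver p i₀ a a'}
    {i' : HomOver p i₀' a' a} (hi : HomOver.IsInv i i') {j₀ : Y ⟶ Y'} {j₀' : Y' ⟶ Y}
    {j : HomOver p j₀ b b'} {j' : HomOver p j₀' b' b} (hj : HomOver.IsInv j j') {s : W ⟶ W'}
    {s' : W' ⟶ W} (hs : s ≫ s' = 𝟙 W) (hs' : s' ≫ s = 𝟙 W') (h₁ : s ≫ x' = x ≫ i₀)
    (h₂ : s ≫ y' = y ≫ j₀) :
    ∃ (k : HomOver p s (meet x a y b) (meet x' a' y' b'))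
      (l : HomOver p s' (meet x' a' y' b') (meet x a y b)), HomOver.IsInv k l ∧
      k.1 ≫ (meetFst x' a' y' b').1 = (meetFst x a y b).1 ≫ i.1 ∧
      k.1 ≫ (meetSnd x' a' y' b').1 = (meetSnd x a y b).1 ≫ j.1 := by
  have h₃ : s' ≫ x = x' ≫ i₀' := by
    rw [← Category.comp_id x, ← hi.base_hom_inv, ← Category.assoc x, ← h₁, Category.assoc,
      ← Category.assoc, hs', Category.id_comp]
  have h₄ : s' ≫ y = y' ≫ j₀' := by
    rw [← Category.comp_id y, ← hj.base_hom_inv, ← Category.assoc y, ← h₂, Category.assoc,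
      ← Category.assoc, hs', Category.id_comp]
  refine ⟨meetLift ((meetFst x a y b).comp i rfl) ((meetSnd x a y b).comp j rfl) h₁ h₂,
    meetLift ((meetFst x' a' y' b').comp i' rfl) ((meetSnd x' a' y' b').comp j' rfl) h₃ h₄,
    ⟨?_, ?_⟩, meetLift_fst _ _ _ _, meetLift_snd _ _ _ _⟩
  · refine meet_ext' (D := HomOver.comp _ _ rfl) (D' := HomOver.id _) hs ?_ ?_ <;>
    simp only [HomOver.comp_val, HomOver.id_val, Category.assoc, meetLift_fst, meetLift_snd,
      meetLift_fst_assoc, meetLift_snd_assoc, hi.1, hj.1, Category.id_comp, Category.comp_id]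
  · refine meet_ext' (D := HomOver.comp _ _ rfl) (D' := HomOver.id _) hs' ?_ ?_ <;>
    simp only [HomOver.comp_val, HomOver.id_val, Category.assoc, meetLift_fst, meetLift_snd,
      meetLift_fst_assoc, meetLift_snd_assoc, hi.2, hj.2, Category.id_comp, Category.comp_id]

/-- Whether the canonical arrows are cocartesian can be tested after replacing a square by an
isomorphic one. -/
theorem cocart_canon_of_inv {X Y X' Y' X₀ Y₀ X₀' Y₀' : B} {f' : X' ⟶ Y'} {h : X' ⟶ X} {k : Y' ⟶ Y}
    {f : X ⟶ Y} (sq : CommSq f' h k f) {f₀' : X₀' ⟶ Y₀'} {h₀ : X₀' ⟶ X₀} {k₀ : Y₀' ⟶ Y₀}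
    {f₀ : X₀ ⟶ Y₀} (sq₀ : CommSq f₀' h₀ k₀ f₀) {a : p.Fiber X} {b : p.Fiber Y}
    {φ : HomOver p f a b} {a₀ : p.Fiber X₀} {b₀ : p.Fiber Y₀} {φ₀ : HomOver p f₀ a₀ b₀}
    {i₀ : X ⟶ X₀} {i₀' : X₀ ⟶ X} {i : HomOver p i₀ a a₀} {i' : HomOver p i₀' a₀ a}
    (hi : HomOver.IsInv i i') {j₀ : Y₀ ⟶ Y} {j₀' : Y ⟶ Y₀} {j : HomOver p j₀ b₀ b}
    {j' : HomOver p j₀' b b₀} (hj : HomOver.IsInv j j') (hφ : φ.1 = i.1 ≫ φ₀.1 ≫ j.1)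
    {s : X' ⟶ X₀'} {s' : X₀' ⟶ X'} (hs : s ≫ s' = 𝟙 _) (hs' : s' ≫ s = 𝟙 _) {t : Y₀' ⟶ Y'}
    {t' : Y' ⟶ Y₀'} (ht : t ≫ t' = 𝟙 _) (ht' : t' ≫ t = 𝟙 _) (hf : f' = s ≫ f₀' ≫ t)
    (hx : s ≫ h₀ = h ≫ i₀) (hy : t ≫ k = k₀ ≫ j₀)
    (H : ∀ d : p.Fiber Y₀', Cocart (canon sq₀ φ₀ d)) (d : p.Fiber Y') : Cocart (canon sq φ d) := by
  obtain ⟨l, hl⟩ := exists_inv_of_cartesian (proj p t d) ht ht'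
  obtain ⟨I, I', hI, hI₁, hI₂⟩ := exists_meet_inv (x := h) (y := f') (x' := h₀) (y' := f₀')
    hi hl.symm hs hs' hx
    (by rw [hf, Category.assoc, Category.assoc, ht, Category.comp_id])
  obtain ⟨J, J', hJ, hJ₁, hJ₂⟩ := exists_meet_inv (x := k₀) (y := 𝟙 Y₀') (x' := k) (y' := 𝟙 Y')
    hj hl ht ht' hy (by rw [Category.comp_id, Category.id_comp])
  refine Cocart.of_inv (H (pullback p t d)) hI hJ ?_
  refine meet_ext' (D := canon sq φ d) (D' := I.comp ((canon sq₀ φ₀ _).comp J rfl) hf.symm) rfl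
    ?_ ?_
  · simp only [HomOver.comp_val, Category.assoc, hJ₁]
    simp only [canon, meetLift_fst, meetLift_fst_assoc, HomOver.comp_val, Category.assoc]
    rw [← Category.assoc I.1, hI₁, Category.assoc, hφ]
  · simp only [HomOver.comp_val, Category.assoc, hJ₂]
    simp only [canon, meetLift_snd, meetLift_snd_assoc]
    rw [← Category.assoc I.1, hI₂, Category.assoc, hl.2, Category.comp_id]

end Meet

end FibCat

end

noncomputable section

namespace FibCat

open CategoryTheory.Functor

variable {B : Type u} [Category.{v} B] {E : Type w} [Category.{x} E] {p : E ⥤ B}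
  [p.IsFibered]

section Adjoint

variable {X Y : B} {f : X ⟶ Y}

theorem cocart_of_isIso {L : p.Fiber X ⥤ p.Fiber Y} (adj : L ⊣ baseChange p f) {a : p.Fiber X}
    {b : p.Fiber Y} (φ : HomOver p f a b) (h : IsIso ((adj.homEquiv a b).symm (toVert φ))) :
    Cocart φ := by
  refine cocart_of_isCocartesian φ ?_
  have := φ.2
  have key : ∀ {c : p.Fiber Y} (χ : b ⟶ c),
      (adj.homEquiv a c) ((adj.homEquiv a b).symm (toVert φ) ≫ χ) =
      toVert (φ.comp (HomOver.ofFiber χ) (Category.comp_id f)) := by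
    intro c χ
    rw [adj.homEquiv_naturality_right, Equiv.apply_symm_apply]
    refine ofVert_injective ?_
    rw [ofVert_toVert, ofVert_comp_map, ofVert_toVert]
  constructor
  intro b' φ' hφ'
  have hb : p.obj b' = Y := IsHomLift.codomain_eq p f φ'
  let c : p.Fiber Y := ⟨b', hb⟩
  let ψ : HomOver p f a c := ⟨φ', hφ'⟩
  let χ : b ⟶ c := inv ((adj.homEquiv a b).symm (toVert φ)) ≫ (adj.homEquiv a c).symm (toVert ψ)
  refine ⟨χ.1, ⟨χ.2, ?_⟩, ?_⟩
  · have := key χ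
    rw [IsIso.hom_inv_id_assoc, Equiv.apply_symm_apply] at this
    have := congrArg ofVert this
    rw [ofVert_toVert, ofVert_toVert] at this
    exact (congrArg Subtype.val this).symm
  · intro χ' hχ'
    let χ₁ : b ⟶ c := ⟨χ', hχ'.1⟩
    have e : φ.comp (HomOver.ofFiber χ₁) (Category.comp_id f) = ψ := HomOver.ext hχ'.2
    have := key χ₁
    rw [e, ← Equiv.eq_symm_apply] at this
    have : χ₁ = χ := by rw [← IsIso.inv_hom_id_assoc ((adj.homEquiv a b).symm (toVert φ)) χ₁, this]
    exact congrArg Subtype.val this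

theorem cocart_unit {L : p.Fiber X ⥤ p.Fiber Y} (adj : L ⊣ baseChange p f) (a : p.Fiber X) :
    Cocart (ofVert (adj.unit.app a)) := by
  refine cocart_of_isIso adj _ ?_
  have : (adj.homEquiv a (L.obj a)).symm (toVert (ofVert (adj.unit.app a))) = 𝟙 _ := by
    rw [toVert_ofVert, Equiv.symm_apply_eq, adj.homEquiv_id]
  exact this ▸ (inferInstance : IsIso (𝟙 (L.obj a)))

end Adjoint

theorem isIso_of_comp_fst_snd {C : Type*} [Category* C] [HasBinaryProducts C] {s a b q d : C}
    {t : s ⟶ a ⨯ b} {l : s ⟶ q} {m : s ⟶ d} (hF : IsIso (prod.lift l m)) {β : q ⟶ a}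
    (hβ : IsIso β) {κ : b ⟶ d} [IsIso κ] (h₁ : t ≫ prod.fst = l ≫ β)
    (h₂ : t ≫ prod.snd ≫ κ = m) : IsIso t := by
  have key : t ≫ prod.map (𝟙 _) κ = prod.lift l m ≫ prod.map β (𝟙 d) := by
    rw [prod.lift_map]
    refine Limits.prod.hom_ext ?_ ?_
    · rw [prod.lift_fst, ← h₁, Category.assoc, prod.map_fst, Category.comp_id]
    · rw [prod.lift_snd, Category.comp_id, ← h₂, Category.assoc, prod.map_snd]
  have : IsIso (t ≫ prod.map (𝟙 a) κ) := by rw [key]; infer_instance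
  exact IsIso.of_isIso_comp_right t (prod.map (𝟙 a) κ)


variable [∀ X : B, HasFiniteProducts (p.Fiber X)]
  [∀ {X Y : B} (f : X ⟶ Y), PreservesFiniteProducts (baseChange p f)]

/-- Frobenius reciprocity and the Beck-Chevalley condition imply that the cocartesian arrows
given by the left adjoint of base change are stable. -/
theorem cocart_canon_unit {X Y X' Y' : B} {f' : X' ⟶ Y'} {h : X' ⟶ X} {k : Y' ⟶ Y} {f : X ⟶ Y}
    (sq : CommSq f' h k f) {L : p.Fiber X ⥤ p.Fiber Y} (adj : L ⊣ baseChange p f)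
    {L' : p.Fiber X' ⥤ p.Fiber Y'} (adj' : L' ⊣ baseChange p f') (hF : Frobenius p f')
    (hB : BeckChevalley p sq) (a : p.Fiber X) (d : p.Fiber Y') :
    Cocart (canon sq (ofVert (adj.unit.app a)) d) := by
  refine cocart_of_isIso adj' _ ?_
  have hB := hB L adj L' adj' a
  have hF := hF L' adj' ((baseChange p h).obj a) d
  obtain ⟨β, hβ⟩ : ∃ β : (baseChange p h).obj a ⟶
      (baseChange p f').obj ((baseChange p k).obj (L.obj a)), toVert (cartLift (proj p k (L.obj a))
    ((proj p h a).comp (ofVert (adj.unit.app a)) rfl) sq.w) = β := ⟨_, rfl⟩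
  replace hB : IsIso ((adj'.homEquiv ((baseChange p h).obj a)
    ((baseChange p k).obj (L.obj a))).symm β) := by subst hβ; exact hB
  let φ : HomOver p f a (L.obj a) := ofVert (adj.unit.app a)
  let t := (adj'.homEquiv _ _).symm (toVert (canon sq φ d))
  let κ : pullback p (𝟙 Y') d ⟶ d := proj p (𝟙 Y') d
  obtain ⟨κ', hk⟩ := exists_inv_of_cartesian (proj p (𝟙 Y') d) (Category.comp_id _)
    (Category.comp_id _)
  have : IsIso κ := ⟨(show d ⟶ pullback p (𝟙 Y') d from κ'), HomOver.ext hk.1, HomOver.ext hk.2⟩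
  let π₁ : meet k (L.obj a) (𝟙 Y') d ⟶ (baseChange p k).obj (L.obj a) := prod.fst
  let π₂ : meet k (L.obj a) (𝟙 Y') d ⟶ pullback p (𝟙 Y') d := prod.snd
  let ρ₁ : meet h a f' d ⟶ (baseChange p h).obj a := prod.fst
  let ρ₂ : meet h a f' d ⟶ (baseChange p f').obj d := prod.snd
  have h₁ : t ≫ π₁ = L'.map ρ₁ ≫ (adj'.homEquiv ((baseChange p h).obj a)
      ((baseChange p k).obj (L.obj a))).symm β := by
    refine (adj'.homEquiv _ _).injective ?_
    rw [adj'.homEquiv_naturality_right, adj'.homEquiv_naturality_left, Equiv.apply_symm_apply,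
      Equiv.apply_symm_apply]
    refine ofVert_injective ?_
    rw [ofVert_comp_map, ofVert_toVert]
    refine cart_ext (proj p k (L.obj a)) ?_
    refine (Category.assoc _ _ _).trans ((meetLift_fst _ _ _ _).trans ?_)
    have e : (ofVert β).1 ≫ (proj p k (L.obj a)).1 = (proj p h a).1 ≫ φ.1 :=
      (congrArg (fun y => (ofVert y).1 ≫ (proj p k (L.obj a)).1) hβ.symm).trans
        ((congrArg (fun y : HomOver p _ _ _ => y.1 ≫ (proj p k (L.obj a)).1)
          (ofVert_toVert _)).trans (cartLift_fac _ _ _))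
    refine (Category.assoc _ _ _).trans (Eq.trans ?_ (congrArg (· ≫ (proj p k (L.obj a)).1)
      (Category.assoc ρ₁.1 β.1 (proj p f' (pullback p k (L.obj a))).1).symm))
    exact (congrArg (ρ₁.1 ≫ ·) e.symm).trans (Category.assoc _ _ _).symm
  have h₂ : t ≫ π₂ ≫ κ = L'.map ρ₂ ≫ adj'.counit.app d := by
    refine (adj'.homEquiv _ _).injective ?_
    rw [adj'.homEquiv_naturality_right, adj'.homEquiv_naturality_left, Equiv.apply_symm_apply,
      ← adj'.homEquiv_symm_id, Equiv.apply_symm_apply]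
    refine ofVert_injective ?_
    rw [ofVert_comp_map, ofVert_toVert]
    refine HomOver.ext ((meetLift_snd _ _ _ _).trans ?_)
    exact (congrArg (· ≫ (proj p f' d).1) (Category.comp_id ρ₂.1)).symm
  exact isIso_of_comp_fst_snd hF hB h₁ h₂

section Stable

variable [HasFiniteProducts B]

theorem map_snd_sq (G : B) {X Y : B} (f : X ⟶ Y) :
    CommSq (prod.map (𝟙 G) f) prod.snd prod.snd f := ⟨prod.map_snd _ _⟩

/-- Stability of a cocartesian arrow, under base change along product projections and under
conjunction. -/
def Stable {X Y : B} {f : X ⟶ Y} {a : p.Fiber X} {b : p.Fiber Y} (φ : HomOver p f a b) : Prop :=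
  ∀ (G : B) (d : p.Fiber (G ⨯ Y)), Cocart (canon (map_snd_sq G f) φ d)

variable {X Y : B} {f : X ⟶ Y} {a : p.Fiber X} {b : p.Fiber Y} {φ : HomOver p f a b}

theorem Stable.of_inv {X' Y' : B} {f' : X' ⟶ Y'} {i₀ : X' ⟶ X} {j₀ : X ⟶ X'} {k₀ : Y ⟶ Y'}
    {l₀ : Y' ⟶ Y} {a' : p.Fiber X'} {b' : p.Fiber Y'} (h : Stable φ) {i : HomOver p i₀ a' a}
    {j : HomOver p j₀ a a'} (hi : HomOver.IsInv i j) {k : HomOver p k₀ b b'}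
    {l : HomOver p l₀ b' b} (hk : HomOver.IsInv k l) {φ' : HomOver p f' a' b'}
    (e : φ'.1 = i.1 ≫ φ.1 ≫ k.1) : Stable φ' := by
  intro G d
  have e₀ : f' = i₀ ≫ f ≫ k₀ := HomOver.over_unique φ' (i.comp (φ.comp k rfl) rfl) e
  refine cocart_canon_of_inv (map_snd_sq G f') (map_snd_sq G f) hi hk e
    (s := prod.map (𝟙 G) i₀) (s' := prod.map (𝟙 G) j₀) (t := prod.map (𝟙 G) k₀)
    (t' := prod.map (𝟙 G) l₀) ?_ ?_ ?_ ?_ ?_ ?_ ?_ (h G) d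
  · rw [prod.map_map, hi.base_hom_inv, Category.id_comp, prod.map_id_id]
  · rw [prod.map_map, hi.base_inv_hom, Category.id_comp, prod.map_id_id]
  · rw [prod.map_map, hk.base_hom_inv, Category.id_comp, prod.map_id_id]
  · rw [prod.map_map, hk.base_inv_hom, Category.id_comp, prod.map_id_id]
  · rw [prod.map_map, prod.map_map, e₀, Category.id_comp, Category.id_comp]
  · rw [prod.map_snd]
  · rw [prod.map_snd]

theorem Stable.exists_desc (hφ : Stable φ) {G T : B} {d : p.Fiber (G ⨯ Y)} {g : G ⨯ Y ⟶ T}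
    {c : p.Fiber T}
    (N : ∀ {Z : B} (e : p.Fiber Z) (w : Z ⟶ G ⨯ Y) (x : Z ⟶ X) (_ : w ≫ prod.snd = x ≫ f)
      (_ : HomOver p x e a) (_ : HomOver p w e d), HomOver p (w ≫ g) e c)
    (hN : ∀ {Z Z' : B} (e : p.Fiber Z) (e' : p.Fiber Z') (z : Z' ⟶ Z) (k : HomOver p z e' e)
      (w : Z ⟶ G ⨯ Y) (x : Z ⟶ X) (h : w ≫ prod.snd = x ≫ f) (A : HomOver p x e a)
      (D : HomOver p w e d) (w' : Z' ⟶ G ⨯ Y) (x' : Z' ⟶ X) (h' : w' ≫ prod.snd = x' ≫ f)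
      (hw : z ≫ w = w') (hx : z ≫ x = x'),
      (N e' w' x' h' (k.comp A hx) (k.comp D hw)).1 = k.1 ≫ (N e w x h A D).1) :
    ∃ χ : HomOver p g (meet prod.snd b (𝟙 (G ⨯ Y)) d) c, ∀ {Z : B} (e : p.Fiber Z)
      (w : Z ⟶ G ⨯ Y) (x : Z ⟶ X) (h : w ≫ prod.snd = x ≫ f) (A : HomOver p x e a)
      (D : HomOver p w e d),
      (meetLift (x := prod.snd) (y := 𝟙 (G ⨯ Y)) (A.comp φ rfl) D h (Category.comp_id w)).1 ≫ χ.1 =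
        (N e w x h A D).1 := by
  obtain ⟨χ, hχ⟩ := Cocart.exists_fac (hφ G d) (N _ (prod.map (𝟙 G) f) prod.snd
    (map_snd_sq G f).w (meetFst _ _ _ _) (meetSnd _ _ _ _)) rfl
  refine ⟨χ, fun e w x h A D => ?_⟩
  have hw : prod.lift (w ≫ prod.fst) x ≫ prod.map (𝟙 G) f = w := by
    rw [prod.lift_map, ← h]
    ext <;> simp [prod.lift_fst, prod.lift_snd]
  let k : HomOver p (prod.lift (w ≫ prod.fst) x) e (meet prod.snd a (prod.map (𝟙 G) f) d) :=
    meetLift A D (prod.lift_snd _ _) hw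
  have hk := hN _ e _ k (prod.map (𝟙 G) f) prod.snd (map_snd_sq G f).w (meetFst _ _ _ _)
    (meetSnd _ _ _ _) w x h hw (prod.lift_snd _ _)
  rw [← hχ] at hk
  have e₁ : k.comp (meetFst _ _ _ _) (prod.lift_snd _ _) = A := HomOver.ext (meetLift_fst _ _ _ _)
  have e₂ : k.comp (meetSnd _ _ _ _) hw = D := HomOver.ext (meetLift_snd _ _ _ _)
  rw [e₁, e₂] at hk
  rw [hk, ← Category.assoc]
  refine congrArg (· ≫ χ.1) ?_
  refine meet_ext' (D' := k.comp (canon _ φ d) rfl) hw.symm ?_ ?_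
  · simp only [HomOver.comp_val, Category.assoc, canon, meetLift_fst]
    rw [← e₁]
    simp only [HomOver.comp_val, Category.assoc]
  · simp only [HomOver.comp_val, Category.assoc, canon, meetLift_snd]
    rw [← e₂]
    simp only [HomOver.comp_val]

theorem Stable.hom_ext (hφ : Stable φ) {G T : B} {d : p.Fiber (G ⨯ Y)} {g : G ⨯ Y ⟶ T}
    {c : p.Fiber T} {χ χ' : HomOver p g (meet prod.snd b (𝟙 (G ⨯ Y)) d) c}
    (H : ∀ {Z : B} (e : p.Fiber Z)
      (w : Z ⟶ G ⨯ Y) (x : Z ⟶ X) (h : w ≫ prod.snd = x ≫ f) (A : HomOver p x e a)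
      (D : HomOver p w e d),
      (meetLift (x := prod.snd) (y := 𝟙 (G ⨯ Y)) (A.comp φ rfl) D h (Category.comp_id w)).1 ≫ χ.1 =
        (meetLift (x := prod.snd) (y := 𝟙 (G ⨯ Y)) (A.comp φ rfl) D h (Category.comp_id w)).1 ≫
          χ'.1) : χ = χ' :=
  Cocart.hom_ext (hφ G d) (H _ _ _ _ _ _)

end Stable

end FibCat

end

noncomputable section

namespace FibCat

open CategoryTheory.Functor

variable {B : Type u} [Category.{v} B] {E : Type w} [Category.{x} E] {p : E ⥤ B}

theorem HomOver.isInv_id {X : B} (a : p.Fiber X) : HomOver.IsInv (HomOver.id a) (HomOver.id a) :=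
  ⟨Category.comp_id _, Category.comp_id _⟩

variable [p.IsFibered] [∀ X : B, HasFiniteProducts (p.Fiber X)]
  [∀ {X Y : B} (f : X ⟶ Y), PreservesFiniteProducts (baseChange p f)] [HasFiniteProducts B]

theorem Cocart.stable_of_stable {X Y : B} {f : X ⟶ Y} {a : p.Fiber X} {b b₀ : p.Fiber Y}
    {φ : HomOver p f a b} {φ₀ : HomOver p f a b₀} (h : Cocart φ) (h₀ : Cocart φ₀)
    (hs : Stable φ₀) : Stable φ := by
  obtain ⟨i, j, hi, e⟩ := h₀.exists_iso h
  refine hs.of_inv (HomOver.isInv_id a) hi ?_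
  rw [HomOver.id_val, Category.id_comp, e]

/-- A cocartesian arrow over the first factor of a commutative square whose other sides are
invertible. -/
theorem exists_cocart_stable {X Y X₀ Y₀ : B} {f : X ⟶ Y} {f₀ : X₀ ⟶ Y₀} {i₀ : X ⟶ X₀}
    {i₀' : X₀ ⟶ X} (hi : i₀ ≫ i₀' = 𝟙 X) (hi' : i₀' ≫ i₀ = 𝟙 X₀) {j₀ : Y₀ ⟶ Y} {j₀' : Y ⟶ Y₀}
    (hj : j₀ ≫ j₀' = 𝟙 Y₀) (hj' : j₀' ≫ j₀ = 𝟙 Y) (hf : f = i₀ ≫ f₀ ≫ j₀)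
    [(baseChange p f₀).IsRightAdjoint]
    (H : ∀ G : B, ∃ (X' Y' : B) (f' : X' ⟶ Y') (h : X' ⟶ X₀) (k : Y' ⟶ Y₀)
      (sq : CommSq f' h k f₀) (s : G ⨯ X ⟶ X') (s' : X' ⟶ G ⨯ X) (t : Y' ⟶ G ⨯ Y)
      (t' : G ⨯ Y ⟶ Y'), s ≫ s' = 𝟙 _ ∧ s' ≫ s = 𝟙 _ ∧ t ≫ t' = 𝟙 _ ∧ t' ≫ t = 𝟙 _ ∧
        prod.map (𝟙 G) f = s ≫ f' ≫ t ∧ s ≫ h = prod.snd ≫ i₀ ∧ t ≫ prod.snd = k ≫ j₀ ∧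
        (baseChange p f').IsRightAdjoint ∧ Frobenius p f' ∧ BeckChevalley p sq)
    (a : p.Fiber X) : ∃ (b : p.Fiber Y) (φ : HomOver p f a b), Cocart φ ∧ Stable φ := by
  obtain ⟨i', hi₁⟩ := exists_inv_of_cartesian (proj p i₀' a) hi' hi
  let adj := Adjunction.ofIsRightAdjoint (baseChange p f₀)
  let φ₀ : HomOver p f₀ (pullback p i₀' a) _ := ofVert (adj.unit.app (pullback p i₀' a))
  obtain ⟨j', hj₁⟩ := exists_inv_of_cartesian (proj p j₀' (((baseChange p f₀).leftAdjoint).obj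
    (pullback p i₀' a))) hj' hj
  refine ⟨_, (i'.comp (φ₀.comp j' rfl) hf.symm), ?_, ?_⟩
  · exact (cocart_unit adj (pullback p i₀' a)).of_inv hi₁.symm hj₁.symm rfl
  · intro G d
    obtain ⟨X', Y', f', h, k, sq, s, s', t, t', h₁, h₂, h₃, h₄, h₅, h₆, h₇, h₈, h₉, hB⟩ := H G
    exact cocart_canon_of_inv (map_snd_sq G f) sq hi₁.symm hj₁.symm rfl h₁ h₂ h₃ h₄ h₅ h₆ h₇
      (fun d => cocart_canon_unit sq adj (Adjunction.ofIsRightAdjoint (baseChange p f')) h₉ hB _ d)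
      d

end FibCat

namespace CartFib

open FibCat

set_option linter.unusedSimpArgs false in
theorem IsExistential.exists_cocart {P : CartFib.{u, v, w, x}} (hP : P.IsExistential)
    {X Y : P.Base} {f : X ⟶ Y} (hf : IsProjection f) (a : P.p.Fiber X) :
    ∃ (b : P.p.Fiber Y) (φ : HomOver P.p f a b), Cocart φ ∧ Stable φ := by
  obtain ⟨I, r, ⟨hr⟩⟩ := hf
  have := hP.adjoint I Y
  obtain ⟨l, hl₁, hl₂⟩ := BinaryFan.IsLimit.lift' hr (prod.fst : I ⨯ Y ⟶ I) prod.snd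
  change l ≫ r = _ at hl₁
  change l ≫ f = _ at hl₂
  have ext : ∀ {Z : P.Base} {u v : Z ⟶ X}, u ≫ r = v ≫ r → u ≫ f = v ≫ f → u = v :=
    fun h h' => BinaryFan.IsLimit.hom_ext hr h h'
  refine exists_cocart_stable (f₀ := (prod.snd : I ⨯ Y ⟶ Y)) (i₀ := prod.lift r f) (i₀' := l)
    (ext ?_ ?_) ?_ (j₀ := 𝟙 Y) (j₀' := 𝟙 Y) (Category.comp_id _) (Category.comp_id _) ?_
    (fun G => ⟨I ⨯ (G ⨯ Y), G ⨯ Y, prod.snd, _, prod.snd, snd_sq I prod.snd,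
      prod.lift (prod.snd ≫ r) (prod.map (𝟙 G) f),
      prod.lift (prod.snd ≫ prod.fst) (prod.lift prod.fst (prod.snd ≫ prod.snd) ≫ l), 𝟙 _, 𝟙 _,
      ?_, ?_, ?_, ?_, ?_, ?_, ?_, hP.adjoint _ _, hP.frobenius _ _, hP.beckChevalley _ _⟩) a
  · rw [Category.assoc, hl₁, prod.lift_fst, Category.id_comp]
  · rw [Category.assoc, hl₂, prod.lift_snd, Category.id_comp]
  · ext <;> simp [prod.lift_fst, prod.lift_snd, hl₁, hl₂]
  · simp [prod.lift_snd]
  · ext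
    · simp [prod.lift_fst, prod.lift_snd_assoc, prod.lift_snd]
    · refine ext ?_ ?_ <;>
      simp [prod.lift_snd, prod.lift_fst, hl₁, hl₂, prod.lift_snd_assoc]
  · ext <;> simp [prod.lift_fst, prod.lift_snd, hl₁, hl₂, prod.lift_snd_assoc, prod.lift_fst_assoc]
  · simp
  · simp
  · simp [prod.lift_snd]
  · ext <;> simp [prod.lift_fst, prod.lift_snd, prod.lift_fst_assoc]
  · simp

set_option linter.unusedSimpArgs false in
theorem IsElementary.exists_cocart {P : CartFib.{u, v, w, x}} (hP : P.IsElementary)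
    {X Y : P.Base} {f : X ⟶ Y} (hf : IsDelta f) (a : P.p.Fiber X) :
    ∃ (b : P.p.Fiber Y) (φ : HomOver P.p f a b), Cocart φ ∧ Stable φ := by
  obtain ⟨I, K, r, k, b, c, ⟨hr⟩, ⟨hb⟩, h₁, h₂⟩ := hf
  have := hP.adjoint I K
  obtain ⟨l, hl₁, hl₂⟩ := BinaryFan.IsLimit.lift' hr (prod.fst : I ⨯ K ⟶ I) prod.snd
  change l ≫ r = _ at hl₁
  change l ≫ k = _ at hl₂
  have ext : ∀ {Z : P.Base} {u v : Z ⟶ X}, u ≫ r = v ≫ r → u ≫ k = v ≫ k → u = v :=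
    fun h h' => BinaryFan.IsLimit.hom_ext hr h h'
  obtain ⟨m, hm₁, hm₂⟩ := BinaryFan.IsLimit.lift' hb (prod.fst : I ⨯ (I ⨯ K) ⟶ I) (prod.snd ≫ l)
  change m ≫ b = _ at hm₁
  change m ≫ c = _ at hm₂
  have ext' : ∀ {Z : P.Base} {u v : Z ⟶ Y}, u ≫ b = v ≫ b → u ≫ c = v ≫ c → u = v :=
    fun h h' => BinaryFan.IsLimit.hom_ext hb h h'
  have e : prod.lift r k ≫ l = 𝟙 X := ext
    (by rw [Category.assoc, hl₁, prod.lift_fst, Category.id_comp])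
    (by rw [Category.assoc, hl₂, prod.lift_snd, Category.id_comp])
  have e' : l ≫ prod.lift r k = 𝟙 _ := by
    refine Limits.prod.hom_ext ?_ ?_ <;> simp [prod.lift_fst, prod.lift_snd, hl₁, hl₂]
  refine exists_cocart_stable (f₀ := delta I K) (i₀ := prod.lift r k) (i₀' := l) e ?_ (j₀ := m)
    (j₀' := prod.lift b (c ≫ prod.lift r k)) ?_ ?_ ?_
    (fun G => ⟨I ⨯ (G ⨯ K), _, delta I (G ⨯ K), _, _, delta_sq I prod.snd,
      prod.lift (prod.snd ≫ r) (prod.map (𝟙 G) k),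
      prod.lift (prod.snd ≫ prod.fst) (prod.lift prod.fst (prod.snd ≫ prod.snd) ≫ l),
      prod.lift (prod.snd ≫ prod.snd ≫ prod.fst)
        (prod.map (𝟙 I) (prod.map (𝟙 I) prod.snd) ≫ m),
      prod.lift (prod.snd ≫ b) (prod.lift (prod.snd ≫ c ≫ r) (prod.map (𝟙 G) (c ≫ k))),
      ?_, ?_, ?_, ?_, ?_, ?_, ?_, hP.adjoint _ _, hP.frobenius _ _, hP.beckChevalley _ _⟩) a
  on_goal 10 => refine Limits.prod.hom_ext ?_ ?_
  on_goal 9 => refine Limits.prod.hom_ext ?_ (ext' ?_ (ext ?_ ?_))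
  on_goal 8 => refine Limits.prod.hom_ext ?_ (ext' ?_ (ext ?_ ?_))
  on_goal 7 => refine Limits.prod.hom_ext ?_ (Limits.prod.hom_ext ?_ (Limits.prod.hom_ext ?_ ?_))
  on_goal 6 => refine Limits.prod.hom_ext ?_ (Limits.prod.hom_ext ?_ ?_)
  on_goal 5 => refine Limits.prod.hom_ext ?_ (ext ?_ ?_)
  on_goal 4 => refine ext' ?_ ?_
  on_goal 3 => refine ext' ?_ (ext ?_ ?_)
  on_goal 2 => refine Limits.prod.hom_ext ?_ (Limits.prod.hom_ext ?_ ?_)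
  · exact e'
  all_goals simp [prod.lift_fst, prod.lift_snd, prod.lift_fst_assoc, prod.lift_snd_assoc, hl₁, hl₂,
    hm₁, hm₂, reassoc_of% hm₂, h₁, h₂, reassoc_of% h₂, e, e']

end CartFib

end

noncomputable section

namespace FibCat

open CategoryTheory.Functor

variable {B : Type u} [Category.{v} B]

theorem nonempty_isLimit_of_existsUnique {P I J : B} {a : P ⟶ I} {b : P ⟶ J}
    (H : ∀ ⦃Z : B⦄ (u : Z ⟶ I) (v : Z ⟶ J), ∃! m : Z ⟶ P, m ≫ a = u ∧ m ≫ b = v) :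
    Nonempty (IsLimit (BinaryFan.mk a b)) :=
  ⟨BinaryFan.isLimitMk (fun s => (H s.fst s.snd).choose) (fun s => (H s.fst s.snd).choose_spec.1.1)
    (fun s => (H s.fst s.snd).choose_spec.1.2)
    (fun s m h h' => (H s.fst s.snd).choose_spec.2 m ⟨h, h'⟩)⟩

theorem existsUnique_of_isLimit {P I J : B} {a : P ⟶ I} {b : P ⟶ J}
    (h : IsLimit (BinaryFan.mk a b)) ⦃Z : B⦄ (u : Z ⟶ I) (v : Z ⟶ J) :
    ∃! m : Z ⟶ P, m ≫ a = u ∧ m ≫ b = v :=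
  ⟨(BinaryFan.IsLimit.lift' h u v).1, (BinaryFan.IsLimit.lift' h u v).2, fun _ hm =>
    BinaryFan.IsLimit.hom_ext h (hm.1.trans (BinaryFan.IsLimit.lift' h u v).2.1.symm)
      (hm.2.trans (BinaryFan.IsLimit.lift' h u v).2.2.symm)⟩

theorem IsProjection.comp {X Y Z : B} {f : X ⟶ Y} {g : Y ⟶ Z} [HasFiniteProducts B]
    (hf : IsProjection f) (hg : IsProjection g) : IsProjection (f ≫ g) := by
  obtain ⟨I, a, ⟨ha⟩⟩ := hf
  obtain ⟨J, b, ⟨hb⟩⟩ := hg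
  refine ⟨I ⨯ J, prod.lift a (f ≫ b), nonempty_isLimit_of_existsUnique fun W u v => ?_⟩
  obtain ⟨m, ⟨h₁, h₂⟩, hm⟩ := existsUnique_of_isLimit hb (u ≫ prod.snd) v
  obtain ⟨n, ⟨h₃, h₄⟩, hn⟩ := existsUnique_of_isLimit ha (u ≫ prod.fst) m
  refine ⟨n, ⟨?_, ?_⟩, fun n' h => hn n' ⟨?_, hm _ ⟨?_, ?_⟩⟩⟩
  · refine Limits.prod.hom_ext ?_ ?_
    · rw [Category.assoc, prod.lift_fst, h₃]
    · rw [Category.assoc, prod.lift_snd, ← Category.assoc, h₄, h₁]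
  · rw [← Category.assoc, h₄, h₂]
  · rw [← h.1, Category.assoc, prod.lift_fst]
  · rw [← h.1, Category.assoc, Category.assoc, prod.lift_snd]
  · rw [← h.2, Category.assoc]

variable [HasFiniteProducts B]

theorem isProjection_id (X : B) : IsProjection (𝟙 X) :=
  ⟨⊤_ B, terminal.from X, nonempty_isLimit_of_existsUnique fun _ _ v =>
    ⟨v, ⟨Subsingleton.elim _ _, Category.comp_id _⟩, fun _ h =>
      (Category.comp_id _).symm.trans h.2⟩⟩

theorem isProjection_snd (X Y : B) : IsProjection (prod.snd : X ⨯ Y ⟶ Y) :=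
  ⟨X, prod.fst, ⟨prodIsProd X Y⟩⟩

theorem isProjection_fst (X Y : B) : IsProjection (prod.fst : X ⨯ Y ⟶ X) :=
  ⟨Y, prod.snd, nonempty_isLimit_of_existsUnique fun _ u v =>
    ⟨prod.lift v u, ⟨prod.lift_snd _ _, prod.lift_fst _ _⟩, fun _ h =>
      Limits.prod.hom_ext (h.2.trans (prod.lift_fst _ _).symm)
        (h.1.trans (prod.lift_snd _ _).symm)⟩⟩

theorem IsProjection.map_id (X : B) {Y Z : B} {f : Y ⟶ Z} (hf : IsProjection f) :
    IsProjection (prod.map (𝟙 X) f) := by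
  obtain ⟨I, a, ⟨ha⟩⟩ := hf
  refine ⟨I, prod.snd ≫ a, nonempty_isLimit_of_existsUnique fun W u v => ?_⟩
  obtain ⟨m, ⟨h₁, h₂⟩, hm⟩ := existsUnique_of_isLimit ha u (v ≫ prod.snd)
  refine ⟨prod.lift (v ≫ prod.fst) m, ⟨?_, ?_⟩, fun n h => ?_⟩
  · rw [prod.lift_snd_assoc, h₁]
  · rw [prod.lift_map, h₂, Category.comp_id, ← prod.comp_lift, prod.lift_fst_snd,
      Category.comp_id]
  · refine Limits.prod.hom_ext ?_ ((hm _ ⟨?_, ?_⟩).trans (prod.lift_snd _ _).symm)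
    · rw [prod.lift_fst, ← h.2, Category.assoc, prod.map_fst, Category.comp_id]
    · rw [← h.1, Category.assoc]
    · rw [← h.2, Category.assoc, Category.assoc, prod.map_snd]

section

variable {E : Type w} [Category.{x} E] {p : E ⥤ B} [p.IsFibered]
  [∀ X : B, HasFiniteProducts (p.Fiber X)]
  [∀ {X Y : B} (f : X ⟶ Y), PreservesFiniteProducts (baseChange p f)]

variable {X Y : B} {f : X ⟶ Y} {a : p.Fiber X} {b : p.Fiber Y} {φ : HomOver p f a b}

/-- A family of arrows which is natural in tuples of arrows from a common domain factors uniquely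
through a stable cocartesian arrow, conjoined with any object over any product of the base. -/
theorem Stable.existsUnique (hφ : Stable φ) {W T : B} {w₀ : W ⟶ Y} (hw₀ : IsProjection w₀)
    {d : p.Fiber W} {g : W ⟶ T} {c : p.Fiber T}
    (N : ∀ {Z : B} (e : p.Fiber Z) (w : Z ⟶ W) (x : Z ⟶ X) (_ : w ≫ w₀ = x ≫ f)
      (_ : HomOver p x e a) (_ : HomOver p w e d), HomOver p (w ≫ g) e c)
    (hN : ∀ {Z Z' : B} (e : p.Fiber Z) (e' : p.Fiber Z') (z : Z' ⟶ Z) (k : HomOver p z e' e)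
      (w : Z ⟶ W) (x : Z ⟶ X) (h : w ≫ w₀ = x ≫ f) (A : HomOver p x e a)
      (D : HomOver p w e d) (w' : Z' ⟶ W) (x' : Z' ⟶ X) (h' : w' ≫ w₀ = x' ≫ f)
      (hw : z ≫ w = w') (hx : z ≫ x = x'),
      (N e' w' x' h' (k.comp A hx) (k.comp D hw)).1 = k.1 ≫ (N e w x h A D).1) :
    ∃! χ : HomOver p g (meet w₀ b (𝟙 W) d) c, ∀ {Z : B} (e : p.Fiber Z)
      (w : Z ⟶ W) (x : Z ⟶ X) (h : w ≫ w₀ = x ≫ f) (A : HomOver p x e a)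
      (D : HomOver p w e d),
      (meetLift (x := w₀) (y := 𝟙 W) (A.comp φ rfl) D h (Category.comp_id w)).1 ≫ χ.1 =
        (N e w x h A D).1 := by
  obtain ⟨G, u, ⟨hu⟩⟩ := hw₀
  obtain ⟨m, hm₁, hm₂⟩ := BinaryFan.IsLimit.lift' hu (prod.fst : G ⨯ Y ⟶ G) prod.snd
  change m ≫ u = _ at hm₁
  change m ≫ w₀ = _ at hm₂
  have hlm : prod.lift u w₀ ≫ m = 𝟙 W := BinaryFan.IsLimit.hom_ext hu
    ((Category.assoc _ _ _).trans ((congrArg (_ ≫ ·) hm₁).trans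
      ((prod.lift_fst _ _).trans (Category.id_comp _).symm)))
    ((Category.assoc _ _ _).trans ((congrArg (_ ≫ ·) hm₂).trans
      ((prod.lift_snd _ _).trans (Category.id_comp _).symm)))
  have hml : m ≫ prod.lift u w₀ = 𝟙 _ := by
    rw [prod.comp_lift, hm₁, hm₂, prod.lift_fst_snd]
  obtain ⟨κ, hκ⟩ := exists_inv_of_cartesian (proj p m d) hml hlm
  have hmw : ∀ {Z : B} (w : Z ⟶ G ⨯ Y), (w ≫ m) ≫ w₀ = w ≫ prod.snd := fun w => by
    rw [Category.assoc, hm₂]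
  have hwl : ∀ {Z : B} (w : Z ⟶ W), (w ≫ prod.lift u w₀) ≫ prod.snd = w ≫ w₀ := fun w => by
    rw [Category.assoc, prod.lift_snd]
  obtain ⟨χ, hχ⟩ := hφ.exists_desc (d := pullback p m d) (g := m ≫ g)
    (fun e w x h A D => (N e (w ≫ m) x ((hmw w).trans h) A (D.comp (proj p m d) rfl)).cast
      (Category.assoc _ _ _))
    (fun e e' z k w x h A D w' x' h' hw hx => by
      refine Eq.trans ?_ (hN e e' z k (w ≫ m) x ((hmw w).trans h) A (D.comp (proj p m d) rfl)
        (w' ≫ m) x' ((hmw w').trans h') (by rw [← hw, Category.assoc]) hx)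
      simp only [HomOver.cast_val]
      congr 2
      exact HomOver.ext (Category.assoc _ _ _))
  let i : HomOver p (prod.lift u w₀) (meet w₀ b (𝟙 W) d) (meet prod.snd b (𝟙 _) (pullback p m d)) :=
    meetLift (meetFst _ _ _ _) ((meetSnd _ _ _ _).comp κ (Category.id_comp _)) (prod.lift_snd _ _)
      (Category.comp_id _)
  have hi : ∀ {Z : B} (e : p.Fiber Z) (w : Z ⟶ W) (x : Z ⟶ X) (h : w ≫ w₀ = x ≫ f)
      (A : HomOver p x e a) (D : HomOver p w e d),
      (meetLift (x := w₀) (y := 𝟙 W) (A.comp φ rfl) D h (Category.comp_id w)).1 ≫ i.1 =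
      (meetLift (x := prod.snd) (y := 𝟙 (G ⨯ Y)) (A.comp φ rfl) (D.comp κ rfl) ((hwl w).trans h)
        (Category.comp_id _)).1 := fun e w x h A D => by
    refine meet_ext' (D := (meetLift (x := w₀) (y := 𝟙 W) (A.comp φ rfl) D h
      (Category.comp_id w)).comp i rfl) rfl ?_ ?_
    · simp [i]
    · simp [i]
  refine ⟨i.comp χ (by rw [← Category.assoc, hlm, Category.id_comp]), ?_, ?_⟩
  · intro Z e w x h A D
    have hw : (w ≫ prod.lift u w₀) ≫ m = w := by rw [Category.assoc, hlm, Category.comp_id]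
    refine (Category.assoc _ _ _).symm.trans ((congrArg (· ≫ χ.1) (hi e w x h A D)).trans ?_)
    refine (hχ e _ x ((hwl w).trans h) A (D.comp κ rfl)).trans ?_
    have H : ∀ {w' : Z ⟶ W} (hw : w' = w) (h' : w' ≫ w₀ = x ≫ f) (D' : HomOver p w' e d)
        (_ : D'.1 = D.1), (N e w' x h' A D').1 = (N e w x h A D).1 := by
      rintro w' rfl h' D' hD
      rw [HomOver.ext hD]
    refine H hw _ _ ?_
    simp only [HomOver.comp_val, Category.assoc, hκ.inv_hom, Category.comp_id]
  · intro χ' hχ'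
    let j : HomOver p m (meet prod.snd b (𝟙 _) (pullback p m d)) (meet w₀ b (𝟙 W) d) :=
      meetLift (meetFst _ _ _ _) ((meetSnd _ _ _ _).comp (proj p m d) (Category.id_comp _)) hm₂
        (Category.comp_id _)
    have e : χ = j.comp χ' rfl := by
      refine hφ.hom_ext fun e w x h A D => ?_
      refine (hχ e w x h A D).trans ((hχ' e (w ≫ m) x ((hmw w).trans h) A
        (D.comp (proj p m d) rfl)).symm.trans (Eq.trans ?_ (Category.assoc _ _ _)))
      refine congrArg (· ≫ χ'.1) ?_
      refine meet_ext' (D' := (meetLift (x := prod.snd) (y := 𝟙 (G ⨯ Y)) (A.comp φ rfl) D h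
        (Category.comp_id w)).comp j rfl) rfl ?_ ?_
      · simp [j]
      · simp [j]
    have hij : i.1 ≫ j.1 = 𝟙 _ := by
      refine meet_ext' (D := i.comp j hlm) (D' := HomOver.id _) rfl ?_ ?_
      · simp [i, j]
      · simp [i, j, hκ.inv_hom]
    refine HomOver.ext ?_
    rw [HomOver.comp_val, e, HomOver.comp_val, ← Category.assoc, hij, Category.id_comp]

theorem Stable.proj_hom_ext (hφ : Stable φ) {W T : B} {w₀ : W ⟶ Y} (hw₀ : IsProjection w₀)
    {d : p.Fiber W} {g : W ⟶ T} {c : p.Fiber T} {χ χ' : HomOver p g (meet w₀ b (𝟙 W) d) c}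
    (H : ∀ {Z : B} (e : p.Fiber Z)
      (w : Z ⟶ W) (x : Z ⟶ X) (h : w ≫ w₀ = x ≫ f) (A : HomOver p x e a) (D : HomOver p w e d),
      (meetLift (x := w₀) (y := 𝟙 W) (A.comp φ rfl) D h (Category.comp_id w)).1 ≫ χ.1 =
        (meetLift (x := w₀) (y := 𝟙 W) (A.comp φ rfl) D h (Category.comp_id w)).1 ≫ χ'.1) :
    χ = χ' := by
  refine (hφ.existsUnique hw₀ (fun e w x h A D => (meetLift (x := w₀) (y := 𝟙 W) (A.comp φ rfl) D h
    (Category.comp_id w)).comp χ' rfl) (fun e e' z k w x h A D w' x' h' hw hx => ?_)).unique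
    (fun e w x h A D => H e w x h A D) (fun _ _ _ _ _ _ => rfl)
  refine Eq.trans ?_ (Category.assoc _ _ _)
  refine congrArg (· ≫ χ'.1) ?_
  refine meet_ext' (D' := k.comp (meetLift (x := w₀) (y := 𝟙 W) (A.comp φ rfl) D h
    (Category.comp_id w)) rfl) hw.symm ?_ ?_ <;> simp

theorem meet_meet_ext {W V X Y T Z : B} {x : W ⟶ X} {a : p.Fiber X} {y : W ⟶ Y} {b : p.Fiber Y}
    {v : V ⟶ W} {t : V ⟶ T} {c : p.Fiber T} {e : p.Fiber Z} {z z' : Z ⟶ V}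
    {D : HomOver p z e (meet v (meet x a y b) t c)}
    {D' : HomOver p z' e (meet v (meet x a y b) t c)}
    (hz : z = z')
    (h₁ : D.1 ≫ (meetFst v _ t c).1 ≫ (meetFst x a y b).1 =
      D'.1 ≫ (meetFst v _ t c).1 ≫ (meetFst x a y b).1)
    (h₂ : D.1 ≫ (meetFst v _ t c).1 ≫ (meetSnd x a y b).1 =
      D'.1 ≫ (meetFst v _ t c).1 ≫ (meetSnd x a y b).1)
    (h₃ : D.1 ≫ (meetSnd v _ t c).1 = D'.1 ≫ (meetSnd v _ t c).1) : D.1 = D'.1 := by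
  subst hz
  refine meet_ext' rfl (congrArg Subtype.val (meet_ext (D := D.comp (meetFst v _ t c) rfl)
    (D' := D'.comp (meetFst v _ t c) rfl) ?_ ?_)) h₃
  · simpa using h₁
  · simpa using h₂

theorem meet_meet_ext' {W V X Y T Z : B} {x : W ⟶ X} {a : p.Fiber X} {y : W ⟶ Y} {b : p.Fiber Y}
    {v : V ⟶ W} {t : V ⟶ T} {c : p.Fiber T} {e : p.Fiber Z} {z z' : Z ⟶ V}
    {D : HomOver p z e (meet t c v (meet x a y b))}
    {D' : HomOver p z' e (meet t c v (meet x a y b))}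
    (hz : z = z')
    (h₁ : D.1 ≫ (meetFst t c v _).1 = D'.1 ≫ (meetFst t c v _).1)
    (h₂ : D.1 ≫ (meetSnd t c v _).1 ≫ (meetFst x a y b).1 =
      D'.1 ≫ (meetSnd t c v _).1 ≫ (meetFst x a y b).1)
    (h₃ : D.1 ≫ (meetSnd t c v _).1 ≫ (meetSnd x a y b).1 =
      D'.1 ≫ (meetSnd t c v _).1 ≫ (meetSnd x a y b).1) : D.1 = D'.1 := by
  subst hz
  refine meet_ext' rfl h₁ (congrArg Subtype.val (meet_ext (D := D.comp (meetSnd t c v _) rfl)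
    (D' := D'.comp (meetSnd t c v _) rfl) ?_ ?_))
  · simpa using h₂
  · simpa using h₃

/-- The external conjunction of two arrows. -/
def box {X₁ Y₁ X₂ Y₂ : B} {f₁ : X₁ ⟶ Y₁} {f₂ : X₂ ⟶ Y₂} {a₁ : p.Fiber X₁} {b₁ : p.Fiber Y₁}
    {a₂ : p.Fiber X₂} {b₂ : p.Fiber Y₂} (φ₁ : HomOver p f₁ a₁ b₁) (φ₂ : HomOver p f₂ a₂ b₂) :
    HomOver p (prod.map f₁ f₂) (meet prod.fst a₁ prod.snd a₂) (meet prod.fst b₁ prod.snd b₂) :=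
  meetLift ((meetFst _ _ _ _).comp φ₁ rfl) ((meetSnd _ _ _ _).comp φ₂ rfl) (prod.map_fst _ _)
    (prod.map_snd _ _)

theorem Stable.box {X₁ Y₁ X₂ Y₂ : B} {f₁ : X₁ ⟶ Y₁} {f₂ : X₂ ⟶ Y₂} {a₁ : p.Fiber X₁}
    {b₁ : p.Fiber Y₁} {a₂ : p.Fiber X₂} {b₂ : p.Fiber Y₂} {φ₁ : HomOver p f₁ a₁ b₁}
    {φ₂ : HomOver p f₂ a₂ b₂} (h₁ : Stable φ₁) (h₂ : Stable φ₂) : Stable (FibCat.box φ₁ φ₂) := by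
  intro G d T g c ψ
  let w₁ : G ⨯ (Y₁ ⨯ X₂) ⟶ Y₁ := prod.snd ≫ prod.fst
  let m₁ : G ⨯ (Y₁ ⨯ X₂) ⟶ G ⨯ (Y₁ ⨯ Y₂) := prod.map (𝟙 _) (prod.map (𝟙 _) f₂)
  let w₂ : G ⨯ (Y₁ ⨯ Y₂) ⟶ Y₂ := prod.snd ≫ prod.snd
  have hw₁ : IsProjection w₁ := (isProjection_snd _ _).comp (isProjection_fst _ _)
  have hw₂ : IsProjection w₂ := (isProjection_snd _ _).comp (isProjection_snd _ _)
  have e₁ : ∀ {Z : B} {w : Z ⟶ G ⨯ (Y₁ ⨯ X₂)} {x : Z ⟶ X₁}, w ≫ w₁ = x ≫ f₁ →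
      prod.lift (w ≫ prod.fst) (prod.lift x (w ≫ prod.snd ≫ prod.snd)) ≫
        prod.map (𝟙 G) (prod.map f₁ f₂) = w ≫ m₁ := fun {Z w x} h => by
    refine Limits.prod.hom_ext ?_ (Limits.prod.hom_ext ?_ ?_) <;>
      simp [m₁, ← h, w₁, prod.lift_fst, prod.lift_snd]
  have e₂ : ∀ {Z : B} {w : Z ⟶ G ⨯ (Y₁ ⨯ Y₂)} {x : Z ⟶ X₂}, w ≫ w₂ = x ≫ f₂ →
      prod.lift (w ≫ prod.fst) (prod.lift (w ≫ prod.snd ≫ prod.fst) x) ≫ m₁ = w :=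
    fun {Z w x} h => by
    refine Limits.prod.hom_ext ?_ (Limits.prod.hom_ext ?_ ?_) <;>
      simp [m₁, ← h, w₂, prod.lift_fst, prod.lift_snd]
  let t₁ : ∀ {Z : B} {e : p.Fiber Z} {w : Z ⟶ G ⨯ (Y₁ ⨯ X₂)} {x : Z ⟶ X₁} (_ : w ≫ w₁ = x ≫ f₁)
    (_ : HomOver p x e a₁) (_ : HomOver p w e (meet m₁ d (prod.snd ≫ prod.snd) a₂)),
      HomOver p (prod.lift (w ≫ prod.fst) (prod.lift x (w ≫ prod.snd ≫ prod.snd))) e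
        (meet prod.snd (meet prod.fst a₁ prod.snd a₂) (prod.map (𝟙 G) (prod.map f₁ f₂)) d) :=
    fun h A D => meetLift (meetLift A (D.comp (meetSnd _ _ _ _) rfl) (prod.lift_fst _ _)
      (prod.lift_snd _ _)) (D.comp (meetFst _ _ _ _) rfl) (prod.lift_snd _ _) (e₁ h)
  let t₂ : ∀ {Z : B} {e : p.Fiber Z} {w : Z ⟶ G ⨯ (Y₁ ⨯ Y₂)} {x : Z ⟶ X₂} (_ : w ≫ w₂ = x ≫ f₂)
    (_ : HomOver p x e a₂) (_ : HomOver p w e (meet (𝟙 _) d (prod.snd ≫ prod.fst) b₁)),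
      HomOver p (prod.lift (w ≫ prod.fst) (prod.lift (w ≫ prod.snd ≫ prod.fst) x)) e
        (meet w₁ b₁ (𝟙 _) (meet m₁ d (prod.snd ≫ prod.snd) a₂)) :=
    fun h A D => meetLift (D.comp (meetSnd _ _ _ _) rfl) (meetLift (D.comp (meetFst _ _ _ _)
      (Category.comp_id _)) A (e₂ h) (by rw [prod.lift_snd_assoc, prod.lift_snd]))
      (by rw [prod.lift_snd_assoc, prod.lift_fst])
      (Category.comp_id _)
  obtain ⟨χ₁, hχ₁, -⟩ := h₁.existsUnique hw₁ (g := m₁ ≫ g) (c := c)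
    (fun e w x h A D => (t₁ h A D).comp ψ
      ((Category.assoc _ _ _).symm.trans ((congrArg (· ≫ g) (e₁ h)).trans (Category.assoc _ _ _))))
    (fun e e' z k w x h A D w' x' h' hw hx => by
      subst hw hx
      refine Eq.trans ?_ (Category.assoc _ _ _)
      refine congrArg (· ≫ ψ.1) ?_
      refine meet_meet_ext (D' := k.comp (t₁ h A D) rfl) (by simp [prod.comp_lift]) ?_ ?_ ?_ <;>
        simp [t₁])
  obtain ⟨χ₂, hχ₂, -⟩ := h₂.existsUnique hw₂ (g := g) (c := c)
    (fun e w x h A D => (t₂ h A D).comp χ₁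
      ((Category.assoc _ _ _).symm.trans (congrArg (· ≫ g) (e₂ h))))
    (fun e e' z k w x h A D w' x' h' hw hx => by
      subst hw hx
      refine Eq.trans ?_ (Category.assoc _ _ _)
      refine congrArg (· ≫ χ₁.1) ?_
      refine meet_meet_ext' (D' := k.comp (t₂ h A D) rfl) (by simp [prod.comp_lift]) ?_ ?_ ?_ <;>
        simp [t₂])
  let r : HomOver p (𝟙 _) (meet prod.snd (meet prod.fst b₁ prod.snd b₂) (𝟙 _) d)
      (meet w₂ b₂ (𝟙 _) (meet (𝟙 _) d (prod.snd ≫ prod.fst) b₁)) :=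
    meetLift ((meetFst _ _ _ _).comp (meetSnd _ _ _ _) rfl) (meetLift (meetSnd _ _ _ _)
      ((meetFst _ _ _ _).comp (meetFst _ _ _ _) rfl) (Category.comp_id _) (Category.id_comp _))
      (Category.id_comp _) (Category.id_comp _)
  let E := meet prod.snd (meet prod.fst a₁ prod.snd a₂) (prod.map (𝟙 G) (prod.map f₁ f₂)) d
  let A₁ : HomOver p (prod.snd ≫ prod.fst) E a₁ := (meetFst _ _ _ _).comp (meetFst _ _ _ _) rfl
  let A₂ : HomOver p (prod.snd ≫ prod.snd) E a₂ := (meetFst _ _ _ _).comp (meetSnd _ _ _ _) rfl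
  let D₁ : HomOver p (prod.map (𝟙 G) (prod.map f₁ (𝟙 X₂))) E
      (meet m₁ d (prod.snd ≫ prod.snd) a₂) :=
    meetLift (meetSnd _ _ _ _) A₂ (by simp [m₁]) (by simp)
  let D₂ : HomOver p (prod.map (𝟙 G) (prod.map f₁ f₂)) E (meet (𝟙 _) d (prod.snd ≫ prod.fst) b₁) :=
    meetLift (meetSnd _ _ _ _) (A₁.comp φ₁ rfl) (Category.comp_id _) (by simp)
  have hE₁ : prod.map (𝟙 G) (prod.map f₁ (𝟙 X₂)) ≫ w₁ = (prod.snd ≫ prod.fst) ≫ f₁ := by simp [w₁]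
  have hE₂ : prod.map (𝟙 G) (prod.map f₁ f₂) ≫ w₂ = (prod.snd ≫ prod.snd) ≫ f₂ := by simp [w₂]
  have hr : (meetLift (x := w₂) (y := 𝟙 _) (A₂.comp φ₂ rfl) D₂ hE₂ (Category.comp_id _)).1 =
      (canon (map_snd_sq G (prod.map f₁ f₂)) (FibCat.box φ₁ φ₂) d).1 ≫ r.1 := by
    refine meet_meet_ext' (D' := (canon (map_snd_sq G (prod.map f₁ f₂)) (FibCat.box φ₁ φ₂) d).comp r
      rfl) (by simp) ?_ ?_ ?_ <;> simp [r, canon, FibCat.box, A₁, A₂, D₂]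
  have eχ : (canon (map_snd_sq G (prod.map f₁ f₂)) (FibCat.box φ₁ φ₂) d).1 ≫ r.1 ≫ χ₂.1 = ψ.1 := by
    refine (Category.assoc _ _ _).symm.trans ((congrArg (· ≫ χ₂.1) hr.symm).trans ?_)
    refine (hχ₂ E _ _ hE₂ A₂ D₂).trans ?_
    refine Eq.trans (congrArg (· ≫ χ₁.1) ?_) ((hχ₁ E _ _ hE₁ A₁ D₁).trans ?_)
    · refine meet_meet_ext' (D := t₂ hE₂ A₂ D₂) ?_ ?_ ?_ ?_
      · refine Limits.prod.hom_ext ?_ (Limits.prod.hom_ext ?_ ?_) <;>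
          simp [prod.lift_fst, prod.lift_snd]
      all_goals simp [t₂, D₁, D₂]
    · refine (congrArg (· ≫ ψ.1) ?_).trans (Category.id_comp _)
      refine meet_meet_ext (D := t₁ hE₁ A₁ D₁) (D' := HomOver.id _) ?_ ?_ ?_ ?_
      · refine Limits.prod.hom_ext ?_ (Limits.prod.hom_ext ?_ ?_) <;>
          simp [prod.lift_fst, prod.lift_snd]
      all_goals simp [t₁, A₁, D₁, A₂]
  refine ⟨r.comp χ₂ (Category.id_comp _), eχ, fun χ' hχ' => ?_⟩
  let j : HomOver p (𝟙 _) (meet w₂ b₂ (𝟙 _) (meet (𝟙 _) d (prod.snd ≫ prod.fst) b₁))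
      (meet prod.snd (meet prod.fst b₁ prod.snd b₂) (𝟙 _) d) :=
    meetLift (meetLift ((meetSnd _ _ _ _).comp (meetSnd _ _ _ _) (Category.id_comp _))
      (meetFst _ _ _ _) rfl rfl) ((meetSnd _ _ _ _).comp (meetFst _ _ _ _) rfl)
      (Category.id_comp _) rfl
  let s : HomOver p m₁ (meet w₁ b₁ (𝟙 _) (meet m₁ d (prod.snd ≫ prod.snd) a₂))
      (meet prod.snd (meet prod.fst b₁ prod.snd b₂) (𝟙 _) d) :=
    meetLift (z₁ := prod.snd ≫ prod.map (𝟙 _) f₂) (meetLift (z₂ := prod.snd ≫ prod.snd ≫ f₂)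
      (meetFst _ _ _ _) (((meetSnd _ _ _ _).comp
      (meetSnd _ _ _ _) (Category.id_comp _)).comp φ₂ (Category.assoc _ _ _)) (by simp [w₁])
      (by simp)) ((meetSnd _ _ _ _).comp (meetFst _ _ _ _) (Category.id_comp _)) (by simp [m₁])
      (Category.comp_id _)
  have hs : s.comp χ' rfl = χ₁ := by
    refine h₁.proj_hom_ext hw₁ fun e w x h A D => ?_
    refine Eq.trans ?_ (hχ₁ e w x h A D).symm
    refine (Category.assoc _ _ _).symm.trans (Eq.trans (congrArg (· ≫ χ'.1) ?_)
      ((Category.assoc _ _ _).trans (congrArg ((t₁ h A D).1 ≫ ·) hχ')))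
    refine meet_meet_ext (D := (meetLift (x := w₁) (y := 𝟙 _) (A.comp φ₁ rfl) D h
      (Category.comp_id w)).comp s rfl) (D' := (t₁ h A D).comp (canon _ (FibCat.box φ₁ φ₂) d) rfl)
      (e₁ h).symm ?_ ?_ ?_ <;> simp [s, t₁, canon, FibCat.box]
  have hj : j.comp χ' (Category.id_comp _) = χ₂ := by
    refine h₂.proj_hom_ext hw₂ fun e w x h A D => ?_
    refine Eq.trans ?_ (hχ₂ e w x h A D).symm
    refine (Category.assoc _ _ _).symm.trans (Eq.trans (congrArg (· ≫ χ'.1) ?_)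
      ((Category.assoc _ _ _).trans (congrArg ((t₂ h A D).1 ≫ ·) (congrArg Subtype.val hs))))
    refine meet_meet_ext (D := (meetLift (x := w₂) (y := 𝟙 _) (A.comp φ₂ rfl) D h
      (Category.comp_id w)).comp j rfl) (D' := (t₂ h A D).comp s rfl)
      ((Category.comp_id _).trans (e₂ h).symm) ?_ ?_ ?_ <;> simp [s, t₂, j]
  have hrj : r.1 ≫ j.1 = 𝟙 _ := by
    refine meet_meet_ext (D := r.comp j rfl) (D' := HomOver.id _) (Category.comp_id _) ?_ ?_ ?_ <;>
      simp [r, j]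
  refine HomOver.ext (Eq.symm ?_)
  refine (congrArg (r.1 ≫ ·) (congrArg Subtype.val hj).symm).trans ?_
  exact (Category.assoc _ _ _).symm.trans ((congrArg (· ≫ χ'.1) hrj).trans (Category.id_comp _))

end

end FibCat

end

noncomputable section

namespace FibCat

open CategoryTheory.Functor

variable {B : Type u} [Category.{v} B] {E : Type w} [Category.{x} E] {p : E ⥤ B}
  [HasFiniteProducts B]

/-- The generic generalized element of a loose arrow. -/
def idPt {I J : B} (α : Rel p I J) : Pts α (.single α) prod.fst prod.snd :=
  .cons ((HomOver.id α).cast prod.lift_fst_snd.symm) (.nil _ _ rfl)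

theorem pre_idPt {Z I J : B} {e : p.Fiber Z} {α : Rel p I J} {s : Z ⟶ I} {t : Z ⟶ J}
    (P : Pts e (.single α) s t) :
    (idPt α).pre P.arrow (prod.lift_fst _ _) (prod.lift_snd _ _) = P := by
  refine Eq.trans ?_ P.cons_arrow
  refine (Pts.pre_cons P.arrow _ _ _ _ (prod.lift_snd _ _)).trans ?_
  congr 1
  exact HomOver.ext (Category.comp_id _)

theorem lift_fst_comp_snd_comp {I J K M : B} (s : I ⟶ K) (t : J ⟶ M) :
    prod.lift (prod.fst ≫ s) (prod.snd ≫ t) = prod.map s t := prod.lift_fst_comp_snd_comp _ _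

variable [p.IsFibered] [∀ X : B, HasFiniteProducts (p.Fiber X)]
  [∀ {X Y : B} (f : X ⟶ Y), PreservesFiniteProducts (baseChange p f)]

/-- The arrow of the total category which corresponds to a cell with one-step domain. -/
def sarr {I J K M : B} {α : Rel p I J} {s : I ⟶ K} {t : J ⟶ M} {β : Rel p K M}
    (ξ : (bilGraph p).Cell (.single α) s t β) : HomOver p (prod.map s t) α β :=
  (act ξ (idPt α) rfl rfl).cast (lift_fst_comp_snd_comp s t)

theorem lift_map_eq {Z I J K M : B} {s : I ⟶ K} {t : J ⟶ M} {a : Z ⟶ I} {b : Z ⟶ J} {a' : Z ⟶ K}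
    {b' : Z ⟶ M} (ha : a ≫ s = a') (hb : b ≫ t = b') :
    prod.lift a b ≫ prod.map s t = prod.lift a' b' := by rw [prod.lift_map, ha, hb]

theorem act_single {I J K M : B} {α : Rel p I J} {s : I ⟶ K} {t : J ⟶ M} {β : Rel p K M}
    (ξ : (bilGraph p).Cell (.single α) s t β) {Z : B} {e : p.Fiber Z} {a : Z ⟶ I} {b : Z ⟶ J}
    (P : Pts e (.single α) a b) {a' : Z ⟶ K} {b' : Z ⟶ M} (ha : a ≫ s = a') (hb : b ≫ t = b') :
    act ξ P ha hb = P.arrow.comp (sarr ξ) (lift_map_eq ha hb) := by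
  have H := act_pre ξ P.arrow (idPt α) rfl rfl (prod.lift_fst a b) (prod.lift_snd a b) ha hb
    (by rw [prod.lift_fst_assoc, ha]) (by rw [prod.lift_snd_assoc, hb])
  rw [pre_idPt] at H
  exact H

/-- The cell which corresponds to an arrow of the total category. -/
def mkSingle {I J K M : B} {α : Rel p I J} {s : I ⟶ K} {t : J ⟶ M} {β : Rel p K M}
    (a : HomOver p (prod.map s t) α β) : (bilGraph p).Cell (.single α) s t β :=
  mkCell ((gen (.single α)).arrow.comp a (lift_map_eq rfl rfl))

@[simp]
theorem sarr_mkSingle {I J K M : B} {α : Rel p I J} {s : I ⟶ K} {t : J ⟶ M} {β : Rel p K M}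
    (a : HomOver p (prod.map s t) α β) : sarr (mkSingle a) = a := by
  refine HomOver.ext ((act_mkCell _ (idPt α) rfl rfl).trans ((Category.assoc _ _ _).symm.trans ?_))
  refine Eq.trans ?_ (Category.id_comp a.1)
  refine congrArg (· ≫ a.1) ?_
  refine (arrow_pre (toCtx (idPt α)) (gen (.single α)) (Pts.pt_first _)
    (Pts.pt_last _)).symm.trans ?_
  rw [pre_toCtx]
  rfl

theorem single_ext {I J K M : B} {α : Rel p I J} {s : I ⟶ K} {t : J ⟶ M} {β : Rel p K M}
    {ξ ζ : (bilGraph p).Cell (.single α) s t β} (h : (sarr ξ).1 = (sarr ζ).1) : ξ = ζ := by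
  refine cell_ext ?_
  rw [act_single, act_single, HomOver.ext h]

theorem sarr_cast {I J K M : B} {α : Rel p I J} {s s' : I ⟶ K} {t t' : J ⟶ M} {β : Rel p K M}
    (ξ : (bilGraph p).Cell (.single α) s t β) (hs : s = s') (ht : t = t') :
    (sarr ((bilGraph p).cast rfl hs ht ξ)).1 = (sarr ξ).1 := by
  subst hs ht; rfl

@[simp]
theorem sarr_idCell {I J : B} (α : Rel p I J) : (sarr ((bilStr p).idCell α)).1 = 𝟙 α.1 :=
  congrArg Subtype.val (act_idCell (idPt α) rfl rfl)

/-- The composition of a cell with a cell with one-step domain. -/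
theorem act_comp_single {I J K M K' M' : B} {α : LPath (Rel p) I J} {s : I ⟶ K} {t : J ⟶ M}
    {β : Rel p K M} {s' : K ⟶ K'} {t' : M ⟶ M'} {γ : Rel p K' M'} {u : I ⟶ K'} {u' : J ⟶ M'}
    (ξ : (bilGraph p).Cell α s t β)
    (ζ : (bilGraph p).Cell (.single β) s' t' γ) (h : s ≫ s' = u) (h' : t ≫ t' = u') {Z : B}
    {e : p.Fiber Z} {a : Z ⟶ I} {b : Z ⟶ J} (P : Pts e α a b) {a' : Z ⟶ K} {b' : Z ⟶ M}
    (ha : a ≫ s = a') (hb : b ≫ t = b') {a'' : Z ⟶ K'} {b'' : Z ⟶ M'}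
    (ha' : a ≫ u = a'') (hb' : b ≫ u' = b'') :
    (act ((bilStr p).comp (.single ξ) ζ h h') P ha' hb').1 = (act ξ P ha hb).1 ≫ (sarr ζ).1 := by
  have e₁ : a' ≫ s' = a'' := by rw [← ha, Category.assoc, h, ha']
  have e₂ : b' ≫ t' = b'' := by rw [← hb, Category.assoc, h', hb']
  rw [act_comp (.single ξ) ζ h h' P ha hb e₁ e₂, actCells_single, act_single]
  rfl

theorem sarr_comp {I J K M K' M' : B} {α : Rel p I J} {s : I ⟶ K} {t : J ⟶ M}
    {β : Rel p K M} {s' : K ⟶ K'} {t' : M ⟶ M'} {γ : Rel p K' M'} {u : I ⟶ K'} {u' : J ⟶ M'}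
    (ξ : (bilGraph p).Cell (.single α) s t β)
    (ζ : (bilGraph p).Cell (.single β) s' t' γ) (h : s ≫ s' = u) (h' : t ≫ t' = u') :
    (sarr ((bilStr p).comp (.single ξ) ζ h h')).1 = (sarr ξ).1 ≫ (sarr ζ).1 :=
  act_comp_single ξ ζ h h' (idPt α) rfl rfl rfl rfl

theorem vertHom_ext {α β : (bil p).Vert} {f g : α ⟶ β} (hl : VDC.VertHom.left f = g.left)
    (hr : VDC.VertHom.right f = g.right) (h : (sarr (VDC.VertHom.cell f)).1 = (sarr g.cell).1) :
    f = g :=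
  VDC.VertHom.ext_cast hl hr (single_ext ((sarr_cast _ _ _).trans h))

theorem vdTrans_ext {D : VDC.{u, v, w, x}} {F G : VDFunctor D (bil p)} {θ φ : VDTrans F G}
    (h : ∀ I, θ.tight.app I = φ.tight.app I)
    (h' : ∀ {I J : D.Ob} (α : D.Loose I J), (sarr (θ.cell α)).1 = (sarr (φ.cell α)).1) : θ = φ :=
  VDTrans.ext_vert h (fun α => vertHom_ext (h _) (h _) (h' α.loose))

section Trans

variable {D : VDGraph.{u, v, w, x}} {P Q : D.Ob → B}
  (lP : ∀ {I J : D.Ob}, D.Loose I J → Rel p (P I) (P J))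
  (lQ : ∀ {I J : D.Ob}, D.Loose I J → Rel p (Q I) (Q J)) (app : ∀ I, P I ⟶ Q I)
  (cell : ∀ {I J : D.Ob} (α : D.Loose I J),
    (bilGraph p).Cell (.single (lP α)) (app I) (app J) (lQ α))

theorem actCells_transCells_cons {I J K : D.Ob} (α : D.Loose I J) (q : LPath D.Loose J K) {Z : B}
    {e : p.Fiber Z} {s : Z ⟶ P I} {m : Z ⟶ P J} {t : Z ⟶ P K}
    (a : HomOver p (prod.lift s m) e (lP α)) (as : Pts e (q.map P lP) m t) {s' : Z ⟶ Q I}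
    {m' : Z ⟶ Q J} {t' : Z ⟶ Q K} (hs : s ≫ app I = s') (hm : m ≫ app J = m')
    (ht : t ≫ app K = t') :
    actCells (VDGraph.transCells (E := bilGraph p) lP lQ app cell (.cons α q))
        (Pts.cons a as : Pts e ((LPath.cons α q).map P lP) s t) hs ht =
      .cons (a.comp (sarr (cell α)) (lift_map_eq hs hm))
        (actCells (VDGraph.transCells (E := bilGraph p) lP lQ app cell q) as hm ht) := by
  refine (actCells_cons (cell α) _ rfl (.cons a (.nil _ _ rfl)) as hs hm ht).trans ?_
  rw [act_single]
  rfl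

theorem actCells_transCells_inv (app' : ∀ I, Q I ⟶ P I)
    (cell' : ∀ {I J : D.Ob} (α : D.Loose I J),
      (bilGraph p).Cell (.single (lQ α)) (app' I) (app' J) (lP α))
    (h : ∀ {I J : D.Ob} (α : D.Loose I J), (sarr (cell' α)).1 ≫ (sarr (cell α)).1 = 𝟙 _)
    (h₀ : ∀ I, app' I ≫ app I = 𝟙 _)
    {I J : D.Ob} (α : LPath D.Loose I J) {Z : B} {e : p.Fiber Z} {s : Z ⟶ Q I} {t : Z ⟶ Q J}
    (R : Pts e (α.map Q lQ) s t) {s' : Z ⟶ P I} {t' : Z ⟶ P J} (hs : s ≫ app' I = s')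
    (ht : t ≫ app' J = t') (hs' : s' ≫ app I = s) (ht' : t' ≫ app J = t) :
    actCells (VDGraph.transCells (E := bilGraph p) lP lQ app cell α)
      (actCells (VDGraph.transCells (E := bilGraph p) lQ lP app' cell' α) R hs ht) hs' ht' = R := by
  induction α with
  | nil => exact Pts.nil_uniq _ _
  | @cons I J K α q ih =>
    obtain ⟨m, a, as, rfl⟩ := Pts.exists_cons R
    have hm : (m ≫ app' J) ≫ app J = m := by rw [Category.assoc, h₀, Category.comp_id]
    rw [actCells_transCells_cons lQ lP app' cell' α q a as hs rfl ht,
      actCells_transCells_cons lP lQ app cell α q _ _ hs' hm ht', ih]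
    congr 1
    refine HomOver.ext ((Category.assoc _ _ _).trans ?_)
    exact (congrArg (a.1 ≫ ·) (h α)).trans (Category.comp_id _)

end Trans

/-- The inverse of a transformation with invertible components. -/
def vdInv {D : VDC.{u, v, w, x}} {F G : VDFunctor D (bil p)} (θ : VDTrans F G)
    (t : G.tight ⟶ F.tight) (h₀ : ∀ I, t.app I ≫ θ.tight.app I = 𝟙 _)
    (c : ∀ {I J : D.Ob} (α : D.Loose I J),
      HomOver p (prod.map (t.app I) (t.app J)) (G.loose α) (F.loose α))
    (h : ∀ {I J : D.Ob} (α : D.Loose I J), HomOver.IsInv (sarr (θ.cell α)) (c α)) :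
    VDTrans G F where
  tight := t
  cell α := mkSingle (c α)
  naturality {I J K M α s s' β} ξ := by
    have e₁ : ∀ {X Y : D.Ob} (r : X ⟶ Y), (t.app X ≫ F.tight.map r) ≫ θ.tight.app Y =
        G.tight.map r := fun {X Y} r => by
      rw [Category.assoc, θ.tight.naturality, ← Category.assoc, h₀, Category.id_comp]
    refine cell_ext (HomOver.ext ?_)
    have hh : ∀ {Z : B} {X Y : D.Ob} (z : Z ⟶ G.tight.obj X) (r : X ⟶ Y),
        (z ≫ t.app X) ≫ F.tight.map r = z ≫ G.tight.map r ≫ t.app Y := fun z r => by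
      rw [Category.assoc, t.naturality]
    let R := gen (G.path α)
    let R' := actCells (VDGraph.transCells (E := bilGraph p) G.loose F.loose t.app
      (fun α => mkSingle (c α)) α) R rfl rfl
    refine (congrArg Subtype.val (act_comp (VDGraph.transCells (E := bilGraph p) G.loose F.loose
      t.app (fun α => mkSingle (c α)) α) (F.cell ξ) (t.naturality s).symm
      (t.naturality s').symm R rfl rfl (hh _ _) (hh _ _) rfl rfl)).trans ?_
    refine Eq.trans ?_ (act_comp_single (G.cell ξ) (mkSingle (c β)) rfl rfl R rfl rfl rfl rfl).symm
    have e₂ : ∀ {Z : B} {X Y : D.Ob} (z : Z ⟶ G.tight.obj X) (r : X ⟶ Y),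
        (z ≫ t.app X) ≫ F.tight.map r ≫ θ.tight.app Y = z ≫ G.tight.map r := fun {_ X Y} z r => by
      rw [← e₁ r, Category.assoc, Category.assoc]
    have e₃ : ∀ {Z : B} {X : D.Ob} (z : Z ⟶ G.tight.obj X),
        (z ≫ t.app X) ≫ θ.tight.app X = z := fun z => by
      rw [Category.assoc, h₀, Category.comp_id]
    have N := congrArg (fun ζ => (act ζ R' (e₂ (first p (G.path α)) s)
      (e₂ (last p (G.path α)) s')).1) (θ.naturality ξ)
    have N₂ := act_comp_single (F.cell ξ) (θ.cell β) rfl rfl R' (hh _ _) (hh _ _)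
      (e₂ (first p (G.path α)) s) (e₂ (last p (G.path α)) s')
    have N₁ := congrArg Subtype.val (act_comp (VDGraph.transCells (E := bilGraph p) F.loose G.loose
      θ.tight.app θ.cell α) (G.cell ξ) (θ.tight.naturality s).symm (θ.tight.naturality s').symm R'
      (e₃ _) (e₃ _) rfl rfl (e₂ (first p (G.path α)) s) (e₂ (last p (G.path α)) s'))
    have N₃ : actCells (VDGraph.transCells (E := bilGraph p) F.loose G.loose
      θ.tight.app θ.cell α) R' (e₃ _) (e₃ _) = R :=
      actCells_transCells_inv F.loose G.loose θ.tight.app θ.cell t.app (fun α => mkSingle (c α))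
        (fun α => by rw [sarr_mkSingle]; exact (h α).inv_hom) h₀ α R rfl rfl (e₃ _) (e₃ _)
    rw [N₃] at N₁
    have N₄ := N₁.symm.trans (N.trans N₂)
    refine Eq.trans ?_ (congrArg (· ≫ (sarr (mkSingle (c β))).1) N₄).symm
    refine Eq.trans ?_ (Category.assoc _ _ _).symm
    rw [sarr_mkSingle, (h β).hom_inv]
    exact (Category.comp_id _).symm

/-- A transformation is invertible if its components are invertible. -/
def vdIso {D : VDC.{u, v, w, x}} {F G : VDFunctor D (bil p)} (θ : VDTrans F G)
    (t : G.tight ⟶ F.tight) (h₀ : ∀ I, t.app I ≫ θ.tight.app I = 𝟙 _)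
    (h₀' : ∀ I, θ.tight.app I ≫ t.app I = 𝟙 _)
    (c : ∀ {I J : D.Ob} (α : D.Loose I J),
      HomOver p (prod.map (t.app I) (t.app J)) (G.loose α) (F.loose α))
    (h : ∀ {I J : D.Ob} (α : D.Loose I J), HomOver.IsInv (sarr (θ.cell α)) (c α)) : F ≅ G where
  hom := θ
  inv := vdInv θ t h₀ c h
  hom_inv_id := vdTrans_ext h₀' (fun α => (sarr_comp (θ.cell α) (mkSingle (c α)) rfl rfl).trans
    ((congrArg (fun y => (sarr (θ.cell α)).1 ≫ y.1) (sarr_mkSingle (c α))).trans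
      ((h α).hom_inv.trans (sarr_idCell _).symm)))
  inv_hom_id := vdTrans_ext h₀ (fun α => (sarr_comp (mkSingle (c α)) (θ.cell α) rfl rfl).trans
    ((congrArg (fun y => y.1 ≫ (sarr (θ.cell α)).1) (sarr_mkSingle (c α))).trans
      ((h α).inv_hom.trans (sarr_idCell _).symm)))

end FibCat

end

noncomputable section

namespace FibCat

open CategoryTheory.Functor

variable {B : Type u} [Category.{v} B] {E : Type w} [Category.{x} E] {p : E ⥤ B}
  [HasFiniteProducts B]

theorem HomOver.isCartesian_comp [p.IsFibered] {X Y Z : B} {f : X ⟶ Y} {g : Y ⟶ Z} {k : X ⟶ Z}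
    {a : p.Fiber X} {b : p.Fiber Y} {c : p.Fiber Z} (φ : HomOver p f a b) (ψ : HomOver p g b c)
    (h : f ≫ g = k) [p.IsCartesian f φ.1] [p.IsCartesian g ψ.1] :
    p.IsCartesian k (φ.comp ψ h).1 := by
  subst h
  exact inferInstanceAs (p.IsCartesian (f ≫ g) (φ.1 ≫ ψ.1))

theorem inv_prodComparison_comp {C D E : Type*} [Category* C] [Category* D] [Category* E]
    [HasFiniteProducts C] [HasFiniteProducts D] [HasFiniteProducts E] (F : C ⥤ D) (G : D ⥤ E)
    [PreservesFiniteProducts F] [PreservesFiniteProducts G] [PreservesFiniteProducts (F ⋙ G)]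
    (X Y : C) : inv (prodComparison G (F.obj X) (F.obj Y)) ≫ G.map (inv (prodComparison F X Y)) =
      inv (prodComparison (F ⋙ G) X Y) := by
  refine IsIso.eq_inv_of_hom_inv_id ?_
  rw [prodComparison_comp, Category.assoc, IsIso.hom_inv_id_assoc, ← G.map_comp,
    IsIso.hom_inv_id, G.map_id]

/-- Transport of a generalized element along an equality of paths. -/
def Pts.castPath {Z : B} {e : p.Fiber Z} {I J : B} {α α' : LPath (Rel p) I J} (h : α = α')
    {s : Z ⟶ I} {t : Z ⟶ J} (R : Pts e α s t) : Pts e α' s t :=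
  h ▸ R

theorem Pts.castPath_cons {Z : B} {e : p.Fiber Z} {I J K : B} {α : Rel p I J}
    {q q' : LPath (Rel p) J K} (h : LPath.cons α q = LPath.cons α q') (h' : q = q') {s : Z ⟶ I}
    {m : Z ⟶ J} {t : Z ⟶ K} (a : HomOver p (prod.lift s m) e α) (as : Pts e q m t) :
    (Pts.cons a as).castPath h = .cons a (as.castPath h') := by
  subst h'; rfl

variable [p.IsFibered] [∀ X : B, HasFiniteProducts (p.Fiber X)]
  [∀ {X Y : B} (f : X ⟶ Y), PreservesFiniteProducts (baseChange p f)]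

theorem act_cast_castPath {I J K M : B} {α α' : LPath (Rel p) I J} (h : α = α') {s : I ⟶ K}
    {t : J ⟶ M} {β : Rel p K M} (ξ : (bilGraph p).Cell α s t β) {Z : B}
    {e : p.Fiber Z} {a : Z ⟶ I} {b : Z ⟶ J} (P : Pts e α a b) {a' : Z ⟶ K} {b' : Z ⟶ M}
    (ha : a ≫ s = a') (hb : b ≫ t = b') :
    act ((bilGraph p).cast h rfl rfl ξ) (P.castPath h) ha hb = act ξ P ha hb := by
  subst h; rfl

@[simp]
theorem sarr_vcomp {D : VDC.{u, v, w, x}} {F G H : VDFunctor D (bil p)} (θ : F ⟶ G) (φ : G ⟶ H)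
    {I J : D.Ob} (α : D.Loose I J) :
    (sarr (VDTrans.cell (θ ≫ φ) α)).1 = (sarr (VDTrans.cell θ α)).1 ≫ (sarr (VDTrans.cell φ α)).1 :=
  sarr_comp (VDTrans.cell θ α) (VDTrans.cell φ α) rfl rfl

end FibCat

namespace CartFib

open FibCat

namespace Mor

variable {P Q : CartFib.{u, v, w, x}} (F : Mor P Q)

/-- The inverse of `relProj`. -/
def relInv {I J : P.Base} (α : Rel P.p I J) :
    HomOver Q.p (prod.lift (F.base.map prod.fst) (F.base.map prod.snd)) (F.fib α) (F.rel α) :=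
  F.mapPt (idPt α).arrow

theorem isInv_relProj {I J : P.Base} (α : Rel P.p I J) :
    HomOver.IsInv (F.relProj α) (F.relInv α) := by
  have h : (F.relInv α).1 ≫ (F.relProj α).1 = 𝟙 _ :=
    (F.mapPt_proj _).trans (F.total.map_id _)
  refine ⟨?_, h⟩
  have hb : F.pcInv I J ≫ prod.lift (F.base.map prod.fst) (F.base.map prod.snd) = 𝟙 _ := by
    rw [prod.comp_lift, pcInv_fst, pcInv_snd, prod.lift_fst_snd]
  refine congrArg Subtype.val (cart_ext (F.relProj α) (φ := (F.relProj α).comp (F.relInv α) hb)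
    (ψ := HomOver.id _) ?_)
  refine (Category.assoc _ _ _).trans ((congrArg ((F.relProj α).1 ≫ ·) h).trans ?_)
  exact (Category.comp_id _).trans (Category.id_comp _).symm

theorem sarr_cell {I J K M : P.Base} {α : Rel P.p I J} {s : I ⟶ K} {t : J ⟶ M} {β : Rel P.p K M}
    (ξ : (bilGraph P.p).Cell (.single α) s t β) :
    (sarr (F.bil.cell ξ)).1 ≫ (F.relProj β).1 = (F.relProj α).1 ≫ F.total.map (sarr ξ).1 := by
  have h₁ := congrArg Subtype.val (F.act_cell ξ (idPt α) rfl rfl)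
  have h₂ := congrArg Subtype.val (act_single (F.cell ξ) (F.mapPts (idPt α))
    (F.map_eq (rfl : prod.fst ≫ s = _)) (F.map_eq (rfl : prod.snd ≫ t = _)))
  have h₃ := h₂.symm.trans h₁
  have h₄ : (F.relInv α).1 ≫ (sarr (F.cell ξ)).1 ≫ (F.relProj β).1 = F.total.map (sarr ξ).1 := by
    refine (Category.assoc _ _ _).symm.trans ((congrArg (· ≫ (F.relProj β).1) ?_).trans
      (F.mapPt_proj (act ξ (idPt α) rfl rfl)))
    refine Eq.trans ?_ h₃
    exact congrArg (fun y : HomOver Q.p _ _ _ => y.1 ≫ (sarr (F.cell ξ)).1)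
      (F.arrow_mapPts (idPt α)).symm
  refine Eq.trans ?_ (congrArg ((F.relProj α).1 ≫ ·) h₄)
  exact ((F.isInv_relProj α).hom_inv_assoc _).symm

end Mor

theorem Trans.sarr_cell {P Q : CartFib.{u, v, w, x}} {F G : Mor P Q} (θ : Trans F G) {I J : P.Base}
    (α : Rel P.p I J) :
    (sarr (θ.bil.cell α)).1 ≫ (G.relProj α).1 = (F.relProj α).1 ≫ θ.total.app α.1 := by
  refine (congrArg (fun y : HomOver Q.p _ _ _ => y.1 ≫ (G.relProj α).1)
    (θ.act_cell α (idPt (F.rel α)) rfl rfl)).trans ?_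
  refine (θ.pt_proj _ _ _).trans ?_
  refine congrArg (· ≫ θ.total.app α.1) ?_
  exact Category.id_comp _

namespace Mor

theorem naturality_of_act {P Q : CartFib.{u, v, w, x}} (F : Mor P Q)
    (H : VDFunctor (FibCat.bil P.p) (FibCat.bil Q.p)) (t : F.base ⟶ H.tight)
    (cell : ∀ {I J : P.Base} (α : Rel P.p I J),
      (bilGraph Q.p).Cell (.single (F.rel α)) (t.app I) (t.app J) (H.loose α))
    {I J K M : P.Base} {α : LPath (Rel P.p) I J} {s : I ⟶ K} {s' : J ⟶ M} {β : Rel P.p K M}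
    (ξ : (bilGraph P.p).Cell α s s' β) {a : F.base.obj (FibCat.base P.p α) ⟶ H.tight.obj I}
    {b : F.base.obj (FibCat.base P.p α) ⟶ H.tight.obj J}
    (N : Pts (F.fib (ctx P.p α)) (H.path α) a b)
    (ha : F.base.map (first P.p α) ≫ t.app I = a) (hb : F.base.map (last P.p α) ≫ t.app J = b)
    (hN : actCells (VDGraph.transCells (D := bilGraph P.p) (E := bilGraph Q.p) F.rel H.loose t.app
      cell α) (F.mapPts (gen α)) ha hb = N)
    (hξ : (act (H.cell ξ) N rfl rfl).1 = (F.mapPt (act ξ (gen α) rfl rfl)).1 ≫ (sarr (cell β)).1) :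
    (FibCat.bil Q.p).comp (VDGraph.transCells (D := bilGraph P.p) (E := bilGraph Q.p) F.rel H.loose
      t.app cell α) (H.cell ξ) (t.naturality s).symm (t.naturality s').symm =
      (FibCat.bil Q.p).comp (.single (F.bil.cell ξ)) (cell β) rfl rfl := by
  have e : ∀ {X Y Z : P.Base} (f : X ⟶ Y) (g : Y ⟶ Z),
      (F.base.map f ≫ t.app Y) ≫ H.tight.map g = F.base.map f ≫ F.base.map g ≫ t.app Z :=
    fun f g => by rw [Category.assoc, t.naturality]
  subst ha hb
  refine F.cell_ext (HomOver.ext ?_)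
  refine (congrArg Subtype.val (act_comp (VDGraph.transCells (D := bilGraph P.p)
    (E := bilGraph Q.p) F.rel H.loose t.app cell α) (H.cell ξ) (t.naturality s).symm
    (t.naturality s').symm (F.mapPts (gen α)) rfl rfl (e (first P.p α) s) (e (last P.p α) s')
    rfl rfl)).trans ?_
  refine (congrArg (fun R => (act (H.cell ξ) R (e (first P.p α) s) (e (last P.p α) s')).1)
    hN).trans (hξ.trans ?_)
  refine Eq.trans ?_ (act_comp_single (F.cell ξ) (cell β) rfl rfl (F.mapPts (gen α))
    (F.map_eq rfl) (F.map_eq rfl) rfl rfl).symm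
  refine congrArg (fun y : HomOver Q.p _ _ _ => y.1 ≫ (sarr (cell β)).1) ?_
  exact (F.act_cell ξ (gen α) rfl rfl).symm

section

variable (P : CartFib.{u, v, w, x})

theorem pcInv_id (I J : P.Base) :
    (Mor.id P).pcInv I J = prod.map (𝟙 I) (𝟙 J) := by
  refine Limits.prod.hom_ext ?_ ?_
  · exact ((Mor.id P).pcInv_fst I J).trans ((prod.map_fst _ _).trans (Category.comp_id _)).symm
  · exact ((Mor.id P).pcInv_snd I J).trans ((prod.map_snd _ _).trans (Category.comp_id _)).symm

def idComparison {I J : P.Base} (α : Rel P.p I J) :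
    HomOver P.p (prod.map (𝟙 I) (𝟙 J)) ((Mor.id P).rel α) α :=
  ((Mor.id P).relProj α).cast (pcInv_id P I J)

theorem actCells_idComparison {Z : P.Base} {e : P.p.Fiber Z} {I J : P.Base}
    {α : LPath (Rel P.p) I J} {s : Z ⟶ I} {t : Z ⟶ J} (R : Pts e α s t)
    (hs : s ≫ 𝟙 I = s) (ht : t ≫ 𝟙 J = t) :
    actCells (VDGraph.transCells (D := bilGraph P.p) (E := bilGraph P.p) (Mor.id P).rel
      (fun α => α) (fun I => 𝟙 I) (fun α => mkSingle (idComparison P α)) α)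
      ((Mor.id P).mapPts R) hs ht = R.castPath (LPath.map_id α).symm := by
  induction R with
  | nil => exact Pts.nil_uniq _ _
  | @cons _ _ _ α q _ m _ a as ih =>
    refine (actCells_transCells_cons (D := bilGraph P.p) (Mor.id P).rel
      (fun α => α) (fun I => 𝟙 I) (fun α => mkSingle (idComparison P α)) α q
      ((Mor.id P).mapPt a) ((Mor.id P).mapPts as) hs (Category.comp_id _) ht).trans ?_
    refine Eq.trans ?_ (Pts.castPath_cons _ (LPath.map_id q).symm a as).symm
    refine congrArg₂ Pts.cons ?_ (ih _ _)
    refine HomOver.ext ?_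
    exact (congrArg (fun y : HomOver P.p _ _ _ => ((Mor.id P).mapPt a).1 ≫ y.1)
      (sarr_mkSingle (idComparison P α))).trans ((Mor.id P).mapPt_proj a)

def idTrans : VDTrans (Mor.id P).bil (VDFunctor.id (FibCat.bil P.p)) where
  tight := 𝟙 _
  cell α := mkSingle (idComparison P α)
  naturality {I J K M α s s' β} ξ := by
    refine (Mor.id P).naturality_of_act (VDFunctor.id (FibCat.bil P.p)) (𝟙 _)
      (fun α => mkSingle (idComparison P α)) ξ ((gen α).castPath (LPath.map_id α).symm)
      (Category.comp_id _) (Category.comp_id _) (actCells_idComparison P (gen α) _ _) ?_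
    refine (congrArg Subtype.val (act_cast_castPath (LPath.map_id α).symm ξ (gen α)
      rfl rfl)).trans ?_
    exact ((congrArg (fun y : HomOver P.p _ _ _ =>
      ((Mor.id P).mapPt (act ξ (gen α) rfl rfl)).1 ≫ y.1)
      (sarr_mkSingle (idComparison P β))).trans ((Mor.id P).mapPt_proj _)).symm

theorem prod_map_id (I J : P.Base) : prod.map (𝟙 I) (𝟙 J) = 𝟙 (I ⨯ J) := by simp

def bilId : (Mor.id P).bil ≅ VDFunctor.id (FibCat.bil P.p) :=
  vdIso (idTrans P) (𝟙 _) (fun _ => Category.comp_id _) (fun _ => Category.comp_id _)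
    (fun {I J} α => ((Mor.id P).relInv α).cast
      ((prod.lift_fst_snd (X := I) (Y := J)).trans (prod_map_id P I J).symm))
    (fun α => by
      have h := (Mor.id P).isInv_relProj α
      refine ⟨?_, ?_⟩
      · exact (congrArg (fun y : HomOver P.p _ _ _ => y.1 ≫ ((Mor.id P).relInv α).1)
          (sarr_mkSingle (idComparison P α))).trans h.hom_inv
      · exact (congrArg (fun y : HomOver P.p _ _ _ => ((Mor.id P).relInv α).1 ≫ y.1)
          (sarr_mkSingle (idComparison P α))).trans h.inv_hom)

end

section

variable {P Q R : CartFib.{u, v, w, x}} (F : Mor P Q) (G : Mor Q R)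

theorem pcInv_comp (I J : P.Base) : G.pcInv (F.base.obj I) (F.base.obj J) ≫
    G.base.map (F.pcInv I J) = (F.comp G).pcInv I J :=
  inv_prodComparison_comp F.base G.base I J

/-- The projection of the iterated action on a loose arrow. -/
def compProj {I J : P.Base} (α : Rel P.p I J) :
    HomOver R.p ((F.comp G).pcInv I J) (G.rel (F.rel α)) ((F.comp G).fib α) :=
  (G.relProj (F.rel α)).comp (G.homMap (F.relProj α)) (pcInv_comp F G I J)

instance {I J : P.Base} (α : Rel P.p I J) :
    R.p.IsCartesian ((F.comp G).pcInv I J) (compProj F G α).1 := by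
  exact HomOver.isCartesian_comp (G.relProj (F.rel α)) (G.homMap (F.relProj α))
    (pcInv_comp F G I J)

def comparison {I J : P.Base} (α : Rel P.p I J) :
    HomOver R.p (prod.map (𝟙 _) (𝟙 _)) ((F.comp G).rel α) (G.rel (F.rel α)) :=
  cartLift (compProj F G α) ((F.comp G).relProj α)
    ((congrArg (· ≫ (F.comp G).pcInv I J) (prod_map_id R _ _)).trans (Category.id_comp _))

def comparisonInv {I J : P.Base} (α : Rel P.p I J) :
    HomOver R.p (prod.map (𝟙 _) (𝟙 _)) (G.rel (F.rel α)) ((F.comp G).rel α) :=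
  cartLift ((F.comp G).relProj α) (compProj F G α)
    ((congrArg (· ≫ (F.comp G).pcInv I J) (prod_map_id R _ _)).trans (Category.id_comp _))

theorem comparison_proj {I J : P.Base} (α : Rel P.p I J) :
    (comparison F G α).1 ≫ (G.relProj (F.rel α)).1 ≫ G.total.map (F.relProj α).1 =
      ((F.comp G).relProj α).1 :=
  cartLift_fac (compProj F G α) _ _

theorem comparisonInv_proj {I J : P.Base} (α : Rel P.p I J) :
    (comparisonInv F G α).1 ≫ ((F.comp G).relProj α).1 =
      (G.relProj (F.rel α)).1 ≫ G.total.map (F.relProj α).1 :=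
  cartLift_fac ((F.comp G).relProj α) _ _

theorem isInv_comparison {I J : P.Base} (α : Rel P.p I J) :
    HomOver.IsInv (comparison F G α) (comparisonInv F G α) := by
  have e : prod.map (𝟙 _) (𝟙 _) ≫ prod.map (𝟙 _) (𝟙 _) =
    𝟙 ((F.comp G).base.obj I ⨯ (F.comp G).base.obj J) := by rw [prod_map_id, Category.comp_id]
  constructor
  · refine congrArg Subtype.val (cart_ext ((F.comp G).relProj α)
      (φ := (comparison F G α).comp (comparisonInv F G α) e) (ψ := HomOver.id _) ?_)
    refine (Category.assoc _ _ _).trans ((congrArg _ (comparisonInv_proj F G α)).trans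
      ((comparison_proj F G α).trans (Category.id_comp _).symm))
  · refine congrArg Subtype.val (cart_ext (compProj F G α)
      (φ := (comparisonInv F G α).comp (comparison F G α) e) (ψ := HomOver.id _) ?_)
    refine (Category.assoc _ _ _).trans ((congrArg _ (comparison_proj F G α)).trans
      ((comparisonInv_proj F G α).trans (Category.id_comp _).symm))

theorem mapPt_comparison {Z : P.Base} {e : P.p.Fiber Z} {I J : P.Base} {α : Rel P.p I J}
    {s : Z ⟶ I} {t : Z ⟶ J} (a : HomOver P.p (prod.lift s t) e α) :
    ((F.comp G).mapPt a).1 ≫ (comparison F G α).1 = (G.mapPt (F.mapPt a)).1 := by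
  refine congrArg Subtype.val (cart_ext (compProj F G α) (φ := ((F.comp G).mapPt a).comp
    (comparison F G α) ((congrArg (_ ≫ ·) (prod_map_id R _ _)).trans (Category.comp_id _)))
    (ψ := G.mapPt (F.mapPt a)) ?_)
  refine (Category.assoc _ _ _).trans ((congrArg _ (comparison_proj F G α)).trans
    (((F.comp G).mapPt_proj a).trans ?_))
  refine Eq.trans ?_ (Category.assoc _ _ _)
  refine Eq.trans ?_ (congrArg (· ≫ G.total.map (F.relProj α).1) (G.mapPt_proj (F.mapPt a))).symm
  exact (congrArg G.total.map (F.mapPt_proj a)).symm.trans (G.total.map_comp _ _)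

theorem actCells_comparison {Z : P.Base} {e : P.p.Fiber Z} {I J : P.Base}
    {α : LPath (Rel P.p) I J} {s : Z ⟶ I} {t : Z ⟶ J} (S : Pts e α s t)
    (hs : (F.comp G).base.map s ≫ 𝟙 _ = G.base.map (F.base.map s))
    (ht : (F.comp G).base.map t ≫ 𝟙 _ = G.base.map (F.base.map t)) :
    actCells (VDGraph.transCells (D := bilGraph P.p) (E := bilGraph R.p) (F.comp G).rel
      (fun α => G.rel (F.rel α)) (fun I => 𝟙 _) (fun α => mkSingle (comparison F G α)) α)
      ((F.comp G).mapPts S) hs ht = (G.mapPts (F.mapPts S)).castPath (LPath.map_map _ _ _ _ α) := by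
  induction S with
  | nil => exact Pts.nil_uniq _ _
  | @cons _ _ _ α q _ m _ a as ih =>
    refine (actCells_transCells_cons (D := bilGraph P.p) (F.comp G).rel
      (fun α => G.rel (F.rel α)) (fun I => 𝟙 _) (fun α => mkSingle (comparison F G α)) α q
      ((F.comp G).mapPt a) ((F.comp G).mapPts as) hs (Category.comp_id _) ht).trans ?_
    refine Eq.trans ?_ (Pts.castPath_cons _ (LPath.map_map _ _ _ _ q) (G.mapPt (F.mapPt a))
      (G.mapPts (F.mapPts as))).symm
    refine congrArg₂ Pts.cons ?_ (ih _ _)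
    refine HomOver.ext ?_
    exact (congrArg (fun y : HomOver R.p _ _ _ => ((F.comp G).mapPt a).1 ≫ y.1)
      (sarr_mkSingle (comparison F G α))).trans (mapPt_comparison F G a)

def compTrans : VDTrans (F.comp G).bil (F.bil.comp G.bil) where
  tight := 𝟙 _
  cell α := mkSingle (comparison F G α)
  naturality {I J K M α s s' β} ξ := by
    refine (F.comp G).naturality_of_act (F.bil.comp G.bil) (𝟙 _)
      (fun α => mkSingle (comparison F G α)) ξ
      ((G.mapPts (F.mapPts (gen α))).castPath (LPath.map_map _ _ _ _ α))
      (Category.comp_id _) (Category.comp_id _) (actCells_comparison F G (gen α) _ _) ?_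
    refine (congrArg Subtype.val (act_cast_castPath (LPath.map_map _ _ _ _ α)
      (G.cell (F.cell ξ)) (G.mapPts (F.mapPts (gen α))) rfl rfl)).trans ?_
    refine Eq.trans ?_ ((congrArg (fun y : HomOver R.p _ _ _ =>
      ((F.comp G).mapPt (act ξ (gen α) rfl rfl)).1 ≫ y.1)
      (sarr_mkSingle (comparison F G β))).trans (mapPt_comparison F G _)).symm
    refine Eq.trans ?_ (congrArg (fun y => (G.mapPt y).1) (F.act_cell ξ (gen α) rfl rfl))
    exact congrArg Subtype.val (G.act_cell (F.cell ξ) (F.mapPts (gen α)) (F.map_eq rfl)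
      (F.map_eq rfl))

def bilComp : (F.comp G).bil ≅ F.bil.comp G.bil :=
  vdIso (compTrans F G) (𝟙 _) (fun _ => Category.comp_id _) (fun _ => Category.comp_id _)
    (comparisonInv F G) (fun α => by
      have h := isInv_comparison F G α
      refine ⟨?_, ?_⟩
      · exact (congrArg (fun y : HomOver R.p _ _ _ => y.1 ≫ (comparisonInv F G α).1)
          (sarr_mkSingle (comparison F G α))).trans h.hom_inv
      · exact (congrArg (fun y : HomOver R.p _ _ _ => (comparisonInv F G α).1 ≫ y.1)
          (sarr_mkSingle (comparison F G α))).trans h.inv_hom)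

end

end Mor

end CartFib

end

noncomputable section

namespace CartFib

open FibCat

namespace Mor

variable {P Q R S : CartFib.{u, v, w, x}}

theorem trans_bil_ext {G : VDFunctor (FibCat.bil P.p) (FibCat.bil Q.p)}
    {F : Mor P Q} {θ φ : VDTrans G F.bil} (h : ∀ I, θ.tight.app I = φ.tight.app I)
    (h' : ∀ {I J : P.Base} (α : Rel P.p I J),
      (sarr (θ.cell α)).1 ≫ (F.relProj α).1 = (sarr (φ.cell α)).1 ≫ (F.relProj α).1) : θ = φ :=
  vdTrans_ext h fun {I J} α => congrArg Subtype.val (cart_ext (F.relProj α)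
    (φ := (sarr (θ.cell α)).cast (congrArg₂ prod.map (h I) (h J)))
    (ψ := sarr (φ.cell α)) (h' α))

theorem bilId_hom_proj {I J : P.Base} (α : Rel P.p I J) :
    (sarr (VDTrans.cell (bilId P).hom α)).1 = ((Mor.id P).relProj α).1 :=
  congrArg Subtype.val (sarr_mkSingle (idComparison P α))

theorem bilComp_hom_proj (F : Mor P Q) (G : Mor Q R) {I J : P.Base} (α : Rel P.p I J) :
    (sarr (VDTrans.cell (bilComp F G).hom α)).1 ≫ (G.relProj (F.rel α)).1 ≫
      G.total.map (F.relProj α).1 = ((F.comp G).relProj α).1 :=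
  (congrArg (fun y : HomOver R.p _ _ _ => y.1 ≫ (G.relProj (F.rel α)).1 ≫
      G.total.map (F.relProj α).1) (sarr_mkSingle (comparison F G α))).trans
    (comparison_proj F G α)

theorem bilComp_inv_proj (F : Mor P Q) (G : Mor Q R) {I J : P.Base} (α : Rel P.p I J) :
    (sarr (VDTrans.cell (bilComp F G).inv α)).1 ≫ ((F.comp G).relProj α).1 =
      (G.relProj (F.rel α)).1 ≫ G.total.map (F.relProj α).1 :=
  (congrArg (fun y : HomOver R.p _ _ _ => y.1 ≫ ((F.comp G).relProj α).1)
    (sarr_mkSingle (comparisonInv F G α))).trans (comparisonInv_proj F G α)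

end Mor

section

variable {C D : Type*} [Category* C] [Category* D]

theorem comp₃_of_eq {a b c d e f g h : C} {s : a ⟶ b} {s' : b ⟶ c} {s'' : c ⟶ d} {r : d ⟶ e}
    {k : c ⟶ f} {l : f ⟶ e} {m : b ⟶ g} {n : g ⟶ f} {R : a ⟶ h} {t : h ⟶ e} {o : g ⟶ h}
    (h₁ : s'' ≫ r = k ≫ l) (h₂ : s' ≫ k = m ≫ n) (h₃ : n ≫ l = o ≫ t) (h₄ : s ≫ m ≫ o = R) :
    (s ≫ s' ≫ s'') ≫ r = R ≫ t := by
  rw [Category.assoc, Category.assoc, h₁, ← Category.assoc s', h₂, Category.assoc, h₃, ← h₄]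
  simp only [Category.assoc]

theorem comp₃_id_of_eq {a b c e g : C} {s : a ⟶ b} {s' : b ⟶ c} {i : c ⟶ c} {r : c ⟶ e} {m : b ⟶ g}
    {n n' : g ⟶ e} {R : a ⟶ e} (hi : i = 𝟙 c) (h₁ : s' ≫ r = m ≫ n) (h₂ : n = n')
    (h₃ : s ≫ m ≫ n' = R) : (s ≫ s' ≫ i) ≫ r = R ≫ 𝟙 e := by
  subst hi h₂ h₃
  rw [Category.comp_id, Category.assoc, h₁, Category.comp_id]

theorem comp₅_of_eq (H : D ⥤ C) {c₀ c₁ c₂ c₃ c₄ : C} {y₀ y₁ y₂ y₃ : D} {s₁ : c₀ ⟶ c₁}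
    {s₂ : c₁ ⟶ c₂} {i : c₂ ⟶ c₂} {s₃ : c₂ ⟶ c₃} {s₄ : c₃ ⟶ c₄} {r : c₄ ⟶ H.obj y₃}
    {k : c₃ ⟶ H.obj y₂} {l : y₂ ⟶ y₃} {h : c₂ ⟶ H.obj y₁} {g : y₁ ⟶ y₂} {h' : c₁ ⟶ H.obj y₀}
    {m : y₀ ⟶ y₁} {n : y₀ ⟶ y₃} {R : c₀ ⟶ H.obj y₃}
    (h₁ : s₄ ≫ r = k ≫ H.map l) (h₂ : s₃ ≫ k = h ≫ H.map g) (hi : i = 𝟙 c₂)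
    (h₃ : s₂ ≫ h = h' ≫ H.map m) (h₄ : m ≫ g ≫ l = n) (h₅ : s₁ ≫ h' ≫ H.map n = R) :
    (s₁ ≫ s₂ ≫ i ≫ s₃ ≫ s₄) ≫ r = R ≫ 𝟙 (H.obj y₃) := by
  subst hi h₄ h₅
  simp only [Category.assoc, Category.id_comp, Category.comp_id, h₁, H.map_comp]
  rw [← Category.assoc s₃, h₂, Category.assoc, ← Category.assoc s₂, h₃, Category.assoc]

theorem id_eq_comp₃ {X : C} {f g : X ⟶ X} (hf : f = 𝟙 X) (hg : g = 𝟙 X) : 𝟙 X = 𝟙 X ≫ f ≫ g := by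
  simp [hf, hg]

theorem id_eq_comp₅ {X : C} {f g h i : X ⟶ X} (hf : f = 𝟙 X) (hg : g = 𝟙 X) (hh : h = 𝟙 X)
    (hi : i = 𝟙 X) : 𝟙 X = 𝟙 X ≫ f ≫ g ≫ h ≫ i := by
  simp [hf, hg, hh, hi]

end

theorem sarr_vcomp₃ {P : CartFib.{u, v, w, x}} {D : VDC.{u, v, w, x}}
    {F G H K : VDFunctor D (FibCat.bil P.p)} (θ : F ⟶ G)
    (φ : G ⟶ H) (ψ : H ⟶ K) {I J : D.Ob} (α : D.Loose I J) :
    (sarr (VDTrans.cell (θ ≫ φ ≫ ψ) α)).1 = (sarr (VDTrans.cell θ α)).1 ≫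
      (sarr (VDTrans.cell φ α)).1 ≫ (sarr (VDTrans.cell ψ α)).1 :=
  (sarr_vcomp θ (φ ≫ ψ) α).trans (congrArg (_ ≫ ·) (sarr_vcomp φ ψ α))

theorem sarr_vcomp₅ {P : CartFib.{u, v, w, x}} {D : VDC.{u, v, w, x}}
    {F G H K L M : VDFunctor D (FibCat.bil P.p)} (θ : F ⟶ G)
    (φ : G ⟶ H) (ψ : H ⟶ K) (χ : K ⟶ L) (ω : L ⟶ M) {I J : D.Ob} (α : D.Loose I J) :
    (sarr (VDTrans.cell (θ ≫ φ ≫ ψ ≫ χ ≫ ω) α)).1 = (sarr (VDTrans.cell θ α)).1 ≫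
      (sarr (VDTrans.cell φ α)).1 ≫ (sarr (VDTrans.cell ψ α)).1 ≫ (sarr (VDTrans.cell χ α)).1 ≫
        (sarr (VDTrans.cell ω α)).1 :=
  (sarr_vcomp₃ θ φ (ψ ≫ χ ≫ ω) α).trans (congrArg (_ ≫ _ ≫ ·) (sarr_vcomp₃ ψ χ ω α))

/-- The assignment of the virtual double category of binary predicates is a pseudofunctor. -/
def bilPseudofunctor : Pseudofunctor CartFib.{u, v, w, x} VDC.{u, v, w, x} where
  toPrelaxFunctorStruct := bilStruct
  map₂_id {P Q} F := by
    refine Mor.trans_bil_ext (fun _ => rfl) (fun α => ?_)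
    refine (Trans.sarr_cell (𝟙 F : Trans F F) α).trans ((Category.comp_id _).trans ?_)
    exact ((congrArg (· ≫ (Mor.relProj F α).1) (sarr_idCell (Mor.rel F α))).trans
      (Category.id_comp _)).symm
  map₂_comp {P Q F G H} η θ := by
    refine Mor.trans_bil_ext (fun _ => rfl) (fun α => ?_)
    refine (Trans.sarr_cell (η ≫ θ) α).trans ?_
    refine Eq.trans ?_ (congrArg (· ≫ (Mor.relProj H α).1)
      (sarr_vcomp (Trans.bil η) (Trans.bil θ) α)).symm
    refine Eq.trans ?_ (Category.assoc _ _ _).symm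
    refine Eq.trans ?_ (congrArg (_ ≫ ·) (Trans.sarr_cell θ α).symm)
    refine Eq.trans ?_ (Category.assoc _ _ _)
    refine Eq.trans ?_ (congrArg (· ≫ _) (Trans.sarr_cell η α).symm)
    exact (Category.assoc _ _ _).symm
  mapId P := Mor.bilId P
  mapComp F G := Mor.bilComp F G
  map₂_whisker_left {P Q R} F G H η := by
    refine Mor.trans_bil_ext (fun X => VDTrans.eq_id_comp_id _) (fun {I J} α => ?_)
    refine (Trans.sarr_cell (Trans.whiskerLeft F η) α).trans ?_
    refine Eq.trans ?_ (congrArg (· ≫ (Mor.relProj (Mor.comp F H) α).1)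
      (sarr_vcomp₃ (Mor.bilComp F G).hom (VDTrans.whiskerLeft (Mor.bil F) (Trans.bil η))
        (Mor.bilComp F H).inv α)).symm
    exact (comp₃_of_eq (Mor.bilComp_inv_proj F H α) (Trans.sarr_cell η (Mor.rel F α))
      (η.total.naturality (Mor.relProj F α).1).symm (Mor.bilComp_hom_proj F G α)).symm
  map₂_whisker_right {P Q R} F G η H := by
    refine Mor.trans_bil_ext (fun X => VDTrans.eq_id_comp_id _) (fun {I J} α => ?_)
    refine (Trans.sarr_cell (Trans.whiskerRight η H) α).trans ?_
    refine Eq.trans ?_ (congrArg (· ≫ (Mor.relProj (Mor.comp G H) α).1)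
      (sarr_vcomp₃ (Mor.bilComp F H).hom (VDTrans.whiskerRight (Trans.bil η) (Mor.bil H))
        (Mor.bilComp G H).inv α)).symm
    refine (comp₃_of_eq (Mor.bilComp_inv_proj G H α) (Mor.sarr_cell H (Trans.cell η α))
      ?_ (Mor.bilComp_hom_proj F H α)).symm
    exact (H.total.map_comp _ _).symm.trans ((congrArg H.total.map (Trans.sarr_cell η α)).trans
      (H.total.map_comp _ _))
  map₂_associator {P Q R S} F G H := by
    refine Mor.trans_bil_ext (fun X => ?_) (fun {I J} α => ?_)
    · exact id_eq_comp₅ (H.base.map_id (G.base.obj (F.base.obj X))) rfl rfl rfl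
    · refine (Trans.sarr_cell (Trans.associator F G H).hom α).trans ?_
      refine Eq.trans ?_ (congrArg (· ≫ (Mor.relProj (Mor.comp F (Mor.comp G H)) α).1)
        (sarr_vcomp₅ (Mor.bilComp (Mor.comp F G) H).hom
          (VDTrans.whiskerRight (Mor.bilComp F G).hom (Mor.bil H))
          (VDFunctor.associator (Mor.bil F) (Mor.bil G) (Mor.bil H)).hom
          (VDTrans.whiskerLeft (Mor.bil F) (Mor.bilComp G H).inv)
          (Mor.bilComp F (Mor.comp G H)).inv α)).symm
      exact (comp₅_of_eq H.total (Mor.bilComp_inv_proj F (Mor.comp G H) α)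
        (Mor.bilComp_inv_proj G H (Mor.rel F α)) (sarr_idCell _)
        (Mor.sarr_cell H (VDTrans.cell (Mor.bilComp F G).hom α))
        (Mor.bilComp_hom_proj F G α) (Mor.bilComp_hom_proj (Mor.comp F G) H α)).symm
  map₂_left_unitor {P Q} F := by
    refine Mor.trans_bil_ext (fun X => ?_) (fun {I J} α => ?_)
    · exact id_eq_comp₃ (F.base.map_id X) rfl
    · refine (Trans.sarr_cell (Trans.leftUnitor F).hom α).trans ?_
      refine Eq.trans ?_ (congrArg (· ≫ (Mor.relProj F α).1)
        (sarr_vcomp₃ (Mor.bilComp (Mor.id P) F).hom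
          (VDTrans.whiskerRight (Mor.bilId P).hom (Mor.bil F))
          (VDFunctor.leftUnitor (Mor.bil F)).hom α)).symm
      exact (comp₃_id_of_eq (sarr_idCell _) (Mor.sarr_cell F (VDTrans.cell (Mor.bilId P).hom α))
        (congrArg F.total.map (Mor.bilId_hom_proj α)) (Mor.bilComp_hom_proj (Mor.id P) F α)).symm
  map₂_right_unitor {P Q} F := by
    refine Mor.trans_bil_ext (fun X => ?_) (fun {I J} α => ?_)
    · exact id_eq_comp₃ rfl rfl
    · refine (Trans.sarr_cell (Trans.rightUnitor F).hom α).trans ?_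
      refine Eq.trans ?_ (congrArg (· ≫ (Mor.relProj F α).1)
        (sarr_vcomp₃ (Mor.bilComp F (Mor.id Q)).hom
          (VDTrans.whiskerLeft (Mor.bil F) (Mor.bilId Q).hom)
          (VDFunctor.rightUnitor (Mor.bil F)).hom α)).symm
      exact (comp₃_id_of_eq (sarr_idCell _)
        (congrArg (· ≫ (Mor.relProj F α).1) (Mor.bilId_hom_proj (F.rel α))) rfl
        (Mor.bilComp_hom_proj F (Mor.id Q) α)).symm

end CartFib

end

noncomputable section

namespace SubBicat

universe u₁ v₁ w₁ u₂ v₂ w₂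

variable {B : Type u₁} [Bicategory.{w₁, v₁} B] {C : Type u₂} [Bicategory.{w₂, v₂} C]

theorem pseudofunctor_ext {F G : Pseudofunctor B C}
    (h : F.toPrelaxFunctorStruct = G.toPrelaxFunctorStruct)
    (h₁ : ∀ a, HEq (F.mapId a) (G.mapId a))
    (h₂ : ∀ {a b c : B} (f : a ⟶ b) (g : b ⟶ c), HEq (F.mapComp f g) (G.mapComp f g)) : F = G := by
  obtain ⟨⟨F, _, _⟩, Fi, Fc, _, _, _, _, _⟩ := F
  obtain ⟨⟨G, _, _⟩, Gi, Gc, _, _, _, _, _⟩ := G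
  dsimp only at h
  subst h
  have e₁ : Fi = Gi := funext fun a => eq_of_heq (h₁ a)
  have e₂ : @Fc = @Gc := by
    funext a b c f g
    exact eq_of_heq (h₂ f g)
  subst e₁ e₂
  rfl

/-- A pseudofunctor with values in a locally full sub-bicategory. -/
def lift (S : SubBicat C) (G : Pseudofunctor B C) (h₀ : ∀ a, S.IsObj (G.obj a))
    (h₁ : ∀ {a b : B} (f : a ⟶ b), S.IsHom (G.map f)) : Pseudofunctor B S.Obj where
  obj a := ⟨G.obj a, h₀ a⟩
  map f := ⟨G.map f, h₁ f⟩
  map₂ η := ⟨G.map₂ η⟩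
  map₂_id f := Hom₂.ext (G.map₂_id f)
  map₂_comp η θ := Hom₂.ext (G.map₂_comp η θ)
  mapId a := isoMk (G.mapId a)
  mapComp f g := isoMk (G.mapComp f g)
  map₂_whisker_left f _ _ η := Hom₂.ext (G.map₂_whisker_left f η)
  map₂_whisker_right η h := Hom₂.ext (G.map₂_whisker_right η h)
  map₂_associator f g h := Hom₂.ext (G.map₂_associator f g h)
  map₂_left_unitor f := Hom₂.ext (G.map₂_left_unitor f)
  map₂_right_unitor f := Hom₂.ext (G.map₂_right_unitor f)

theorem lift_comp_incl (S : SubBicat C) (G : Pseudofunctor B C) (h₀ : ∀ a, S.IsObj (G.obj a))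
    (h₁ : ∀ {a b : B} (f : a ⟶ b), S.IsHom (G.map f)) : (S.lift G h₀ h₁).comp S.incl = G := by
  refine pseudofunctor_ext rfl (fun a => heq_of_eq (Iso.ext ?_))
    (fun f g => heq_of_eq (Iso.ext ?_))
  · exact Category.comp_id (G.mapId a).hom
  · exact Category.comp_id (G.mapComp f g).hom

end SubBicat

end

noncomputable section

namespace FibCat

open CategoryTheory.Functor

variable {B : Type u} [Category.{v} B] {E : Type w} [Category.{x} E] {p : E ⥤ B}
  [HasFiniteProducts B]
  [p.IsFibered] [∀ X : B, HasFiniteProducts (p.Fiber X)]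
  [∀ {X Y : B} (f : X ⟶ Y), PreservesFiniteProducts (baseChange p f)]

theorem isCartesian_of_existsUnique {X Y : B} {f : X ⟶ Y} {a : p.Fiber X} {b : p.Fiber Y}
    (φ : HomOver p f a b) (h : ∀ (c : p.Fiber X) (ψ : HomOver p f c b),
      ∃! χ : HomOver p (𝟙 X) c a, χ.1 ≫ φ.1 = ψ.1) : p.IsCartesian f φ.1 := by
  have := φ.2
  constructor
  intro a' φ' h'
  obtain ⟨χ, h₁, h₂⟩ := h ⟨a', IsHomLift.domain_eq p f φ'⟩ ⟨φ', h'⟩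
  exact ⟨χ.1, ⟨χ.2, h₁⟩, fun y hy => congrArg Subtype.val (h₂ ⟨y, hy.1⟩ hy.2)⟩

theorem isRestriction_of_isCartesian {I J K M : B} {r : Rel p I J} {f : I ⟶ K} {g : J ⟶ M}
    {α : Rel p K M} (ρ : (bilGraph p).Cell (.single r) f g α)
    (h : p.IsCartesian (prod.map f g) (sarr ρ).1) : VDC.IsRestriction (D := bil p) ρ := by
  intro X Y γ s t ξ
  have e₁ : prod.lift (first p γ ≫ s) (last p γ ≫ t) ≫ prod.map f g =
      prod.lift (first p γ ≫ s ≫ f) (last p γ ≫ t ≫ g) := by simp [prod.lift_map]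
  have key : ∀ ζ : (bilGraph p).Cell γ s t r,
      (bilStr p).comp (.single ζ) ρ rfl rfl = ξ ↔
        (act ζ (gen γ) rfl rfl).1 ≫ (sarr ρ).1 = (act ξ (gen γ) rfl rfl).1 := fun ζ => by
    have := act_comp_single ζ ρ rfl rfl (gen γ) rfl rfl rfl rfl
    refine ⟨fun hζ => this.symm.trans ?_, fun hζ => cell_ext (HomOver.ext (this.trans hζ))⟩
    rw [hζ]
  refine ⟨mkCell (cartLift (sarr ρ) (act ξ (gen γ) rfl rfl) e₁), ?_, fun ζ hζ => ?_⟩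
  · refine (key _).2 ?_
    rw [act_mkCell_gen]
    exact cartLift_fac (sarr ρ) _ e₁
  · refine cell_ext (cart_ext (sarr ρ) (((key ζ).1 hζ).trans ?_))
    rw [act_mkCell_gen]
    exact (cartLift_fac (sarr ρ) _ e₁).symm

theorem isCartesian_of_existsUnique_cell {I J K M : B} {r : Rel p I J} {f : I ⟶ K} {g : J ⟶ M}
    {α : Rel p K M} (ρ : (bilGraph p).Cell (.single r) f g α)
    (h : ∀ (c : Rel p I J) (ξ : (bilGraph p).Cell (.single c) (𝟙 I ≫ f) (𝟙 J ≫ g) α),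
      ∃! ζ : (bilGraph p).Cell (.single c) (𝟙 I) (𝟙 J) r, (bil p).comp (.single ζ) ρ rfl rfl = ξ) :
    p.IsCartesian (prod.map f g) (sarr ρ).1 := by
  refine isCartesian_of_existsUnique (sarr ρ) fun c ψ => ?_
  have e : prod.map f g = prod.map (𝟙 I ≫ f) (𝟙 J ≫ g) := by simp
  have e' : prod.map (𝟙 I) (𝟙 J) = 𝟙 (I ⨯ J) := by simp
  obtain ⟨ζ, h₁, h₂⟩ := h c (mkSingle (ψ.cast e))
  refine ⟨(sarr ζ).cast e', ?_, fun χ hχ => ?_⟩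
  · exact (sarr_comp ζ ρ rfl rfl).symm.trans ((congrArg (fun y => (sarr y).1) h₁).trans
      (congrArg Subtype.val (sarr_mkSingle (ψ.cast e))))
  · have := h₂ (mkSingle (χ.cast e'.symm)) (single_ext ?_)
    · refine HomOver.ext ?_
      refine (congrArg Subtype.val (sarr_mkSingle (χ.cast e'.symm))).symm.trans ?_
      exact congrArg (fun y => (sarr y).1) this
    · refine (sarr_comp (mkSingle (χ.cast e'.symm)) ρ rfl rfl).trans ?_
      refine (congrArg (fun y : HomOver p _ _ _ => y.1 ≫ (sarr ρ).1)
        (sarr_mkSingle (χ.cast e'.symm))).trans (hχ.trans ?_)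
      exact (congrArg Subtype.val (sarr_mkSingle (ψ.cast e))).symm

theorem isCartesian_of_isRestriction {I J K M : B} {r : Rel p I J} {f : I ⟶ K} {g : J ⟶ M}
    {α : Rel p K M} (ρ : (bilGraph p).Cell (.single r) f g α)
    (h : VDC.IsRestriction (D := bil p) ρ) : p.IsCartesian (prod.map f g) (sarr ρ).1 :=
  isCartesian_of_existsUnique_cell ρ fun c ξ => h (.single c) (𝟙 I) (𝟙 J) ξ

variable (p) in
theorem hasRestrictions_bil : VDC.HasRestrictions (bil p) := fun _ _ _ _ f g α =>
  ⟨pullback p (prod.map f g) α, mkSingle (proj p (prod.map f g) α),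
    isRestriction_of_isCartesian _ (by rw [sarr_mkSingle]; infer_instance)⟩

theorem isCartesian_of_comp {X Y Z : B} {f : X ⟶ Y} {g : Y ⟶ Z} {k : X ⟶ Z} {a : p.Fiber X}
    {b : p.Fiber Y} {c : p.Fiber Z} (φ : HomOver p f a b) (ψ : HomOver p g b c)
    (h : f ≫ g = k) [p.IsCartesian g ψ.1] (hφ : p.IsCartesian k (φ.comp ψ h).1) :
    p.IsCartesian f φ.1 := by
  subst h
  have := φ.2
  have : p.IsCartesian (f ≫ g) (φ.1 ≫ ψ.1) := hφ
  have : p.IsStronglyCartesian f φ.1 := IsStronglyCartesian.of_comp (g := g) (ψ := ψ.1) p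
  infer_instance

end FibCat

namespace CartFib.Mor

open FibCat

theorem isCartesian_sarr_cell {P Q : CartFib.{u, v, w, x}} (F : Mor P Q) {I J K M : P.Base}
    {r : Rel P.p I J} {s : I ⟶ K} {t : J ⟶ M} {α : Rel P.p K M}
    (ρ : (bilGraph P.p).Cell (.single r) s t α)
    [P.p.IsCartesian (prod.map s t) (sarr ρ).1] :
    Q.p.IsCartesian (prod.map (F.base.map s) (F.base.map t))
      (sarr (α := F.rel r) (F.cell ρ)).1 := by
  have e : prod.map (F.base.map s) (F.base.map t) ≫ F.pcInv K M =
      F.pcInv I J ≫ F.base.map (prod.map s t) := (prodComparison_inv_natural F.base s t).symm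
  refine isCartesian_of_comp (sarr (α := F.rel r) (F.cell ρ)) (F.relProj α) e ?_
  have h₁ := HomOver.isCartesian_comp (F.relProj r) (F.homMap (sarr ρ)) rfl
  have h₂ := F.sarr_cell ρ
  exact cast (congrArg (fun y => Q.p.IsCartesian _ y) h₂.symm) h₁

theorem bil_preservesRestrictions {P Q : CartFib.{u, v, w, x}} (F : Mor P Q) :
    F.bil.PreservesRestrictions := by
  intro I J K M r s t α ρ h
  have := isCartesian_of_isRestriction ρ h
  exact isRestriction_of_isCartesian (F.bil.cell ρ) (F.isCartesian_sarr_cell ρ)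

end CartFib.Mor

end

noncomputable section

namespace FibCat

open CategoryTheory.Functor

variable {B : Type u} [Category.{v} B] {E : Type w} [Category.{x} E] {p : E ⥤ B}
  [HasFiniteProducts B]
  [p.IsFibered] [∀ X : B, HasFiniteProducts (p.Fiber X)]
  [∀ {X Y : B} (f : X ⟶ Y), PreservesFiniteProducts (baseChange p f)]

/-- The arrow of the total category which corresponds to a cell with identity tight boundary. -/
def arr {I J : B} {α : LPath (Rel p) I J} {c : Rel p I J}
    (κ : (bilGraph p).Cell α (𝟙 I) (𝟙 J) c) :
    HomOver p (prod.lift (first p α) (last p α)) (ctx p α) c :=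
  act κ (gen α) (Category.comp_id _) (Category.comp_id _)

theorem act_arr {I J : B} {α : LPath (Rel p) I J} {c : Rel p I J}
    (κ : (bilGraph p).Cell α (𝟙 I) (𝟙 J) c) {Z : B} {e : p.Fiber Z} {x : Z ⟶ base p α}
    (A : HomOver p x e (ctx p α)) {a : Z ⟶ I} {b : Z ⟶ J} (ha : x ≫ first p α = a)
    (hb : x ≫ last p α = b) (ha' : a ≫ 𝟙 I = a) (hb' : b ≫ 𝟙 J = b) :
    (act κ ((gen α).pre A ha hb) ha' hb').1 = A.1 ≫ (arr κ).1 :=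
  congrArg Subtype.val (act_pre κ A (gen α) (Category.comp_id _) (Category.comp_id _) ha hb ha' hb'
    ha hb)

section

variable {I J K M : B} {l : LPath (Rel p) K I} {c : Rel p I J} {r : LPath (Rel p) J M}
  {α : LPath (Rel p) I J} {Z Z' : B} {e : p.Fiber Z} {e' : p.Fiber Z'} {y : Z ⟶ base p l}
  {z : Z ⟶ I ⨯ J} {x : Z ⟶ base p α} {y' : Z ⟶ base p r} {a : Z ⟶ K} {b : Z ⟶ M}

/-- A generalized element of a path with a distinguished loose arrow. -/
def glue (L : HomOver p y e (ctx p l)) (C : HomOver p z e c) (R : HomOver p y' e (ctx p r))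
    (h₁ : y ≫ last p l = z ≫ prod.fst) (h₂ : y' ≫ first p r = z ≫ prod.snd)
    (ha : y ≫ first p l = a) (hb : y' ≫ last p r = b) : Pts e (l.append (.cons c r)) a b :=
  ((gen l).pre L ha h₁).append (.cons (C.cast (by rw [← prod.comp_lift, prod.lift_fst_snd,
    Category.comp_id])) ((gen r).pre R h₂ hb)) rfl

/-- A generalized element of a path with a distinguished segment. -/
def glue₃ (L : HomOver p y e (ctx p l)) (A : HomOver p x e (ctx p α)) (R : HomOver p y' e (ctx p r))
    (h₁ : y ≫ last p l = x ≫ first p α) (h₂ : y' ≫ first p r = x ≫ last p α)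
    (ha : y ≫ first p l = a) (hb : y' ≫ last p r = b) :
    Pts e (l.append (α.append r)) a b :=
  ((gen l).pre L ha h₁).append (((gen α).pre A rfl rfl).append ((gen r).pre R h₂ hb) rfl) rfl

theorem pre_glue {k : Z' ⟶ Z} (φ : HomOver p k e' e)
    (L : HomOver p y e (ctx p l)) (C : HomOver p z e c) (R : HomOver p y' e (ctx p r))
    (h₁ : y ≫ last p l = z ≫ prod.fst) (h₂ : y' ≫ first p r = z ≫ prod.snd)
    (ha : y ≫ first p l = a) (hb : y' ≫ last p r = b) {a' : Z' ⟶ K} {b' : Z' ⟶ M}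
    (ha' : k ≫ a = a') (hb' : k ≫ b = b') {y₁ : Z' ⟶ base p l} {z₁ : Z' ⟶ I ⨯ J}
    {y₁' : Z' ⟶ base p r} (hy : k ≫ y = y₁) (hz : k ≫ z = z₁) (hy' : k ≫ y' = y₁') :
    (glue L C R h₁ h₂ ha hb).pre φ ha' hb' = glue (φ.comp L hy) (φ.comp C hz) (φ.comp R hy')
      (by rw [← hy, ← hz, Category.assoc, h₁, Category.assoc])
      (by rw [← hy', ← hz, Category.assoc, h₂, Category.assoc])
      (by rw [← hy, Category.assoc, ha, ha']) (by rw [← hy', Category.assoc, hb, hb']) := by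
  subst hy hz hy' ha hb
  refine (Pts.pre_append φ _ _ rfl ha' (Category.assoc _ _ _).symm hb').trans ?_
  rw [Pts.pre_cons _ _ _ _ _ (Category.assoc _ _ _).symm]
  unfold glue
  congr 1
  · exact Pts.pre_pre L φ (gen l) _ _ _ _ rfl _ _
  · congr 1
    exact Pts.pre_pre R φ (gen r) _ _ _ _ rfl _ _

theorem pre_glue₃ {k : Z' ⟶ Z} (φ : HomOver p k e' e)
    (L : HomOver p y e (ctx p l)) (A : HomOver p x e (ctx p α)) (R : HomOver p y' e (ctx p r))
    (h₁ : y ≫ last p l = x ≫ first p α) (h₂ : y' ≫ first p r = x ≫ last p α)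
    (ha : y ≫ first p l = a) (hb : y' ≫ last p r = b) {a' : Z' ⟶ K} {b' : Z' ⟶ M}
    (ha' : k ≫ a = a') (hb' : k ≫ b = b') {y₁ : Z' ⟶ base p l} {x₁ : Z' ⟶ base p α}
    {y₁' : Z' ⟶ base p r} (hy : k ≫ y = y₁) (hx : k ≫ x = x₁) (hy' : k ≫ y' = y₁') :
    (glue₃ L A R h₁ h₂ ha hb).pre φ ha' hb' = glue₃ (φ.comp L hy) (φ.comp A hx) (φ.comp R hy')
      (by rw [← hy, ← hx, Category.assoc, h₁, Category.assoc])
      (by rw [← hy', ← hx, Category.assoc, h₂, Category.assoc])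
      (by rw [← hy, Category.assoc, ha, ha']) (by rw [← hy', Category.assoc, hb, hb']) := by
  subst hy hx hy' ha hb
  refine (Pts.pre_append φ _ _ rfl ha' (Category.assoc _ _ _).symm hb').trans ?_
  rw [Pts.pre_append φ _ _ rfl _ (Category.assoc _ _ _).symm]
  unfold glue₃
  congr 1
  · exact Pts.pre_pre L φ (gen l) _ _ _ _ rfl _ _
  · congr 1
    · exact Pts.pre_pre A φ (gen α) _ _ _ _ rfl _ _
    · exact Pts.pre_pre R φ (gen r) _ _ _ _ rfl _ _

theorem glue_toCtx {m : Z ⟶ I} {n : Z ⟶ J} (U : Pts e l a m) (C : HomOver p (prod.lift m n) e c)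
    (V : Pts e r n b) :
    U.append (.cons C V) rfl = glue (toCtx U) C (toCtx V)
      (U.pt_last.trans (prod.lift_fst _ _).symm) (V.pt_first.trans (prod.lift_snd _ _).symm)
      U.pt_first V.pt_last := by
  have key : ∀ {m' : Z ⟶ I} {n' : Z ⟶ J} (hm : m = m') (hn : n = n'),
      U.append (.cons C V) rfl = ((gen l).pre (toCtx U) U.pt_first (U.pt_last.trans hm)).append
        (.cons (C.cast (by rw [hm, hn])) ((gen r).pre (toCtx V) (V.pt_first.trans hn) V.pt_last))
        rfl := by
    intro m' n' hm hn
    subst hm hn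
    rw [pre_toCtx, pre_toCtx]
    rfl
  exact key (prod.lift_fst m n).symm (prod.lift_snd m n).symm

theorem glue₃_toCtx {m : Z ⟶ I} {n : Z ⟶ J} (U : Pts e l a m) (W : Pts e α m n)
    (V : Pts e r n b) :
    U.append (W.append V rfl) rfl = glue₃ (toCtx U) (toCtx W) (toCtx V)
      (U.pt_last.trans W.pt_first.symm) (V.pt_first.trans W.pt_last.symm)
      U.pt_first V.pt_last := by
  have key : ∀ {m' : Z ⟶ I} {n' : Z ⟶ J} (hm : m = m') (hn : n = n'),
      U.append (W.append V rfl) rfl =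
        ((gen l).pre (toCtx U) U.pt_first (U.pt_last.trans hm)).append
        (((gen α).pre (toCtx W) (W.pt_first.trans hm) (W.pt_last.trans hn)).append
          ((gen r).pre (toCtx V) (V.pt_first.trans hn) V.pt_last) rfl) rfl := by
    intro m' n' hm hn
    subst hm hn
    rw [pre_toCtx, pre_toCtx, pre_toCtx]
  exact key W.pt_first.symm W.pt_last.symm

theorem exists_glue (S : Pts e (l.append (.cons c r)) a b) :
    ∃ (y : Z ⟶ base p l) (z : Z ⟶ I ⨯ J) (y' : Z ⟶ base p r) (L : HomOver p y e (ctx p l))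
      (C : HomOver p z e c) (R : HomOver p y' e (ctx p r)) (h₁ : y ≫ last p l = z ≫ prod.fst)
      (h₂ : y' ≫ first p r = z ≫ prod.snd) (ha : y ≫ first p l = a) (hb : y' ≫ last p r = b),
      S = glue L C R h₁ h₂ ha hb := by
  have h := Pts.append_split (α₁ := l) (α₂ := .cons c r) rfl S
  generalize S.split (α₁ := l) (α₂ := .cons c r) rfl = T at h
  obtain ⟨m, U, V⟩ := T
  obtain ⟨m', C, R, rfl⟩ := Pts.exists_cons V
  exact ⟨_, _, _, _, _, _, _, _, _, _, h.symm.trans (glue_toCtx U C R)⟩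

theorem exists_glue₃ (S : Pts e (l.append (α.append r)) a b) :
    ∃ (y : Z ⟶ base p l) (x : Z ⟶ base p α) (y' : Z ⟶ base p r) (L : HomOver p y e (ctx p l))
      (A : HomOver p x e (ctx p α)) (R : HomOver p y' e (ctx p r))
      (h₁ : y ≫ last p l = x ≫ first p α) (h₂ : y' ≫ first p r = x ≫ last p α)
      (ha : y ≫ first p l = a) (hb : y' ≫ last p r = b), S = glue₃ L A R h₁ h₂ ha hb := by
  have h := Pts.append_split (α₁ := l) (α₂ := α.append r) rfl S
  generalize S.split (α₁ := l) (α₂ := α.append r) rfl = T at h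
  obtain ⟨m, U, V⟩ := T
  have h' := Pts.append_split (α₁ := α) (α₂ := r) rfl V
  generalize V.split (α₁ := α) (α₂ := r) rfl = T' at h'
  obtain ⟨m', W, R⟩ := T'
  subst h'
  exact ⟨_, _, _, _, _, _, _, _, _, _, h.symm.trans (glue₃_toCtx U W R)⟩

theorem actCells_whisker (κ : (bilGraph p).Cell α (𝟙 I) (𝟙 J) c) {m : Z ⟶ I} {n : Z ⟶ J}
    (U : Pts e l a m) (W : Pts e α m n) (V : Pts e r n b) (ha : a ≫ 𝟙 K = a) (hb : b ≫ 𝟙 M = b) :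
    actCells (VDC.whisker (D := bil p) l κ r) (U.append (W.append V rfl) rfl) ha hb =
      U.append (.cons (act κ W (Category.comp_id m) (Category.comp_id n)) V) rfl := by
  induction U with
  | nil _ _ h =>
    subst h
    refine (actCells_cons κ ((bilStr p).idCells r) rfl W V ha (Category.comp_id _) hb).trans ?_
    rw [actCells_id r V (Category.comp_id _) hb rfl rfl]
    rfl
  | cons x xs ih =>
    refine (actCells_cons ((bilStr p).idCell _) (VDC.whisker (D := bil p) _ κ r) rfl
      (.cons x (.nil _ _ rfl)) (xs.append (W.append V rfl) rfl) ha (Category.comp_id _) hb).trans ?_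
    rw [act_idCell]
    exact congrArg (Pts.cons _) (ih κ W (Category.comp_id _))

theorem actCells_whisker_glue (κ : (bilGraph p).Cell α (𝟙 I) (𝟙 J) c)
    (L : HomOver p y e (ctx p l)) (A : HomOver p x e (ctx p α)) (R : HomOver p y' e (ctx p r))
    (h₁ : y ≫ last p l = x ≫ first p α) (h₂ : y' ≫ first p r = x ≫ last p α)
    (ha : y ≫ first p l = a) (hb : y' ≫ last p r = b) (ha' : a ≫ 𝟙 K = a) (hb' : b ≫ 𝟙 M = b)
    (hz : x ≫ prod.lift (first p α) (last p α) = z) (h₁' : y ≫ last p l = z ≫ prod.fst)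
    (h₂' : y' ≫ first p r = z ≫ prod.snd) :
    actCells (VDC.whisker (D := bil p) l κ r) (glue₃ L A R h₁ h₂ ha hb) ha' hb' =
      glue L (A.comp (arr κ) hz) R h₁' h₂' ha hb := by
  have key : ∀ {m : Z ⟶ I} {n : Z ⟶ J} (hm : x ≫ first p α = m) (hn : x ≫ last p α = n)
      (hm' : y ≫ last p l = m) (hn' : y' ≫ first p r = n) (hz : x ≫ prod.lift (first p α) (last p α)
        = prod.lift m n) {m' : Z ⟶ I} {n' : Z ⟶ J} (em : m = m') (en : n = n'),
      ((gen l).pre L ha hm').append (.cons (act κ ((gen α).pre A hm hn) (Category.comp_id _)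
        (Category.comp_id _)) ((gen r).pre R hn' hb)) rfl = ((gen l).pre L ha
          (hm'.trans em)).append (.cons (((A.comp (arr κ) hz)).cast (by rw [em, en]))
            ((gen r).pre R (hn'.trans en) hb)) rfl := by
    intro m n hm hn hm' hn' hz m' n' em en
    subst em en
    congr 2
    exact HomOver.ext (act_arr κ A hm hn _ _)
  subst hz
  refine (actCells_whisker κ _ _ _ ha' hb').trans ?_
  refine (key rfl rfl h₁ h₂ ?_ ?_ ?_).trans rfl
  · rw [prod.comp_lift]
  · rw [Category.assoc, prod.lift_fst]
  · rw [Category.assoc, prod.lift_snd]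

/-- The pair of the tight arrows around the distinguished loose arrow. -/
def mids (c : Rel p I J) (r : LPath (Rel p) J M) : ∀ {K : B} (l : LPath (Rel p) K I),
    base p (l.append (.cons c r)) ⟶ I ⨯ J
  | _, .nil _ => prod.map (𝟙 I) (first p r)
  | _, .cons _ l => prod.snd ≫ mids c r l

theorem pt_mids {m : Z ⟶ I} {n : Z ⟶ J} (U : Pts e l a m) (C : HomOver p (prod.lift m n) e c)
    (V : Pts e r n b) : (U.append (.cons C V) rfl).pt ≫ mids c r l = prod.lift m n := by
  induction U with
  | nil _ _ h =>
    subst h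
    refine (prod.lift_map _ _ _ _).trans ?_
    rw [Category.comp_id, V.pt_first]
  | cons x xs ih =>
    refine (Category.assoc _ _ _).symm.trans ?_
    refine (congrArg (· ≫ mids c r _) (prod.lift_snd _ _)).trans (ih C)

theorem isProjection_first (r : LPath (Rel p) J M) : IsProjection (first p r) := by
  cases r with
  | nil => exact isProjection_id _
  | cons a r => exact isProjection_fst _ _

theorem isProjection_mids (c : Rel p I J) (r : LPath (Rel p) J M) (l : LPath (Rel p) K I) :
    IsProjection (mids c r l) := by
  induction l with
  | nil => exact (isProjection_first r).map_id _
  | cons x l ih => exact (isProjection_snd _ _).comp (ih c)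

end

end FibCat

end

noncomputable section

namespace FibCat

open CategoryTheory.Functor

variable {B : Type u} [Category.{v} B] {E : Type w} [Category.{x} E] {p : E ⥤ B}
  [HasFiniteProducts B]
  [p.IsFibered] [∀ X : B, HasFiniteProducts (p.Fiber X)]
  [∀ {X Y : B} (f : X ⟶ Y), PreservesFiniteProducts (baseChange p f)]

section

variable {I J K M : B} {l : LPath (Rel p) K I} {c : Rel p I J} {r : LPath (Rel p) J M}
  {α : LPath (Rel p) I J} {Z Z' : B} {e : p.Fiber Z} {e' : p.Fiber Z'} {y y₁ : Z ⟶ base p l}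
  {z z₁ : Z ⟶ I ⨯ J} {x x₁ : Z ⟶ base p α} {y' y₁' : Z ⟶ base p r} {a : Z ⟶ K} {b : Z ⟶ M}

theorem toCtx_pre_gen (L : HomOver p y e (ctx p l)) {a : Z ⟶ K} {b : Z ⟶ I}
    (ha : y ≫ first p l = a) (hb : y ≫ last p l = b) :
    (toCtx ((gen l).pre L ha hb)).1 = L.1 :=
  (toCtx_pre L (gen l) ha hb).trans ((congrArg (L.1 ≫ ·) (toCtx_gen l)).trans (Category.comp_id _))

theorem glue_inj {L : HomOver p y e (ctx p l)} {C : HomOver p z e c} {R : HomOver p y' e (ctx p r)}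
    {h₁ : y ≫ last p l = z ≫ prod.fst} {h₂ : y' ≫ first p r = z ≫ prod.snd}
    {ha : y ≫ first p l = a} {hb : y' ≫ last p r = b}
    {L₁ : HomOver p y₁ e (ctx p l)} {C₁ : HomOver p z₁ e c} {R₁ : HomOver p y₁' e (ctx p r)}
    {h₁' : y₁ ≫ last p l = z₁ ≫ prod.fst} {h₂' : y₁' ≫ first p r = z₁ ≫ prod.snd}
    {ha' : y₁ ≫ first p l = a} {hb' : y₁' ≫ last p r = b}
    (h : glue L C R h₁ h₂ ha hb = glue L₁ C₁ R₁ h₁' h₂' ha' hb') :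
    L.1 = L₁.1 ∧ C.1 = C₁.1 ∧ R.1 = R₁.1 := by
  have key := (Pts.split_append (p := p) _ _ rfl).symm.trans
    ((congrArg (fun S => Pts.split l rfl S) h).trans (Pts.split_append (p := p) _ _ rfl))
  refine ⟨?_, ?_, ?_⟩
  · exact (toCtx_pre_gen L _ _).symm.trans
      ((congrArg (fun T : PtsSplit e l _ a b => (toCtx T.fst).1) key).trans (toCtx_pre_gen L₁ _ _))
  · exact congrArg (fun T : PtsSplit e l (.cons c r) a b =>
      (Pts.arrow (T.snd.split (.single c) rfl).fst).1) key
  · exact (toCtx_pre_gen R _ _).symm.trans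
      ((congrArg (fun T : PtsSplit e l (.cons c r) a b =>
        (toCtx (T.snd.split (.single c) rfl).snd).1) key).trans (toCtx_pre_gen R₁ _ _))

theorem pt_glue_mids (L : HomOver p y e (ctx p l)) (C : HomOver p z e c)
    (R : HomOver p y' e (ctx p r))
    (h₁ : y ≫ last p l = z ≫ prod.fst) (h₂ : y' ≫ first p r = z ≫ prod.snd)
    (ha : y ≫ first p l = a) (hb : y' ≫ last p r = b) :
    (glue L C R h₁ h₂ ha hb).pt ≫ mids c r l = z :=
  (pt_mids _ _ _).trans (by rw [← prod.comp_lift, prod.lift_fst_snd, Category.comp_id])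

theorem act_glue₃_congr {N Q : B} {s : K ⟶ N} {t : M ⟶ Q} {γ : Rel p N Q}
    (ν : (bilGraph p).Cell (l.append (α.append r)) s t γ)
    {L : HomOver p y e (ctx p l)} {A : HomOver p x e (ctx p α)}
    {R : HomOver p y' e (ctx p r)}
    {L₁ : HomOver p y₁ e (ctx p l)} {A₁ : HomOver p x₁ e (ctx p α)}
    {R₁ : HomOver p y₁' e (ctx p r)}
    (hL : L.1 = L₁.1) (hA : A.1 = A₁.1) (hR : R.1 = R₁.1)
    {h₁ : y ≫ last p l = x ≫ first p α} {h₂ : y' ≫ first p r = x ≫ last p α}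
    {ha : y ≫ first p l = a} {hb : y' ≫ last p r = b}
    {h₁' : y₁ ≫ last p l = x₁ ≫ first p α} {h₂' : y₁' ≫ first p r = x₁ ≫ last p α}
    {a₁ : Z ⟶ K} {b₁ : Z ⟶ M}
    {ha' : y₁ ≫ first p l = a₁} {hb' : y₁' ≫ last p r = b₁}
    {n : Z ⟶ N} {q : Z ⟶ Q} {n₁ : Z ⟶ N} {q₁ : Z ⟶ Q} (hn : a ≫ s = n) (hq : b ≫ t = q)
    (hn₁ : a₁ ≫ s = n₁) (hq₁ : b₁ ≫ t = q₁) :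
    (act ν (glue₃ L A R h₁ h₂ ha hb) hn hq).1 =
      (act ν (glue₃ L₁ A₁ R₁ h₁' h₂' ha' hb') hn₁ hq₁).1 := by
  obtain rfl := HomOver.over_unique L L₁ hL
  obtain rfl := HomOver.over_unique A A₁ hA
  obtain rfl := HomOver.over_unique R R₁ hR
  obtain rfl := HomOver.ext hL
  obtain rfl := HomOver.ext hA
  obtain rfl := HomOver.ext hR
  subst ha hb ha' hb' hn hq hn₁ hq₁
  rfl

theorem act_comp_whisker {κ : (bilGraph p).Cell α (𝟙 I) (𝟙 J) c} {N Q : B} {s : K ⟶ N} {t : M ⟶ Q}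
    {γ : Rel p N Q} (ζ : (bilGraph p).Cell (l.append (.cons c r)) s t γ)
    (L : HomOver p y e (ctx p l)) (A : HomOver p x e (ctx p α)) (R : HomOver p y' e (ctx p r))
    (h₁ : y ≫ last p l = x ≫ first p α) (h₂ : y' ≫ first p r = x ≫ last p α)
    (ha : y ≫ first p l = a) (hb : y' ≫ last p r = b)
    (hz : x ≫ prod.lift (first p α) (last p α) = z) (h₁' : y ≫ last p l = z ≫ prod.fst)
    (h₂' : y' ≫ first p r = z ≫ prod.snd) {n : Z ⟶ N} {q : Z ⟶ Q} (hn : a ≫ s = n)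
    (hq : b ≫ t = q) :
    act ((bil p).comp (VDC.whisker (D := bil p) l κ r) ζ (Category.id_comp s) (Category.id_comp t))
      (glue₃ L A R h₁ h₂ ha hb) hn hq = act ζ (glue L (A.comp (arr κ) hz) R h₁' h₂' ha hb) hn hq :=
  (act_comp (VDC.whisker (D := bil p) l κ r) ζ (Category.id_comp s) (Category.id_comp t)
    (glue₃ L A R h₁ h₂ ha hb) (Category.comp_id _) (Category.comp_id _) hn hq hn hq).trans
    (congrArg (fun S => act ζ S hn hq) (actCells_whisker_glue κ L A R h₁ h₂ ha hb _ _ hz h₁' h₂'))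

end

/-- A cell which induces a stable cocartesian arrow is a composite. -/
theorem existsUnique_of_stable {I J : B} {α : LPath (Rel p) I J} {c : Rel p I J}
    {κ : (bilGraph p).Cell α (𝟙 I) (𝟙 J) c} (h : Stable (arr κ)) {K M N Q : B}
    (l : LPath (Rel p) K I) (r : LPath (Rel p) J M) (s : K ⟶ N) (t : M ⟶ Q) (γ : Rel p N Q)
    (ν : (bilGraph p).Cell (l.append (α.append r)) s t γ) :
    ∃! ζ : (bilGraph p).Cell (l.append (.cons c r)) s t γ,
      (bil p).comp (VDC.whisker (D := bil p) l κ r) ζ (Category.id_comp s) (Category.id_comp t) =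
        ν := by
  obtain ⟨wl, w₀, wr, GA, GC, GR, h₁, h₂, ha, hb, hG⟩ := exists_glue (gen (l.append (.cons c r)))
  have hw₀ : mids c r l = w₀ := by
    rw [← pt_glue_mids GA GC GR h₁ h₂ ha hb, ← hG, pt_gen, Category.id_comp]
  have hp : IsProjection w₀ := hw₀ ▸ isProjection_mids c r l
  have e₁ : ∀ {Z : B} {w : Z ⟶ base p (l.append (.cons c r))} {x : Z ⟶ base p α},
      w ≫ w₀ = x ≫ prod.lift (first p α) (last p α) → (w ≫ wl) ≫ last p l = x ≫ first p α :=
    fun {Z w x} h => by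
      rw [Category.assoc, h₁, ← Category.assoc, h, Category.assoc, prod.lift_fst]
  have e₂ : ∀ {Z : B} {w : Z ⟶ base p (l.append (.cons c r))} {x : Z ⟶ base p α},
      w ≫ w₀ = x ≫ prod.lift (first p α) (last p α) → (w ≫ wr) ≫ first p r = x ≫ last p α :=
    fun {Z w x} h => by
      rw [Category.assoc, h₂, ← Category.assoc, h, Category.assoc, prod.lift_snd]
  have e₃ : ∀ {Z : B} (w : Z ⟶ base p (l.append (.cons c r))),
      (w ≫ wl) ≫ first p l = w ≫ first p (l.append (.cons c r)) := fun w => by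
    rw [Category.assoc, ha]
  have e₄ : ∀ {Z : B} (w : Z ⟶ base p (l.append (.cons c r))),
      (w ≫ wr) ≫ last p r = w ≫ last p (l.append (.cons c r)) := fun w => by
    rw [Category.assoc, hb]
  have hT : ∀ {Z : B} {e : p.Fiber Z} {y : Z ⟶ base p l} {z : Z ⟶ I ⨯ J} {y' : Z ⟶ base p r}
      {a : Z ⟶ K} {b : Z ⟶ M} (L : HomOver p y e (ctx p l)) (C : HomOver p z e c)
      (R : HomOver p y' e (ctx p r))
      (h₁ : y ≫ last p l = z ≫ prod.fst) (h₂ : y' ≫ first p r = z ≫ prod.snd)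
      (ha : y ≫ first p l = a) (hb : y' ≫ last p r = b),
      (toCtx (glue L C R h₁ h₂ ha hb)).1 ≫ GA.1 = L.1 ∧
      (toCtx (glue L C R h₁ h₂ ha hb)).1 ≫ GC.1 = C.1 ∧
      (toCtx (glue L C R h₁ h₂ ha hb)).1 ≫ GR.1 = R.1 := by
    intro Z e y z y' a b L C R h₁' h₂' ha' hb'
    have H := pre_toCtx (glue L C R h₁' h₂' ha' hb')
    rw [hG, pre_glue _ _ _ _ _ _ _ _ _ _ rfl rfl rfl] at H
    exact glue_inj H
  have hg : ∀ {Z : B} {w : Z ⟶ base p (l.append (.cons c r))},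
      w ≫ prod.lift (first p (l.append (.cons c r)) ≫ s) (last p (l.append (.cons c r)) ≫ t) =
        prod.lift ((w ≫ first p (l.append (.cons c r))) ≫ s)
          ((w ≫ last p (l.append (.cons c r))) ≫ t) := fun {Z w} => by
    rw [prod.comp_lift, Category.assoc, Category.assoc]
  let θ' := meetLift (x := w₀) (y := 𝟙 _) (z := 𝟙 _) GC (meetLift (x := wl) (y := wr) (z := 𝟙 _)
    GA GR (Category.id_comp _) (Category.id_comp _)) (Category.id_comp _) (Category.id_comp _)
  have hθ : θ'.1 ≫ (meetSnd w₀ c (𝟙 _) _).1 ≫ (meetFst wl (ctx p l) wr (ctx p r)).1 = GA.1 ∧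
      θ'.1 ≫ (meetFst w₀ c (𝟙 _) (meet wl (ctx p l) wr (ctx p r))).1 = GC.1 ∧
      θ'.1 ≫ (meetSnd w₀ c (𝟙 _) _).1 ≫ (meetSnd wl (ctx p l) wr (ctx p r)).1 = GR.1 := by
    refine ⟨?_, ?_, ?_⟩ <;> simp only [θ', meetLift_fst, meetLift_snd_assoc, meetLift_snd]
  refine existsUnique_of_exists_of_unique ?_ ?_
  · obtain ⟨χ, hχ, -⟩ := h.existsUnique hp (d := meet wl (ctx p l) wr (ctx p r))
      (g := prod.lift (first p (l.append (.cons c r)) ≫ s) (last p (l.append (.cons c r)) ≫ t))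
      (fun e w x h A D => (act ν (glue₃ (D.comp (meetFst _ _ _ _) rfl) A
        (D.comp (meetSnd _ _ _ _) rfl) (e₁ h) (e₂ h) (e₃ w) (e₄ w)) rfl rfl).cast hg.symm)
      (fun {Z Z'} e e' z k w x h A D w' x' h' hw hx => by
        subst hw hx
        have H := congrArg Subtype.val (act_pre ν k (glue₃ (D.comp (meetFst _ _ _ _) rfl) A
          (D.comp (meetSnd _ _ _ _) rfl) (e₁ h) (e₂ h) (e₃ w) (e₄ w)) rfl rfl rfl rfl rfl rfl
          (Category.assoc _ _ _).symm (Category.assoc _ _ _).symm)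
        refine Eq.trans ?_ H
        rw [pre_glue₃ k _ _ _ _ _ _ _ _ _ rfl rfl rfl]
        exact act_glue₃_congr ν (Category.assoc _ _ _) rfl (Category.assoc _ _ _) rfl rfl rfl rfl)
    refine ⟨mkCell (θ'.comp χ (Category.id_comp _)), cell_ext ?_⟩
    obtain ⟨y, x, y', L, A, R, k₁, k₂, ka, kb, hS⟩ := exists_glue₃ (gen (l.append (α.append r)))
    rw [hS]
    have k₁' : y ≫ last p l = (x ≫ prod.lift (first p α) (last p α)) ≫ prod.fst := by
      rw [k₁, Category.assoc, prod.lift_fst]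
    have k₂' : y' ≫ first p r = (x ≫ prod.lift (first p α) (last p α)) ≫ prod.snd := by
      rw [k₂, Category.assoc, prod.lift_snd]
    refine (act_comp_whisker _ L A R k₁ k₂ ka kb rfl k₁' k₂' rfl rfl).trans (HomOver.ext ?_)
    refine (act_mkCell _ _ _ _).trans ?_
    obtain ⟨t₁, t₂, t₃⟩ := hT L (A.comp (arr κ) rfl) R k₁' k₂' ka kb
    generalize toCtx (glue L (A.comp (arr κ) rfl) R k₁' k₂' ka kb) = τ at t₁ t₂ t₃
    generalize (glue L (A.comp (arr κ) rfl) R k₁' k₂' ka kb).pt = w at τ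
    have q₂ : w ≫ w₀ = x ≫ prod.lift (first p α) (last p α) :=
      HomOver.over_unique (τ.comp GC rfl) (A.comp (arr κ) rfl) t₂
    have q₁ : w ≫ wl = y := HomOver.over_unique (τ.comp GA rfl) L t₁
    have q₃ : w ≫ wr = y' := HomOver.over_unique (τ.comp GR rfl) R t₃
    let D := meetLift (x := wl) (y := wr) L R q₁ q₃
    refine Eq.trans ?_ ((hχ _ w x q₂ A D).trans (act_glue₃_congr ν (meetLift_fst _ _ _ _) rfl
      (meetLift_snd _ _ _ _) rfl rfl rfl rfl))
    refine (Category.assoc _ _ _).symm.trans (congrArg (· ≫ χ.1) ?_)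
    refine meet_meet_ext' (D := τ.comp θ' rfl) (Category.comp_id _) ?_ ?_ ?_
    · simp only [HomOver.comp_val, Category.assoc, hθ.2.1, meetLift_fst, t₂]
    · simp only [HomOver.comp_val, Category.assoc, hθ.1, meetLift_snd_assoc, t₁, D, meetLift_fst]
    · simp only [HomOver.comp_val, Category.assoc, hθ.2.2, meetLift_snd_assoc, t₃, D, meetLift_snd]
  · intro ζ₁ ζ₂ hζ₁ hζ₂
    let d := meet wl (ctx p l) wr (ctx p r)
    let S := glue (e := meet w₀ c (𝟙 _) d) ((meetSnd w₀ c (𝟙 _) d).comp (meetFst _ _ _ _)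
      (Category.id_comp _)) (meetFst w₀ c (𝟙 _) d) ((meetSnd w₀ c (𝟙 _) d).comp (meetSnd _ _ _ _)
      (Category.id_comp _)) h₁ h₂ ha hb
    have hS : S.pre θ' (Category.id_comp _) (Category.id_comp _) =
        gen (l.append (.cons c r)) := by
      rw [hG]
      refine (pre_glue _ _ _ _ _ _ _ _ _ _ (Category.id_comp _) (Category.id_comp _)
        (Category.id_comp _)).trans ?_
      congr 1
      · exact HomOver.ext hθ.1
      · exact HomOver.ext hθ.2.1
      · exact HomOver.ext hθ.2.2
    have key : act ζ₁ S rfl rfl = act ζ₂ S rfl rfl := by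
      refine h.proj_hom_ext hp fun e w x k A D => ?_
      have H : ∀ ζ : (bilGraph p).Cell (l.append (.cons c r)) s t γ,
          (bil p).comp (VDC.whisker (D := bil p) l κ r) ζ (Category.id_comp s)
            (Category.id_comp t) = ν →
          (meetLift (x := w₀) (y := 𝟙 _) (A.comp (arr κ) rfl) D k (Category.comp_id w)).1 ≫
            (act ζ S rfl rfl).1 = (act ν (glue₃ (D.comp (meetFst _ _ _ _) rfl) A
              (D.comp (meetSnd _ _ _ _) rfl) (e₁ k) (e₂ k) (e₃ w) (e₄ w)) rfl rfl).1 := by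
        intro ζ hζ
        have H := congrArg Subtype.val (act_pre ζ (meetLift (x := w₀) (y := 𝟙 _)
          (A.comp (arr κ) rfl) D k (Category.comp_id w)) S rfl rfl rfl rfl rfl rfl
          (Category.assoc _ _ _).symm (Category.assoc _ _ _).symm)
        refine H.symm.trans ?_
        rw [← hζ, act_comp_whisker ζ _ A _ _ _ _ _ k.symm
          (by rw [Category.assoc, h₁, Category.assoc]) (by rw [Category.assoc, h₂, Category.assoc])]
        refine congrArg (fun T => (act ζ T rfl rfl).1) ?_
        refine (pre_glue _ _ _ _ _ _ _ _ _ _ rfl rfl rfl).trans ?_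
        congr 1
        · exact HomOver.ext (meetLift_snd_assoc _ _ _ _ _)
        · exact HomOver.ext (meetLift_fst _ _ _ _)
        · exact HomOver.ext (meetLift_snd_assoc _ _ _ _ _)
      exact (H ζ₁ hζ₁).trans (H ζ₂ hζ₂).symm
    refine cell_ext ?_
    have H : ∀ ζ : (bilGraph p).Cell (l.append (.cons c r)) s t γ,
        (act ζ (gen _) rfl rfl).1 = θ'.1 ≫ (act ζ S rfl rfl).1 := fun ζ => by
      rw [← hS]
      exact congrArg Subtype.val (act_pre ζ θ' S rfl rfl _ _ _ _ (Category.id_comp _)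
        (Category.id_comp _))
    exact HomOver.ext ((H ζ₁).trans ((congrArg (fun y => θ'.1 ≫ y.1) key).trans (H ζ₂).symm))

theorem isComposite_of_stable {I J : B} {α : LPath (Rel p) I J} {c : Rel p I J}
    {κ : (bilGraph p).Cell α (𝟙 I) (𝟙 J) c} (h : Stable (arr κ)) :
    VDC.IsComposite (D := bil p) κ :=
  fun _ _ l r _ _ s t γ ν => existsUnique_of_stable h l r s t γ ν

end FibCat

end

noncomputable section

theorem VDC.IsComposite.existsUnique {D : VDC.{u, v, w, x}} {I J : D.Ob} {α : LPath D.Loose I J}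
    {c : D.Loose I J} {κ : D.Cell α (𝟙 I) (𝟙 J) c} (h : VDC.IsComposite κ) {γ : D.Loose I J}
    (ν : D.Cell α (𝟙 I) (𝟙 J) γ) :
    ∃! ζ : D.Cell (.single c) (𝟙 I) (𝟙 J) γ,
      D.comp (VDGraph.Cells.single κ) ζ (Category.id_comp _) (Category.id_comp _) = ν := by
  have key : ∀ {α' : LPath D.Loose I J} (e : α.append (.nil J) = α')
      (ν : D.Cell α' (𝟙 I) (𝟙 J) γ),
      ∃! ζ : D.Cell (.single c) (𝟙 I) (𝟙 J) γ,
        D.comp (.cons κ (.nil (𝟙 J) (𝟙 J) rfl) e) ζ (Category.id_comp _)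
          (Category.id_comp _) = ν := by
    intro α' e ν
    subst e
    exact h (.nil I) (.nil J) (𝟙 I) (𝟙 J) γ ν
  exact key α.append_nil ν

namespace FibCat

open CategoryTheory.Functor

section

variable {B : Type u} [Category.{v} B] {E : Type w} [Category.{x} E] {p : E ⥤ B}
  [HasFiniteProducts B]

/-- The pair of the first and the last object of a path. -/
abbrev ends {I J : B} (α : LPath (Rel p) I J) : base p α ⟶ I ⨯ J :=
  prod.lift (first p α) (last p α)

theorem isProjection_last {I J : B} (α : LPath (Rel p) I J) : IsProjection (last p α) := by
  induction α with
  | nil => exact isProjection_id _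
  | cons a α ih => exact (isProjection_snd _ _).comp ih

theorem isProjection_ends {I J : B} (α : LPath (Rel p) I J) (h : 0 < α.length) :
    IsProjection (ends α) := by
  cases α with
  | nil => exact (lt_irrefl _ h).elim
  | cons a α =>
    have e : ends (.cons a α) = prod.map (𝟙 _) (last p α) :=
      Limits.prod.hom_ext ((prod.lift_fst _ _).trans
        ((Category.comp_id _).symm.trans (prod.map_fst _ _).symm))
        ((prod.lift_snd _ _).trans (prod.map_snd _ _).symm)
    rw [e]
    exact (isProjection_last α).map_id _

theorem isDelta_ends {I J : B} (α : LPath (Rel p) I J) (h : α.length = 0) :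
    IsDelta (ends α) := by
  cases α with
  | nil =>
    exact ⟨I, ⊤_ B, 𝟙 I, terminal.from I, prod.fst, prod.snd,
      nonempty_isLimit_of_existsUnique fun _ u v => ⟨u, ⟨Category.comp_id _, Subsingleton.elim _ _⟩,
        fun _ h => (Category.comp_id _).symm.trans h.1⟩,
      ⟨prodIsProd _ _⟩, prod.lift_fst _ _, prod.lift_snd _ _⟩
  | cons a α => exact (Nat.succ_ne_zero _ h).elim

variable [p.IsFibered] [∀ X : B, HasFiniteProducts (p.Fiber X)]
  [∀ {X Y : B} (f : X ⟶ Y), PreservesFiniteProducts (baseChange p f)]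

theorem arr_mkCell {I J : B} {α : LPath (Rel p) I J} {c : Rel p I J}
    (φ : HomOver p (ends α) (ctx p α) c) (e : ends α =
      prod.lift (first p α ≫ 𝟙 I) (last p α ≫ 𝟙 J)) : arr (mkCell (φ.cast e)) = φ := by
  have h := congrArg Subtype.val (act_mkCell_gen (φ.cast e))
  exact HomOver.ext h

theorem arr_injective {I J : B} {α : LPath (Rel p) I J} {c : Rel p I J}
    {κ κ' : (bilGraph p).Cell α (𝟙 I) (𝟙 J) c} (h : (arr κ).1 = (arr κ').1) : κ = κ' :=
  cell_ext (HomOver.ext h)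

theorem arr_comp_single {I J : B} {α : LPath (Rel p) I J} {c γ : Rel p I J}
    (κ : (bilGraph p).Cell α (𝟙 I) (𝟙 J) c) (ζ : (bilGraph p).Cell (.single c) (𝟙 I) (𝟙 J) γ) :
    (arr ((bil p).comp (VDGraph.Cells.single κ) ζ (Category.id_comp _) (Category.id_comp _))).1 =
      (arr κ).1 ≫ (sarr ζ).1 :=
  act_comp_single κ ζ (Category.id_comp _) (Category.id_comp _) (gen α) (Category.comp_id _)
    (Category.comp_id _) (Category.comp_id _) (Category.comp_id _)

theorem cocart_arr {I J : B} {α : LPath (Rel p) I J} {c : Rel p I J}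
    {κ : (bilGraph p).Cell α (𝟙 I) (𝟙 J) c}
    (h : ∀ {γ : Rel p I J} (ν : (bilGraph p).Cell α (𝟙 I) (𝟙 J) γ),
      ∃! ζ : (bilGraph p).Cell (.single c) (𝟙 I) (𝟙 J) γ, (bil p).comp (VDGraph.Cells.single κ) ζ
        (Category.id_comp _) (Category.id_comp _) = ν) :
    Cocart (arr κ) := by
  refine cocart_of_isCocartesian _ { toIsHomLift := (arr κ).2, universal_property := ?_ }
  intro b' φ' hφ'
  obtain ⟨b, rfl⟩ : ∃ b : Rel p I J, b.1 = b' := ⟨⟨b', IsHomLift.codomain_eq p (ends α) φ'⟩, rfl⟩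
  obtain ⟨ψ, rfl⟩ : ∃ ψ : HomOver p (ends α) (ctx p α) b, ψ.1 = φ' := ⟨⟨φ', hφ'⟩, rfl⟩
  have e : ends α = prod.lift (first p α ≫ 𝟙 I) (last p α ≫ 𝟙 J) := by
    rw [Category.comp_id, Category.comp_id]
  have e' : prod.map (𝟙 I) (𝟙 J) = 𝟙 (I ⨯ J) := prod.map_id_id
  obtain ⟨ζ, hζ, hu⟩ := h (mkCell (ψ.cast e))
  refine ⟨((sarr ζ).cast e').1, ⟨((sarr ζ).cast e').2, ?_⟩, fun χ hχ => ?_⟩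
  · exact (arr_comp_single κ ζ).symm.trans ((congrArg (fun y => (arr y).1) hζ).trans
      (congrArg Subtype.val (arr_mkCell ψ e)))
  · obtain ⟨χ', rfl⟩ : ∃ χ' : HomOver p (𝟙 (I ⨯ J)) c b, χ'.1 = χ := ⟨⟨χ, hχ.1⟩, rfl⟩
    have hs := congrArg Subtype.val (sarr_mkSingle (χ'.cast e'.symm))
    refine hs.symm.trans (congrArg (fun y => (sarr y).1) (hu _ (arr_injective ?_)))
    refine (arr_comp_single κ _).trans ?_
    refine (congrArg ((arr κ).1 ≫ ·) hs).trans (hχ.2.trans ?_)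
    exact (congrArg Subtype.val (arr_mkCell ψ e)).symm

variable (p) in
/-- Stable cocartesian arrows exist, on the conjunctions of the paths with length in `S`. -/
def HasStable (S : Set ℕ) : Prop :=
  ∀ ⦃I J : B⦄ (α : LPath (Rel p) I J), α.length ∈ S →
    ∃ (c : Rel p I J) (φ : HomOver p (ends α) (ctx p α) c), Cocart φ ∧ Stable φ

theorem HasStable.hasComposites {S : Set ℕ} (h : HasStable p S) :
    VDC.HasComposites S (bil p) := by
  have key : ∀ (I J : B) (α : LPath (Rel p) I J), α.length ∈ S → ∃ (c : Rel p I J)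
      (κ : (bilGraph p).Cell α (𝟙 I) (𝟙 J) c), VDC.IsComposite (D := bil p) κ := by
    intro I J α hα
    obtain ⟨c, φ, -, hφ⟩ := h α hα
    have e : ends α = prod.lift (first p α ≫ 𝟙 I) (last p α ≫ 𝟙 J) := by
      rw [Category.comp_id, Category.comp_id]
    exact ⟨c, mkCell (φ.cast e), isComposite_of_stable (by rw [arr_mkCell]; exact hφ)⟩
  exact fun I J α hα => key I J α hα

theorem HasStable.stable_arr {S : Set ℕ} (h : HasStable p S) {I J : B} {α : LPath (Rel p) I J}
    (hα : α.length ∈ S) {c : Rel p I J} {κ : (bilGraph p).Cell α (𝟙 I) (𝟙 J) c}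
    (hκ : Cocart (arr κ)) : Stable (arr κ) := by
  obtain ⟨_, _, h₁, h₂⟩ := h α hα
  exact hκ.stable_of_stable h₁ h₂

end

end FibCat

namespace CartFib

open FibCat

theorem IsExistential.hasStable {P : CartFib.{u, v, w, x}} (hP : P.IsExistential) :
    HasStable P.p {n | 0 < n} :=
  fun _ _ α hα => hP.exists_cocart (isProjection_ends α hα) _

theorem IsElementary.hasStable {P : CartFib.{u, v, w, x}} (hP : P.IsElementary) :
    HasStable P.p {0} :=
  fun _ _ α hα => hP.exists_cocart (isDelta_ends α hα) _

theorem hasStable_univ {P : CartFib.{u, v, w, x}} (h : P.IsElementary) (h' : P.IsExistential) :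
    HasStable P.p Set.univ := fun _ _ α _ => by
  obtain hα | hα := Nat.eq_zero_or_pos α.length
  · exact h.hasStable α hα
  · exact h'.hasStable α hα

namespace Mor

variable {P Q : CartFib.{u, v, w, x}} (F : Mor P Q)

theorem isInv_desc {I J : P.Base} (α : LPath (Rel P.p) I J) :
    HomOver.IsInv (F.desc α) (toCtx (F.mapPts (gen α))) := by
  constructor
  · exact (toCtx_pre (F.desc α) (F.mapPts (gen α)) (F.bmap_first α) (F.bmap_last α)).symm.trans
      ((congrArg (fun S => (toCtx S).1) (F.pre_desc α)).trans (toCtx_gen _))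
  · exact (congrArg Subtype.val (F.toCtx_desc (gen α))).trans
      ((congrArg F.total.map (toCtx_gen α)).trans (F.total.map_id _))

theorem arr_cell {I J : P.Base} {α : LPath (Rel P.p) I J} {c : Rel P.p I J}
    (κ : (bilGraph P.p).Cell α (𝟙 I) (𝟙 J) c) :
    (arr ((bilGraph Q.p).cast rfl (F.base.map_id I) (F.base.map_id J) (F.cell κ))).1 =
      (F.desc α).1 ≫ F.total.map (arr κ).1 ≫ (F.relInv c).1 := by
  have e₁ := (congrArg (first Q.p (F.path α) ≫ ·) (F.base.map_id I)).trans (Category.comp_id _)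
  have e₂ := (congrArg (last Q.p (F.path α) ≫ ·) (F.base.map_id J)).trans (Category.comp_id _)
  have h₁ := congrArg Subtype.val (act_cast (F.cell κ) (F.base.map_id I) (F.base.map_id J)
    (gen (F.path α)) e₁ e₂ (Category.comp_id _) (Category.comp_id _))
  refine h₁.trans ?_
  have h₂ := congrArg Subtype.val (act_pre (F.cell κ) (F.desc α) (F.mapPts (gen α))
    (F.map_eq (Category.comp_id _)) (F.map_eq (Category.comp_id _)) (F.bmap_first α)
    (F.bmap_last α) e₁ e₂ (F.bmap_first α) (F.bmap_last α))
  refine (congrArg (fun S => (act (F.cell κ) S e₁ e₂).1) (F.pre_desc α)).symm.trans (h₂.trans ?_)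
  refine congrArg ((F.desc α).1 ≫ ·) ?_
  have h₃ := congrArg Subtype.val (F.act_cell κ (gen α) (Category.comp_id _) (Category.comp_id _))
  refine h₃.trans ?_
  refine ((congrArg (_ ≫ ·) (F.isInv_relProj c).hom_inv).trans (Category.comp_id _)).symm.trans ?_
  exact (Category.assoc _ _ _).symm.trans (congrArg (· ≫ (F.relInv c).1) (F.mapPt_proj _))

theorem bil_preservesComposites {S : Set ℕ} (hQ : HasStable Q.p S)
    (hF : ∀ ⦃I J : P.Base⦄ (α : LPath (Rel P.p) I J), α.length ∈ S → ∀ {c : Rel P.p I J}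
      (φ : HomOver P.p (ends α) (ctx P.p α) c), Cocart φ → Cocart (F.homMap φ)) :
    F.bil.PreservesComposites S := by
  have key : ∀ {I J : P.Base} {α : LPath (Rel P.p) I J} {c : Rel P.p I J}
      (κ : (bilGraph P.p).Cell α (𝟙 I) (𝟙 J) c), α.length ∈ S →
      VDC.IsComposite (D := FibCat.bil P.p) κ → VDC.IsComposite (D := FibCat.bil Q.p)
        ((bilGraph Q.p).cast rfl (F.base.map_id I) (F.base.map_id J) (F.cell κ)) := by
    intro I J α c κ hα h
    have h₁ := hF α hα (arr κ) (cocart_arr h.existsUnique)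
    refine isComposite_of_stable (hQ.stable_arr ?_ ?_)
    · rw [LPath.length_map]; exact hα
    · exact h₁.of_inv (F.isInv_desc α) (F.isInv_relProj c).symm (F.arr_cell κ)
  exact fun I J α c κ hα h => key κ hα h

end Mor

theorem Mor.IsExistential.preservesComposites {P Q : CartFib.{u, v, w, x}} {F : Mor P Q}
    (hF : F.IsExistential) (hQ : Q.IsExistential) : F.bil.PreservesComposites {n | 0 < n} :=
  F.bil_preservesComposites hQ.hasStable fun _ _ α hα _ φ h =>
    cocart_of_isCocartesian _ (hF _ (isProjection_ends α hα) φ.1 h.isCocartesian)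

theorem Mor.IsElementary.preservesComposites {P Q : CartFib.{u, v, w, x}} {F : Mor P Q}
    (hF : F.IsElementary) (hQ : Q.IsElementary) : F.bil.PreservesComposites {0} :=
  F.bil_preservesComposites hQ.hasStable fun _ _ α hα _ φ h =>
    cocart_of_isCocartesian _ (hF _ (isDelta_ends α hα) φ.1 h.isCocartesian)

theorem Mor.preservesComposites_univ {P Q : CartFib.{u, v, w, x}} {F : Mor P Q}
    (h : F.IsElementary) (h' : F.IsExistential) (hQ : HasStable Q.p Set.univ) :
    F.bil.PreservesComposites Set.univ :=
  F.bil_preservesComposites hQ fun _ _ α _ _ φ hφ => by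
    obtain hα | hα := Nat.eq_zero_or_pos α.length
    · exact cocart_of_isCocartesian _ (h _ (isDelta_ends α hα) φ.1 hφ.isCocartesian)
    · exact cocart_of_isCocartesian _ (h' _ (isProjection_ends α hα) φ.1 hφ.isCocartesian)

end CartFib

end

noncomputable section

namespace FibCat

open CategoryTheory.Functor

section

variable {B : Type u} [Category.{v} B] {E : Type w} [Category.{x} E] {p : E ⥤ B}
  [HasFiniteProducts B]
  [p.IsFibered] [∀ X : B, HasFiniteProducts (p.Fiber X)]
  [∀ {X Y : B} (f : X ⟶ Y), PreservesFiniteProducts (baseChange p f)]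

section

variable {D : VDGraph.{u, v, w, x}} {P Q : D.Ob → B}
  (lP : ∀ {I J : D.Ob}, D.Loose I J → Rel p (P I) (P J))
  (lQ : ∀ {I J : D.Ob}, D.Loose I J → Rel p (Q I) (Q J)) (app : ∀ I, P I ⟶ Q I)
  (cell : ∀ {I J : D.Ob} (α : D.Loose I J),
    (bilGraph p).Cell (.single (lP α)) (app I) (app J) (lQ α))

theorem actCells_transCells_append {I J K : D.Ob} {α₁ : LPath D.Loose I J} {α₂ : LPath D.Loose J K}
    {α : LPath D.Loose I K} (h : α₁.append α₂ = α) {Z : B} {e : p.Fiber Z} {s : Z ⟶ P I}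
    {m : Z ⟶ P J} {t : Z ⟶ P K} (R₁ : Pts e (α₁.map P lP) s m) (R₂ : Pts e (α₂.map P lP) m t)
    (h₁ : (α₁.map P lP).append (α₂.map P lP) = α.map P lP)
    (h₂ : (α₁.map Q lQ).append (α₂.map Q lQ) = α.map Q lQ) {s' : Z ⟶ Q I} {m' : Z ⟶ Q J}
    {t' : Z ⟶ Q K} (hs : s ≫ app I = s') (hm : m ≫ app J = m') (ht : t ≫ app K = t') :
    actCells (VDGraph.transCells (E := bilGraph p) lP lQ app cell α) (R₁.append R₂ h₁) hs ht =
      (actCells (VDGraph.transCells (E := bilGraph p) lP lQ app cell α₁) R₁ hs hm).append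
        (actCells (VDGraph.transCells (E := bilGraph p) lP lQ app cell α₂) R₂ hm ht) h₂ := by
  subst h
  induction α₁ with
  | nil =>
    obtain rfl := R₁.nil_eq
    obtain ⟨⟩ := R₁
    obtain rfl := hs.symm.trans hm
    rfl
  | cons β α₁ ih =>
    obtain ⟨n, a, as, rfl⟩ := Pts.exists_cons R₁
    refine (congrArg (fun S => actCells _ S hs ht) (Pts.cons_append a as R₂ h₁
      (LPath.map_append _ _ _ _).symm)).trans ?_
    refine (actCells_transCells_cons lP lQ app cell β (α₁.append α₂) a _ hs rfl ht).trans ?_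
    rw [ih as R₂ rfl hm (LPath.map_append _ _ _ _).symm (LPath.map_append _ _ _ _).symm]
    refine (Pts.cons_append _ _ _ h₂ (LPath.map_append _ _ _ _).symm).symm.trans ?_
    refine congrArg (fun S => Pts.append S _ h₂) ?_
    exact (actCells_transCells_cons lP lQ app cell β α₁ a as hs rfl hm).symm

end

/-- A family of arrows between the images of two homomorphisms, which is natural for single cells,
is natural for paths of cells. -/
theorem actCells_transCells_natural {D : VDGraph.{u, v, w, x}}
    {T G : VDGraphHom D (bilGraph p)} {app : ∀ I, T.tight.obj I ⟶ G.tight.obj I}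
    (hnat : ∀ {I J : D.Ob} (s : I ⟶ J), T.tight.map s ≫ app J = app I ≫ G.tight.map s)
    {cell : ∀ {I J : D.Ob} (α : D.Loose I J),
      (bilGraph p).Cell (.single (T.loose α)) (app I) (app J) (G.loose α)}
    (hcell : ∀ {I J K M : D.Ob} {α : LPath D.Loose I J} {s : I ⟶ K} {t : J ⟶ M} {β : D.Loose K M}
      (ξ : D.Cell α s t β) {Z : B} {e : p.Fiber Z} {a : Z ⟶ T.tight.obj I} {b : Z ⟶ T.tight.obj J}
      (R : Pts e (T.path α) a b) {a' : Z ⟶ T.tight.obj K} {b' : Z ⟶ T.tight.obj M}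
      (ha : a ≫ T.tight.map s = a') (hb : b ≫ T.tight.map t = b') {c : Z ⟶ G.tight.obj I}
      {d : Z ⟶ G.tight.obj J} (hc : a ≫ app I = c) (hd : b ≫ app J = d) {c' : Z ⟶ G.tight.obj K}
      {d' : Z ⟶ G.tight.obj M} (hc' : c ≫ G.tight.map s = c') (hd' : d ≫ G.tight.map t = d'),
      (act (T.cell ξ) R ha hb).1 ≫ (sarr (cell β)).1 =
        (act (G.cell ξ) (actCells (VDGraph.transCells T.loose G.loose app cell α) R hc hd)
          hc' hd').1) :
    ∀ {I J K M : D.Ob} {α : LPath D.Loose I J} {s : I ⟶ K} {t : J ⟶ M} {β : LPath D.Loose K M}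
      (χ : D.Cells α s t β) {Z : B} {e : p.Fiber Z} {a : Z ⟶ T.tight.obj I}
      {b : Z ⟶ T.tight.obj J}
      (R : Pts e (T.path α) a b) {a' : Z ⟶ T.tight.obj K} {b' : Z ⟶ T.tight.obj M}
      (ha : a ≫ T.tight.map s = a') (hb : b ≫ T.tight.map t = b') {c : Z ⟶ G.tight.obj I}
      {d : Z ⟶ G.tight.obj J} (hc : a ≫ app I = c) (hd : b ≫ app J = d) {c' : Z ⟶ G.tight.obj K}
      {d' : Z ⟶ G.tight.obj M} (hc' : c ≫ G.tight.map s = c') (hd' : d ≫ G.tight.map t = d')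
      (ha' : a' ≫ app K = c') (hb' : b' ≫ app M = d'),
      actCells (VDGraph.transCells T.loose G.loose app cell β) (actCells (T.cells χ) R ha hb)
          ha' hb' =
        actCells (G.cells χ) (actCells (VDGraph.transCells T.loose G.loose app cell α) R hc hd)
          hc' hd'
  | _, _, _, _, _, _, _, _, .nil _ _ _, _, _, _, _, _, _, _, _, _, _, _, _, _, _, _, _, _, _, _ =>
    Pts.nil_uniq _ _
  | _, _, _, _, _, _, _, _, .cons (α₁ := α₁) (α₂ := α₂) (β := β) (q := q) ξ ξs h,
      _, _, _, _, R, _, _,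
    ha, hb, _, _, hc, hd, _, _, hc', hd', ha', hb' => by
    have h₁ := (LPath.map_append T.tight.obj T.loose α₁ _).symm.trans (congrArg T.path h)
    have h₂ := (LPath.map_append G.tight.obj G.loose α₁ _).symm.trans (congrArg G.path h)
    have e := Pts.append_split h₁ R
    generalize R.split _ h₁ = r at e
    subst e
    have hn : ∀ {X Y : D.Ob} (f : X ⟶ Y) {Z : B} (z : Z ⟶ T.tight.obj X),
        (z ≫ app X) ≫ G.tight.map f = (z ≫ T.tight.map f) ≫ app Y := fun f _ z => by
      rw [Category.assoc, Category.assoc, hnat]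
    refine (congrArg (fun S => actCells _ S ha' hb') (actCells_cons (T.cell ξ) (T.cells ξs) h₁ r.fst
      r.snd ha rfl hb)).trans ?_
    refine (actCells_transCells_cons T.loose G.loose app cell β q _ _ ha' rfl hb').trans ?_
    refine Eq.trans ?_ (congrArg (fun S => actCells _ S hc' hd') (actCells_transCells_append T.loose
      G.loose app cell h r.fst r.snd h₁ h₂ hc rfl hd)).symm
    refine Eq.trans ?_ (actCells_cons (G.cell ξ) (G.cells ξs) h₂ _ _ hc' (hn _ _) hd').symm
    refine congrArg₂ Pts.cons (HomOver.ext ?_) ?_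
    · exact hcell ξ r.fst ha rfl hc rfl hc' (hn _ _)
    · exact actCells_transCells_natural hnat hcell ξs r.snd rfl hb rfl hd (hn _ _) hd' rfl hb'

end

end FibCat

end

noncomputable section

namespace FibCat

open CategoryTheory.Functor

section

variable {B : Type u} [Category.{v} B] {E : Type w} [Category.{x} E] {p : E ⥤ B}
  [HasFiniteProducts B]
  [p.IsFibered] [∀ X : B, HasFiniteProducts (p.Fiber X)]
  [∀ {X Y : B} (f : X ⟶ Y), PreservesFiniteProducts (baseChange p f)]

variable (p) in
/-- Pairs of objects, of loose arrows and of cells. -/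
abbrev pairGraph : VDGraph.{u, v, w, x} := VDC.prodGraph (bil p) (bil p)

/-- The external conjunction of two loose arrows. -/
def boxLoose {I J : (pairGraph p).Ob} (α : (pairGraph p).Loose I J) :
    Rel p (I.1 ⨯ I.2) (J.1 ⨯ J.2) :=
  meet (prod.map prod.fst prod.fst) α.1 (prod.map prod.snd prod.snd) α.2

abbrev boxPath {I J : (pairGraph p).Ob} (α : LPath (pairGraph p).Loose I J) :
    LPath (Rel p) (I.1 ⨯ I.2) (J.1 ⨯ J.2) :=
  α.map (fun X => X.1 ⨯ X.2) boxLoose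

abbrev fstPath {I J : (pairGraph p).Ob} (α : LPath (pairGraph p).Loose I J) :
    LPath (Rel p) I.1 J.1 :=
  α.map Prod.fst Prod.fst

abbrev sndPath {I J : (pairGraph p).Ob} (α : LPath (pairGraph p).Loose I J) :
    LPath (Rel p) I.2 J.2 :=
  α.map Prod.snd Prod.snd

def fstCell {I J : (pairGraph p).Ob} (α : (pairGraph p).Loose I J) :
    (bilGraph p).Cell (.single (boxLoose α)) (prod.fst : I.1 ⨯ I.2 ⟶ I.1) prod.fst α.1 :=
  mkSingle (meetFst _ _ _ _)

def sndCell {I J : (pairGraph p).Ob} (α : (pairGraph p).Loose I J) :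
    (bilGraph p).Cell (.single (boxLoose α)) (prod.snd : I.1 ⨯ I.2 ⟶ I.2) prod.snd α.2 :=
  mkSingle (meetSnd _ _ _ _)

theorem sarr_fstCell {I J : (pairGraph p).Ob} (α : (pairGraph p).Loose I J) :
    sarr (fstCell α) = meetFst _ _ _ _ := sarr_mkSingle _

theorem sarr_sndCell {I J : (pairGraph p).Ob} (α : (pairGraph p).Loose I J) :
    sarr (sndCell α) = meetSnd _ _ _ _ := sarr_mkSingle _

/-- The projections of a path of external conjunctions. -/
def fstCells {I J : (pairGraph p).Ob} (α : LPath (pairGraph p).Loose I J) :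
    (bilGraph p).Cells (boxPath α) (prod.fst : I.1 ⨯ I.2 ⟶ I.1) prod.fst (fstPath α) :=
  VDGraph.transCells (D := pairGraph p) (E := bilGraph p) (P := fun X => X.1 ⨯ X.2)
    (Q := Prod.fst) boxLoose Prod.fst (fun _ => prod.fst) fstCell α

def sndCells {I J : (pairGraph p).Ob} (α : LPath (pairGraph p).Loose I J) :
    (bilGraph p).Cells (boxPath α) (prod.snd : I.1 ⨯ I.2 ⟶ I.2) prod.snd (sndPath α) :=
  VDGraph.transCells (D := pairGraph p) (E := bilGraph p) (P := fun X => X.1 ⨯ X.2)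
    (Q := Prod.snd) boxLoose Prod.snd (fun _ => prod.snd) sndCell α

section

variable {I J K M : (pairGraph p).Ob} {Z Z' : B} {e : p.Fiber Z} {e' : p.Fiber Z'}

/-- The two projections of a generalized element. -/
def fstPts (α : LPath (pairGraph p).Loose I J) {s : Z ⟶ I.1 ⨯ I.2} {t : Z ⟶ J.1 ⨯ J.2}
    (R : Pts e (boxPath α) s t) {s' : Z ⟶ I.1} {t' : Z ⟶ J.1} (hs : s ≫ prod.fst = s')
    (ht : t ≫ prod.fst = t') : Pts e (fstPath α) s' t' :=
  actCells (fstCells α) R hs ht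

def sndPts (α : LPath (pairGraph p).Loose I J) {s : Z ⟶ I.1 ⨯ I.2} {t : Z ⟶ J.1 ⨯ J.2}
    (R : Pts e (boxPath α) s t) {s' : Z ⟶ I.2} {t' : Z ⟶ J.2} (hs : s ≫ prod.snd = s')
    (ht : t ≫ prod.snd = t') : Pts e (sndPath α) s' t' :=
  actCells (sndCells α) R hs ht

theorem fstPts_pre (α : LPath (pairGraph p).Loose I J) {z : Z' ⟶ Z} (φ : HomOver p z e' e)
    {s : Z ⟶ I.1 ⨯ I.2} {t : Z ⟶ J.1 ⨯ J.2}
    (R : Pts e (boxPath α) s t) {s' : Z ⟶ I.1} {t' : Z ⟶ J.1} (hs : s ≫ prod.fst = s')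
    (ht : t ≫ prod.fst = t') {c : Z' ⟶ I.1 ⨯ I.2} {d : Z' ⟶ J.1 ⨯ J.2} (hc : z ≫ s = c)
    (hd : z ≫ t = d) {c' : Z' ⟶ I.1} {d' : Z' ⟶ J.1} (hc' : c ≫ prod.fst = c')
    (hd' : d ≫ prod.fst = d') (hc'' : z ≫ s' = c') (hd'' : z ≫ t' = d') :
    fstPts α (R.pre φ hc hd) hc' hd' = (fstPts α R hs ht).pre φ hc'' hd'' :=
  actCells_pre (fstCells α) φ R hs ht hc hd hc' hd' hc'' hd''

theorem sndPts_pre (α : LPath (pairGraph p).Loose I J) {z : Z' ⟶ Z} (φ : HomOver p z e' e)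
    {s : Z ⟶ I.1 ⨯ I.2} {t : Z ⟶ J.1 ⨯ J.2}
    (R : Pts e (boxPath α) s t) {s' : Z ⟶ I.2} {t' : Z ⟶ J.2} (hs : s ≫ prod.snd = s')
    (ht : t ≫ prod.snd = t') {c : Z' ⟶ I.1 ⨯ I.2} {d : Z' ⟶ J.1 ⨯ J.2} (hc : z ≫ s = c)
    (hd : z ≫ t = d) {c' : Z' ⟶ I.2} {d' : Z' ⟶ J.2} (hc' : c ≫ prod.snd = c')
    (hd' : d ≫ prod.snd = d') (hc'' : z ≫ s' = c') (hd'' : z ≫ t' = d') :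
    sndPts α (R.pre φ hc hd) hc' hd' = (sndPts α R hs ht).pre φ hc'' hd'' :=
  actCells_pre (sndCells α) φ R hs ht hc hd hc' hd' hc'' hd''

theorem fstPts_cons (α : (pairGraph p).Loose I J) (q : LPath (pairGraph p).Loose J K)
    {s : Z ⟶ I.1 ⨯ I.2} {m : Z ⟶ J.1 ⨯ J.2} {t : Z ⟶ K.1 ⨯ K.2}
    (a : HomOver p (prod.lift s m) e (boxLoose α)) (as : Pts e (boxPath q) m t) {s' : Z ⟶ I.1}
    {m' : Z ⟶ J.1} {t' : Z ⟶ K.1} (hs : s ≫ prod.fst = s') (hm : m ≫ prod.fst = m')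
    (ht : t ≫ prod.fst = t') :
    fstPts (.cons α q) (.cons a as) hs ht =
      .cons (a.comp (meetFst _ _ _ _) (lift_map_eq hs hm)) (fstPts q as hm ht) :=
  (actCells_transCells_cons (D := pairGraph p) (P := fun X => X.1 ⨯ X.2)
    (Q := Prod.fst) boxLoose Prod.fst (fun _ => prod.fst) fstCell α q a as hs hm ht).trans
    (congrArg (fun y => Pts.cons (a.comp y (lift_map_eq hs hm)) (fstPts q as hm ht))
      (sarr_fstCell α))

theorem sndPts_cons (α : (pairGraph p).Loose I J) (q : LPath (pairGraph p).Loose J K)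
    {s : Z ⟶ I.1 ⨯ I.2} {m : Z ⟶ J.1 ⨯ J.2} {t : Z ⟶ K.1 ⨯ K.2}
    (a : HomOver p (prod.lift s m) e (boxLoose α)) (as : Pts e (boxPath q) m t) {s' : Z ⟶ I.2}
    {m' : Z ⟶ J.2} {t' : Z ⟶ K.2} (hs : s ≫ prod.snd = s') (hm : m ≫ prod.snd = m')
    (ht : t ≫ prod.snd = t') :
    sndPts (.cons α q) (.cons a as) hs ht =
      .cons (a.comp (meetSnd _ _ _ _) (lift_map_eq hs hm)) (sndPts q as hm ht) :=
  (actCells_transCells_cons (D := pairGraph p) (P := fun X => X.1 ⨯ X.2)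
    (Q := Prod.snd) boxLoose Prod.snd (fun _ => prod.snd) sndCell α q a as hs hm ht).trans
    (congrArg (fun y => Pts.cons (a.comp y (lift_map_eq hs hm)) (sndPts q as hm ht))
      (sarr_sndCell α))

theorem lift_fst_eq {X X' Y Y' : B} {f : X ⟶ X'} {g : Y ⟶ Y'} {s : Z ⟶ X ⨯ Y} {s₁ : Z ⟶ X}
    (h : s ≫ prod.fst = s₁) : (s ≫ prod.map f g) ≫ prod.fst = s₁ ≫ f := by
  rw [Category.assoc, prod.map_fst, ← Category.assoc, h]

theorem lift_snd_eq {X X' Y Y' : B} {f : X ⟶ X'} {g : Y ⟶ Y'} {s : Z ⟶ X ⨯ Y} {s₁ : Z ⟶ Y}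
    (h : s ≫ prod.snd = s₁) : (s ≫ prod.map f g) ≫ prod.snd = s₁ ≫ g := by
  rw [Category.assoc, prod.map_snd, ← Category.assoc, h]

/-- The external conjunction of two cells. -/
def boxCell {α : LPath (pairGraph p).Loose I J} {s : I ⟶ K} {t : J ⟶ M}
    {β : (pairGraph p).Loose K M} (ξ : (pairGraph p).Cell α s t β) :
    (bilGraph p).Cell (boxPath α) (prod.map s.1 s.2) (prod.map t.1 t.2) (boxLoose β) :=
  mkCell (meetLift (act ξ.1 (fstPts α (gen (boxPath α)) rfl rfl) rfl rfl)
    (act ξ.2 (sndPts α (gen (boxPath α)) rfl rfl) rfl rfl)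
    (lift_map_eq (lift_fst_eq rfl) (lift_fst_eq rfl))
    (lift_map_eq (lift_snd_eq rfl) (lift_snd_eq rfl)))

theorem act_boxCell_fst {α : LPath (pairGraph p).Loose I J} {s : I ⟶ K} {t : J ⟶ M}
    {β : (pairGraph p).Loose K M} (ξ : (pairGraph p).Cell α s t β) {a : Z ⟶ I.1 ⨯ I.2}
    {b : Z ⟶ J.1 ⨯ J.2} (R : Pts e (boxPath α) a b) {a' : Z ⟶ K.1 ⨯ K.2} {b' : Z ⟶ M.1 ⨯ M.2}
    (ha : a ≫ prod.map s.1 s.2 = a') (hb : b ≫ prod.map t.1 t.2 = b') {c : Z ⟶ I.1} {d : Z ⟶ J.1}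
    (hc : a ≫ prod.fst = c) (hd : b ≫ prod.fst = d) {c' : Z ⟶ K.1} {d' : Z ⟶ M.1}
    (hc' : c ≫ s.1 = c') (hd' : d ≫ t.1 = d') :
    (act (boxCell ξ) R ha hb).1 ≫ (meetFst (prod.map prod.fst prod.fst) β.1
      (prod.map prod.snd prod.snd) β.2).1 = (act ξ.1 (fstPts α R hc hd) hc' hd').1 := by
  refine (congrArg (· ≫ _) (act_mkCell _ R ha hb)).trans ?_
  refine (Category.assoc _ _ _).trans ((congrArg ((toCtx R).1 ≫ ·) (meetLift_fst _ _ _ _)).trans ?_)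
  have e₁ : R.pt ≫ first p (boxPath α) ≫ prod.fst = c := by rw [← Category.assoc, R.pt_first, hc]
  have e₂ : R.pt ≫ last p (boxPath α) ≫ prod.fst = d := by rw [← Category.assoc, R.pt_last, hd]
  have h := fstPts_pre α (toCtx R) (gen (boxPath α)) rfl rfl R.pt_first R.pt_last hc hd e₁ e₂
  rw [pre_toCtx] at h
  rw [h]
  exact (congrArg Subtype.val (act_pre ξ.1 (toCtx R) (fstPts α (gen (boxPath α)) rfl rfl) rfl rfl
    e₁ e₂ hc' hd' (by rw [← Category.assoc, e₁, hc']) (by rw [← Category.assoc, e₂, hd']))).symm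

theorem act_boxCell_snd {α : LPath (pairGraph p).Loose I J} {s : I ⟶ K} {t : J ⟶ M}
    {β : (pairGraph p).Loose K M} (ξ : (pairGraph p).Cell α s t β) {a : Z ⟶ I.1 ⨯ I.2}
    {b : Z ⟶ J.1 ⨯ J.2} (R : Pts e (boxPath α) a b) {a' : Z ⟶ K.1 ⨯ K.2} {b' : Z ⟶ M.1 ⨯ M.2}
    (ha : a ≫ prod.map s.1 s.2 = a') (hb : b ≫ prod.map t.1 t.2 = b') {c : Z ⟶ I.2} {d : Z ⟶ J.2}
    (hc : a ≫ prod.snd = c) (hd : b ≫ prod.snd = d) {c' : Z ⟶ K.2} {d' : Z ⟶ M.2}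
    (hc' : c ≫ s.2 = c') (hd' : d ≫ t.2 = d') :
    (act (boxCell ξ) R ha hb).1 ≫ (meetSnd (prod.map prod.fst prod.fst) β.1
      (prod.map prod.snd prod.snd) β.2).1 = (act ξ.2 (sndPts α R hc hd) hc' hd').1 := by
  refine (congrArg (· ≫ _) (act_mkCell _ R ha hb)).trans ?_
  refine (Category.assoc _ _ _).trans ((congrArg ((toCtx R).1 ≫ ·) (meetLift_snd _ _ _ _)).trans ?_)
  have e₁ : R.pt ≫ first p (boxPath α) ≫ prod.snd = c := by rw [← Category.assoc, R.pt_first, hc]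
  have e₂ : R.pt ≫ last p (boxPath α) ≫ prod.snd = d := by rw [← Category.assoc, R.pt_last, hd]
  have h := sndPts_pre α (toCtx R) (gen (boxPath α)) rfl rfl R.pt_first R.pt_last hc hd e₁ e₂
  rw [pre_toCtx] at h
  rw [h]
  exact (congrArg Subtype.val (act_pre ξ.2 (toCtx R) (sndPts α (gen (boxPath α)) rfl rfl) rfl rfl
    e₁ e₂ hc' hd' (by rw [← Category.assoc, e₁, hc']) (by rw [← Category.assoc, e₂, hd']))).symm

end

variable (p) in
abbrev boxHom : VDGraphHom (pairGraph p) (bilGraph p) where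
  tight := { obj := fun X => X.1 ⨯ X.2, map := fun f => prod.map f.1 f.2 }
  loose α := boxLoose α
  cell ξ := boxCell ξ

theorem fstPts_actCells {I J K M : (pairGraph p).Ob} {α : LPath (pairGraph p).Loose I J}
    {s : I ⟶ K} {t : J ⟶ M} {β : LPath (pairGraph p).Loose K M} (χ : (pairGraph p).Cells α s t β)
    {Z : B} {e : p.Fiber Z} {a : Z ⟶ I.1 ⨯ I.2} {b : Z ⟶ J.1 ⨯ J.2}
    (R : Pts e (boxPath α) a b) {a' : Z ⟶ K.1 ⨯ K.2} {b' : Z ⟶ M.1 ⨯ M.2}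
    (ha : a ≫ prod.map s.1 s.2 = a') (hb : b ≫ prod.map t.1 t.2 = b') {c : Z ⟶ I.1} {d : Z ⟶ J.1}
    (hc : a ≫ prod.fst = c) (hd : b ≫ prod.fst = d) {c' : Z ⟶ K.1} {d' : Z ⟶ M.1}
    (hc' : c ≫ s.1 = c') (hd' : d ≫ t.1 = d')
    (ha' : a' ≫ prod.fst = c') (hb' : b' ≫ prod.fst = d') :
    fstPts β (actCells ((boxHom p).cells χ) R ha hb) ha' hb' =
      actCells ((VDC.prodFst (bil p) (bil p)).cells χ) (fstPts α R hc hd) hc' hd' :=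
  actCells_transCells_natural (T := boxHom p) (G := VDC.prodFst (bil p) (bil p))
    (app := fun _ => prod.fst) (fun _ => prod.map_fst _ _) (cell := fstCell)
    (fun {_ _ _ _ _ _ _ β} ξ {_ _ _ _} R {_ _} ha hb {_ _} hc hd {_ _} hc' hd' =>
      (congrArg (fun y : HomOver p _ _ _ => (act (boxCell ξ) R ha hb).1 ≫ y.1)
        (sarr_fstCell β)).trans (act_boxCell_fst ξ R ha hb hc hd hc' hd'))
    χ R ha hb hc hd hc' hd' ha' hb'

theorem sndPts_actCells {I J K M : (pairGraph p).Ob} {α : LPath (pairGraph p).Loose I J}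
    {s : I ⟶ K} {t : J ⟶ M} {β : LPath (pairGraph p).Loose K M} (χ : (pairGraph p).Cells α s t β)
    {Z : B} {e : p.Fiber Z} {a : Z ⟶ I.1 ⨯ I.2} {b : Z ⟶ J.1 ⨯ J.2}
    (R : Pts e (boxPath α) a b) {a' : Z ⟶ K.1 ⨯ K.2} {b' : Z ⟶ M.1 ⨯ M.2}
    (ha : a ≫ prod.map s.1 s.2 = a') (hb : b ≫ prod.map t.1 t.2 = b') {c : Z ⟶ I.2} {d : Z ⟶ J.2}
    (hc : a ≫ prod.snd = c) (hd : b ≫ prod.snd = d) {c' : Z ⟶ K.2} {d' : Z ⟶ M.2}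
    (hc' : c ≫ s.2 = c') (hd' : d ≫ t.2 = d')
    (ha' : a' ≫ prod.snd = c') (hb' : b' ≫ prod.snd = d') :
    sndPts β (actCells ((boxHom p).cells χ) R ha hb) ha' hb' =
      actCells ((VDC.prodSnd (bil p) (bil p)).cells χ) (sndPts α R hc hd) hc' hd' :=
  actCells_transCells_natural (T := boxHom p) (G := VDC.prodSnd (bil p) (bil p))
    (app := fun _ => prod.snd) (fun _ => prod.map_snd _ _) (cell := sndCell)
    (fun {_ _ _ _ _ _ _ β} ξ {_ _ _ _} R {_ _} ha hb {_ _} hc hd {_ _} hc' hd' =>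
      (congrArg (fun y : HomOver p _ _ _ => (act (boxCell ξ) R ha hb).1 ≫ y.1)
        (sarr_sndCell β)).trans (act_boxCell_snd ξ R ha hb hc hd hc' hd'))
    χ R ha hb hc hd hc' hd' ha' hb'

end

end FibCat

end

noncomputable section

namespace FibCat

open CategoryTheory.Functor

theorem cast_fst {D E : VDC.{u, v, w, x}} {I J K M : (VDC.prodGraph D E).Ob}
    {α α' : LPath (VDC.prodGraph D E).Loose I J} {s s' : I ⟶ K} {t t' : J ⟶ M}
    {β : (VDC.prodGraph D E).Loose K M} (hα : α = α') (hs : s = s') (ht : t = t')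
    (ξ : (VDC.prodGraph D E).Cell α s t β) :
    ((VDC.prodGraph D E).cast hα hs ht ξ).1 =
      D.cast (congrArg (fun α => α.map Prod.fst Prod.fst) hα)
      (congrArg (fun f : I ⟶ K => f.1) hs) (congrArg (fun f : J ⟶ M => f.1) ht) ξ.1 := by
  subst hα hs ht; rfl

theorem cast_snd {D E : VDC.{u, v, w, x}} {I J K M : (VDC.prodGraph D E).Ob}
    {α α' : LPath (VDC.prodGraph D E).Loose I J} {s s' : I ⟶ K} {t t' : J ⟶ M}
    {β : (VDC.prodGraph D E).Loose K M} (hα : α = α') (hs : s = s') (ht : t = t')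
    (ξ : (VDC.prodGraph D E).Cell α s t β) :
    ((VDC.prodGraph D E).cast hα hs ht ξ).2 =
      E.cast (congrArg (fun α => α.map Prod.snd Prod.snd) hα)
      (congrArg (fun f : I ⟶ K => f.2) hs) (congrArg (fun f : J ⟶ M => f.2) ht) ξ.2 := by
  subst hα hs ht; rfl

variable {B : Type u} [Category.{v} B] {E : Type w} [Category.{x} E] {p : E ⥤ B}
  [HasFiniteProducts B]
  [p.IsFibered] [∀ X : B, HasFiniteProducts (p.Fiber X)]
  [∀ {X Y : B} (f : X ⟶ Y), PreservesFiniteProducts (baseChange p f)]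

theorem Pts.castPath_castPath {Z : B} {e : p.Fiber Z} {I J : B} {α α' : LPath (Rel p) I J}
    (h : α = α') (h' : α' = α) {s : Z ⟶ I} {t : Z ⟶ J} (R : Pts e α s t) :
    (R.castPath h).castPath h' = R := by
  subst h; rfl

/-- A single cell of the external conjunction acts by its two components. -/
theorem sarr_boxCell_fst {I J K M : (pairGraph p).Ob} {α : (pairGraph p).Loose I J} {s : I ⟶ K}
    {t : J ⟶ M} {β : (pairGraph p).Loose K M} (ξ : (pairGraph p).Cell (.single α) s t β) :
    (sarr (boxCell ξ)).1 ≫ (meetFst (prod.map prod.fst prod.fst) β.1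
      (prod.map prod.snd prod.snd) β.2).1 = (meetFst (prod.map prod.fst prod.fst) α.1
      (prod.map prod.snd prod.snd) α.2).1 ≫ (sarr (α := α.1) (β := β.1) ξ.1).1 := by
  refine (act_boxCell_fst ξ (idPt (boxLoose α)) rfl rfl rfl rfl rfl rfl).trans ?_
  refine (congrArg Subtype.val (act_single (α := α.1) (β := β.1) ξ.1 _ rfl rfl)).trans ?_
  refine congrArg (· ≫ (sarr (α := α.1) (β := β.1) ξ.1).1) ?_
  refine (congrArg (fun P => (Pts.arrow P).1)
    (fstPts_cons α (.nil _) _ (.nil _ _ rfl) rfl rfl rfl)).trans ?_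
  exact Category.id_comp _

theorem sarr_boxCell_snd {I J K M : (pairGraph p).Ob} {α : (pairGraph p).Loose I J} {s : I ⟶ K}
    {t : J ⟶ M} {β : (pairGraph p).Loose K M} (ξ : (pairGraph p).Cell (.single α) s t β) :
    (sarr (boxCell ξ)).1 ≫ (meetSnd (prod.map prod.fst prod.fst) β.1
      (prod.map prod.snd prod.snd) β.2).1 = (meetSnd (prod.map prod.fst prod.fst) α.1
      (prod.map prod.snd prod.snd) α.2).1 ≫ (sarr (α := α.2) (β := β.2) ξ.2).1 := by
  refine (act_boxCell_snd ξ (idPt (boxLoose α)) rfl rfl rfl rfl rfl rfl).trans ?_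
  refine (congrArg Subtype.val (act_single (α := α.2) (β := β.2) ξ.2 _ rfl rfl)).trans ?_
  refine congrArg (· ≫ (sarr (α := α.2) (β := β.2) ξ.2).1) ?_
  refine (congrArg (fun P => (Pts.arrow P).1)
    (sndPts_cons α (.nil _) _ (.nil _ _ rfl) rfl rfl rfl)).trans ?_
  exact Category.id_comp _

theorem act_boxCell_comp_fst {I J K M P Q : (pairGraph p).Ob} {α : LPath (pairGraph p).Loose I J}
    {s : I ⟶ K} {s' : J ⟶ M} {β : LPath (pairGraph p).Loose K M} {t : K ⟶ P} {t' : M ⟶ Q}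
    {γ : (pairGraph p).Loose P Q} {u : I ⟶ P} {u' : J ⟶ Q} (χ : (pairGraph p).Cells α s s' β)
    (ζ : (pairGraph p).Cell β t t' γ) (h : s ≫ t = u) (h' : s' ≫ t' = u') {Z : B} {e : p.Fiber Z}
    {a : Z ⟶ I.1 ⨯ I.2} {b : Z ⟶ J.1 ⨯ J.2} (R : Pts e (boxPath α) a b) {a' : Z ⟶ K.1 ⨯ K.2}
    {b' : Z ⟶ M.1 ⨯ M.2} (ha : a ≫ prod.map s.1 s.2 = a') (hb : b ≫ prod.map s'.1 s'.2 = b')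
    {a'' : Z ⟶ P.1 ⨯ P.2} {b'' : Z ⟶ Q.1 ⨯ Q.2} (ha' : a' ≫ prod.map t.1 t.2 = a'')
    (hb' : b' ≫ prod.map t'.1 t'.2 = b'') (ha'' : a ≫ prod.map u.1 u.2 = a'')
    (hb'' : b ≫ prod.map u'.1 u'.2 = b'') :
    (act (boxCell ((VDC.prodStruct (bil p) (bil p)).comp χ ζ h h')) R ha'' hb'').1 ≫
        (meetFst (prod.map prod.fst prod.fst) γ.1 (prod.map prod.snd prod.snd) γ.2).1 =
      (act (boxCell ζ) (actCells ((boxHom p).cells χ) R ha hb) ha' hb').1 ≫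
        (meetFst (prod.map prod.fst prod.fst) γ.1 (prod.map prod.snd prod.snd) γ.2).1 := by
  have f₁ : s.1 ≫ t.1 = u.1 := congrArg (fun f : I ⟶ P => f.1) h
  have f₂ : s'.1 ≫ t'.1 = u'.1 := congrArg (fun f : J ⟶ Q => f.1) h'
  have k₁ : a' ≫ prod.fst = (a ≫ prod.fst) ≫ s.1 := by rw [← ha, lift_fst_eq rfl]
  have k₂ : b' ≫ prod.fst = (b ≫ prod.fst) ≫ s'.1 := by rw [← hb, lift_fst_eq rfl]
  have l₁ : ((a ≫ prod.fst) ≫ s.1) ≫ t.1 = (a ≫ prod.fst) ≫ u.1 := by rw [Category.assoc, f₁]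
  have l₂ : ((b ≫ prod.fst) ≫ s'.1) ≫ t'.1 = (b ≫ prod.fst) ≫ u'.1 := by rw [Category.assoc, f₂]
  refine (act_boxCell_fst _ R ha'' hb'' rfl rfl rfl rfl).trans (Eq.trans ?_
    (act_boxCell_fst ζ _ ha' hb' k₁ k₂ l₁ l₂).symm)
  refine congrArg Subtype.val ((act_comp (α := fstPath α) (β := fstPath β) (γ := γ.1) _ _ f₁ f₂
    (fstPts α R rfl rfl) rfl rfl l₁ l₂ rfl rfl).trans ?_)
  exact congrArg (fun S => act (α := fstPath β) (β := γ.1) ζ.1 S l₁ l₂)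
    (fstPts_actCells χ R ha hb rfl rfl rfl rfl k₁ k₂).symm

theorem act_boxCell_comp_snd {I J K M P Q : (pairGraph p).Ob} {α : LPath (pairGraph p).Loose I J}
    {s : I ⟶ K} {s' : J ⟶ M} {β : LPath (pairGraph p).Loose K M} {t : K ⟶ P} {t' : M ⟶ Q}
    {γ : (pairGraph p).Loose P Q} {u : I ⟶ P} {u' : J ⟶ Q} (χ : (pairGraph p).Cells α s s' β)
    (ζ : (pairGraph p).Cell β t t' γ) (h : s ≫ t = u) (h' : s' ≫ t' = u') {Z : B} {e : p.Fiber Z}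
    {a : Z ⟶ I.1 ⨯ I.2} {b : Z ⟶ J.1 ⨯ J.2} (R : Pts e (boxPath α) a b) {a' : Z ⟶ K.1 ⨯ K.2}
    {b' : Z ⟶ M.1 ⨯ M.2} (ha : a ≫ prod.map s.1 s.2 = a') (hb : b ≫ prod.map s'.1 s'.2 = b')
    {a'' : Z ⟶ P.1 ⨯ P.2} {b'' : Z ⟶ Q.1 ⨯ Q.2} (ha' : a' ≫ prod.map t.1 t.2 = a'')
    (hb' : b' ≫ prod.map t'.1 t'.2 = b'') (ha'' : a ≫ prod.map u.1 u.2 = a'')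
    (hb'' : b ≫ prod.map u'.1 u'.2 = b'') :
    (act (boxCell ((VDC.prodStruct (bil p) (bil p)).comp χ ζ h h')) R ha'' hb'').1 ≫
        (meetSnd (prod.map prod.fst prod.fst) γ.1 (prod.map prod.snd prod.snd) γ.2).1 =
      (act (boxCell ζ) (actCells ((boxHom p).cells χ) R ha hb) ha' hb').1 ≫
        (meetSnd (prod.map prod.fst prod.fst) γ.1 (prod.map prod.snd prod.snd) γ.2).1 := by
  have f₁ : s.2 ≫ t.2 = u.2 := congrArg (fun f : I ⟶ P => f.2) h
  have f₂ : s'.2 ≫ t'.2 = u'.2 := congrArg (fun f : J ⟶ Q => f.2) h'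
  have k₁ : a' ≫ prod.snd = (a ≫ prod.snd) ≫ s.2 := by rw [← ha, lift_snd_eq rfl]
  have k₂ : b' ≫ prod.snd = (b ≫ prod.snd) ≫ s'.2 := by rw [← hb, lift_snd_eq rfl]
  have l₁ : ((a ≫ prod.snd) ≫ s.2) ≫ t.2 = (a ≫ prod.snd) ≫ u.2 := by rw [Category.assoc, f₁]
  have l₂ : ((b ≫ prod.snd) ≫ s'.2) ≫ t'.2 = (b ≫ prod.snd) ≫ u'.2 := by rw [Category.assoc, f₂]
  refine (act_boxCell_snd _ R ha'' hb'' rfl rfl rfl rfl).trans (Eq.trans ?_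
    (act_boxCell_snd ζ _ ha' hb' k₁ k₂ l₁ l₂).symm)
  refine congrArg Subtype.val ((act_comp (α := sndPath α) (β := sndPath β) (γ := γ.2) _ _ f₁ f₂
    (sndPts α R rfl rfl) rfl rfl l₁ l₂ rfl rfl).trans ?_)
  exact congrArg (fun S => act (α := sndPath β) (β := γ.2) ζ.2 S l₁ l₂)
    (sndPts_actCells χ R ha hb rfl rfl rfl rfl k₁ k₂).symm

variable (p) in
/-- The external conjunction, as a functor. -/
def boxFunctor : VDFunctor (VDC.prod (bil p) (bil p)) (bil p) where
  toVDGraphHom := boxHom p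
  cell_id {I J} α := by
    have key : ∀ {I J : (pairGraph p).Ob} (α : (pairGraph p).Loose I J),
        (sarr (boxCell ((VDC.prodStruct (bil p) (bil p)).idCell α))).1 = 𝟙 (boxLoose α).1 := by
      intro I J α
      refine congrArg Subtype.val (meet_ext (D' := (HomOver.id (boxLoose α)).cast
        (by simp)) ?_ ?_)
      · refine (sarr_boxCell_fst _).trans ?_
        exact (congrArg (_ ≫ ·) (sarr_idCell α.1)).trans
          ((Category.comp_id _).trans (Category.id_comp _).symm)
      · refine (sarr_boxCell_snd _).trans ?_
        exact (congrArg (_ ≫ ·) (sarr_idCell α.2)).trans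
          ((Category.comp_id _).trans (Category.id_comp _).symm)
    exact single_ext ((key α).trans (((sarr_cast _ _ _).trans (sarr_idCell (boxLoose α))).symm))
  cell_comp {I J K M P Q α s s' β t t' γ u u'} χ ζ h h' := by
    have e₁ : prod.map s.1 s.2 ≫ prod.map t.1 t.2 = prod.map u.1 u.2 := by
      rw [prod.map_map]; exact congrArg (fun f : I ⟶ P => prod.map f.1 f.2) h
    have e₂ : prod.map s'.1 s'.2 ≫ prod.map t'.1 t'.2 = prod.map u'.1 u'.2 := by
      rw [prod.map_map]; exact congrArg (fun f : J ⟶ Q => prod.map f.1 f.2) h'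
    have e₃ : (first p (boxPath α) ≫ prod.map s.1 s.2) ≫ prod.map t.1 t.2 =
        first p (boxPath α) ≫ prod.map u.1 u.2 := by rw [Category.assoc, e₁]
    have e₄ : (last p (boxPath α) ≫ prod.map s'.1 s'.2) ≫ prod.map t'.1 t'.2 =
        last p (boxPath α) ≫ prod.map u'.1 u'.2 := by rw [Category.assoc, e₂]
    refine cell_ext ?_
    refine Eq.trans ?_ (act_comp ((boxHom p).cells χ) (boxCell ζ) e₁ e₂ (gen (boxPath α)) rfl rfl
      e₃ e₄ rfl rfl).symm
    exact meet_ext (act_boxCell_comp_fst χ ζ h h' _ rfl rfl e₃ e₄ rfl rfl)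
      (act_boxCell_comp_snd χ ζ h h' _ rfl rfl e₃ e₄ rfl rfl)

end FibCat

end

noncomputable section

namespace FibCat

open CategoryTheory.Functor

variable {B : Type u} [Category.{v} B] {E : Type w} [Category.{x} E] {p : E ⥤ B}
  [HasFiniteProducts B]
  [p.IsFibered] [∀ X : B, HasFiniteProducts (p.Fiber X)]
  [∀ {X Y : B} (f : X ⟶ Y), PreservesFiniteProducts (baseChange p f)]

theorem lift_id_map_fst (I J : B) : prod.map (prod.lift (𝟙 I) (𝟙 I)) (prod.lift (𝟙 J) (𝟙 J)) ≫
    prod.map prod.fst prod.fst = 𝟙 (I ⨯ J) := by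
  simp [prod.lift_fst]

theorem lift_id_map_snd (I J : B) : prod.map (prod.lift (𝟙 I) (𝟙 I)) (prod.lift (𝟙 J) (𝟙 J)) ≫
    prod.map prod.snd prod.snd = 𝟙 (I ⨯ J) := by
  simp [prod.lift_snd]

/-- The diagonal of a loose arrow. -/
def diagArr {I J : B} (α : Rel p I J) :
    HomOver p (prod.map (prod.lift (𝟙 I) (𝟙 I)) (prod.lift (𝟙 J) (𝟙 J))) α
      (boxLoose (I := (I, I)) (J := (J, J)) (α, α)) :=
  meetLift (HomOver.id α) (HomOver.id α) (lift_id_map_fst I J) (lift_id_map_snd I J)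

theorem diagArr_fst {I J : B} (α : Rel p I J) :
    (diagArr α).1 ≫ (meetFst (prod.map prod.fst prod.fst)
    α (prod.map prod.snd prod.snd) α).1 = 𝟙 α.1 := meetLift_fst _ _ _ _

theorem diagArr_snd {I J : B} (α : Rel p I J) :
    (diagArr α).1 ≫ (meetSnd (prod.map prod.fst prod.fst)
    α (prod.map prod.snd prod.snd) α).1 = 𝟙 α.1 := meetLift_snd _ _ _ _

theorem comp_eq_comp_single {I J K M P Q N O : B} {α : LPath (Rel p) I J} {s : I ⟶ K} {s' : J ⟶ M}
    {β : LPath (Rel p) K M} {t : K ⟶ P} {t' : M ⟶ Q} {γ : Rel p P Q} {u : I ⟶ P} {u' : J ⟶ Q}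
    {δ : Rel p N O} {r : I ⟶ N} {r' : J ⟶ O} {q : N ⟶ P} {q' : O ⟶ Q}
    (χ : (bilGraph p).Cells α s s' β) (ζ : (bilGraph p).Cell β t t' γ)
    (ξ : (bilGraph p).Cell α r r' δ) (κ : (bilGraph p).Cell (.single δ) q q' γ)
    (h : s ≫ t = u) (h' : s' ≫ t' = u') (k : r ≫ q = u) (k' : r' ≫ q' = u')
    (H : ∀ {Z : B} {e : p.Fiber Z} {a : Z ⟶ I} {b : Z ⟶ J} (R : Pts e α a b) {a' : Z ⟶ K}
      {b' : Z ⟶ M} {c : Z ⟶ N} {d : Z ⟶ O} {a'' : Z ⟶ P} {b'' : Z ⟶ Q} (ha : a ≫ s = a')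
      (hb : b ≫ s' = b') (ha' : a' ≫ t = a'') (hb' : b' ≫ t' = b'') (hc : a ≫ r = c)
      (hd : b ≫ r' = d) (_ : c ≫ q = a'') (_ : d ≫ q' = b''),
      (act ζ (actCells χ R ha hb) ha' hb').1 = (act ξ R hc hd).1 ≫ (sarr κ).1) :
    (bilStr p).comp χ ζ h h' = (bilStr p).comp (.single ξ) κ k k' := by
  have e₁ : (first p α ≫ s) ≫ t = first p α ≫ u := by rw [Category.assoc, h]
  have e₂ : (last p α ≫ s') ≫ t' = last p α ≫ u' := by rw [Category.assoc, h']
  refine cell_ext (HomOver.ext ?_)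
  refine (congrArg Subtype.val (act_comp χ ζ h h' (gen α) rfl rfl e₁ e₂ rfl rfl)).trans ?_
  refine Eq.trans ?_ (act_comp_single ξ κ k k' (gen α) rfl rfl rfl rfl).symm
  exact H (gen α) rfl rfl e₁ e₂ rfl rfl (by rw [Category.assoc, k]) (by rw [Category.assoc, k'])

theorem comp_lift_id_fst {Z I : B} {s : Z ⟶ I} {s' : Z ⟶ I ⨯ I}
    (h : s ≫ prod.lift (𝟙 I) (𝟙 I) = s') : s' ≫ prod.fst = s := by
  rw [← h, Category.assoc, prod.lift_fst, Category.comp_id]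

theorem comp_lift_id_snd {Z I : B} {s : Z ⟶ I} {s' : Z ⟶ I ⨯ I}
    (h : s ≫ prod.lift (𝟙 I) (𝟙 I) = s') : s' ≫ prod.snd = s := by
  rw [← h, Category.assoc, prod.lift_snd, Category.comp_id]

theorem exists_diagPts {I J : B} (α : LPath (Rel p) I J) {Z : B} {e : p.Fiber Z} {s : Z ⟶ I}
    {t : Z ⟶ J} (R : Pts e α s t)
    (h₁ : α = α.map (fun I => I) (fun α => α))
    (h₂ : boxPath ((VDC.diagHom (bil p)).path α) =
      α.map (fun I => I ⨯ I) (fun {I J} α => boxLoose (I := (I, I)) (J := (J, J)) (α, α)))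
    {s' : Z ⟶ I ⨯ I} {t' : Z ⟶ J ⨯ J} (hs : s ≫ prod.lift (𝟙 I) (𝟙 I) = s')
    (ht : t ≫ prod.lift (𝟙 J) (𝟙 J) = t') :
    ∃ S : Pts e (boxPath ((VDC.diagHom (bil p)).path α)) s' t',
      actCells (VDGraph.transCells (D := bilGraph p) (E := bilGraph p) (P := fun I => I)
        (Q := fun I => I ⨯ I) (fun α => α)
        (fun {I J} α => boxLoose (I := (I, I)) (J := (J, J)) (α, α))
        (fun I => prod.lift (𝟙 I) (𝟙 I)) (fun α => mkSingle (diagArr α)) α)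
        (R.castPath h₁) hs ht = S.castPath h₂ ∧
      fstPts _ S (comp_lift_id_fst hs) (comp_lift_id_fst ht) =
        R.castPath (VDC.diag_path_fst (bil p) α) ∧
      sndPts _ S (comp_lift_id_snd hs) (comp_lift_id_snd ht) =
        R.castPath (VDC.diag_path_snd (bil p) α) := by
  induction R with
  | nil s t h => exact ⟨.nil _ _ (by rw [← hs, ← ht, h]), rfl, rfl, rfl⟩
  | @cons I J K α q s m t a as ih =>
    obtain ⟨S, hS, hS₁, hS₂⟩ := ih (LPath.map_id q).symm (LPath.map_map _ _ _ _ _) rfl ht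
    refine ⟨.cons (a.comp (diagArr α) (lift_map_eq hs rfl)) S, ?_, ?_, ?_⟩
    · refine (congrArg (fun T => actCells _ T hs ht)
        (Pts.castPath_cons _ (LPath.map_id q).symm a as)).trans ?_
      refine (actCells_transCells_cons (D := bilGraph p) (P := fun I => I)
        (Q := fun I => I ⨯ I) (fun α => α)
        (fun {I J} α => boxLoose (I := (I, I)) (J := (J, J)) (α, α))
        (fun I => prod.lift (𝟙 I) (𝟙 I)) (fun α => mkSingle (diagArr α)) α q
        a (as.castPath (LPath.map_id q).symm) hs rfl ht).trans ?_
      refine Eq.trans ?_ (Pts.castPath_cons _ (LPath.map_map _ _ _ _ _) _ S).symm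
      refine congrArg₂ Pts.cons ?_ hS
      exact congrArg (fun y => a.comp y (lift_map_eq hs rfl)) (sarr_mkSingle (diagArr α))
    · refine (fstPts_cons _ _ _ S _ (comp_lift_id_fst rfl) _).trans ?_
      refine Eq.trans ?_ (Pts.castPath_cons _ (VDC.diag_path_fst (bil p) q) a as).symm
      refine congrArg₂ Pts.cons ?_ hS₁
      exact HomOver.ext ((Category.assoc _ _ _).trans ((congrArg (a.1 ≫ ·) (diagArr_fst α)).trans
        (Category.comp_id _)))
    · refine (sndPts_cons _ _ _ S _ (comp_lift_id_snd rfl) _).trans ?_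
      refine Eq.trans ?_ (Pts.castPath_cons _ (VDC.diag_path_snd (bil p) q) a as).symm
      refine congrArg₂ Pts.cons ?_ hS₂
      exact HomOver.ext ((Category.assoc _ _ _).trans ((congrArg (a.1 ≫ ·) (diagArr_snd α)).trans
        (Category.comp_id _)))

variable (p) in
/-- The unit of the adjunction between the diagonal and the external conjunction. -/
def diagUnit : VDTrans (VDFunctor.id (bil p)) ((VDC.diag (bil p)).comp (boxFunctor p)) where
  tight :=
    { app := fun X => prod.lift (𝟙 X) (𝟙 X)
      naturality := fun X Y f => (prod.comp_lift _ _ _).trans (by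
        refine Eq.trans ?_ (prod.lift_map _ _ f f).symm
        exact congrArg₂ prod.lift ((Category.comp_id f).trans (Category.id_comp f).symm)
          ((Category.comp_id f).trans (Category.id_comp f).symm)) }
  cell α := mkSingle (diagArr α)
  naturality {I J K M α s t β} ξ := by
    refine comp_eq_comp_single _ _ _ _ _ _ _ _ ?_
    intro Z e a b R a' b' c d a'' b'' ha hb ha' hb' hc hd hc' hd'
    obtain ⟨R, rfl⟩ : ∃ R', R = Pts.castPath (LPath.map_id α).symm R' :=
      ⟨R.castPath (LPath.map_id α), (R.castPath_castPath _ _).symm⟩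
    obtain ⟨S, hS, hS₁, hS₂⟩ := exists_diagPts α R (LPath.map_id α).symm (LPath.map_map _ _ _ _ _)
      ha hb
    refine (congrArg (fun T => (act _ T ha' hb').1) hS).trans ?_
    refine (congrArg Subtype.val (act_cast_castPath (LPath.map_map _ _ _ _ _)
      (boxCell ((VDC.diagHom (bil p)).cell ξ)) S ha' hb')).trans ?_
    refine Eq.trans ?_ (congrArg₂ (fun (y : HomOver p _ _ _) (z : HomOver p _ _ _) => y.1 ≫ z.1)
      (act_cast_castPath (LPath.map_id α).symm ξ R hc hd) (sarr_mkSingle (diagArr β))).symm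
    refine congrArg Subtype.val (meet_ext (D' := (act ξ R hc hd).comp (diagArr β)
      (lift_map_eq hc' hd')) ?_ ?_)
    · refine (act_boxCell_fst _ S ha' hb' (comp_lift_id_fst ha) (comp_lift_id_fst hb) hc
        hd).trans ?_
      rw [hS₁]
      refine (congrArg Subtype.val (act_cast_castPath (VDC.diag_path_fst (bil p) α) ξ R hc
        hd)).trans ?_
      exact ((Category.assoc _ _ _).trans ((congrArg ((act ξ R hc hd).1 ≫ ·) (diagArr_fst β)).trans
        (Category.comp_id _))).symm
    · refine (act_boxCell_snd _ S ha' hb' (comp_lift_id_snd ha) (comp_lift_id_snd hb) hc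
        hd).trans ?_
      rw [hS₂]
      refine (congrArg Subtype.val (act_cast_castPath (VDC.diag_path_snd (bil p) α) ξ R hc
        hd)).trans ?_
      exact ((Category.assoc _ _ _).trans ((congrArg ((act ξ R hc hd).1 ≫ ·) (diagArr_snd β)).trans
        (Category.comp_id _))).symm

theorem boxPath_eq_fst {I J : (pairGraph p).Ob} (α : LPath (pairGraph p).Loose I J) :
    boxPath α = fstPath (((boxFunctor p).comp (VDC.diag (bil p))).path α) := by
  induction α with
  | nil => rfl
  | cons α q ih => exact congrArg (LPath.cons (boxLoose α)) ih

theorem boxPath_eq_snd {I J : (pairGraph p).Ob} (α : LPath (pairGraph p).Loose I J) :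
    boxPath α = sndPath (((boxFunctor p).comp (VDC.diag (bil p))).path α) := by
  induction α with
  | nil => rfl
  | cons α q ih => exact congrArg (LPath.cons (boxLoose α)) ih

variable (p) in
/-- The components of the counit of the adjunction between the diagonal and the external
conjunction. -/
abbrev diagCounitCells {I J : (pairGraph p).Ob} (α : LPath (pairGraph p).Loose I J) :
    (pairGraph p).Cells (((boxFunctor p).comp (VDC.diag (bil p))).path α) (prod.fst, prod.snd)
      (prod.fst, prod.snd) ((VDFunctor.id (VDC.prod (bil p) (bil p))).path α) :=
  VDGraph.transCells (D := pairGraph p) (E := pairGraph p)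
    (P := fun X => (X.1 ⨯ X.2, X.1 ⨯ X.2)) (Q := fun X => X)
    (fun α => (boxLoose α, boxLoose α)) (fun α => α) (fun _ => (prod.fst, prod.snd))
    (fun α => (fstCell α, sndCell α)) α

theorem actCells_diagCounit_fst {I J : (pairGraph p).Ob} (α : LPath (pairGraph p).Loose I J) {Z : B}
    {e : p.Fiber Z} {s : Z ⟶ I.1 ⨯ I.2} {t : Z ⟶ J.1 ⨯ J.2} (R : Pts e (boxPath α) s t)
    (h : fstPath α = fstPath ((VDFunctor.id (VDC.prod (bil p) (bil p))).path α))
    {s' : Z ⟶ I.1} {t' : Z ⟶ J.1} (hs : s ≫ prod.fst = s') (ht : t ≫ prod.fst = t') :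
    actCells ((VDC.prodFst (bil p) (bil p)).cells (diagCounitCells p α))
      (R.castPath (boxPath_eq_fst α)) hs ht = (fstPts α R hs ht).castPath h := by
  induction α with
  | nil => rfl
  | @cons I K J α q ih =>
    obtain ⟨m, a, as, rfl⟩ := Pts.exists_cons (α := boxLoose α) (q := boxPath q) R
    refine (congrArg (fun T => actCells ((VDC.prodFst (bil p) (bil p)).cells
      (diagCounitCells p (.cons α q))) T hs ht)
      (Pts.castPath_cons _ (boxPath_eq_fst q) a as)).trans ?_
    refine (actCells_cons (α₁ := .single (boxLoose α)) (fstCell α)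
      ((VDC.prodFst (bil p) (bil p)).cells (diagCounitCells p q)) rfl (.cons a (.nil m m rfl))
      (as.castPath (boxPath_eq_fst q)) hs rfl ht).trans ?_
    refine Eq.trans ?_ (congrArg (Pts.castPath h) (fstPts_cons α q a as hs rfl ht)).symm
    have h' : fstPath q = fstPath ((VDFunctor.id (VDC.prod (bil p) (bil p))).path q) :=
      congrArg fstPath (LPath.map_id q).symm
    refine Eq.trans ?_ (Pts.castPath_cons h h' _ _).symm
    refine congrArg₂ Pts.cons ?_ (ih as h' rfl ht)
    refine (act_single (fstCell α) _ hs rfl).trans ?_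
    exact congrArg (fun y => a.comp y (lift_map_eq hs rfl)) (sarr_fstCell α)

theorem actCells_diagCounit_snd {I J : (pairGraph p).Ob} (α : LPath (pairGraph p).Loose I J) {Z : B}
    {e : p.Fiber Z} {s : Z ⟶ I.1 ⨯ I.2} {t : Z ⟶ J.1 ⨯ J.2} (R : Pts e (boxPath α) s t)
    (h : sndPath α = sndPath ((VDFunctor.id (VDC.prod (bil p) (bil p))).path α))
    {s' : Z ⟶ I.2} {t' : Z ⟶ J.2} (hs : s ≫ prod.snd = s') (ht : t ≫ prod.snd = t') :
    actCells ((VDC.prodSnd (bil p) (bil p)).cells (diagCounitCells p α))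
      (R.castPath (boxPath_eq_snd α)) hs ht = (sndPts α R hs ht).castPath h := by
  induction α with
  | nil => rfl
  | @cons I K J α q ih =>
    obtain ⟨m, a, as, rfl⟩ := Pts.exists_cons (α := boxLoose α) (q := boxPath q) R
    refine (congrArg (fun T => actCells ((VDC.prodSnd (bil p) (bil p)).cells
      (diagCounitCells p (.cons α q))) T hs ht)
      (Pts.castPath_cons _ (boxPath_eq_snd q) a as)).trans ?_
    refine (actCells_cons (α₁ := .single (boxLoose α)) (sndCell α)
      ((VDC.prodSnd (bil p) (bil p)).cells (diagCounitCells p q)) rfl (.cons a (.nil m m rfl))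
      (as.castPath (boxPath_eq_snd q)) hs rfl ht).trans ?_
    refine Eq.trans ?_ (congrArg (Pts.castPath h) (sndPts_cons α q a as hs rfl ht)).symm
    have h' : sndPath q = sndPath ((VDFunctor.id (VDC.prod (bil p) (bil p))).path q) :=
      congrArg sndPath (LPath.map_id q).symm
    refine Eq.trans ?_ (Pts.castPath_cons h h' _ _).symm
    refine congrArg₂ Pts.cons ?_ (ih as h' rfl ht)
    refine (act_single (sndCell α) _ hs rfl).trans ?_
    exact congrArg (fun y => a.comp y (lift_map_eq hs rfl)) (sarr_sndCell α)

theorem boxDiag_cell_fst {I J K M : (pairGraph p).Ob} {α : LPath (pairGraph p).Loose I J}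
    {s : I ⟶ K} {t : J ⟶ M} {β : (pairGraph p).Loose K M} (ξ : (pairGraph p).Cell α s t β) :
    (((boxFunctor p).comp (VDC.diag (bil p))).cell ξ).1 =
      (bilGraph p).cast (boxPath_eq_fst α) rfl rfl (boxCell ξ) :=
  (cast_fst (D := bil p) (E := bil p) _ rfl rfl ((VDC.diagHom (bil p)).cell (boxCell ξ))).trans
    (VDGraph.cast_cast (D := bilGraph p) (s := prod.map s.1 s.2) (t := prod.map t.1 t.2)
      (VDC.diag_path_fst (bil p) (boxPath α)) rfl rfl
      ((VDC.diag_path_fst (bil p) (boxPath α)).symm.trans (boxPath_eq_fst α)) rfl rfl (boxCell ξ))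

theorem boxDiag_cell_snd {I J K M : (pairGraph p).Ob} {α : LPath (pairGraph p).Loose I J}
    {s : I ⟶ K} {t : J ⟶ M} {β : (pairGraph p).Loose K M} (ξ : (pairGraph p).Cell α s t β) :
    (((boxFunctor p).comp (VDC.diag (bil p))).cell ξ).2 =
      (bilGraph p).cast (boxPath_eq_snd α) rfl rfl (boxCell ξ) :=
  (cast_snd (D := bil p) (E := bil p) _ rfl rfl ((VDC.diagHom (bil p)).cell (boxCell ξ))).trans
    (VDGraph.cast_cast (D := bilGraph p) (s := prod.map s.1 s.2) (t := prod.map t.1 t.2)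
      (VDC.diag_path_snd (bil p) (boxPath α)) rfl rfl
      ((VDC.diag_path_snd (bil p) (boxPath α)).symm.trans (boxPath_eq_snd α)) rfl rfl (boxCell ξ))

variable (p) in
/-- The counit of the adjunction between the diagonal and the external conjunction. -/
def diagCounit : VDTrans ((boxFunctor p).comp (VDC.diag (bil p)))
    (VDFunctor.id (VDC.prod (bil p) (bil p))) where
  tight :=
    { app := fun X => (prod.fst, prod.snd)
      naturality := fun X Y f => Prod.ext (prod.map_fst _ _) (prod.map_snd _ _) }
  cell α := (fstCell α, sndCell α)
  naturality {I J K M α s t β} ξ := by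
    refine Prod.ext ?_ ?_
    · refine comp_eq_comp_single _ _ _ _ (prod.map_fst s.1 s.2).symm (prod.map_fst t.1 t.2).symm
        rfl rfl ?_
      intro Z e a b R a' b' c d a'' b'' ha hb ha' hb' hc hd hc' hd'
      obtain ⟨R, rfl⟩ : ∃ R', R = Pts.castPath (boxPath_eq_fst α) R' :=
        ⟨R.castPath (boxPath_eq_fst α).symm, (R.castPath_castPath _ _).symm⟩
      have h₀ : fstPath α = fstPath ((VDFunctor.id (VDC.prod (bil p) (bil p))).path α) :=
        congrArg fstPath (LPath.map_id α).symm
      refine (congrArg (fun T => (act _ T ha' hb').1)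
        (actCells_diagCounit_fst α R h₀ ha hb)).trans ?_
      refine (congrArg (fun ζ => (act ζ ((fstPts α R ha hb).castPath h₀) ha' hb').1)
        (cast_fst (D := bil p) (E := bil p) (LPath.map_id α).symm rfl rfl ξ)).trans ?_
      refine (congrArg Subtype.val (act_cast_castPath h₀ ξ.1 (fstPts α R ha hb) ha' hb')).trans ?_
      refine (act_boxCell_fst ξ R hc hd ha hb ha' hb').symm.trans ?_
      refine Eq.trans ?_ (congrArg₂ (fun (y : HomOver p _ _ _) (z : HomOver p _ _ _) => y.1 ≫ z.1)
        (((congrArg (fun χ => act χ (R.castPath (boxPath_eq_fst α)) hc hd)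
          (boxDiag_cell_fst ξ))).trans
          (act_cast_castPath (boxPath_eq_fst α) (boxCell ξ) R hc hd)) (sarr_fstCell β)).symm
      rfl
    · refine comp_eq_comp_single _ _ _ _ (prod.map_snd s.1 s.2).symm (prod.map_snd t.1 t.2).symm
        rfl rfl ?_
      intro Z e a b R a' b' c d a'' b'' ha hb ha' hb' hc hd hc' hd'
      obtain ⟨R, rfl⟩ : ∃ R', R = Pts.castPath (boxPath_eq_snd α) R' :=
        ⟨R.castPath (boxPath_eq_snd α).symm, (R.castPath_castPath _ _).symm⟩
      have h₀ : sndPath α = sndPath ((VDFunctor.id (VDC.prod (bil p) (bil p))).path α) :=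
        congrArg sndPath (LPath.map_id α).symm
      refine (congrArg (fun T => (act _ T ha' hb').1)
        (actCells_diagCounit_snd α R h₀ ha hb)).trans ?_
      refine (congrArg (fun ζ => (act ζ ((sndPts α R ha hb).castPath h₀) ha' hb').1)
        (cast_snd (D := bil p) (E := bil p) (LPath.map_id α).symm rfl rfl ξ)).trans ?_
      refine (congrArg Subtype.val (act_cast_castPath h₀ ξ.2 (sndPts α R ha hb) ha' hb')).trans ?_
      refine (act_boxCell_snd ξ R hc hd ha hb ha' hb').symm.trans ?_
      refine Eq.trans ?_ (congrArg₂ (fun (y : HomOver p _ _ _) (z : HomOver p _ _ _) => y.1 ≫ z.1)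
        (((congrArg (fun χ => act χ (R.castPath (boxPath_eq_snd α)) hc hd)
          (boxDiag_cell_snd ξ))).trans
          (act_cast_castPath (boxPath_eq_snd α) (boxCell ξ) R hc hd)) (sarr_sndCell β)).symm
      rfl

end FibCat

end

noncomputable section

section

variable {C : Type u} [Bicategory.{w, v} C] {a b : C} {f : a ⟶ b} {g : b ⟶ a}

theorem leftZigzag_eq (η : 𝟙 a ⟶ f ≫ g) (θ : g ≫ f ⟶ 𝟙 b) :
    leftZigzag η θ = η ▷ f ≫ (α_ f g f).hom ≫ f ◁ θ := by
  simp [leftZigzag, bicategoricalComp]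

theorem rightZigzag_eq (η : 𝟙 a ⟶ f ≫ g) (θ : g ≫ f ⟶ 𝟙 b) :
    rightZigzag η θ = g ◁ η ≫ (α_ g f g).inv ≫ θ ▷ g := by
  simp [rightZigzag, bicategoricalComp]

end

namespace VDC

/-- An adjunction of virtual double categories, from the triangle identities at objects and at
loose arrows. -/
def adjunctionMk {D E : VDC.{u, v, w, x}} (f : VDFunctor D E) (g : VDFunctor E D)
    (η : VDTrans (VDFunctor.id D) (f.comp g)) (θ : VDTrans (g.comp f) (VDFunctor.id E))
    (h₁ : ∀ I, f.tight.map (η.tight.app I) ≫ θ.tight.app (f.tight.obj I) = 𝟙 (f.tight.obj I))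
    (h₂ : ∀ α, f.vert.map (η.vert α) ≫ θ.vert (f.vert.obj α) = 𝟙 (f.vert.obj α))
    (h₃ : ∀ I, η.tight.app (g.tight.obj I) ≫ g.tight.map (θ.tight.app I) = 𝟙 (g.tight.obj I))
    (h₄ : ∀ α, η.vert (g.vert.obj α) ≫ g.vert.map (θ.vert α) = 𝟙 (g.vert.obj α)) :
    Bicategory.Adjunction (show D ⟶ E from f) (show E ⟶ D from g) where
  unit := η
  counit := θ
  left_triangle := by
    refine (leftZigzag_eq _ _).trans (VDTrans.ext_vert (fun I => ?_) (fun α => ?_))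
    · exact (congrArg (_ ≫ ·) (Category.id_comp _)).trans ((h₁ I).trans (Category.id_comp _).symm)
    · exact (congrArg (_ ≫ ·) (Category.id_comp _)).trans ((h₂ α).trans
        (Category.id_comp (𝟙 (f.vert.obj α))).symm)
  right_triangle := by
    refine (rightZigzag_eq _ _).trans (VDTrans.ext_vert (fun I => ?_) (fun α => ?_))
    · exact (congrArg (_ ≫ ·) (Category.id_comp _)).trans ((h₃ I).trans (Category.id_comp _).symm)
    · exact (congrArg (_ ≫ ·) (Category.id_comp _)).trans ((h₄ α).trans
        (Category.id_comp (𝟙 (g.vert.obj α))).symm)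

end VDC

namespace FibCat

open CategoryTheory.Functor

variable {B : Type u} [Category.{v} B] {E : Type w} [Category.{x} E] {p : E ⥤ B}
  [HasFiniteProducts B]
  [p.IsFibered] [∀ X : B, HasFiniteProducts (p.Fiber X)]
  [∀ {X Y : B} (f : X ⟶ Y), PreservesFiniteProducts (baseChange p f)]

theorem prodVert_ext {α β : (VDC.prod (bil p) (bil p)).Vert} {f g : α ⟶ β}
    (hl : VDC.VertHom.left f = g.left) (hr : VDC.VertHom.right f = g.right)
    (h₁ : (sarr (α := α.loose.1) (β := β.loose.1) (VDC.VertHom.cell f).1).1 =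
      (sarr (α := α.loose.1) (β := β.loose.1) g.cell.1).1)
    (h₂ : (sarr (α := α.loose.2) (β := β.loose.2) (VDC.VertHom.cell f).2).1 =
      (sarr (α := α.loose.2) (β := β.loose.2) g.cell.2).1) : f = g :=
  VDC.VertHom.ext_cast hl hr (Prod.ext
    ((cast_fst (D := bil p) (E := bil p) rfl hl hr _).trans
      (single_ext ((sarr_cast _ _ _).trans h₁)))
    ((cast_snd (D := bil p) (E := bil p) rfl hl hr _).trans
      (single_ext ((sarr_cast _ _ _).trans h₂))))

/-- The counit of the adjunction between the diagonal and the external conjunction, at a pair of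
loose arrows. -/
def diagCounitCell {I J : (pairGraph p).Ob} (α : (pairGraph p).Loose I J) :
    (pairGraph p).Cell (I := (I.1 ⨯ I.2, I.1 ⨯ I.2)) (J := (J.1 ⨯ J.2, J.1 ⨯ J.2)) (K := I) (M := J)
      (.single (boxLoose α, boxLoose α)) (prod.fst, prod.snd) (prod.fst, prod.snd) α :=
  (fstCell α, sndCell α)

theorem lift_id_map_fst_snd (X Y : B) : prod.lift (𝟙 (X ⨯ Y)) (𝟙 (X ⨯ Y)) ≫
    prod.map prod.fst prod.snd = 𝟙 (X ⨯ Y) := by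
  simp

theorem diagArr_boxCell {I J : (pairGraph p).Ob} (α : (pairGraph p).Loose I J) :
    (diagArr (boxLoose α)).1 ≫ (sarr (boxCell (diagCounitCell α))).1 = 𝟙 (boxLoose α).1 := by
  refine congrArg Subtype.val (meet_ext (D := (diagArr (boxLoose α)).comp
    (sarr (boxCell (diagCounitCell α))) ((prod.map_map _ _ _ _).trans
      (congrArg₂ prod.map (lift_id_map_fst_snd I.1 I.2) (lift_id_map_fst_snd J.1 J.2))))
    (D' := (HomOver.id (boxLoose α)).cast prod.map_id_id.symm) ?_ ?_)
  · refine (Category.assoc _ _ _).trans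
      ((congrArg ((diagArr (boxLoose α)).1 ≫ ·) (sarr_boxCell_fst (diagCounitCell α))).trans ?_)
    refine (Category.assoc _ _ _).symm.trans
      ((congrArg (· ≫ (sarr (fstCell α)).1) (diagArr_fst (boxLoose α))).trans ?_)
    exact congrArg (fun y : HomOver p _ _ _ => 𝟙 (boxLoose α).1 ≫ y.1) (sarr_fstCell α)
  · refine (Category.assoc _ _ _).trans
      ((congrArg ((diagArr (boxLoose α)).1 ≫ ·) (sarr_boxCell_snd (diagCounitCell α))).trans ?_)
    refine (Category.assoc _ _ _).symm.trans
      ((congrArg (· ≫ (sarr (sndCell α)).1) (diagArr_snd (boxLoose α))).trans ?_)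
    exact congrArg (fun y : HomOver p _ _ _ => 𝟙 (boxLoose α).1 ≫ y.1) (sarr_sndCell α)

variable (p) in
/-- The external conjunction is right adjoint to the diagonal. -/
def diagAdjunction : Bicategory.Adjunction
    (show bil p ⟶ VDC.prod (bil p) (bil p) from VDC.diag (bil p)) (boxFunctor p) :=
  VDC.adjunctionMk _ _ (diagUnit p) (diagCounit p)
    (fun I => Prod.ext (prod.lift_fst _ _) (prod.lift_snd _ _))
    (fun α => by
      refine prodVert_ext (Prod.ext (prod.lift_fst _ _) (prod.lift_snd _ _))
        (Prod.ext (prod.lift_fst _ _) (prod.lift_snd _ _)) ?_ ?_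
      · refine (sarr_comp (mkSingle (diagArr α.loose)) (fstCell (I := (α.src, α.src))
          (J := (α.tgt, α.tgt)) (α.loose, α.loose)) rfl rfl).trans ?_
        refine (congrArg₂ (fun (y : HomOver p _ _ _) (z : HomOver p _ _ _) => y.1 ≫ z.1)
          (sarr_mkSingle _) (sarr_fstCell _)).trans ?_
        exact (diagArr_fst α.loose).trans (sarr_idCell α.loose).symm
      · refine (sarr_comp (mkSingle (diagArr α.loose)) (sndCell (I := (α.src, α.src))
          (J := (α.tgt, α.tgt)) (α.loose, α.loose)) rfl rfl).trans ?_
        refine (congrArg₂ (fun (y : HomOver p _ _ _) (z : HomOver p _ _ _) => y.1 ≫ z.1)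
          (sarr_mkSingle _) (sarr_sndCell _)).trans ?_
        exact (diagArr_snd α.loose).trans (sarr_idCell α.loose).symm)
    (fun I => lift_id_map_fst_snd I.1 I.2)
    (fun α => vertHom_ext (lift_id_map_fst_snd _ _) (lift_id_map_fst_snd _ _)
      ((sarr_comp (mkSingle (diagArr (boxLoose α.loose))) (boxCell (diagCounitCell α.loose))
          rfl rfl).trans
        ((congrArg (fun y : HomOver p _ _ _ =>
          y.1 ≫ (sarr (boxCell (diagCounitCell α.loose))).1) (sarr_mkSingle _)).trans
            ((diagArr_boxCell α.loose).trans (sarr_idCell (boxLoose α.loose)).symm))))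

end FibCat

end

noncomputable section

namespace FibCat

open CategoryTheory.Functor

variable {B : Type u} [Category.{v} B] {E : Type w} [Category.{x} E] {p : E ⥤ B}
  [HasFiniteProducts B]
  [p.IsFibered] [∀ X : B, HasFiniteProducts (p.Fiber X)]
  [∀ {X Y : B} (f : X ⟶ Y), PreservesFiniteProducts (baseChange p f)]

theorem isCartesian_of_meet {W W' X X' Y Y' : B} {x : W ⟶ X} {a : p.Fiber X} {y : W ⟶ Y}
    {b : p.Fiber Y} {x' : W' ⟶ X'} {a' : p.Fiber X'} {y' : W' ⟶ Y'} {b' : p.Fiber Y'} {g : W ⟶ W'}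
    {f₁ : X ⟶ X'} {f₂ : Y ⟶ Y'} (φ : HomOver p g (meet x a y b) (meet x' a' y' b'))
    (φ₁ : HomOver p f₁ a a') (φ₂ : HomOver p f₂ b b') [p.IsCartesian f₁ φ₁.1]
    [p.IsCartesian f₂ φ₂.1] (h₁ : φ.1 ≫ (meetFst x' a' y' b').1 = (meetFst x a y b).1 ≫ φ₁.1)
    (h₂ : φ.1 ≫ (meetSnd x' a' y' b').1 = (meetSnd x a y b).1 ≫ φ₂.1) :
    p.IsCartesian g φ.1 := by
  have e₁ : x ≫ f₁ = g ≫ x' :=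
    (HomOver.over_unique (φ.comp (meetFst x' a' y' b') rfl) ((meetFst x a y b).comp φ₁ rfl) h₁).symm
  have e₂ : y ≫ f₂ = g ≫ y' :=
    (HomOver.over_unique (φ.comp (meetSnd x' a' y' b') rfl) ((meetSnd x a y b).comp φ₂ rfl) h₂).symm
  refine isCartesian_of_existsUnique φ fun c ψ => ⟨meetLift
      (cartLift φ₁ (ψ.comp (meetFst x' a' y' b')
    rfl) e₁) (cartLift φ₂ (ψ.comp (meetSnd x' a' y' b') rfl) e₂) (Category.id_comp x)
    (Category.id_comp y), ?_, fun χ hχ => ?_⟩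
  · refine meet_ext' (D := (meetLift _ _ _ _).comp φ rfl) (Category.id_comp g) ?_ ?_
    · rw [HomOver.comp_val, Category.assoc, h₁, meetLift_fst_assoc, cartLift_fac, HomOver.comp_val]
    · rw [HomOver.comp_val, Category.assoc, h₂, meetLift_snd_assoc, cartLift_fac, HomOver.comp_val]
  · refine meet_ext ?_ ?_
    · rw [meetLift_fst]
      refine congrArg Subtype.val (cart_ext φ₁ (φ := χ.comp (meetFst x a y b) (Category.id_comp x))
        (ψ := cartLift φ₁ (ψ.comp (meetFst x' a' y' b') rfl) e₁) ?_)
      rw [cartLift_fac, HomOver.comp_val, HomOver.comp_val, Category.assoc, ← h₁, ← Category.assoc,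
        hχ]
    · rw [meetLift_snd]
      refine congrArg Subtype.val (cart_ext φ₂ (φ := χ.comp (meetSnd x a y b) (Category.id_comp y))
        (ψ := cartLift φ₂ (ψ.comp (meetSnd x' a' y' b') rfl) e₂) ?_)
      rw [cartLift_fac, HomOver.comp_val, HomOver.comp_val, Category.assoc, ← h₂, ← Category.assoc,
        hχ]

section

variable {I J K M : (pairGraph p).Ob}

theorem isCartesian_fst_of_isRestriction {r : (pairGraph p).Loose I J} {s : I ⟶ K} {t : J ⟶ M}
    {α : (pairGraph p).Loose K M} {ρ : (pairGraph p).Cell (.single r) s t α}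
    (h : VDC.IsRestriction (D := VDC.prod (bil p) (bil p)) ρ) :
    p.IsCartesian (prod.map s.1 t.1) (sarr (α := r.1) (β := α.1) ρ.1).1 := by
  refine isCartesian_of_existsUnique_cell (r := r.1) (α := α.1) ρ.1 fun c ξ => ?_
  have e₁ : s.2 = (𝟙 I ≫ s).2 := (Category.id_comp s.2).symm
  have e₂ : t.2 = (𝟙 J ≫ t).2 := (Category.id_comp t.2).symm
  obtain ⟨ζ, h₁, h₂⟩ := h (.single (c, r.2)) (𝟙 I) (𝟙 J) (ξ, (bil p).cast rfl e₁ e₂ ρ.2)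
  have h₃ := Prod.ext_iff.1 h₁
  refine ⟨ζ.1, h₃.1, fun ζ' h' => ?_⟩
  exact congrArg (fun ζ : (pairGraph p).Cell (.single (c, r.2)) (𝟙 I) (𝟙 J) r => ζ.1)
    (h₂ (ζ', ζ.2) (Prod.ext h' h₃.2))

theorem isCartesian_snd_of_isRestriction {r : (pairGraph p).Loose I J} {s : I ⟶ K} {t : J ⟶ M}
    {α : (pairGraph p).Loose K M} {ρ : (pairGraph p).Cell (.single r) s t α}
    (h : VDC.IsRestriction (D := VDC.prod (bil p) (bil p)) ρ) :
    p.IsCartesian (prod.map s.2 t.2) (sarr (α := r.2) (β := α.2) ρ.2).1 := by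
  refine isCartesian_of_existsUnique_cell (r := r.2) (α := α.2) ρ.2 fun c ξ => ?_
  have e₁ : s.1 = (𝟙 I ≫ s).1 := (Category.id_comp s.1).symm
  have e₂ : t.1 = (𝟙 J ≫ t).1 := (Category.id_comp t.1).symm
  obtain ⟨ζ, h₁, h₂⟩ := h (.single (r.1, c)) (𝟙 I) (𝟙 J) ((bil p).cast rfl e₁ e₂ ρ.1, ξ)
  have h₃ := Prod.ext_iff.1 h₁
  refine ⟨ζ.2, h₃.2, fun ζ' h' => ?_⟩
  exact congrArg (fun ζ : (pairGraph p).Cell (.single (r.1, c)) (𝟙 I) (𝟙 J) r => ζ.2)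
    (h₂ (ζ.1, ζ') (Prod.ext h₃.1 h'))

theorem isRestriction_boxCell {r : (pairGraph p).Loose I J} {s : I ⟶ K} {t : J ⟶ M}
    {α : (pairGraph p).Loose K M} {ρ : (pairGraph p).Cell (.single r) s t α}
    (h₁ : p.IsCartesian (prod.map s.1 t.1) (sarr (α := r.1) (β := α.1) ρ.1).1)
    (h₂ : p.IsCartesian (prod.map s.2 t.2) (sarr (α := r.2) (β := α.2) ρ.2).1) :
    VDC.IsRestriction (D := bil p) (boxCell ρ) := by
  exact isRestriction_of_isCartesian (r := boxLoose r) (α := boxLoose α) (boxCell ρ)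
    (isCartesian_of_meet (sarr (boxCell ρ)) (sarr (α := r.1) (β := α.1) ρ.1)
      (sarr (α := r.2) (β := α.2) ρ.2) (sarr_boxCell_fst ρ) (sarr_boxCell_snd ρ))

end

theorem boxFunctor_preservesRestrictions : (boxFunctor p).PreservesRestrictions :=
  fun _ _ _ _ _ _ _ _ _ h => isRestriction_boxCell (isCartesian_fst_of_isRestriction h)
    (isCartesian_snd_of_isRestriction h)

section

variable {I J : (pairGraph p).Ob} {Z : B} {e : p.Fiber Z}

theorem exists_pairPts (α : LPath (pairGraph p).Loose I J) {s : Z ⟶ I.1 ⨯ I.2} {t : Z ⟶ J.1 ⨯ J.2}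
    {s₁ : Z ⟶ I.1} {t₁ : Z ⟶ J.1} {s₂ : Z ⟶ I.2} {t₂ : Z ⟶ J.2} (R₁ : Pts e (fstPath α) s₁ t₁)
    (R₂ : Pts e (sndPath α) s₂ t₂) (hs₁ : s ≫ prod.fst = s₁) (ht₁ : t ≫ prod.fst = t₁)
    (hs₂ : s ≫ prod.snd = s₂) (ht₂ : t ≫ prod.snd = t₂) :
    ∃ S : Pts e (boxPath α) s t, fstPts α S hs₁ ht₁ = R₁ ∧ sndPts α S hs₂ ht₂ = R₂ := by
  induction α with
  | nil =>
    exact ⟨.nil _ _ (Limits.prod.hom_ext (hs₁.trans (R₁.nil_eq.trans ht₁.symm))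
      (hs₂.trans (R₂.nil_eq.trans ht₂.symm))), Pts.nil_uniq _ _, Pts.nil_uniq _ _⟩
  | @cons I K J α q ih =>
    obtain ⟨m₁, a₁, as₁, rfl⟩ := Pts.exists_cons (α := α.1) (q := fstPath q) R₁
    obtain ⟨m₂, a₂, as₂, rfl⟩ := Pts.exists_cons (α := α.2) (q := sndPath q) R₂
    obtain ⟨S, rfl, rfl⟩ := ih (s := prod.lift m₁ m₂) as₁ as₂ (prod.lift_fst _ _) ht₁
      (prod.lift_snd _ _) ht₂
    refine ⟨.cons (meetLift a₁ a₂ (lift_map_eq hs₁ (prod.lift_fst _ _))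
      (lift_map_eq hs₂ (prod.lift_snd _ _))) S, ?_, ?_⟩
    · refine (fstPts_cons α q _ S hs₁ (prod.lift_fst _ _) ht₁).trans ?_
      exact congrArg (fun a => Pts.cons a _) (HomOver.ext (meetLift_fst _ _ _ _))
    · refine (sndPts_cons α q _ S hs₂ (prod.lift_snd _ _) ht₂).trans ?_
      exact congrArg (fun a => Pts.cons a _) (HomOver.ext (meetLift_snd _ _ _ _))

theorem pairPts_ext (α : LPath (pairGraph p).Loose I J) {s : Z ⟶ I.1 ⨯ I.2} {t : Z ⟶ J.1 ⨯ J.2}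
    {S S' : Pts e (boxPath α) s t} {s₁ : Z ⟶ I.1} {t₁ : Z ⟶ J.1} {s₂ : Z ⟶ I.2} {t₂ : Z ⟶ J.2}
    (hs₁ : s ≫ prod.fst = s₁) (ht₁ : t ≫ prod.fst = t₁)
    (hs₂ : s ≫ prod.snd = s₂) (ht₂ : t ≫ prod.snd = t₂)
    (h₁ : fstPts α S hs₁ ht₁ = fstPts α S' hs₁ ht₁)
    (h₂ : sndPts α S hs₂ ht₂ = sndPts α S' hs₂ ht₂) : S = S' := by
  induction α with
  | nil => exact Pts.nil_uniq _ _
  | @cons I K J α q ih =>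
    obtain ⟨m, a, as, rfl⟩ := Pts.exists_cons (α := boxLoose α) (q := boxPath q) S
    obtain ⟨m', a', as', rfl⟩ := Pts.exists_cons (α := boxLoose α) (q := boxPath q) S'
    have k₁ := Pts.cons.inj ((fstPts_cons α q a as hs₁ rfl ht₁).symm.trans
      (h₁.trans (fstPts_cons α q a' as' hs₁ rfl ht₁)))
    have k₂ := Pts.cons.inj ((sndPts_cons α q a as hs₂ rfl ht₂).symm.trans
      (h₂.trans (sndPts_cons α q a' as' hs₂ rfl ht₂)))
    obtain rfl : m = m' := Limits.prod.hom_ext k₁.1 k₂.1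
    refine congrArg₂ Pts.cons (meet_ext (congrArg Subtype.val (eq_of_heq k₁.2.1))
      (congrArg Subtype.val (eq_of_heq k₂.2.1))) ?_
    exact ih rfl ht₁ rfl ht₂ (eq_of_heq k₁.2.2) (eq_of_heq k₂.2.2)

end

end FibCat

end

noncomputable section

namespace FibCat

open CategoryTheory.Functor

variable {B : Type u} [Category.{v} B] {E : Type w} [Category.{x} E] {p : E ⥤ B}
  [HasFiniteProducts B]
  [p.IsFibered] [∀ X : B, HasFiniteProducts (p.Fiber X)]
  [∀ {X Y : B} (f : X ⟶ Y), PreservesFiniteProducts (baseChange p f)]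

section

variable {I J : (pairGraph p).Ob}

theorem cocart_arr_fst {α : LPath (pairGraph p).Loose I J} {c : (pairGraph p).Loose I J}
    {κ : (pairGraph p).Cell α (𝟙 I) (𝟙 J) c}
    (h : VDC.IsComposite (D := VDC.prod (bil p) (bil p)) κ) :
    Cocart (arr (α := fstPath α) (c := c.1) κ.1) := by
  refine cocart_arr (α := fstPath α) (c := c.1) fun {γ} ν => ?_
  obtain ⟨ζ, h₁, h₂⟩ := VDC.IsComposite.existsUnique h (γ := (γ, c.2)) (ν, κ.2)
  have h₃ := Prod.ext_iff.1 h₁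
  refine ⟨ζ.1, h₃.1, fun ζ' h' => ?_⟩
  exact congrArg (fun ζ : (pairGraph p).Cell (.single c) (𝟙 I) (𝟙 J) (γ, c.2) => ζ.1)
    (h₂ (ζ', ζ.2) (Prod.ext h' h₃.2))

theorem cocart_arr_snd {α : LPath (pairGraph p).Loose I J} {c : (pairGraph p).Loose I J}
    {κ : (pairGraph p).Cell α (𝟙 I) (𝟙 J) c}
    (h : VDC.IsComposite (D := VDC.prod (bil p) (bil p)) κ) :
    Cocart (arr (α := sndPath α) (c := c.2) κ.2) := by
  refine cocart_arr (α := sndPath α) (c := c.2) fun {γ} ν => ?_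
  obtain ⟨ζ, h₁, h₂⟩ := VDC.IsComposite.existsUnique h (γ := (c.1, γ)) (κ.1, ν)
  have h₃ := Prod.ext_iff.1 h₁
  refine ⟨ζ.2, h₃.2, fun ζ' h' => ?_⟩
  exact congrArg (fun ζ : (pairGraph p).Cell (.single c) (𝟙 I) (𝟙 J) (c.1, γ) => ζ.2)
    (h₂ (ζ.1, ζ') (Prod.ext h₃.1 h'))

/-- The conjunction along a path of external conjunctions, as an external conjunction. -/
def boxCtx (α : LPath (pairGraph p).Loose I J) :
    HomOver p (prod.lift (fstPts α (gen (boxPath α)) rfl rfl).pt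
      (sndPts α (gen (boxPath α)) rfl rfl).pt) (ctx p (boxPath α))
      (meet prod.fst (ctx p (fstPath α)) prod.snd (ctx p (sndPath α))) :=
  meetLift (toCtx (fstPts α (gen (boxPath α)) rfl rfl))
    (toCtx (sndPts α (gen (boxPath α)) rfl rfl)) (prod.lift_fst _ _) (prod.lift_snd _ _)

theorem exists_isInv_boxCtx (α : LPath (pairGraph p).Loose I J) :
    ∃ (j₀ : _) (j : HomOver p j₀ _ _), HomOver.IsInv (boxCtx α) j := by
  let m₁ : HomOver p prod.fst (meet prod.fst (ctx p (fstPath α)) prod.snd (ctx p (sndPath α))) _ :=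
    meetFst _ _ _ _
  let m₂ : HomOver p prod.snd (meet prod.fst (ctx p (fstPath α)) prod.snd (ctx p (sndPath α))) _ :=
    meetSnd _ _ _ _
  let s : base p (fstPath α) ⨯ base p (sndPath α) ⟶ I.1 ⨯ I.2 :=
    prod.map (first p (fstPath α)) (first p (sndPath α))
  let t : base p (fstPath α) ⨯ base p (sndPath α) ⟶ J.1 ⨯ J.2 :=
    prod.map (last p (fstPath α)) (last p (sndPath α))
  have hs₁ : s ≫ prod.fst = prod.fst ≫ first p (fstPath α) := prod.map_fst _ _
  have hs₂ : s ≫ prod.snd = prod.snd ≫ first p (sndPath α) := prod.map_snd _ _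
  have ht₁ : t ≫ prod.fst = prod.fst ≫ last p (fstPath α) := prod.map_fst _ _
  have ht₂ : t ≫ prod.snd = prod.snd ≫ last p (sndPath α) := prod.map_snd _ _
  obtain ⟨S, hS₁, hS₂⟩ := exists_pairPts α ((gen (fstPath α)).pre m₁ rfl rfl)
    ((gen (sndPath α)).pre m₂ rfl rfl) hs₁ ht₁ hs₂ ht₂
  have i₁ : (boxCtx α).1 ≫ m₁.1 = (toCtx (fstPts α (gen (boxPath α)) rfl rfl)).1 :=
    meetLift_fst _ _ _ _
  have i₂ : (boxCtx α).1 ≫ m₂.1 = (toCtx (sndPts α (gen (boxPath α)) rfl rfl)).1 :=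
    meetLift_snd _ _ _ _
  have es : prod.lift (fstPts α (gen (boxPath α)) rfl rfl).pt
      (sndPts α (gen (boxPath α)) rfl rfl).pt ≫ s = first p (boxPath α) := by
    refine (prod.lift_map _ _ _ _).trans (Limits.prod.hom_ext ?_ ?_)
    · exact (prod.lift_fst _ _).trans (Pts.pt_first _)
    · exact (prod.lift_snd _ _).trans (Pts.pt_first _)
  have et : prod.lift (fstPts α (gen (boxPath α)) rfl rfl).pt
      (sndPts α (gen (boxPath α)) rfl rfl).pt ≫ t = last p (boxPath α) := by
    refine (prod.lift_map _ _ _ _).trans (Limits.prod.hom_ext ?_ ?_)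
    · exact (prod.lift_fst _ _).trans (Pts.pt_last _)
    · exact (prod.lift_snd _ _).trans (Pts.pt_last _)
  refine ⟨S.pt, toCtx S, ?_, ?_⟩
  · refine (toCtx_pre (boxCtx α) S es et).symm.trans ?_
    have e : S.pre (boxCtx α) es et = gen (boxPath α) := by
      refine pairPts_ext α rfl rfl rfl rfl ?_ ?_
      · have k₁ : prod.lift (fstPts α (gen (boxPath α)) rfl rfl).pt
            (sndPts α (gen (boxPath α)) rfl rfl).pt ≫ prod.fst ≫ first p (fstPath α) =
              first p (boxPath α) ≫ prod.fst := by rw [← hs₁, ← Category.assoc, es]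
        have k₂ : prod.lift (fstPts α (gen (boxPath α)) rfl rfl).pt
            (sndPts α (gen (boxPath α)) rfl rfl).pt ≫ prod.fst ≫ last p (fstPath α) =
              last p (boxPath α) ≫ prod.fst := by rw [← ht₁, ← Category.assoc, et]
        refine (fstPts_pre α (boxCtx α) S hs₁ ht₁ es et rfl rfl k₁ k₂).trans ?_
        rw [hS₁]
        refine (Pts.pre_pre m₁ (boxCtx α) (gen (fstPath α)) rfl rfl k₁ k₂ (prod.lift_fst _ _)
          (Pts.pt_first _) (Pts.pt_last _)).trans ?_
        refine (congrArg (fun y => (gen (fstPath α)).pre y (Pts.pt_first _) (Pts.pt_last _))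
          (HomOver.ext i₁)).trans (pre_toCtx _)
      · have k₁ : prod.lift (fstPts α (gen (boxPath α)) rfl rfl).pt
            (sndPts α (gen (boxPath α)) rfl rfl).pt ≫ prod.snd ≫ first p (sndPath α) =
              first p (boxPath α) ≫ prod.snd := by rw [← hs₂, ← Category.assoc, es]
        have k₂ : prod.lift (fstPts α (gen (boxPath α)) rfl rfl).pt
            (sndPts α (gen (boxPath α)) rfl rfl).pt ≫ prod.snd ≫ last p (sndPath α) =
              last p (boxPath α) ≫ prod.snd := by rw [← ht₂, ← Category.assoc, et]
        refine (sndPts_pre α (boxCtx α) S hs₂ ht₂ es et rfl rfl k₁ k₂).trans ?_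
        rw [hS₂]
        refine (Pts.pre_pre m₂ (boxCtx α) (gen (sndPath α)) rfl rfl k₁ k₂ (prod.lift_snd _ _)
          (Pts.pt_first _) (Pts.pt_last _)).trans ?_
        refine (congrArg (fun y => (gen (sndPath α)).pre y (Pts.pt_first _) (Pts.pt_last _))
          (HomOver.ext i₂)).trans (pre_toCtx _)
    rw [e]
    exact toCtx_gen _
  · have v₁ : (toCtx S).1 ≫ (toCtx (fstPts α (gen (boxPath α)) rfl rfl)).1 = m₁.1 := by
      have k₁ : S.pt ≫ first p (boxPath α) ≫ prod.fst = prod.fst ≫ first p (fstPath α) := by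
        rw [← Category.assoc, S.pt_first, hs₁]
      have k₂ : S.pt ≫ last p (boxPath α) ≫ prod.fst = prod.fst ≫ last p (fstPath α) := by
        rw [← Category.assoc, S.pt_last, ht₁]
      refine (toCtx_pre (toCtx S) (fstPts α (gen (boxPath α)) rfl rfl) k₁ k₂).symm.trans ?_
      rw [← fstPts_pre α (toCtx S) (gen (boxPath α)) rfl rfl S.pt_first S.pt_last hs₁ ht₁ k₁ k₂,
        pre_toCtx, hS₁]
      refine (toCtx_pre m₁ (gen (fstPath α)) rfl rfl).trans ?_
      exact (congrArg (m₁.1 ≫ ·) (toCtx_gen _)).trans (Category.comp_id _)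
    have v₂ : (toCtx S).1 ≫ (toCtx (sndPts α (gen (boxPath α)) rfl rfl)).1 = m₂.1 := by
      have k₁ : S.pt ≫ first p (boxPath α) ≫ prod.snd = prod.snd ≫ first p (sndPath α) := by
        rw [← Category.assoc, S.pt_first, hs₂]
      have k₂ : S.pt ≫ last p (boxPath α) ≫ prod.snd = prod.snd ≫ last p (sndPath α) := by
        rw [← Category.assoc, S.pt_last, ht₂]
      refine (toCtx_pre (toCtx S) (sndPts α (gen (boxPath α)) rfl rfl) k₁ k₂).symm.trans ?_
      rw [← sndPts_pre α (toCtx S) (gen (boxPath α)) rfl rfl S.pt_first S.pt_last hs₂ ht₂ k₁ k₂,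
        pre_toCtx, hS₂]
      refine (toCtx_pre m₂ (gen (sndPath α)) rfl rfl).trans ?_
      exact (congrArg (m₂.1 ≫ ·) (toCtx_gen _)).trans (Category.comp_id _)
    refine meet_ext' (D := (toCtx S).comp (boxCtx α) rfl) (D' := HomOver.id _) ?_ ?_ ?_
    · refine Limits.prod.hom_ext ?_ ?_
      · rw [Category.assoc, prod.lift_fst, Category.id_comp]
        exact HomOver.over_unique ((toCtx S).comp (toCtx _) rfl) m₁ v₁
      · rw [Category.assoc, prod.lift_snd, Category.id_comp]
        exact HomOver.over_unique ((toCtx S).comp (toCtx _) rfl) m₂ v₂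
    · exact (Category.assoc _ _ _).trans ((congrArg ((toCtx S).1 ≫ ·) i₁).trans
        (v₁.trans (Category.id_comp _).symm))
    · exact (Category.assoc _ _ _).trans ((congrArg ((toCtx S).1 ≫ ·) i₂).trans
        (v₂.trans (Category.id_comp _).symm))

theorem exists_boxLoose_inv (c : (pairGraph p).Loose I J) :
    ∃ (k₀ : _) (l₀ : _) (k : HomOver p k₀ (meet prod.fst c.1 prod.snd c.2) (boxLoose c))
      (l : HomOver p l₀ (boxLoose c) (meet prod.fst c.1 prod.snd c.2)), HomOver.IsInv k l ∧
      k₀ = prod.lift (prod.map prod.fst prod.fst) (prod.map prod.snd prod.snd) ∧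
      k.1 ≫ (meetFst (prod.map prod.fst prod.fst) c.1 (prod.map prod.snd prod.snd) c.2).1 =
        (meetFst prod.fst c.1 prod.snd c.2).1 ∧
      k.1 ≫ (meetSnd (prod.map prod.fst prod.fst) c.1 (prod.map prod.snd prod.snd) c.2).1 =
        (meetSnd prod.fst c.1 prod.snd c.2).1 := by
  have e : ∀ {X₁ X₂ Y₁ Y₂ : B},
      prod.lift (prod.map prod.fst prod.fst) (prod.map prod.snd prod.snd) ≫
        prod.lift (prod.map prod.fst prod.fst) (prod.map prod.snd prod.snd) =
          𝟙 ((X₁ ⨯ X₂) ⨯ (Y₁ ⨯ Y₂)) := by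
    intro X₁ X₂ Y₁ Y₂
    ext <;> simp [prod.lift_fst, prod.lift_snd]
  obtain ⟨k, l, h, h₁, h₂⟩ := exists_meet_inv
    (x := (prod.fst : (I.1 ⨯ J.1) ⨯ (I.2 ⨯ J.2) ⟶ I.1 ⨯ J.1))
    (y := (prod.snd : (I.1 ⨯ J.1) ⨯ (I.2 ⨯ J.2) ⟶ I.2 ⨯ J.2))
    (x' := (prod.map prod.fst prod.fst : (I.1 ⨯ I.2) ⨯ (J.1 ⨯ J.2) ⟶ I.1 ⨯ J.1))
    (y' := (prod.map prod.snd prod.snd : (I.1 ⨯ I.2) ⨯ (J.1 ⨯ J.2) ⟶ I.2 ⨯ J.2))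
    (HomOver.isInv_id c.1) (HomOver.isInv_id c.2) e e
    (by ext <;> simp [prod.lift_fst, prod.lift_snd])
    (by ext <;> simp [prod.lift_fst, prod.lift_snd])
  exact ⟨_, _, k, l, h, rfl, h₁.trans (Category.comp_id _), h₂.trans (Category.comp_id _)⟩

/-- The external conjunction of two cells with identity tight boundary. -/
def boxComp {α : LPath (pairGraph p).Loose I J} {c : (pairGraph p).Loose I J}
    (κ : (pairGraph p).Cell α (𝟙 I) (𝟙 J) c) :
    (bilGraph p).Cell (boxPath α) (𝟙 ((I.1 : B) ⨯ (I.2 : B))) (𝟙 ((J.1 : B) ⨯ (J.2 : B)))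
      (boxLoose c) :=
  (bilGraph p).cast (α := boxPath α) rfl (prod.map_id_id (X := (I.1 : B)) (Y := (I.2 : B)))
    (prod.map_id_id (X := (J.1 : B)) (Y := (J.2 : B))) (boxCell (s := 𝟙 I) (t := 𝟙 J) κ)

theorem arr_boxComp_fst {α : LPath (pairGraph p).Loose I J} {c : (pairGraph p).Loose I J}
    (κ : (pairGraph p).Cell α (𝟙 I) (𝟙 J) c) :
    (arr (boxComp κ)).1 ≫
        (meetFst (prod.map prod.fst prod.fst) c.1 (prod.map prod.snd prod.snd) c.2).1 =
      (toCtx (fstPts α (gen (boxPath α)) rfl rfl)).1 ≫ (arr (α := fstPath α) (c := c.1) κ.1).1 := by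
  have e₁ : first p (boxPath α) ≫ prod.map (𝟙 (I.1 : B)) (𝟙 (I.2 : B)) = first p (boxPath α) := by
    rw [prod.map_id_id, Category.comp_id]
  have e₂ : last p (boxPath α) ≫ prod.map (𝟙 (J.1 : B)) (𝟙 (J.2 : B)) = last p (boxPath α) := by
    rw [prod.map_id_id, Category.comp_id]
  refine (congrArg (fun y : HomOver p _ _ _ => y.1 ≫ _) (act_cast (boxCell (s := 𝟙 I) (t := 𝟙 J) κ)
    (prod.map_id_id (X := (I.1 : B)) (Y := (I.2 : B)))
    (prod.map_id_id (X := (J.1 : B)) (Y := (J.2 : B))) (gen (boxPath α)) e₁ e₂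
    (Category.comp_id _) (Category.comp_id _))).trans ?_
  refine (act_boxCell_fst κ (gen (boxPath α)) e₁ e₂ rfl rfl (Category.comp_id _)
    (Category.comp_id _)).trans ?_
  refine Eq.trans ?_ (act_arr (α := fstPath α) (c := c.1) κ.1
    (toCtx (fstPts α (gen (boxPath α)) rfl rfl)) (Pts.pt_first _) (Pts.pt_last _)
    (Category.comp_id _) (Category.comp_id _))
  rw [pre_toCtx]

theorem arr_boxComp_snd {α : LPath (pairGraph p).Loose I J} {c : (pairGraph p).Loose I J}
    (κ : (pairGraph p).Cell α (𝟙 I) (𝟙 J) c) :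
    (arr (boxComp κ)).1 ≫
        (meetSnd (prod.map prod.fst prod.fst) c.1 (prod.map prod.snd prod.snd) c.2).1 =
      (toCtx (sndPts α (gen (boxPath α)) rfl rfl)).1 ≫ (arr (α := sndPath α) (c := c.2) κ.2).1 := by
  have e₁ : first p (boxPath α) ≫ prod.map (𝟙 (I.1 : B)) (𝟙 (I.2 : B)) = first p (boxPath α) := by
    rw [prod.map_id_id, Category.comp_id]
  have e₂ : last p (boxPath α) ≫ prod.map (𝟙 (J.1 : B)) (𝟙 (J.2 : B)) = last p (boxPath α) := by
    rw [prod.map_id_id, Category.comp_id]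
  refine (congrArg (fun y : HomOver p _ _ _ => y.1 ≫ _) (act_cast (boxCell (s := 𝟙 I) (t := 𝟙 J) κ)
    (prod.map_id_id (X := (I.1 : B)) (Y := (I.2 : B)))
    (prod.map_id_id (X := (J.1 : B)) (Y := (J.2 : B))) (gen (boxPath α)) e₁ e₂
    (Category.comp_id _) (Category.comp_id _))).trans ?_
  refine (act_boxCell_snd κ (gen (boxPath α)) e₁ e₂ rfl rfl (Category.comp_id _)
    (Category.comp_id _)).trans ?_
  refine Eq.trans ?_ (act_arr (α := sndPath α) (c := c.2) κ.2
    (toCtx (sndPts α (gen (boxPath α)) rfl rfl)) (Pts.pt_first _) (Pts.pt_last _)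
    (Category.comp_id _) (Category.comp_id _))
  rw [pre_toCtx]

theorem comp_comp_comp_eq {C : Type*} [Category* C] {X₀ X₁ X₂ X₃ Y₀ Y₁ : C} {i : X₀ ⟶ X₁}
    {b : X₁ ⟶ X₂} {k : X₂ ⟶ X₃} {m : X₃ ⟶ Y₁} {m' : X₂ ⟶ Y₁} {n : X₁ ⟶ Y₀} {a : Y₀ ⟶ Y₁}
    {t : X₀ ⟶ Y₀} (h₁ : k ≫ m = m') (h₂ : b ≫ m' = n ≫ a) (h₃ : i ≫ n = t) :
    (i ≫ (b ≫ k)) ≫ m = t ≫ a := by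
  subst h₁ h₃
  simp only [Category.assoc, h₂]

theorem lift_eq_lift_comp {C : Type*} [Category* C] [HasFiniteProducts C]
    {Z X Y I₁ I₂ J₁ J₂ : C} {f : Z ⟶ I₁ ⨯ I₂} {l : Z ⟶ J₁ ⨯ J₂} {a : Z ⟶ X} {c : Z ⟶ Y}
    {f₁ : X ⟶ I₁} {f₂ : Y ⟶ I₂} {l₁ : X ⟶ J₁} {l₂ : Y ⟶ J₂} (h₁ : f ≫ prod.fst = a ≫ f₁)
    (h₂ : f ≫ prod.snd = c ≫ f₂) (h₃ : l ≫ prod.fst = a ≫ l₁) (h₄ : l ≫ prod.snd = c ≫ l₂) :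
    prod.lift f l = prod.lift a c ≫ prod.map (prod.lift f₁ l₁) (prod.lift f₂ l₂) ≫
      prod.lift (prod.map prod.fst prod.fst) (prod.map prod.snd prod.snd) := by
  refine Limits.prod.hom_ext (Limits.prod.hom_ext ?_ ?_) (Limits.prod.hom_ext ?_ ?_) <;>
    simp [prod.lift_fst, prod.lift_snd, h₁, h₂, h₃, h₄]

theorem isComposite_boxCell {S : Set ℕ} (hS : HasStable p S) {α : LPath (pairGraph p).Loose I J}
    (hα : α.length ∈ S) {c : (pairGraph p).Loose I J} {κ : (pairGraph p).Cell α (𝟙 I) (𝟙 J) c}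
    (h : VDC.IsComposite (D := VDC.prod (bil p) (bil p)) κ) :
    VDC.IsComposite (D := bil p) (boxComp κ) := by
  have s₁ := hS.stable_arr ((LPath.length_map Prod.fst Prod.fst α).symm ▸ hα) (cocart_arr_fst h)
  have s₂ := hS.stable_arr ((LPath.length_map Prod.snd Prod.snd α).symm ▸ hα) (cocart_arr_snd h)
  obtain ⟨j₀, j, hj⟩ := exists_isInv_boxCtx α
  obtain ⟨k₀, l₀, k, l, hk, hk₀, hk₁, hk₂⟩ := exists_boxLoose_inv c
  refine isComposite_of_stable ((s₁.box s₂).of_inv hj hk ?_)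
  refine meet_ext' (D' := (boxCtx α).comp ((box (arr (α := fstPath α) (c := c.1) κ.1)
    (arr (α := sndPath α) (c := c.2) κ.2)).comp k rfl) rfl) ?_ ?_ ?_
  · subst hk₀
    exact lift_eq_lift_comp (Pts.pt_first _).symm (Pts.pt_first _).symm (Pts.pt_last _).symm
      (Pts.pt_last _).symm
  · exact (arr_boxComp_fst κ).trans (comp_comp_comp_eq hk₁ (meetLift_fst _ _ _ _)
      (meetLift_fst _ _ _ _)).symm
  · exact (arr_boxComp_snd κ).trans (comp_comp_comp_eq hk₂ (meetLift_snd _ _ _ _)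
      (meetLift_snd _ _ _ _)).symm

theorem boxFunctor_preservesComposites {S : Set ℕ} (hS : HasStable p S) :
    (boxFunctor p).PreservesComposites S := by
  intro I J α c κ hα h
  exact isComposite_boxCell hS hα h

end

end FibCat

end

noncomputable section

namespace FibCat

open CategoryTheory.Functor

variable {B : Type u} [Category.{v} B] {E : Type w} [Category.{x} E] {p : E ⥤ B}
  [HasFiniteProducts B]
  [p.IsFibered] [∀ X : B, HasFiniteProducts (p.Fiber X)]
  [∀ {X Y : B} (f : X ⟶ Y), PreservesFiniteProducts (baseChange p f)]

theorem cell_ext_of_isTerminal {I J K M : B} {α : LPath (Rel p) I J} {s : I ⟶ K} {t : J ⟶ M}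
    {β : Rel p K M} (hβ : IsTerminal β) (ξ ζ : (bilGraph p).Cell α s t β) : ξ = ζ :=
  cell_ext (terminal_ext hβ _ _)

variable (p) in
/-- The terminal loose arrow. -/
abbrev topLoose : Rel p (⊤_ B) (⊤_ B) := ⊤_ (p.Fiber ((⊤_ B) ⨯ (⊤_ B)))

/-- The cells into a terminal loose arrow. -/
def topCell {I J : B} (α : LPath (Rel p) I J) (s : I ⟶ ⊤_ B) (t : J ⟶ ⊤_ B) :
    (bilGraph p).Cell α s t (topLoose p) :=
  mkCell (homTerminal terminalIsTerminal _ _)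

theorem topCell_ext {I J : B} {α : LPath (Rel p) I J} {s : I ⟶ ⊤_ B} {t : J ⟶ ⊤_ B}
    (ξ ζ : (bilGraph p).Cell α s t (topLoose p)) : ξ = ζ :=
  cell_ext_of_isTerminal terminalIsTerminal ξ ζ

theorem sarr_top {I J : B} {α : Rel p I J} {s s' : I ⟶ ⊤_ B} {t t' : J ⟶ ⊤_ B}
    (ξ : (bilGraph p).Cell (.single α) s t (topLoose p))
    (ζ : (bilGraph p).Cell (.single α) s' t' (topLoose p)) : (sarr ξ).1 = (sarr ζ).1 := by
  obtain rfl : s = s' := terminal.hom_ext _ _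
  obtain rfl : t = t' := terminal.hom_ext _ _
  rw [topCell_ext ξ ζ]

variable (p) in
/-- The functor which chooses the terminal object and the terminal loose arrow. -/
def topFunctor : VDFunctor VDC.terminal.{u, v, w, x} (bil p) where
  tight := { obj := fun _ => ⊤_ B, map := fun _ => 𝟙 _ }
  loose _ := topLoose p
  cell _ := topCell _ _ _
  cell_id _ := topCell_ext _ _
  cell_comp _ _ _ _ := topCell_ext _ _

variable (p) in
theorem topFunctor_preservesRestrictions : (topFunctor p).PreservesRestrictions := by
  have key : ∀ {X Y : B} (γ : LPath (Rel p) X Y) (h : X ⟶ ⊤_ B) (k : Y ⟶ ⊤_ B) (f g : ⊤_ B ⟶ ⊤_ B)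
      (ρ : (bilGraph p).Cell (.single (topLoose p)) f g (topLoose p))
      (ξ : (bilGraph p).Cell γ (h ≫ f) (k ≫ g) (topLoose p)),
      ∃! ζ : (bilGraph p).Cell γ h k (topLoose p), (bil p).comp (.single ζ) ρ rfl rfl = ξ :=
    fun γ h k f g ρ ξ => ⟨topCell γ h k, topCell_ext _ _, fun _ _ => topCell_ext _ _⟩
  intro I J K M r s t α ρ _ X Y γ h k ξ
  exact key γ h k _ _ _ ξ

variable (p) in
/-- The right adjoint of the functor to the terminal virtual double category. -/
def bangAdjunction : Bicategory.Adjunction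
    (show bil p ⟶ VDC.terminal.{u, v, w, x} from VDC.bang (bil p)) (topFunctor p) :=
  VDC.adjunctionMk _ _
    { tight := { app := fun I => terminal.from (C := B) I
                 naturality := fun _ _ _ => terminal.hom_ext (C := B) _ _ }
      cell := fun α => topCell (.single α) _ _
      naturality := fun _ => topCell_ext _ _ }
    { tight := { app := fun _ => PUnit.unit
                 naturality := fun _ _ _ => rfl }
      cell := fun _ => PUnit.unit
      naturality := fun _ => rfl }
    (fun _ => rfl) (fun _ => rfl) (fun _ => terminal.hom_ext (C := B) _ _)
    (fun _ => vertHom_ext (terminal.hom_ext (C := B) _ _) (terminal.hom_ext (C := B) _ _)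
      (sarr_top _ _))

theorem exists_topPts {I J : PUnit.{u + 1}}
    (α : LPath (fun _ _ : PUnit.{u + 1} => PUnit.{w + 1}) I J) {Z : B}
    (e : p.Fiber Z) (s t : Z ⟶ ⊤_ B) :
    Nonempty (Pts e (α.map (fun _ => ⊤_ B) fun _ => topLoose p) s t) := by
  induction α generalizing s with
  | nil => exact ⟨.nil _ _ (terminal.hom_ext _ _)⟩
  | cons a α ih =>
    obtain ⟨R⟩ := ih (terminal.from Z)
    exact ⟨.cons (homTerminal terminalIsTerminal _ _) R⟩

theorem topPts_ext {I J : PUnit.{u + 1}}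
    (α : LPath (fun _ _ : PUnit.{u + 1} => PUnit.{w + 1}) I J) {Z : B}
    {e : p.Fiber Z} {s t : Z ⟶ ⊤_ B}
    (R S : Pts e (α.map (fun _ => ⊤_ B) fun _ => topLoose p) s t) : R = S := by
  induction α generalizing s with
  | nil => exact Pts.nil_uniq _ _
  | cons a α ih =>
    obtain ⟨m, a, R, rfl⟩ := Pts.exists_cons R
    obtain ⟨n, b, S, rfl⟩ := Pts.exists_cons S
    obtain rfl : m = n := terminal.hom_ext _ _
    exact congrArg₂ Pts.cons (terminal_ext terminalIsTerminal _ _) (ih R S)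

theorem HomOver.IsInv.cocart {X Y : B} {f : X ⟶ Y} {g : Y ⟶ X} {a : p.Fiber X} {b : p.Fiber Y}
    {φ : HomOver p f a b} {ψ : HomOver p g b a} (h : IsInv φ ψ) : Cocart φ := by
  intro T k c χ
  refine ⟨ψ.comp χ ?_, h.hom_inv_assoc χ.1, fun ζ hζ => HomOver.ext ?_⟩
  · rw [← Category.assoc, h.base_inv_hom, Category.id_comp]
  · exact (h.inv_hom_assoc ζ.1).symm.trans (congrArg (ψ.1 ≫ ·) hζ)

theorem isInv_top {I J : PUnit.{u + 1}} (α : LPath (fun _ _ : PUnit.{u + 1} => PUnit.{w + 1}) I J)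
    {f : base p (α.map (fun _ => ⊤_ B) fun _ => topLoose p) ⟶ (⊤_ B) ⨯ (⊤_ B)}
    (φ : HomOver p f (ctx p (α.map (fun _ => ⊤_ B) fun _ => topLoose p)) (topLoose p)) :
    ∃ (g : _) (ψ : HomOver p g _ _), HomOver.IsInv φ ψ := by
  obtain ⟨R⟩ := exists_topPts α (topLoose p) (terminal.from _) (terminal.from _)
  refine ⟨R.pt, toCtx R, ?_, ?_⟩
  · refine (toCtx_pre φ R (s' := first p _) (t' := last p _) (terminal.hom_ext _ _)
      (terminal.hom_ext _ _)).symm.trans ?_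
    rw [topPts_ext α (R.pre φ _ _) (gen _)]
    exact toCtx_gen _
  · refine congrArg Subtype.val (terminal_ext terminalIsTerminal ((toCtx R).comp φ
      (Limits.prod.hom_ext (terminal.hom_ext _ _) (terminal.hom_ext _ _))) (HomOver.id _))

theorem topFunctor_preservesComposites {S : Set ℕ} (hS : HasStable p S) :
    (topFunctor p).PreservesComposites S := by
  intro I J α c κ hα _
  obtain ⟨_, _, h⟩ := isInv_top α (arr ((bilGraph p).cast rfl ((topFunctor p).tight.map_id I)
    ((topFunctor p).tight.map_id J) ((topFunctor p).cell κ)))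
  exact isComposite_of_stable (hS.stable_arr ((LPath.length_map _ _ α).symm ▸ hα) h.cocart)

theorem isCartesian_bil {S : Set ℕ} (hS : HasStable p S) : VDC.IsCartesian S (bil p) :=
  ⟨⟨topFunctor p, topFunctor_preservesRestrictions p, topFunctor_preservesComposites hS,
    ⟨bangAdjunction p⟩⟩,
   ⟨boxFunctor p, boxFunctor_preservesRestrictions, boxFunctor_preservesComposites hS,
    ⟨diagAdjunction p⟩⟩⟩

end FibCat

end

noncomputable section

namespace FibCat

open CategoryTheory.Functor

variable {B : Type u} [Category.{v} B] {E : Type w} [Category.{x} E] {p : E ⥤ B}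
  [HasFiniteProducts B]
  [p.IsFibered] [∀ X : B, HasFiniteProducts (p.Fiber X)]
  [∀ {X Y : B} (f : X ⟶ Y), PreservesFiniteProducts (baseChange p f)]

variable (p) in
theorem isCartesian_proj {X Y : B} (f : X ⟶ Y) (b : p.Fiber Y) : p.IsCartesian f (proj p f b).1 :=
  inferInstance

section

variable {X Y Y' : B} {f : X ⟶ Y} {g : X ⟶ Y'} {a : p.Fiber Y} {b : p.Fiber Y'} {c : p.Fiber X}

/-- The domain is the product of the base changes of the codomains. -/
def JointlyCartesian (φ : HomOver p f c a) (ψ : HomOver p g c b) : Prop :=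
  ∀ ⦃Z : B⦄ (z : Z ⟶ X) (e : p.Fiber Z) (φ' : HomOver p (z ≫ f) e a)
    (ψ' : HomOver p (z ≫ g) e b),
    ∃! χ : HomOver p z e c, χ.1 ≫ φ.1 = φ'.1 ∧ χ.1 ≫ ψ.1 = ψ'.1

theorem jointlyCartesian_of_isLimit {φ : HomOver p f c a} {ψ : HomOver p g c b} {a' b' : p.Fiber X}
    {u : c ⟶ a'} {v : c ⟶ b'} (h : Nonempty (IsLimit (BinaryFan.mk u v)))
    (κ : HomOver p f a' a) (l : HomOver p g b' b) (hκ : p.IsCartesian f κ.1)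
    (hl : p.IsCartesian g l.1) (h₁ : u.1 ≫ κ.1 = φ.1)
    (h₂ : v.1 ≫ l.1 = ψ.1) : JointlyCartesian φ ψ := by
  intro Z z e φ' ψ'
  obtain ⟨χ, e₁, e₂⟩ := exists_pair h (cartLift κ φ' rfl) (cartLift l ψ' rfl)
  have k₁ : χ.1 ≫ φ.1 = φ'.1 := (congrArg (χ.1 ≫ ·) h₁.symm).trans
    ((Category.assoc _ _ _).symm.trans ((congrArg (· ≫ κ.1) e₁).trans (cartLift_fac κ φ' rfl)))
  have k₂ : χ.1 ≫ ψ.1 = ψ'.1 := (congrArg (χ.1 ≫ ·) h₂.symm).trans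
    ((Category.assoc _ _ _).symm.trans ((congrArg (· ≫ l.1) e₂).trans (cartLift_fac l ψ' rfl)))
  refine ⟨χ, ⟨k₁, k₂⟩, fun χ' h' => pair_ext h ?_ ?_⟩
  · refine congrArg Subtype.val (cart_ext κ (φ := χ'.comp (HomOver.ofFiber u) (Category.comp_id z))
      (ψ := χ.comp (HomOver.ofFiber u) (Category.comp_id z)) ?_)
    refine (Category.assoc _ _ _).trans ((congrArg (χ'.1 ≫ ·) h₁).trans (h'.1.trans ?_))
    exact k₁.symm.trans ((congrArg (χ.1 ≫ ·) h₁.symm).trans (Category.assoc _ _ _).symm)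
  · refine congrArg Subtype.val (cart_ext l (φ := χ'.comp (HomOver.ofFiber v) (Category.comp_id z))
      (ψ := χ.comp (HomOver.ofFiber v) (Category.comp_id z)) ?_)
    refine (Category.assoc _ _ _).trans ((congrArg (χ'.1 ≫ ·) h₂).trans (h'.2.trans ?_))
    exact k₂.symm.trans ((congrArg (χ.1 ≫ ·) h₂.symm).trans (Category.assoc _ _ _).symm)

theorem JointlyCartesian.of_inv {φ : HomOver p f c a} {ψ : HomOver p g c b}
    (h : JointlyCartesian φ ψ) {X₁ Y₁ Y₁' : B} {f₁ : X₁ ⟶ Y₁} {g₁ : X₁ ⟶ Y₁'} {a₁ : p.Fiber Y₁}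
    {b₁ : p.Fiber Y₁'} {c₁ : p.Fiber X₁} {φ₁ : HomOver p f₁ c₁ a₁} {ψ₁ : HomOver p g₁ c₁ b₁}
    {i₀ : X₁ ⟶ X} {i₀' : X ⟶ X₁} {i : HomOver p i₀ c₁ c} {i' : HomOver p i₀' c c₁}
    (hi : HomOver.IsInv i i') {j₀ : Y₁ ⟶ Y} {j₀' : Y ⟶ Y₁} {j : HomOver p j₀ a₁ a}
    {j' : HomOver p j₀' a a₁} (hj : HomOver.IsInv j j') {k₀ : Y₁' ⟶ Y'} {k₀' : Y' ⟶ Y₁'}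
    {k : HomOver p k₀ b₁ b} {k' : HomOver p k₀' b b₁} (hk : HomOver.IsInv k k')
    (h₁ : φ₁.1 ≫ j.1 = i.1 ≫ φ.1) (h₂ : ψ₁.1 ≫ k.1 = i.1 ≫ ψ.1) : JointlyCartesian φ₁ ψ₁ := by
  intro Z z e φ' ψ'
  have b₁ : (z ≫ f₁) ≫ j₀ = (z ≫ i₀) ≫ f := by
    rw [Category.assoc, Category.assoc]
    exact congrArg (z ≫ ·) (HomOver.over_unique (φ₁.comp j rfl) (i.comp φ rfl) h₁)
  have b₂ : (z ≫ g₁) ≫ k₀ = (z ≫ i₀) ≫ g := by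
    rw [Category.assoc, Category.assoc]
    exact congrArg (z ≫ ·) (HomOver.over_unique (ψ₁.comp k rfl) (i.comp ψ rfl) h₂)
  obtain ⟨χ, ⟨e₁, e₂⟩, e₃⟩ := h (z ≫ i₀) e (φ'.comp j b₁) (ψ'.comp k b₂)
  have hz : (z ≫ i₀) ≫ i₀' = z := by rw [Category.assoc, hi.base_hom_inv, Category.comp_id]
  have key : ∀ {d d' d'' t t' : E} {y : d ⟶ d'} {q : d' ⟶ t} {n : t ⟶ t'} {n' : t' ⟶ t}
      {m : d' ⟶ d''} {r : d'' ⟶ t'} {s : d ⟶ t} (_ : q ≫ n = m ≫ r) (_ : n ≫ n' = 𝟙 t),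
      y ≫ q = s ↔ (y ≫ m) ≫ r = s ≫ n := by
    intro d d' d'' t t' y q n n' m r s h h'
    rw [Category.assoc, ← h, ← Category.assoc]
    refine ⟨fun h => by rw [h], fun h => ?_⟩
    have := congrArg (· ≫ n') h
    simpa only [Category.assoc, h', Category.comp_id] using this
  have hχ : (χ.1 ≫ i'.1) ≫ i.1 = χ.1 :=
    (Category.assoc _ _ _).trans ((congrArg (χ.1 ≫ ·) hi.inv_hom).trans (Category.comp_id _))
  refine ⟨χ.comp i' hz, ⟨(key h₁ hj.hom_inv).2 ?_, (key h₂ hk.hom_inv).2 ?_⟩, fun χ' h' => ?_⟩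
  · exact (congrArg (· ≫ φ.1) hχ).trans e₁
  · exact (congrArg (· ≫ ψ.1) hχ).trans e₂
  · have := e₃ (χ'.comp i rfl) ⟨(key h₁ hj.hom_inv).1 h'.1, (key h₂ hk.hom_inv).1 h'.2⟩
    refine HomOver.ext ?_
    refine ((congrArg (χ'.1 ≫ ·) hi.hom_inv).trans (Category.comp_id _)).symm.trans ?_
    refine (Category.assoc _ _ _).symm.trans ?_
    exact congrArg (fun y : HomOver p _ _ _ => y.1 ≫ i'.1) this

end

section

variable {P P' I I' J J' : B} {π : Rel p P P'} {α : Rel p I I'} {β : Rel p J J'} {a : P ⟶ I}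
  {a' : P' ⟶ I'} {b : P ⟶ J} {b' : P' ⟶ J'} {π₁ : (bilGraph p).Cell (.single π) a a' α}
  {π₂ : (bilGraph p).Cell (.single π) b b' β}

theorem nonempty_isLimit_of_isProductCone (h : VDC.IsProductCone (D := bil p) π₁ π₂) :
    Nonempty (IsLimit (BinaryFan.mk (toVert (sarr π₁)) (toVert (sarr π₂)))) := by
  have e' : prod.map (𝟙 P) (𝟙 P') = 𝟙 (P ⨯ P') := by simp
  have key : ∀ {I I' : B} {α : Rel p I I'} {a : P ⟶ I} {a' : P' ⟶ I'}
      (π₁ : (bilGraph p).Cell (.single π) a a' α) (d : Rel p P P') (f : d ⟶ _)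
      (e : prod.map a a' = prod.map (𝟙 P ≫ a) (𝟙 P' ≫ a'))
      (ζ : (bilGraph p).Cell (.single d) (𝟙 P) (𝟙 P') π) (l : d ⟶ π) (_ : l.1 = (sarr ζ).1),
      (bilStr p).comp (.single ζ) π₁ rfl rfl = mkSingle ((ofVert f).cast e) ↔
        l ≫ toVert (sarr π₁) = f := by
    intro I I' α a a' π₁ d f e ζ l hl
    have h₁ : (ofVert (l ≫ toVert (sarr π₁))).1 = (sarr ζ).1 ≫ (sarr π₁).1 :=
      (Category.assoc _ _ _).trans ((congrArg (l.1 ≫ ·)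
        (congrArg Subtype.val (ofVert_toVert (sarr π₁)))).trans (congrArg (· ≫ (sarr π₁).1) hl))
    have h₂ := (sarr_comp ζ π₁ rfl rfl).symm
    have h₃ := congrArg Subtype.val (sarr_mkSingle (p := p) ((ofVert f).cast e))
    refine ⟨fun h => ofVert_injective (HomOver.ext ?_), fun h => single_ext ?_⟩
    · exact h₁.trans (h₂.trans ((congrArg (fun y => (sarr y).1) h).trans h₃))
    · exact h₂.symm.trans (h₁.symm.trans ((congrArg (fun y => (ofVert y).1) h).trans h₃.symm))
  refine nonempty_isLimit_of_existsUnique fun d f g => ?_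
  have e₁ : prod.map a a' = prod.map (𝟙 P ≫ a) (𝟙 P' ≫ a') := by simp
  have e₂ : prod.map b b' = prod.map (𝟙 P ≫ b) (𝟙 P' ≫ b') := by simp
  obtain ⟨ζ, ⟨h₁, h₂⟩, h₃⟩ := h.cell (.single d) (𝟙 P) (𝟙 P') (mkSingle ((ofVert f).cast e₁))
    (mkSingle ((ofVert g).cast e₂))
  refine ⟨⟨(sarr ζ).1, ((sarr ζ).cast e').2⟩, ⟨(key π₁ d f e₁ ζ _ rfl).1 h₁,
    (key π₂ d g e₂ ζ _ rfl).1 h₂⟩,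
    fun l hl => ?_⟩
  have hs := sarr_mkSingle (p := p) ((HomOver.ofFiber l).cast e'.symm)
  have := h₃ (mkSingle ((HomOver.ofFiber l).cast e'.symm))
    ⟨(key π₁ d f e₁ _ l (congrArg Subtype.val hs).symm).2 hl.1,
      (key π₂ d g e₂ _ l (congrArg Subtype.val hs).symm).2 hl.2⟩
  exact Subtype.ext ((congrArg Subtype.val hs).symm.trans (congrArg (fun y => (sarr y).1) this))

theorem existsUnique_of_jointlyCartesian (h : JointlyCartesian (sarr π₁) (sarr π₂)) {X Y : B}
    (γ : LPath (Rel p) X Y) (s : X ⟶ P) (t : Y ⟶ P')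
    (ξ₁ : (bilGraph p).Cell γ (s ≫ a) (t ≫ a') α) (ξ₂ : (bilGraph p).Cell γ (s ≫ b) (t ≫ b') β) :
    ∃! ζ : (bilGraph p).Cell γ s t π, (bilStr p).comp (.single ζ) π₁ rfl rfl = ξ₁ ∧
      (bilStr p).comp (.single ζ) π₂ rfl rfl = ξ₂ := by
  have e : ∀ {I I' : B} (a : P ⟶ I) (a' : P' ⟶ I'),
      prod.lift (first p γ ≫ s ≫ a) (last p γ ≫ t ≫ a') =
        prod.lift (first p γ ≫ s) (last p γ ≫ t) ≫ prod.map a a' := by simp [prod.lift_map]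
  have key : ∀ {I I' : B} {α : Rel p I I'} {a : P ⟶ I} {a' : P' ⟶ I'}
      (π₁ : (bilGraph p).Cell (.single π) a a' α)
      (ξ : (bilGraph p).Cell γ (s ≫ a) (t ≫ a') α) (ζ : (bilGraph p).Cell γ s t π),
      (bilStr p).comp (.single ζ) π₁ rfl rfl = ξ ↔
        (act ζ (gen γ) rfl rfl).1 ≫ (sarr π₁).1 = (act ξ (gen γ) rfl rfl).1 := fun π₁ ξ ζ => by
    have := act_comp_single ζ π₁ rfl rfl (gen γ) rfl rfl rfl rfl
    refine ⟨fun hζ => this.symm.trans ?_, fun hζ => cell_ext (HomOver.ext (this.trans hζ))⟩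
    rw [hζ]
  obtain ⟨χ, ⟨h₁, h₂⟩, h₃⟩ := h _ _ ((act ξ₁ (gen γ) rfl rfl).cast (e a a'))
    ((act ξ₂ (gen γ) rfl rfl).cast (e b b'))
  refine ⟨mkCell χ, ⟨(key π₁ ξ₁ _).2 ?_, (key π₂ ξ₂ _).2 ?_⟩, fun ζ hζ => ?_⟩
  · rw [act_mkCell_gen]; exact h₁
  · rw [act_mkCell_gen]; exact h₂
  · refine cell_ext ((h₃ _ ⟨(key π₁ ξ₁ ζ).1 hζ.1, (key π₂ ξ₂ ζ).1 hζ.2⟩).trans ?_)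
    rw [act_mkCell_gen]

theorem nonempty_isTerminal_of_isTerminalLoose {T T' : B} {τ : Rel p T T'}
    (h : VDC.IsTerminalLoose (D := bil p) τ) : Nonempty (IsTerminal τ) := by
  have e' : prod.map (𝟙 T) (𝟙 T') = 𝟙 (T ⨯ T') := by simp
  have key : ∀ d : Rel p T T', ∃! l : d ⟶ τ, True := by
    intro d
    obtain ⟨⟨ζ⟩, ⟨hζ⟩⟩ := h.cell (.single d) (𝟙 T) (𝟙 T')
    refine ⟨⟨(sarr (α := d) (β := τ) ζ).1, ((sarr (α := d) (β := τ) ζ).cast e').2⟩, trivial,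
      fun l _ => ?_⟩
    have hs := sarr_mkSingle (p := p) ((HomOver.ofFiber l).cast e'.symm)
    exact Subtype.ext ((congrArg Subtype.val hs).symm.trans
      (congrArg (fun y => (sarr (α := d) (β := τ) y).1) (hζ _ _)))
  choose l _ hl using key
  exact ⟨IsTerminal.ofUniqueHom l fun d m => hl d m trivial⟩

end

end FibCat

namespace CartFib.Mor

open FibCat

variable {P Q : CartFib.{u, v, w, x}} (F : Mor P Q)

theorem isTerminalLoose_rel {T T' : P.Base} {τ : Rel P.p T T'}
    (h : VDC.IsTerminalLoose (D := FibCat.bil P.p) τ) :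
    VDC.IsTerminalLoose (D := FibCat.bil Q.p) (F.rel τ) := by
  obtain ⟨hτ⟩ := nonempty_isTerminal_of_isTerminalLoose h
  have hF : IsTerminal (F.rel τ) := (hτ.isTerminalObj (fiberMap F.base F.total F.comm _)
    _).isTerminalObj (baseChange Q.p (F.pcInv T T')) _
  refine ⟨h.left.map fun h => h.isTerminalObj F.base _,
    h.right.map fun h => h.isTerminalObj F.base _, ?_⟩
  have key : ∀ (X Y : Q.Base) (γ : LPath (Rel Q.p) X Y) (s : X ⟶ F.base.obj T)
      (t : Y ⟶ F.base.obj T'), Nonempty ((bilGraph Q.p).Cell γ s t (F.rel τ)) ∧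
        Subsingleton ((bilGraph Q.p).Cell γ s t (F.rel τ)) := fun X Y γ s t =>
    ⟨⟨mkCell (homTerminal hF _ _)⟩, ⟨cell_ext_of_isTerminal hF⟩⟩
  exact key

theorem isProductCone_cell {C C' I I' J J' : P.Base} {π : Rel P.p C C'} {α : Rel P.p I I'}
    {β : Rel P.p J J'} {a : C ⟶ I} {a' : C' ⟶ I'} {b : C ⟶ J} {b' : C' ⟶ J'}
    {π₁ : (bilGraph P.p).Cell (.single π) a a' α} {π₂ : (bilGraph P.p).Cell (.single π) b b' β}
    (h : VDC.IsProductCone (D := FibCat.bil P.p) π₁ π₂) :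
    VDC.IsProductCone (D := FibCat.bil Q.p) (F.bil.cell π₁) (F.bil.cell π₂) := by
  obtain ⟨hl⟩ := nonempty_isLimit_of_isProductCone h
  have h₁ : ∀ {I I' : P.Base} {α : Rel P.p I I'} {a : C ⟶ I} {a' : C' ⟶ I'}
      (π₁ : (bilGraph P.p).Cell (.single π) a a' α),
      ((fiberMap F.base F.total F.comm _).map (toVert (sarr π₁))).1 ≫
        (F.homMap (proj P.p (prod.map a a') α)).1 = (F.homMap (sarr π₁)).1 := fun π₁ =>
    (F.total.map_comp _ _).symm.trans
      (congrArg (fun y => F.total.map y.1) (ofVert_toVert (sarr π₁)))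
  have hj : JointlyCartesian (F.homMap (sarr π₁)) (F.homMap (sarr π₂)) :=
    jointlyCartesian_of_isLimit
      ⟨mapIsLimitOfPreservesOfIsLimit (fiberMap F.base F.total F.comm _) _ _ hl⟩
      (F.homMap (proj P.p (prod.map a a') α)) (F.homMap (proj P.p (prod.map b b') β))
      (F.cartesian _ _ (isCartesian_proj P.p (prod.map a a') α))
      (F.cartesian _ _ (isCartesian_proj P.p (prod.map b b') β)) (h₁ π₁) (h₁ π₂)
  have hj' : JointlyCartesian (sarr (α := F.rel π) (β := F.rel α) (F.bil.cell π₁))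
      (sarr (α := F.rel π) (β := F.rel β) (F.bil.cell π₂)) :=
    hj.of_inv (F.isInv_relProj π) (F.isInv_relProj α) (F.isInv_relProj β) (F.sarr_cell π₁)
      (F.sarr_cell π₂)
  exact ⟨h.left.map fun h => mapIsLimitOfPreservesOfIsLimit F.base _ _ h,
    h.right.map fun h => mapIsLimitOfPreservesOfIsLimit F.base _ _ h,
    fun X Y γ s t ξ₁ ξ₂ => existsUnique_of_jointlyCartesian hj' γ s t ξ₁ ξ₂⟩

theorem bil_preservesProducts : F.bil.PreservesProducts where
  tight := F.preservesBase
  terminal _ h := F.isTerminalLoose_rel h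
  product _ _ h := F.isProductCone_cell h

end CartFib.Mor

end

namespace CartFib

open FibCat

theorem bil_isObj {P : CartFib.{u, v, w, x}} {S : Set ℕ} (h : HasStable P.p S) :
    (VDC.cartesianFVDC S).IsObj (bilPseudofunctor.obj P) :=
  ⟨hasRestrictions_bil P.p, h.hasComposites, isCartesian_bil h⟩

theorem bil_isHom {P Q : CartFib.{u, v, w, x}} (F : Mor P Q) {S : Set ℕ}
    (h : F.bil.PreservesComposites S) :
    (VDC.cartesianFVDC S).IsHom (bilPseudofunctor.map (show P ⟶ Q from F)) :=
  ⟨F.bil_preservesRestrictions, h, F.bil_preservesProducts⟩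

theorem hasStable_empty (P : CartFib.{u, v, w, x}) : HasStable P.p ∅ :=
  fun _ _ _ h => h.elim

end CartFib

/-- The assignment `Bil` extends to a 2-functor (a pseudofunctor, strict on the tight parts) which
restricts to the four classes of fibrations and of cartesian fibrational virtual double categories. -/
theorem mainTheorem9 :
    ∃ Bil : Pseudofunctor CartFib.{u, v, w, x} VDC.{u, v, w, x},
      Bil.toPrelaxFunctorStruct = CartFib.bilStruct ∧
      (∀ (P : CartFib.{u, v, w, x}) (X : (Bil.obj P).Ob),
        ∃ e, (VDTrans.tight (Bil.mapId P).hom).app X = eqToHom e) ∧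
      (∀ {P Q R : CartFib.{u, v, w, x}} (F : P ⟶ Q) (G : Q ⟶ R) (X : (Bil.obj P).Ob),
        ∃ e, (VDTrans.tight (Bil.mapComp F G).hom).app X = eqToHom e) ∧
      (∃ B : Pseudofunctor CartFib.{u, v, w, x} (VDC.cartesianFVDC.{u, v, w, x} ∅).Obj,
        B.comp (VDC.cartesianFVDC ∅).incl = Bil) ∧
      (∃ B : Pseudofunctor CartFib.elementary.{u, v, w, x}.Obj
          (VDC.cartesianFVDC.{u, v, w, x} {0}).Obj,
        B.comp (VDC.cartesianFVDC {0}).incl = CartFib.elementary.incl.comp Bil) ∧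
      (∃ B : Pseudofunctor CartFib.existential.{u, v, w, x}.Obj
          (VDC.cartesianFVDC.{u, v, w, x} {n | 0 < n}).Obj,
        B.comp (VDC.cartesianFVDC {n | 0 < n}).incl = CartFib.existential.incl.comp Bil) ∧
      (∃ B : Pseudofunctor CartFib.elementaryExistential.{u, v, w, x}.Obj
          (VDC.cartesianFVDC.{u, v, w, x} Set.univ).Obj,
        B.comp (VDC.cartesianFVDC Set.univ).incl = CartFib.elementaryExistential.incl.comp Bil) := by

  refine ⟨CartFib.bilPseudofunctor, rfl, fun _ _ => ⟨rfl, rfl⟩, fun _ _ _ => ⟨rfl, rfl⟩, ?_⟩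
  refine ⟨⟨_, SubBicat.lift_comp_incl _ CartFib.bilPseudofunctor
    (fun P => CartFib.bil_isObj P.hasStable_empty)
    fun F => CartFib.bil_isHom F fun _ _ _ _ _ h => h.elim⟩, ?_, ?_, ?_⟩
  · refine ⟨_, SubBicat.lift_comp_incl _ (CartFib.elementary.incl.comp CartFib.bilPseudofunctor)
      (fun P => CartFib.bil_isObj (P := P.obj) (CartFib.IsElementary.hasStable P.isObj))
      fun {P Q} F => CartFib.bil_isHom (P := P.obj) (Q := Q.obj) (SubBicat.Hom.hom F)
        (CartFib.Mor.IsElementary.preservesComposites (SubBicat.Hom.isHom F) Q.isObj)⟩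
  · refine ⟨_, SubBicat.lift_comp_incl _ (CartFib.existential.incl.comp CartFib.bilPseudofunctor)
      (fun P => CartFib.bil_isObj (P := P.obj) (CartFib.IsExistential.hasStable P.isObj))
      fun {P Q} F => CartFib.bil_isHom (P := P.obj) (Q := Q.obj) (SubBicat.Hom.hom F)
        (CartFib.Mor.IsExistential.preservesComposites (SubBicat.Hom.isHom F) Q.isObj)⟩
  · refine ⟨_, SubBicat.lift_comp_incl _
      (CartFib.elementaryExistential.incl.comp CartFib.bilPseudofunctor)
      (fun P => CartFib.bil_isObj (P := P.obj)
        (CartFib.hasStable_univ (And.left P.isObj) (And.right P.isObj)))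
      fun {P Q} F => ?_⟩
    have h : CartFib.Mor.IsElementary (SubBicat.Hom.hom F) ∧
      CartFib.Mor.IsExistential (SubBicat.Hom.hom F) := SubBicat.Hom.isHom F
    exact CartFib.bil_isHom (P := P.obj) (Q := Q.obj) (SubBicat.Hom.hom F)
      (CartFib.Mor.preservesComposites_univ h.1 h.2
        (CartFib.hasStable_univ (And.left Q.isObj) (And.right Q.isObj)))
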